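/- Let $G=G_1\times\cdots\times G_m$ be a compact connected simply connected Lie group with simple factors $G_i$, let $T\subset G$ be a maximal torus with Lie algebra $\mathfrak t$, let $\Pi=\ker(\exp\colon\mathfrak t\to T)$, and let $\cdot$ be the basic inner product on $\mathfrak g=\mathfrak g_1\oplus\cdots\oplus\mathfrak g_m$ (on each $\mathfrak g_i$ the invariant inner product for which the short co-roots have length $\sqrt2$). Let $LG$ be the group of loops $S^1=\mathbb R/\mathbb Z\to G$ of a fixed Sobolev class $\varsigma>\frac12$, acting on $L\mathfrak g^*=\Omega^1_{\varsigma-1}(S^1,\mathfrak g)$ by gauge transformations $g\cdot a=\mathrm{Ad}_g a-dg\,g^{-1}$; $\Pi$ is a subgroup of $LG$, with $\eta\in\Pi$ corresponding to the loop $s\mapsto\exp(-s\eta)$. Let $\Omega G\subset LG$ be the subgroup of loops based at $1$. Let $(\mathcal M,\omega,\mu_{\mathcal M})$ be a proper Hamiltonian $LG$-space: a Banach manifold with a smooth action of $LG$, an invariant weakly symplectic form $\omega$, and a proper equivariant moment map $\mu_{\mathcal M}\colon\mathcal M\to L\mathfrak g^*$. Let $R\subset L\mathfrak g^*$ be the image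 of an $N(T)\ltimes\Pi$-equivariant embedding $\mathfrak t\times\overline B_\epsilon(\mathfrak t^\perp)\to L\mathfrak g^*$, $\epsilon>0$, extending the inclusion of $\mathfrak t$ as constant connections, such that $R$ consists of smooth connections, is transverse to the $\Omega G$-orbits, and intersects each $\Omega G$-orbit that it meets in a $\Pi$-orbit. Let $X=\mu_{\mathcal M}^{-1}(R)$ be the corresponding global transversal. Let $\ell=(\ell_1,\dots,\ell_m)$ be a tuple of positive integers and let $\widehat{LG}^{(\ell)}$ be the central extension of $LG$ by $U(1)$ with Lie algebra cocycle $(\xi_1,\xi_2)\mapsto 2\pi i\int_{S^1}\ell\,d\xi_1\cdot\xi_2$. Let $\mathcal S\to\mathcal M$ be a level $\ell$ spinor bundle for $\mathrm{hol}_{\mathcal M}^*T(\mathcal M/\Omega G)$, where $\mathrm{hol}_{\mathcal M}\colon\mathcal M\to\mathcal M/\Omega G$ is the quotient map and $\mathcal M/\Omega G$ has a $G$-invariant Riemannian metric; that is, a spinor bundle with a compatible action of $\widehat{LG}^{(\ell)}$ for which the Clifford action is equivariant. Let $\mathcal L=\mathrm{Hom}_{\mathbb C l}(\mathcal S^*,\mathcal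 S)$ be its anti-canonical line bundle, with an invariant Hermitian connection $\nabla^{\mathcal L}$. The $\mathrm{Spin}_c$ moment map $\phi_{\mathcal M}$ is given by $2\pi i\langle\phi_{\mathcal M},\xi\rangle=\frac12(\mathcal L^{\mathcal L}_\xi-\nabla^{\mathcal L}_{\xi_{\mathcal M}})$ for $\xi\in L\mathfrak g$, where $\xi_{\mathcal M}(x)=\frac{d}{du}\big|_{0}\exp(-u\xi)\cdot x$ and $\mathcal L^{\mathcal L}_\xi$ is the infinitesimal action on sections of $\mathcal L$. Let $\phi\colon X\to\mathfrak t$ be the restriction of $\phi_{\mathcal M}$ to $X$ followed by the projection to $\mathfrak t$, and let $\kappa(x)=\phi(x)_X(x)$ be the $\mathrm{Spin}_c$ Kirwan vector field on $X$. For $\beta\in\mathfrak t$ put $\mathcal Z_\beta=X^\beta\cap\phi^{-1}(\beta)$, where $X^\beta$ is the set of points of $X$ fixed by $\exp(u\beta)$ for all $u\in\mathbb R$, and put $\mathcal B=\{\beta\in\mathfrak t\mid\mathcal Z_\beta\ne\emptyset\}$. Then: 1. The zero set of $\kappa$ is $\kappa^{-1}(0)=\bigcup_{\beta\in\mathcal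 B}\mathcal Z_\beta$. 2. There is a finite subset $\mathcal B_*\subset\mathcal B$, minimal with respect to inclusion, such that for each $\beta\in\mathcal B$ there are $\beta_*\in\mathcal B_*$ and $\eta\in\Pi$ with $\mathcal Z_\beta=\eta\cdot\mathcal Z_{\beta_*}$. 3. If $T$ acts non-trivially on $X$, then $\kappa$ itself is not $\Pi$-invariant. -/

import Mathlib

open Bundle Topology
open scoped Manifold ContDiff ENNReal

attribute [local instance] Matrix.normedAddCommGroup Matrix.normedSpace

noncomputable section

namespace LoopSpace

/-! ### Compact simply connected groups, as closed subgroups of unitary groups -/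

abbrev Mat (n : ℕ) : Type := Matrix (Fin n) (Fin n) ℂ

abbrev UGroup (n : ℕ) : Type := Matrix.unitaryGroup (Fin n) ℂ

/-- The Lie algebra of a closed subgroup `H` of `U(n)`: all `ξ` with `exp (t ξ) ∈ H` for all `t`.
For closed `H` this set is a real subspace already, so that taking the span adds nothing. -/
def lieAlg {n : ℕ} (H : Subgroup (UGroup n)) : Submodule ℝ (Mat n) :=
  Submodule.span ℝ {ξ | ∀ t : ℝ, ∃ h ∈ H, (h : Mat n) = NormedSpace.exp (t • ξ)}

/-- A torus in `U(n)`: a closed connected abelian subgroup. -/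
def IsTorus {n : ℕ} (T : Subgroup (UGroup n)) : Prop :=
  IsClosed (T : Set (UGroup n)) ∧ IsConnected (T : Set (UGroup n)) ∧
    ∀ a ∈ T, ∀ b ∈ T, a * b = b * a

/-- `T` is a maximal torus of `G`. -/
def IsMaximalTorus {n : ℕ} (T G : Subgroup (UGroup n)) : Prop :=
  Maximal (fun T' => IsTorus T' ∧ T' ≤ G) T

/-- A (real) Lie algebra of matrices is simple: non-abelian without proper nonzero ideals. -/
def IsSimpleLie {n : ℕ} (g : Submodule ℝ (Mat n)) : Prop :=
  (∃ a ∈ g, ∃ b ∈ g, a * b ≠ b * a) ∧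
    ∀ J : Submodule ℝ (Mat n), J ≤ g → (∀ a ∈ g, ∀ b ∈ J, a * b - b * a ∈ J) → J = ⊥ ∨ J = g

/-- `η ∈ 𝔱` is a co-root of `(G, T)`: there is a nonzero root vector `X ∈ 𝔤 ⊗ ℂ`, with root `α`
(normalized by `[ξ, X] = 2 π i α(ξ) X`), such that `η` is a multiple of `[X, X̄]` and `α(η) = 2`. -/
def IsCoroot {n : ℕ} (G T : Subgroup (UGroup n)) (η : Mat n) : Prop :=
  η ∈ lieAlg T ∧ ∃ X : Mat n, X ≠ 0 ∧
    (∃ A ∈ lieAlg G, ∃ B ∈ lieAlg G, X = A + Complex.I • B) ∧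
    (∀ ξ ∈ lieAlg T, ∃ α : ℝ, ξ * X - X * ξ = ((2 * Real.pi * α : ℝ) * Complex.I) • X) ∧
    (∃ r : ℝ, η = (r * Complex.I) • (X * X.conjTranspose - X.conjTranspose * X)) ∧
    η * X - X * η = ((4 * Real.pi : ℝ) * Complex.I) • X

/-- A compact connected simply connected Lie group `G = G₁ × ⋯ × Gₘ` with its simple factors, each
realized as a closed group of unitary matrices, and a maximal torus `T = T₁ × ⋯ × Tₘ`. -/
structure CompactGroup (m : ℕ) where
  size : Fin m → ℕ
  G : ∀ i, Subgroup (UGroup (size i))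
  T : ∀ i, Subgroup (UGroup (size i))
  isClosed (i : Fin m) : IsClosed (G i : Set (UGroup (size i)))
  simplyConnected (i : Fin m) : SimplyConnectedSpace (G i)
  simple (i : Fin m) : IsSimpleLie (lieAlg (G i))
  maximalTorus (i : Fin m) : IsMaximalTorus (T i) (G i)

namespace CompactGroup

variable {m : ℕ} (K : CompactGroup m)

/-- The ambient algebra of block diagonal matrices. -/
abbrev A : Type := ∀ i, Mat (K.size i)

/-- The Lie algebra `𝔤 = 𝔤₁ ⊕ ⋯ ⊕ 𝔤ₘ`. -/
def g : Submodule ℝ K.A := Submodule.pi Set.univ fun i => lieAlg (K.G i)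

/-- The Lie algebra `𝔱 = 𝔱₁ ⊕ ⋯ ⊕ 𝔱ₘ` of the maximal torus. -/
def t : Submodule ℝ K.A := Submodule.pi Set.univ fun i => lieAlg (K.T i)

theorem t_le_g : K.t ≤ K.g := fun _ hξ i hi =>
  Submodule.span_mono
    (fun _ hx s => (hx s).imp fun _ h => ⟨(K.maximalTorus i).prop.2 h.1, h.2⟩) (hξ i hi)

/-- The factor `c` for which the short co-roots of `𝔤ᵢ` have length `√2` with respect to
`(ξ, ζ) ↦ -c Tr (ξ ζ)`. -/
def basicScale (i : Fin m) : ℝ :=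
  2 / sInf {q : ℝ | ∃ η, IsCoroot (K.G i) (K.T i) η ∧ q = -(Matrix.trace (η * η)).re}

/-- The basic inner product `·` on `𝔤`, extended complex-bilinearly. -/
def ip (ξ ζ : K.A) : ℂ := ∑ i, -(K.basicScale i * Matrix.trace (ξ i * ζ i))

/-- The orthogonal complement `𝔱^⊥` of `𝔱` in `𝔤`. -/
def tPerp : Submodule ℝ K.A where
  carrier := {v | v ∈ K.g ∧ ∀ a ∈ K.t, K.ip a v = 0}
  zero_mem' := ⟨K.g.zero_mem, fun a _ => by simp [ip]⟩
  add_mem' := by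
    rintro v w ⟨hv, hv'⟩ ⟨hw, hw'⟩
    refine ⟨K.g.add_mem hv hw, fun a ha => ?_⟩
    have h : K.ip a (v + w) = K.ip a v + K.ip a w := by
      simp only [ip, Pi.add_apply, mul_add, Matrix.trace_add, neg_add, Finset.sum_add_distrib]
    rw [h, hv' a ha, hw' a ha, add_zero]
  smul_mem' := by
    rintro c v ⟨hv, hv'⟩
    refine ⟨K.g.smul_mem c hv, fun a ha => ?_⟩
    have h : K.ip a (c • v) = (c : ℂ) * K.ip a v := by
      simp only [ip, Pi.smul_apply, Matrix.mul_smul, Matrix.trace_smul, Finset.mul_sum,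
        Complex.real_smul]
      exact Finset.sum_congr rfl fun i _ => by ring
    rw [h, hv' a ha, mul_zero]

/-- Multiplication by `ℓᵢ` on the `i`-th summand. -/
def mulLevel (ℓ : Fin m → ℤ) (ξ : K.A) : K.A := fun i => (ℓ i : ℂ) • ξ i

/-! ### Loops of Sobolev class -/

/-- `L𝔤` and `L𝔤*`: the elements of the Sobolev space `H^s(S¹, 𝔤)`, `S¹ = ℝ/ℤ`. An element of
`H^s` is stored as the square summable family `(1 + k²)^(s/2) u_k`, where `u_k` (see `coeff`) are
its Fourier coefficients. It is `𝔤`-valued if and only if the coefficients `u_k + u_{-k}` of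
`cos (2 π k x)` and `i (u_k - u_{-k})` of `sin (2 π k x)` are in `𝔤`; the weights play no role for
this condition. `L𝔤` is the case `s = ς` and `L𝔤*` (connections) the case `s = ς - 1`. -/
def loopAlg : Submodule ℝ (lp (fun _ : ℤ => K.A) 2) where
  carrier := {u | ∀ k : ℤ, u k + u (-k) ∈ K.g ∧ Complex.I • (u k - u (-k)) ∈ K.g}
  zero_mem' := fun k => by simp
  add_mem' := by
    intro u v hu hv k
    refine ⟨?_, ?_⟩
    · have h := K.g.add_mem (hu k).1 (hv k).1
      simpa [add_add_add_comm] using h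
    · have h := K.g.add_mem (hu k).2 (hv k).2
      rw [← smul_add] at h
      simpa [add_sub_add_comm] using h
  smul_mem' := by
    intro c u hu k
    refine ⟨?_, ?_⟩
    · have h := K.g.smul_mem c (hu k).1
      simpa [smul_add] using h
    · have h := K.g.smul_mem c (hu k).2
      rw [smul_comm] at h
      simpa [smul_sub] using h

abbrev Lg : Type := K.loopAlg

abbrev LgDual : Type := K.loopAlg

/-- The `k`-th Fourier coefficient of an element of `H^s`. -/
def coeff (s : ℝ) (u : K.loopAlg) (k : ℤ) : K.A :=
  ((1 + (k : ℝ) ^ 2) ^ (-s / 2)) • (u : lp (fun _ : ℤ => K.A) 2) k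

/-- The value of a loop `ξ ∈ L𝔤` at a point. -/
def eval (ς : ℝ) (ξ : K.Lg) (x : UnitAddCircle) : K.A :=
  ∑' k : ℤ, (fourier k x : ℂ) • K.coeff ς ξ k

/-- Constant loops with values in `𝔱`. -/
def const (ξ : K.t) : K.loopAlg :=
  ⟨lp.single 2 0 (ξ : K.A), fun k => by
    have h : (ξ : K.A) ∈ K.g := K.t_le_g ξ.2
    rcases eq_or_ne k 0 with rfl | hk
    · refine ⟨?_, ?_⟩
      · simpa using K.g.add_mem h h
      · simp
    · have hk' : -k ≠ 0 := neg_ne_zero.2 hk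
      refine ⟨?_, ?_⟩ <;> simp [hk, hk', -neg_eq_zero]⟩

/-- The pairing `∫_{S¹} a · ξ` between `L𝔤*` and `L𝔤`. -/
def pair (ς : ℝ) (a : K.LgDual) (ξ : K.Lg) : ℝ :=
  ∑' k : ℤ, (K.ip (K.coeff (ς - 1) a k) (K.coeff ς ξ (-k))).re

/-- `∫_{S¹} ℓ dξ · ζ`, for `ξ, ζ ∈ L𝔤`. -/
def cocycle (ς : ℝ) (ℓ : Fin m → ℤ) (ξ ζ : K.Lg) : ℝ :=
  ∑' k : ℤ, (K.ip (K.mulLevel ℓ (((2 * Real.pi * k : ℝ) * Complex.I) • K.coeff ς ξ k))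
    (K.coeff ς ζ (-k))).re

/-- A loop in `G`, as a loop of matrices. -/
def loopMat (g : UnitAddCircle → ∀ i, K.G i) (x : UnitAddCircle) : K.A :=
  fun i => (((g x i : UGroup (K.size i))) : Mat (K.size i))

/-- The loop group `LG`: loops in `G` of Sobolev class `ς`. For `ς > 1/2` these loops are closed
under pointwise products and inverses, so that passing to the generated subgroup adds nothing. -/
def loopGroup (ς : ℝ) : Subgroup (UnitAddCircle → ∀ i, K.G i) :=
  Subgroup.closure {g | Continuous g ∧
    Summable fun k : ℤ => (1 + (k : ℝ) ^ 2) ^ ς * ‖fourierCoeff (K.loopMat g) k‖ ^ 2}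

abbrev LG (ς : ℝ) : Type := K.loopGroup ς

/-- The exponential map `L𝔤 → LG`, which is the pointwise one. -/
def loopExp (ς : ℝ) (ξ : K.Lg) : K.LG ς :=
  open Classical in
  if h : ∃ g : K.LG ς, ∀ x, K.loopMat g.1 x = NormedSpace.exp (K.eval ς ξ x) then h.choose else 1

/-- `ξ' = Ad_g ξ`. -/
def IsAd (ς : ℝ) (g : K.LG ς) (ξ ξ' : K.Lg) : Prop :=
  ∀ x, K.eval ς ξ' x * K.loopMat g.1 x = K.loopMat g.1 x * K.eval ς ξ x

/-- `b = Ad_g a - dg g⁻¹`, the gauge action of `LG` on `L𝔤*`, in the form `b g = g a - dg` and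
written in terms of Fourier coefficients (the products are convolutions). -/
def IsGauge (ς : ℝ) (g : K.LG ς) (a b : K.LgDual) : Prop :=
  ∀ k : ℤ, ∑' q : ℤ, K.coeff (ς - 1) b (k - q) * fourierCoeff (K.loopMat g.1) q =
    ∑' q : ℤ, fourierCoeff (K.loopMat g.1) (k - q) * K.coeff (ς - 1) a q -
      ((2 * Real.pi * k : ℝ) * Complex.I) • fourierCoeff (K.loopMat g.1) k

/-- `g` is the loop `x ↦ exp (-x η)`. -/
def IsLatticeLoop (ς : ℝ) (η : K.t) (g : K.LG ς) : Prop :=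
  ∀ x : ℝ, K.loopMat g.1 (x : UnitAddCircle) = NormedSpace.exp (-x • (η : K.A))

/-- The integral lattice `Π = ker (exp : 𝔱 → T)`. -/
def lattice : Set K.t := {η | NormedSpace.exp (η : K.A) = 1}

/-- The lattice `Π` as a subgroup of `LG`. -/
def latticeLoops (ς : ℝ) : Set (K.LG ς) := {g | ∃ η ∈ K.lattice, K.IsLatticeLoop ς η g}

/-- `ξ(0) = 0`, that is, `ξ ∈ Ω𝔤`. -/
def IsBased (ς : ℝ) (ξ : K.Lg) : Prop := K.eval ς ξ 0 = 0

/-! ### The thickening `R` of `𝔱` in `L𝔤*` -/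

/-- The product `𝔱 × B̄_ε(𝔱^⊥)`. -/
def tube (ε : ℝ) : Set (K.t × K.tPerp) := {p | (K.ip p.2 p.2).re ≤ ε ^ 2}

/-- `r` is an `N(T) ⋉ Π`-equivariant embedding `𝔱 × B̄_ε(𝔱^⊥) → L𝔤*` extending the inclusion of
`𝔱`, whose image `R` consists of smooth connections, is transverse to the `ΩG`-orbits, and
intersects each `ΩG`-orbit that it meets in an orbit of `Π`. -/
structure IsThickening (ς ε : ℝ) (r : K.t × K.tPerp → K.LgDual) : Prop where
  pos : 0 < ε
  zero (a : K.t) : r (a, 0) = K.const a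
  contDiffOn : ContDiffOn ℝ ∞ r (K.tube ε)
  immersion : ∀ p ∈ K.tube ε, Function.Injective (fderivWithin ℝ r (K.tube ε) p)
  embedding : IsEmbedding ((K.tube ε).domRestrict r)
  weyl (n : ∀ i, K.G i)
    (hn : ∀ i, ∀ h : UGroup (K.size i), h ∈ K.T i ↔ (n i : UGroup (K.size i)) * h * (n i)⁻¹ ∈ K.T i)
    (g : K.LG ς) (hg : ∀ x, g.1 x = n) (p p' : K.t × K.tPerp) (hp : p ∈ K.tube ε)
    (h₁ : ∀ i, (p'.1 : K.A) i * (n i : UGroup (K.size i)) = (n i : UGroup (K.size i)) *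
      (p.1 : K.A) i)
    (h₂ : ∀ i, (p'.2 : K.A) i * (n i : UGroup (K.size i)) = (n i : UGroup (K.size i)) *
      (p.2 : K.A) i) : K.IsGauge ς g (r p) (r p')
  translation (η : K.t) (hη : η ∈ K.lattice) (g : K.LG ς) (hg : K.IsLatticeLoop ς η g)
    (p : K.t × K.tPerp) (hp : p ∈ K.tube ε) : K.IsGauge ς g (r p) (r (p.1 + η, p.2))
  smooth (p : K.t × K.tPerp) (hp : p ∈ K.tube ε) (n : ℕ) :
    ∃ C : ℝ, ∀ k : ℤ, |(k : ℝ)| ^ n * ‖K.coeff (ς - 1) (r p) k‖ ≤ C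
  transverse (p : K.t × K.tPerp) (hp : p ∈ K.tube ε) (b : K.LgDual) :
    ∃ w : K.t × K.tPerp, ∃ ξ : K.Lg, K.IsBased ς ξ ∧ ∀ k : ℤ,
      K.coeff (ς - 1) b k = K.coeff (ς - 1) (fderivWithin ℝ r (K.tube ε) p w) k +
        (((2 * Real.pi * k : ℝ) * Complex.I) • K.coeff ς ξ k +
          ∑' q : ℤ, (K.coeff (ς - 1) (r p) (k - q) * K.coeff ς ξ q -
            K.coeff ς ξ q * K.coeff (ς - 1) (r p) (k - q)))
  orbit (a b : K.LgDual) (ha : a ∈ r '' K.tube ε) (hb : b ∈ r '' K.tube ε) (g : K.LG ς)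
    (hg : g.1 0 = 1) (hab : K.IsGauge ς g a b) : ∃ h ∈ K.latticeLoops ς, K.IsGauge ς h a b

/-! ### The central extension of level `ℓ` -/

/-- `Ghat` is the central extension of `LG` by `U(1)` of level `ℓ`: a Banach Lie group with Lie
algebra `L𝔤 ⊕ iℝ`, the Lie algebra extension being given by the cocycle
`(ξ, ζ) ↦ 2 π i ∫ ℓ dξ · ζ`. The exponential map of `Ghat` is
`(ξ, i θ) ↦ exp (ξ) * central (e^{iθ})`, and the adjoint action is
`Ad_a (ξ, 0) = (Ad_{proj a} ξ, 2 π i (adj a ξ))`; the derivative of the latter in the direction of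
`ξ` at the identity is the Lie bracket. -/
structure LevelExtension (ς : ℝ) (ℓ : Fin m → ℤ) (Ghat : Type*) [Group Ghat]
    [TopologicalSpace Ghat] [ChartedSpace (K.Lg × ℝ) Ghat] where
  proj : Ghat →* K.LG ς
  central : Circle →* Ghat
  exp : K.Lg → Ghat
  adj : Ghat → K.Lg →L[ℝ] ℝ
  proj_surjective : Function.Surjective proj
  central_injective : Function.Injective central
  ker_proj : proj.ker = central.range
  central_comm (z : Circle) (a : Ghat) : central z * a = a * central z
  proj_exp (ξ : K.Lg) (x : UnitAddCircle) :
    K.loopMat (proj (exp ξ)).1 x = NormedSpace.exp (K.eval ς ξ x)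
  exp_add_smul (s t : ℝ) (ξ : K.Lg) : exp ((s + t) • ξ) = exp (s • ξ) * exp (t • ξ)
  contMDiff_exp : ContMDiff 𝓘(ℝ, K.Lg × ℝ) 𝓘(ℝ, K.Lg × ℝ) ∞
    fun q : K.Lg × ℝ => exp q.1 * central (Circle.exp q.2)
  isLocalDiffeomorphAt_exp : IsLocalDiffeomorphAt 𝓘(ℝ, K.Lg × ℝ) 𝓘(ℝ, K.Lg × ℝ) ∞
    (fun q : K.Lg × ℝ => exp q.1 * central (Circle.exp q.2)) 0
  conj_exp (a : Ghat) (ξ ξ' : K.Lg) (h : K.IsAd ς (proj a) ξ ξ') :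
    a * exp ξ * a⁻¹ = exp ξ' * central (Circle.exp (2 * Real.pi * adj a ξ))
  hasDerivAt_adj (ξ ζ : K.Lg) :
    HasDerivAt (fun u : ℝ => adj (exp (u • ξ)) ζ) (K.cocycle ς ℓ ξ ζ) 0

end CompactGroup

/-! ### Hamiltonian loop group spaces -/

section Hamiltonian

variable {m : ℕ} (K : CompactGroup m) (ς : ℝ)
  {E : Type*} [NormedAddCommGroup E] [NormedSpace ℝ E]
  {M : Type*} [TopologicalSpace M] [ChartedSpace E M] [IsManifold 𝓘(ℝ, E) ∞ M]
  [MulAction (K.LG ς) M]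

/-- The action of `LG` on the Banach manifold `M` is smooth. Since `exp` gives charts of `LG` near
the identity, this is expressed through `(ξ, x) ↦ exp (ξ) • x`. -/
def IsSmoothAction (M : Type*) [TopologicalSpace M] [ChartedSpace E M]
    [MulAction (K.LG ς) M] : Prop :=
  (∀ g : K.LG ς, ContMDiff 𝓘(ℝ, E) 𝓘(ℝ, E) ∞ fun x : M => g • x) ∧
    ContMDiff (𝓘(ℝ, K.Lg).prod 𝓘(ℝ, E)) 𝓘(ℝ, E) ∞
      fun q : K.Lg × M => K.loopExp ς q.1 • q.2

/-- The vector field `ξ_M(x) = d/du|₀ exp (-u ξ) • x`. -/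
def genField (ξ : K.Lg) (x : M) : TangentSpace 𝓘(ℝ, E) x :=
  mfderiv 𝓘(ℝ, ℝ) 𝓘(ℝ, E) (fun u : ℝ => K.loopExp ς (-u • ξ) • x) 0 (1 : ℝ)

/-- The differential of the action of `g ∈ LG` on `M`. -/
def dAct (g : K.LG ς) (x : M) : TangentSpace 𝓘(ℝ, E) x →L[ℝ] TangentSpace 𝓘(ℝ, E) (g • x) :=
  mfderiv 𝓘(ℝ, E) 𝓘(ℝ, E) (fun y : M => g • y) x

/-- A smooth covariant tensor field of degree two. -/
def IsSmoothTwoTensor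
    (b : ∀ x : M, TangentSpace 𝓘(ℝ, E) x →L[ℝ] TangentSpace 𝓘(ℝ, E) x →L[ℝ] ℝ) : Prop :=
  ContMDiff 𝓘(ℝ, E) (𝓘(ℝ, E).prod 𝓘(ℝ, E →L[ℝ] E →L[ℝ] ℝ)) ∞
    fun x => TotalSpace.mk' (E →L[ℝ] E →L[ℝ] ℝ)
      (E := fun x : M => TangentSpace 𝓘(ℝ, E) x →L[ℝ] TangentSpace 𝓘(ℝ, E) x →L[ℝ] ℝ) x (b x)

/-- The coordinate expression of a covariant two-tensor in the chart at `x₀`. -/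
def inChart (b : ∀ x : M, TangentSpace 𝓘(ℝ, E) x →L[ℝ] TangentSpace 𝓘(ℝ, E) x →L[ℝ] ℝ)
    (x₀ : M) (y v w : E) : ℝ :=
  b ((extChartAt 𝓘(ℝ, E) x₀).symm y)
    (mfderiv 𝓘(ℝ, E) 𝓘(ℝ, E) (extChartAt 𝓘(ℝ, E) x₀).symm y v)
    (mfderiv 𝓘(ℝ, E) 𝓘(ℝ, E) (extChartAt 𝓘(ℝ, E) x₀).symm y w)

/-- A proper Hamiltonian `LG`-space `(M, σ, μ)`. -/
structure IsHamiltonian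
    (σ : ∀ x : M, TangentSpace 𝓘(ℝ, E) x →L[ℝ] TangentSpace 𝓘(ℝ, E) x →L[ℝ] ℝ)
    (μ : M → K.LgDual) : Prop where
  smoothAction : IsSmoothAction K ς (E := E) M
  smooth_form : IsSmoothTwoTensor σ
  alternating (x : M) (v : TangentSpace 𝓘(ℝ, E) x) : σ x v v = 0
  nondegenerate (x : M) (v : TangentSpace 𝓘(ℝ, E) x) (hv : ∀ w, σ x v w = 0) : v = 0
  closed (x₀ : M) (y : E) (hy : y ∈ (extChartAt 𝓘(ℝ, E) x₀).target) (u v w : E) :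
    fderiv ℝ (fun z => inChart σ x₀ z v w) y u + fderiv ℝ (fun z => inChart σ x₀ z w u) y v +
      fderiv ℝ (fun z => inChart σ x₀ z u v) y w = 0
  invariant (g : K.LG ς) (x : M) (v w : TangentSpace 𝓘(ℝ, E) x) :
    σ (g • x) (dAct K ς g x v) (dAct K ς g x w) = σ x v w
  smooth_moment : ContMDiff 𝓘(ℝ, E) 𝓘(ℝ, K.LgDual) ∞ μ
  proper : IsProperMap μ
  equivariant (g : K.LG ς) (x : M) : K.IsGauge ς g (μ x) (μ (g • x))
  moment (ξ : K.Lg) (x : M) (v : TangentSpace 𝓘(ℝ, E) x) :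
    σ x (genField K ς ξ x) v = -(mfderiv 𝓘(ℝ, E) 𝓘(ℝ, ℝ) (fun y => K.pair ς (μ y) ξ) x v : ℝ)

/-- The tangent space of the `ΩG`-orbit through `x`, the kernel of `T_x M → T (M / ΩG)`. (The
values of generating vector fields form a subspace already.) -/
def vert (x : M) : Submodule ℝ (TangentSpace 𝓘(ℝ, E) x) :=
  Submodule.span ℝ {v | ∃ ξ : K.Lg, K.IsBased ς ξ ∧ v = genField K ς ξ x}

/-! ### Level `ℓ` spinor bundles and the `Spin_c` moment map -/

variable {ℓ : Fin m → ℤ} {Ghat : Type*} [Group Ghat] [TopologicalSpace Ghat]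
  [ChartedSpace (K.Lg × ℝ) Ghat] (P : K.LevelExtension ς ℓ Ghat)
  {F : Type*} [NormedAddCommGroup F] [NormedSpace ℂ F]
  {S : M → Type*} [TopologicalSpace (TotalSpace F S)]
  [∀ x, AddCommGroup (S x)] [∀ x, Module ℂ (S x)] [∀ x, TopologicalSpace (S x)]
  [∀ x, IsTopologicalAddGroup (S x)] [∀ x, ContinuousSMul ℝ (S x)]
  [FiberBundle F S] [VectorBundle ℝ F S] [ContMDiffVectorBundle ∞ F S 𝓘(ℝ, E)]
  [MulAction Ghat (TotalSpace F S)]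

/-- The component in the fibre over `x` of a point of the total space that lies over `x`. -/
def toFiber (x : M) (u : TotalSpace F S) : S x :=
  open Classical in if h : u.proj = x then h ▸ u.2 else 0

/-- The map `S_x → S_{a x}` given by the action of `a ∈ Ghat` on the bundle `S`. -/
def fibAct (a : Ghat) (x : M) (s : S x) : S (P.proj a • x) :=
  toFiber (F := F) (P.proj a • x) (a • TotalSpace.mk' F x s)

/-- A spinor bundle `S` of level `ℓ` for `hol^* T(M / ΩG) = TM / (tangent spaces of ΩG-orbits)`,
the metric on `M / ΩG` being given by its pullback `h` to `M`. The Clifford action is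
`c : TM → End S`, with kernel the directions of the `ΩG`-orbits, and `grading` is the grading
operator. -/
structure IsSpinorBundle
    (h : ∀ x : M, TangentSpace 𝓘(ℝ, E) x →L[ℝ] TangentSpace 𝓘(ℝ, E) x →L[ℝ] ℝ)
    (metric : ContMDiffRiemannianMetric 𝓘(ℝ, E) ∞ F S)
    (grading : ∀ x : M, S x →L[ℝ] S x)
    (c : ∀ x : M, TangentSpace 𝓘(ℝ, E) x →L[ℝ] S x →L[ℝ] S x) : Prop where
  h_smooth : IsSmoothTwoTensor h
  h_symm (x : M) (v w : TangentSpace 𝓘(ℝ, E) x) : h x v w = h x w v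
  h_nonneg (x : M) (v : TangentSpace 𝓘(ℝ, E) x) : 0 ≤ h x v v
  h_ker (x : M) (v : TangentSpace 𝓘(ℝ, E) x) : h x v v = 0 ↔ v ∈ vert K ς x
  h_invariant (g : K.LG ς) (x : M) (v w : TangentSpace 𝓘(ℝ, E) x) :
    h (g • x) (dAct K ς g x v) (dAct K ς g x w) = h x v w
  metric_hermitian (x : M) (s t : S x) :
    metric.inner x (Complex.I • s) (Complex.I • t) = metric.inner x s t
  grading_smooth : ContMDiff 𝓘(ℝ, E) (𝓘(ℝ, E).prod 𝓘(ℝ, F →L[ℝ] F)) ∞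
    fun x => TotalSpace.mk' (F →L[ℝ] F) (E := fun x : M => S x →L[ℝ] S x) x (grading x)
  grading_I (x : M) (s : S x) : grading x (Complex.I • s) = Complex.I • grading x s
  grading_sq (x : M) (s : S x) : grading x (grading x s) = s
  grading_symm (x : M) (s t : S x) :
    metric.inner x (grading x s) t = metric.inner x s (grading x t)
  c_smooth : ContMDiff 𝓘(ℝ, E) (𝓘(ℝ, E).prod 𝓘(ℝ, E →L[ℝ] F →L[ℝ] F)) ∞
    fun x => TotalSpace.mk' (E →L[ℝ] F →L[ℝ] F)
      (E := fun x : M => TangentSpace 𝓘(ℝ, E) x →L[ℝ] S x →L[ℝ] S x) x (c x)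
  c_I (x : M) (v : TangentSpace 𝓘(ℝ, E) x) (s : S x) :
    c x v (Complex.I • s) = Complex.I • c x v s
  c_odd (x : M) (v : TangentSpace 𝓘(ℝ, E) x) (s : S x) :
    grading x (c x v s) = -c x v (grading x s)
  c_sq (x : M) (v : TangentSpace 𝓘(ℝ, E) x) (s : S x) : c x v (c x v s) = -(h x v v • s)
  c_skew (x : M) (v : TangentSpace 𝓘(ℝ, E) x) (s t : S x) :
    metric.inner x (c x v s) t = -metric.inner x s (c x v t)
  /-- The fibres of the complex Clifford bundle are matrix algebras of size `2^(rank / 2)`, so that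
  the Clifford action is an isomorphism onto `End S` if and only if `S` has that rank. -/
  rank (x : M) : Module.finrank ℂ (S x) ^ 2 =
    2 ^ Module.finrank ℝ (TangentSpace 𝓘(ℝ, E) x ⧸ vert K ς x)
  act_proj (a : Ghat) (u : TotalSpace F S) : (a • u).proj = P.proj a • u.proj
  act_smooth : ContMDiff (𝓘(ℝ, K.Lg × ℝ).prod (𝓘(ℝ, E).prod 𝓘(ℝ, F)))
    (𝓘(ℝ, E).prod 𝓘(ℝ, F)) ∞ fun q : Ghat × TotalSpace F S => q.1 • q.2
  act_add (a : Ghat) (x : M) (s t : S x) :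
    fibAct K ς P (F := F) a x (s + t) = fibAct K ς P (F := F) a x s + fibAct K ς P (F := F) a x t
  act_smul (a : Ghat) (x : M) (z : ℂ) (s : S x) :
    fibAct K ς P (F := F) a x (z • s) = z • fibAct K ς P (F := F) a x s
  act_central (z : Circle) (x : M) (s : S x) :
    P.central z • TotalSpace.mk' F x s = TotalSpace.mk' F x ((z : ℂ) • s)
  act_unitary (a : Ghat) (x : M) (s t : S x) :
    metric.inner _ (fibAct K ς P (F := F) a x s) (fibAct K ς P (F := F) a x t) =
      metric.inner x s t
  act_grading (a : Ghat) (x : M) (s : S x) :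
    fibAct K ς P (F := F) a x (grading x s) = grading _ (fibAct K ς P (F := F) a x s)
  act_c (a : Ghat) (x : M) (v : TangentSpace 𝓘(ℝ, E) x) (s : S x) :
    fibAct K ς P (F := F) a x (c x v s) =
      c _ (dAct K ς (P.proj a) x v) (fibAct K ς P (F := F) a x s)

/-- The fibre at `x` of the anti-canonical line bundle `𝓛 = Hom_{ℂl}(S^*, S)`. The Hermitian metric
identifies the dual of `S_x` with the conjugate of `S_x`, hence `𝓛_x` with the complex antilinear
maps `S_x → S_x` that commute with the Clifford action; `z ∈ ℂ` acts by `(z λ)(s) = z λ(s)`. -/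
def InAnticanonical (c : ∀ x : M, TangentSpace 𝓘(ℝ, E) x →L[ℝ] S x →L[ℝ] S x) (x : M)
    (lam : S x →L[ℝ] S x) : Prop :=
  (∀ s, lam (Complex.I • s) = -(Complex.I • lam s)) ∧ ∀ v s, lam (c x v s) = c x v (lam s)

/-- `lam` is a smooth section of `𝓛` over the open set `U`. -/
def IsSectionOn (c : ∀ x : M, TangentSpace 𝓘(ℝ, E) x →L[ℝ] S x →L[ℝ] S x) (U : Set M)
    (lam : ∀ x : M, S x →L[ℝ] S x) : Prop :=
  IsOpen U ∧ (∀ x ∈ U, InAnticanonical c x (lam x)) ∧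
    ContMDiffOn 𝓘(ℝ, E) (𝓘(ℝ, E).prod 𝓘(ℝ, F →L[ℝ] F)) ∞
      (fun x => TotalSpace.mk' (F →L[ℝ] F) (E := fun x : M => S x →L[ℝ] S x) x (lam x)) U

/-- The differential of a complex valued function on `M`. -/
def dFun (f : M → ℂ) (x : M) (v : TangentSpace 𝓘(ℝ, E) x) : ℂ := mfderiv 𝓘(ℝ, E) 𝓘(ℝ, ℂ) f x v

/-- `D` is an invariant Hermitian connection on `𝓛`, as a covariant derivative of local sections.
The Hermitian metric on `𝓛` is the one for which the unit sections consist of isometries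
of the fibres of `S`. -/
structure IsConnection (metric : ContMDiffRiemannianMetric 𝓘(ℝ, E) ∞ F S)
    (c : ∀ x : M, TangentSpace 𝓘(ℝ, E) x →L[ℝ] S x →L[ℝ] S x)
    (D : (∀ x : M, S x →L[ℝ] S x) → ∀ x : M, TangentSpace 𝓘(ℝ, E) x →L[ℝ] S x →L[ℝ] S x) :
    Prop where
  mem (U : Set M) (lam : ∀ x : M, S x →L[ℝ] S x) (hl : IsSectionOn (F := F) c U lam) (x : M)
    (hx : x ∈ U) (v : TangentSpace 𝓘(ℝ, E) x) : InAnticanonical c x (D lam x v)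
  smooth (U : Set M) (lam : ∀ x : M, S x →L[ℝ] S x) (hl : IsSectionOn (F := F) c U lam) :
    ContMDiffOn 𝓘(ℝ, E) (𝓘(ℝ, E).prod 𝓘(ℝ, E →L[ℝ] F →L[ℝ] F)) ∞
      (fun x => TotalSpace.mk' (E →L[ℝ] F →L[ℝ] F)
        (E := fun x : M => TangentSpace 𝓘(ℝ, E) x →L[ℝ] S x →L[ℝ] S x) x (D lam x)) U
  local_op (U : Set M) (lam lam' : ∀ x : M, S x →L[ℝ] S x) (hl : IsSectionOn (F := F) c U lam)
    (heq : ∀ x ∈ U, lam x = lam' x) (x : M) (hx : x ∈ U) : D lam x = D lam' x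
  add (U : Set M) (lam lam' : ∀ x : M, S x →L[ℝ] S x) (hl : IsSectionOn (F := F) c U lam)
    (hl' : IsSectionOn (F := F) c U lam') (x : M) (hx : x ∈ U) :
    D (fun y => lam y + lam' y) x = D lam x + D lam' x
  leibniz (U : Set M) (f : M → ℂ) (hf : ContMDiffOn 𝓘(ℝ, E) 𝓘(ℝ, ℂ) ∞ f U)
    (lam lam' : ∀ x : M, S x →L[ℝ] S x) (hl : IsSectionOn (F := F) c U lam)
    (hl' : ∀ x ∈ U, ∀ s, lam' x s = f x • lam x s)
    (x : M) (hx : x ∈ U) (v : TangentSpace 𝓘(ℝ, E) x) (s : S x) :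
    D lam' x v s = dFun f x v • lam x s + f x • D lam x v s
  hermitian (U : Set M) (lam : ∀ x : M, S x →L[ℝ] S x) (hl : IsSectionOn (F := F) c U lam)
    (hunit : ∀ x ∈ U, ∀ s, metric.inner x (lam x s) (lam x s) = metric.inner x s s)
    (x : M) (hx : x ∈ U) (v : TangentSpace 𝓘(ℝ, E) x) :
    ∃ a : ℝ, ∀ s, D lam x v s = ((a : ℂ) * Complex.I) • lam x s
  invariant (a : Ghat) (U U' : Set M) (lam lam' : ∀ x : M, S x →L[ℝ] S x)
    (hU : ∀ x ∈ U, P.proj a • x ∈ U')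
    (hl : IsSectionOn (F := F) c U lam) (hl' : IsSectionOn (F := F) c U' lam')
    (heq : ∀ x ∈ U, ∀ s, lam' (P.proj a • x) (fibAct K ς P (F := F) a x s) =
      fibAct K ς P (F := F) a x (lam x s))
    (x : M) (hx : x ∈ U) (v : TangentSpace 𝓘(ℝ, E) x) (s : S x) :
    D lam' (P.proj a • x) (dAct K ς (P.proj a) x v) (fibAct K ς P (F := F) a x s) =
      fibAct K ς P (F := F) a x (D lam x v s)

/-- The section `a · lam` of `𝓛`, `(a · lam)(x) = a ∘ lam(a⁻¹ x) ∘ a⁻¹`, evaluated at `s ∈ S_x`. -/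
def actSection (a : Ghat) (lam : ∀ x : M, S x →L[ℝ] S x) (x : M) (s : S x) : S x :=
  toFiber (F := F) x (a • TotalSpace.mk' F (P.proj a⁻¹ • x)
    (lam (P.proj a⁻¹ • x) (fibAct K ς P (F := F) a⁻¹ x s)))

/-- `φM` is the `Spin_c` moment map: `2 π i ⟨φM, ξ⟩ = (1/2) (𝓛_ξ - D_{ξ_M})` on sections of the
anti-canonical line bundle, where `𝓛_ξ lam = d/du|₀ exp (u ξ) · lam`. -/
def IsSpincMomentMap (c : ∀ x : M, TangentSpace 𝓘(ℝ, E) x →L[ℝ] S x →L[ℝ] S x)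
    (D : (∀ x : M, S x →L[ℝ] S x) → ∀ x : M, TangentSpace 𝓘(ℝ, E) x →L[ℝ] S x →L[ℝ] S x)
    (φM : M → Module.Dual ℝ K.Lg) : Prop :=
  ∀ (ξ : K.Lg) (U : Set M) (lam : ∀ x : M, S x →L[ℝ] S x), IsSectionOn (F := F) c U lam →
    ∀ x ∈ U, ∀ s : S x, HasDerivAt (fun u : ℝ => actSection K ς P (F := F) (P.exp (u • ξ)) lam x s)
      (D lam x (genField K ς ξ x) s + (2 * (2 * Real.pi * φM x ξ : ℝ) * Complex.I) • lam x s) 0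

/-! ### The Kirwan vector field and its zero set -/

/-- The fixed point set `X^β` of the one-parameter group generated by `β ∈ 𝔱`. -/
def fixedSet (X : Set M) (β : K.t) : Set M :=
  {x ∈ X | ∀ u : ℝ, K.loopExp ς (K.const (u • β)) • x = x}

/-- `Z_β = X^β ∩ φ⁻¹(β)`. -/
def zeroPart (X : Set M) (φ : M → K.t) (β : K.t) : Set M :=
  fixedSet K ς X β ∩ {x | φ x = β}

/-- The set `B` of all `β` with `Z_β ≠ ∅`. -/
def indexSet (X : Set M) (φ : M → K.t) : Set K.t := {β | (zeroPart K ς X φ β).Nonempty}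

/-- The `Spin_c` Kirwan vector field `κ(x) = φ(x)_X(x)`. -/
def kirwan (φ : M → K.t) (x : M) : TangentSpace 𝓘(ℝ, E) x := genField K ς (K.const (φ x)) x

/-- `A` is a finite subset of `B` such that each `Z_β`, `β ∈ B`, is a `Π`-translate of some `Z_α`
with `α ∈ A`. -/
def IsFiniteSystem (X : Set M) (φ : M → K.t) (A : Set K.t) : Prop :=
  A ⊆ indexSet K ς X φ ∧ A.Finite ∧ ∀ β ∈ indexSet K ς X φ, ∃ α ∈ A, ∃ g ∈ K.latticeLoops ς,
    zeroPart K ς X φ β = (fun x => g • x) '' zeroPart K ς X φ α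

end Hamiltonian

end LoopSpace

end

/-!
Why the theorem holds.

A one-parameter group fixes a point exactly when its generating vector field vanishes there
(`genField_eq_zero_iff`), so `κ` vanishes at `x` exactly when `exp (u β)` fixes `x` for all `u`,
where `β = φ x`. This is the description of the zeros of `κ`.

Everything else rests on how `φ` changes along the lattice. The `Spin_c` moment map is equivariant
for the affine action of the loop group that the central extension defines on the dual of its Lie
algebra (`IsSpincMomentMap.smul_eq`). This is read off from the moment map equation for a local
section of the anti-canonical line bundle and for its translates by lifts of loops; sections without
zeros near a given point are made by averaging a conjugate linear endomorphism over a local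
orthonormal frame of the Clifford action (`IsSpinorBundle.exists_section`). The lattice loop of a
co-root is a product of two exponentials in the loop group of the `SU(2)` of the co-root, so its
adjoint action on the central extension is found by integrating the cocycle along two explicit
curves (`CompactGroup.exists_lift`). Together, `φ (η · x) = φ x + ℓ η` for `η` in the co-root
lattice (`IsSpincMomentMap.eq_add_levelT`).

Finiteness modulo the lattice has three ingredients.

* If `η` in the lattice fixes `x` along its one-parameter group, then `exp η` acts on the fibre of
  the line bundle at `x` by a scalar that does not depend on `x`, as its lift is central, so the
  pairing of `φ x` with `η` is determined modulo half integers (`IsSpincMomentMap.exp_eq`).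
* The transversal is the union of the lattice translates of a compact set, since the moment map is
  proper (`IsHamiltonian.exists_isCompact`).
* Only finitely many infinitesimal stabilizers for the action of the maximal torus occur near a
  point (`TorusAction.exists_nhds_finite_stab`), hence also on the whole transversal
  (`IsSpinorBundle.finite_stab`). The action is linearized near the point by averaging a chart over
  the stabilizer. The isotropy representation is on a Banach space, but it has finitely many
  weights: the tangent space of the orbit of the based loop group is an image of `L𝔤`, on which
  the torus acts pointwise, and the normal space is finite-dimensional because the spinor bundle has
  finite rank (`exists_isotropyWeights`).

The stabilizer of a set of points is a closed subgroup of the torus, so the lattice is cocompact in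
its Lie algebra. A critical value `β` at `x` belongs to the Lie algebra of the stabilizer of `x`,
where its pairings with the lattice are determined modulo half integers. For each of the finitely
many stabilizers these values fall into finitely many classes under translation by `ℓ` times the
lattice, and each class contributes one orbit of critical sets
(`TorusAction.exists_finite_critical`). A finite system of least cardinality is minimal.

If `κ` is invariant under the lattice, then comparing `κ` at `x` and at `η · x` shows that the
generating vector field of `ℓ η` vanishes at all points of the transversal. The co-roots span `𝔱`
(`span_coroots`) and the level is positive, so all of `𝔱` acts trivially there. That there are
enough co-roots is derived from the definition of the maximal torus: a nonzero element of `𝔱` does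
not commute with all of the simple Lie algebra, so it acts non-trivially on some root vector
(`exists_isCoroot_trace_ne_zero`).
-/
noncomputable section

namespace LoopSpace

open Polynomial Module

/-! ### Weights of commuting families of operators -/

/-- A commuting family of operators that preserves a nonzero finite-dimensional complex subspace
has a common eigenvector in it: on a minimal invariant subspace each operator is a scalar. -/
theorem exists_common_eigenvector {V : Type*} [AddCommGroup V] [Module ℂ V]
    {ι : Type*} (B : ι → End ℂ V) (hB : ∀ i j, Commute (B i) (B j)) (W : Submodule ℂ V)
    [FiniteDimensional ℂ W] (hW : W ≠ ⊥) (hinv : ∀ i, ∀ w ∈ W, B i w ∈ W) :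
    ∃ v ∈ W, v ≠ 0 ∧ ∃ χ : ι → ℂ, ∀ i, B i v = χ i • v := by
  induction hn : finrank ℂ W using Nat.strong_induction_on generalizing W with
  | _ n ih =>
  by_cases hscal : ∀ i, ∃ c : ℂ, ∀ w ∈ W, B i w = c • w
  · choose χ hχ using hscal
    obtain ⟨v, hv, hv0⟩ := W.ne_bot_iff.1 hW
    exact ⟨v, hv, hv0, χ, fun i => hχ i v hv⟩
  · push Not at hscal
    obtain ⟨i, hi⟩ := hscal
    have : Nontrivial W := Submodule.nontrivial_iff_ne_bot.2 hW
    obtain ⟨c, hc⟩ := Module.End.exists_eigenvalue ((B i).restrict (hinv i))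
    obtain ⟨w, hw⟩ := hc.exists_hasEigenvector
    -- the eigenspace is a smaller invariant subspace
    let W' : Submodule ℂ V := W ⊓ Module.End.eigenspace (B i) c
    have hmem : ∀ x, x ∈ W' ↔ x ∈ W ∧ B i x = c • x := fun x => by
      simp [W']
    have hW' : W' ≠ ⊥ := by
      refine (Submodule.ne_bot_iff _).2 ⟨w, (hmem _).2 ⟨w.2, ?_⟩, ?_⟩
      · have := congrArg Subtype.val hw.apply_eq_smul
        simpa using this
      · simpa using hw.2
    obtain ⟨x, hx, hxc⟩ := hi c
    have hlt : W' < W := lt_of_le_of_ne inf_le_left fun h => hxc (((hmem x).1 (h ▸ hx)).2)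
    have : FiniteDimensional ℂ W' := Submodule.finiteDimensional_of_le hlt.le
    obtain ⟨v, hv, hv0, χ, hχ⟩ := ih _ (hn ▸ Submodule.finrank_lt_finrank_of_lt hlt) W' hW'
      (fun j w hw => (hmem _).2 ⟨hinv j w ((hmem w).1 hw).1, by
        rw [← Module.End.mul_apply, (hB i j).eq, Module.End.mul_apply, ((hmem w).1 hw).2,
          map_smul]⟩) rfl
    exact ⟨v, hlt.le hv, hv0, χ, hχ⟩

theorem aeval_intertwine {R U U' : Type*} [CommRing R] [AddCommGroup U] [Module R U]
    [AddCommGroup U'] [Module R U'] (T : U →ₗ[R] U') (A : End R U) (A' : End R U')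
    (h : ∀ u, T (A u) = A' (T u)) (p : R[X]) (u : U) : T (aeval A p u) = aeval A' p (T u) := by
  induction p using Polynomial.induction_on' generalizing u with
  | add p q hp hq => simp [hp, hq]
  | monomial k a =>
    have : ∀ y, T ((A ^ k) y) = (A' ^ k) (T y) := by
      induction k with
      | zero => intro y; rfl
      | succ k ihk =>
        intro y; rw [pow_succ, pow_succ, Module.End.mul_apply, Module.End.mul_apply, ihk, h]
    rw [aeval_monomial, aeval_monomial, Module.End.mul_apply, Module.End.mul_apply, ← this]
    simp [Module.algebraMap_end_apply]

/-- The polynomial with the roots `χ ξ`, `χ ∈ L`. -/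
def weightPoly {V : Type*} [AddCommGroup V] [Module ℝ V] (L : List (V →ₗ[ℝ] ℂ)) (ξ : V) : ℂ[X] :=
  (L.map fun χ => X - C (χ ξ)).prod

/-- A commuting real-linear family of operators on a finite-dimensional complex space is killed
by a product of linear factors that depend linearly on the parameter. -/
theorem exists_weights {𝔥 : Type*} [AddCommGroup 𝔥] [Module ℝ 𝔥]
    {V : Type*} [AddCommGroup V] [Module ℂ V] [FiniteDimensional ℂ V]
    (B : 𝔥 →ₗ[ℝ] End ℂ V) (hB : ∀ ξ ζ, Commute (B ξ) (B ζ)) :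
    ∃ L : List (𝔥 →ₗ[ℝ] ℂ), ∀ ξ, aeval (B ξ) (weightPoly L ξ) = 0 := by
  induction hn : finrank ℂ V generalizing V with
  | zero =>
    have := finrank_zero_iff.1 hn
    exact ⟨[], fun ξ => LinearMap.ext fun v => Subsingleton.elim _ _⟩
  | succ n ih =>
    have : Nontrivial V := nontrivial_of_finrank_pos (R := ℂ) (by omega)
    obtain ⟨v, -, hv, χ, hχ⟩ := exists_common_eigenvector (fun ξ => B ξ) hB ⊤ top_ne_bot
      (fun _ _ _ => trivial)
    -- the eigenvalue is a real-linear function of the parameter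
    have hlin : ∃ χ' : 𝔥 →ₗ[ℝ] ℂ, ∀ ξ, B ξ v = χ' ξ • v := by
      refine ⟨{ toFun := χ, map_add' := fun a b => ?_, map_smul' := fun c a => ?_ }, hχ⟩
      · apply smul_left_injective ℂ hv
        simp only [add_smul]
        rw [← hχ, ← hχ, ← hχ, map_add]; rfl
      · apply smul_left_injective ℂ hv
        simp only [RingHom.id_apply]
        rw [← hχ, map_smul, LinearMap.smul_apply, hχ, smul_assoc]
    obtain ⟨χ', hχ'⟩ := hlin
    have hle : ∀ ξ, ℂ ∙ v ≤ (ℂ ∙ v).comap (B ξ) := fun ξ => by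
      rw [Submodule.span_singleton_le_iff_mem, Submodule.mem_comap, hχ']
      exact Submodule.smul_mem _ _ (Submodule.mem_span_singleton_self v)
    let B' : 𝔥 →ₗ[ℝ] End ℂ (V ⧸ ℂ ∙ v) :=
      { toFun := fun ξ => (ℂ ∙ v).mapQ (ℂ ∙ v) (B ξ) (hle ξ)
        map_add' := fun a b => by ext x; simp
        map_smul' := fun c a => by ext x; simp }
    have hB' : ∀ ξ x, B' ξ ((ℂ ∙ v).mkQ x) = (ℂ ∙ v).mkQ (B ξ x) := fun ξ x => rfl
    have hpB' : ∀ ξ (p : ℂ[X]) x, aeval (B' ξ) p ((ℂ ∙ v).mkQ x) = (ℂ ∙ v).mkQ (aeval (B ξ) p x) := by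
      exact fun ξ p x => (aeval_intertwine _ _ _ (fun u => (hB' ξ u).symm) p x).symm
    have hfr : finrank ℂ (V ⧸ ℂ ∙ v) = n := by
      have h1 := Submodule.finrank_quotient_add_finrank (ℂ ∙ v)
      rw [finrank_span_singleton hv] at h1
      omega
    obtain ⟨L, hL⟩ := ih B' (fun ξ ζ => by
      refine LinearMap.ext fun x => ?_
      obtain ⟨x, rfl⟩ := (ℂ ∙ v).mkQ_surjective x
      rw [Module.End.mul_apply, Module.End.mul_apply, hB', hB', hB', hB', ← Module.End.mul_apply,
        (hB ξ ζ).eq, Module.End.mul_apply]) hfr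
    refine ⟨χ' :: L, fun ξ => LinearMap.ext fun x => ?_⟩
    have h0 : (ℂ ∙ v).mkQ (aeval (B ξ) (weightPoly L ξ) x) = 0 := by rw [← hpB', hL]; rfl
    rw [Submodule.mkQ_apply, Submodule.Quotient.mk_eq_zero, Submodule.mem_span_singleton] at h0
    obtain ⟨c, hc⟩ := h0
    rw [weightPoly, List.map_cons, List.prod_cons, map_mul, Module.End.mul_apply,
      ← weightPoly, ← hc]
    simp [hχ', Module.algebraMap_end_apply]

/-- The real polynomial with the roots `χ ξ` and their conjugates, `χ ∈ L`. -/
def realWeightPoly {V : Type*} [AddCommGroup V] [Module ℝ V] (L : List (V →ₗ[ℝ] ℂ)) (ξ : V) : ℝ[X] :=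
  (L.map fun χ => X ^ 2 - C (2 * (χ ξ).re) * X + C (Complex.normSq (χ ξ))).prod

theorem realWeightPoly_append {V : Type*} [AddCommGroup V] [Module ℝ V]
    (L L' : List (V →ₗ[ℝ] ℂ)) (ξ : V) :
    realWeightPoly (L ++ L') ξ = realWeightPoly L ξ * realWeightPoly L' ξ := by
  simp [realWeightPoly]

theorem weightPoly_dvd_realWeightPoly {V : Type*} [AddCommGroup V] [Module ℝ V]
    (L : List (V →ₗ[ℝ] ℂ)) (ξ : V) :
    weightPoly L ξ ∣ (realWeightPoly L ξ).map (algebraMap ℝ ℂ) := by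
  induction L with
  | nil => simp [weightPoly, realWeightPoly]
  | cons χ L ih =>
    simp only [weightPoly, realWeightPoly, List.map_cons, List.prod_cons, Polynomial.map_mul] at ih ⊢
    refine mul_dvd_mul ⟨X - C (starRingEnd ℂ (χ ξ)), ?_⟩ ih
    have h1 : (C ((2 * (χ ξ).re : ℝ) : ℂ) : ℂ[X]) = C (χ ξ) + C (starRingEnd ℂ (χ ξ)) := by
      rw [← C_add, Complex.add_conj]
    have h2 : (C ((Complex.normSq (χ ξ) : ℝ) : ℂ) : ℂ[X]) = C (χ ξ) * C (starRingEnd ℂ (χ ξ)) := by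
      rw [← C_mul, Complex.mul_conj]
    simp only [Polynomial.map_add, Polynomial.map_sub, Polynomial.map_mul, Polynomial.map_pow,
      map_X, map_C, Complex.coe_algebraMap]
    rw [h1, h2]; ring

/-- Real version of `exists_weights`, obtained by complexification. -/
theorem exists_realWeights {𝔥 : Type*} [AddCommGroup 𝔥] [Module ℝ 𝔥]
    {V : Type*} [AddCommGroup V] [Module ℝ V] [FiniteDimensional ℝ V]
    (B : 𝔥 →ₗ[ℝ] End ℝ V) (hB : ∀ ξ ζ, Commute (B ξ) (B ζ)) :
    ∃ L : List (𝔥 →ₗ[ℝ] ℂ), ∀ ξ, aeval (B ξ) (realWeightPoly L ξ) = 0 := by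
  let BC : 𝔥 →ₗ[ℝ] End ℂ (TensorProduct ℝ ℂ V) :=
    { toFun := fun ξ => (B ξ).baseChange ℂ
      map_add' := fun a b => by rw [map_add, LinearMap.baseChange_add]
      map_smul' := fun c a => by
        rw [map_smul, LinearMap.baseChange_smul]; rfl }
  obtain ⟨L, hL⟩ := exists_weights BC (fun ξ ζ => by
    change (B ξ).baseChange ℂ * (B ζ).baseChange ℂ = (B ζ).baseChange ℂ * (B ξ).baseChange ℂ
    rw [Module.End.mul_eq_comp, Module.End.mul_eq_comp, ← LinearMap.baseChange_comp,
      ← LinearMap.baseChange_comp, ← Module.End.mul_eq_comp, ← Module.End.mul_eq_comp,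
      (hB ξ ζ).eq])
  refine ⟨L, fun ξ => LinearMap.ext fun v => ?_⟩
  let T : V →ₗ[ℝ] TensorProduct ℝ ℂ V := TensorProduct.mk ℝ ℂ V 1
  have hT : Function.Injective T := by
    have := Module.Flat.rTensor_preserves_injective_linearMap (M := V) (Algebra.linearMap ℝ ℂ)
      (algebraMap ℝ ℂ).injective
    intro a b hab
    have h2 := @this ((TensorProduct.lid ℝ V).symm a) ((TensorProduct.lid ℝ V).symm b)
      (by simpa [T] using hab)
    exact (TensorProduct.lid ℝ V).symm.injective h2
  apply hT
  rw [LinearMap.zero_apply, map_zero,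
    aeval_intertwine T (B ξ) ((BC ξ).restrictScalars ℝ) (fun u => rfl)]
  have h1 : ∀ (p : ℝ[X]) (x : TensorProduct ℝ ℂ V), aeval ((BC ξ).restrictScalars ℝ) p x =
      aeval (BC ξ) (p.map (algebraMap ℝ ℂ)) x := by
    intro p x
    rw [Polynomial.aeval_map_algebraMap]
    induction p using Polynomial.induction_on' with
    | add p q hp hq => simp [hp, hq]
    | monomial k a =>
      have : ∀ y, (((BC ξ).restrictScalars ℝ) ^ k) y = ((BC ξ) ^ k) y := by
        induction k with
        | zero => intro y; rfl
        | succ k ihk =>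
          intro y; rw [pow_succ, pow_succ, Module.End.mul_apply, Module.End.mul_apply, ihk]; rfl
      rw [aeval_monomial, aeval_monomial, Module.End.mul_apply, Module.End.mul_apply, this]
      simp [Algebra.algebraMap_eq_smul_one]
  rw [h1]
  obtain ⟨q, hq⟩ := weightPoly_dvd_realWeightPoly L ξ
  rw [hq, mul_comm, map_mul]
  exact (congrArg (fun f => aeval (BC ξ) q (f (T v))) (hL ξ)).trans (map_zero _)

open Polynomial Module

/-- The real quadratic polynomial with a root `a` that is large compared with `‖B‖` acts injectively
under `B`. -/
theorem eq_zero_of_quadratic_eq_zero {E : Type*} [NormedAddCommGroup E] [NormedSpace ℝ E]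
    (B : E →L[ℝ] E) (a : ℂ) (ha : 3 * ‖B‖ < ‖a‖) (v : E)
    (h : B (B v) - (2 * a.re) • B v + Complex.normSq a • v = 0) : v = 0 := by
  by_contra hv
  have hv' : 0 < ‖v‖ := norm_pos_iff.2 hv
  have h1 : Complex.normSq a • v = (2 * a.re) • B v - B (B v) := by
    rw [← sub_eq_zero, ← h]; abel
  have h2 : ‖a‖ ^ 2 * ‖v‖ ≤ (2 * ‖a‖) * (‖B‖ * ‖v‖) + ‖B‖ * (‖B‖ * ‖v‖) := by
    calc ‖a‖ ^ 2 * ‖v‖ = ‖Complex.normSq a • v‖ := by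
          rw [norm_smul, Complex.normSq_eq_norm_sq, Real.norm_of_nonneg (by positivity)]
      _ ≤ ‖(2 * a.re) • B v‖ + ‖B (B v)‖ := by rw [h1]; exact norm_sub_le _ _
      _ ≤ _ := by
          gcongr
          · rw [norm_smul, norm_mul]
            gcongr
            · simp
            · exact Complex.abs_re_le_norm a
            · exact B.le_opNorm v
          · exact (B.le_opNorm _).trans (by gcongr; exact B.le_opNorm v)
  have hB : 0 ≤ ‖B‖ := norm_nonneg B
  have h3 : ‖a‖ ^ 2 ≤ 2 * ‖a‖ * ‖B‖ + ‖B‖ * ‖B‖ := by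
    refine le_of_mul_le_mul_right ?_ hv'
    linarith
  nlinarith

/-- On the kernel of `B ξ` the operators `B (ξ' + ξ)` and `B ξ'` agree, so the factors of the weight
polynomial that belong to weights larger than `3 ‖B ξ'‖` act injectively. If all other weights vanish
at `ξ' + ξ`, then `B ξ'` acts nilpotently. -/
theorem exists_pow_apply_eq_zero {𝔥 : Type*} [AddCommGroup 𝔥] [Module ℝ 𝔥]
    {E : Type*} [NormedAddCommGroup E] [NormedSpace ℝ E]
    (B : 𝔥 →ₗ[ℝ] (E →L[ℝ] E)) (hB : ∀ ξ ζ v, B ξ (B ζ v) = B ζ (B ξ v))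
    (ξ ξ' : 𝔥) (L : List (𝔥 →ₗ[ℝ] ℂ))
    (hL : ∀ χ ∈ L, χ (ξ' + ξ) = 0 ∨ 3 * ‖B ξ'‖ < ‖χ (ξ' + ξ)‖) (w : E) (hw : B ξ w = 0)
    (h : aeval (B (ξ' + ξ) : End ℝ E) (realWeightPoly L (ξ' + ξ)) w = 0) :
    ∃ n : ℕ, ((B ξ' : End ℝ E) ^ n) w = 0 := by
  induction L generalizing w with
  | nil => exact ⟨0, by simpa [realWeightPoly] using h⟩
  | cons χ L ih =>
    have hsum : ∀ u, B ξ u = 0 → B (ξ' + ξ) u = B ξ' u := fun u hu => by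
      rw [map_add, add_apply, hu, add_zero]
    set a := χ (ξ' + ξ) with ha
    set w1 := B ξ' (B ξ' w) - (2 * a.re) • B ξ' w + Complex.normSq a • w with hw1
    have hBw : B ξ (B ξ' w) = 0 := by rw [hB, hw, map_zero]
    have hBBw : B ξ (B ξ' (B ξ' w)) = 0 := by rw [hB, hBw, map_zero]
    have hw1' : B ξ w1 = 0 := by simp [hw1, hw, hBw, hBBw]
    obtain ⟨n, hn⟩ := ih (fun χ hχ => hL χ (List.mem_cons_of_mem _ hχ)) w1 hw1' (by
      rw [realWeightPoly, List.map_cons, List.prod_cons, mul_comm, map_mul,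
        Module.End.mul_apply] at h
      have h1 : aeval (B (ξ' + ξ) : End ℝ E)
          (X ^ 2 - C (2 * (χ (ξ' + ξ)).re) * X + C (Complex.normSq (χ (ξ' + ξ)))) w = w1 := by
        simp only [map_add (aeval _), map_sub, map_mul, map_pow, aeval_X, aeval_C,
          LinearMap.add_apply, LinearMap.sub_apply, Module.End.mul_apply,
          Module.algebraMap_end_apply, pow_two, ContinuousLinearMap.coe_coe]
        rw [hw1, ← ha, hsum w hw, hsum _ hBw, mul_smul]
      rw [h1] at h
      exact h)
    have hn' : B ξ' (B ξ' (((B ξ' : End ℝ E) ^ n) w)) - (2 * a.re) • B ξ' (((B ξ' : End ℝ E) ^ n) w) +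
        Complex.normSq a • ((B ξ' : End ℝ E) ^ n) w = 0 := by
      rw [← hn, hw1, map_add, map_sub, map_smul, map_smul]
      have hc : ∀ u, ((B ξ' : End ℝ E) ^ n) (B ξ' u) = B ξ' (((B ξ' : End ℝ E) ^ n) u) := fun u => by
        rw [← ContinuousLinearMap.coe_coe, ← Module.End.mul_apply, ← pow_succ, pow_succ',
          Module.End.mul_apply]
      rw [hc, hc]
    rcases hL χ List.mem_cons_self with h0 | h0
    · refine ⟨n + 2, ?_⟩
      rw [← ha] at h0
      rw [pow_succ', pow_succ', Module.End.mul_apply, Module.End.mul_apply]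
      simpa [h0] using hn'
    · exact ⟨n, eq_zero_of_quadratic_eq_zero (B ξ') a h0 _ hn'⟩

/-- A commuting linear family of semisimple operators with finitely many weights has only finitely
many annihilators of vectors: the annihilator of `v` is the common kernel of the weights that
vanish on it. -/
theorem finite_annihilators {𝔥 : Type*} [AddCommGroup 𝔥] [Module ℝ 𝔥]
    {E : Type*} [NormedAddCommGroup E] [NormedSpace ℝ E]
    (B : 𝔥 →ₗ[ℝ] (E →L[ℝ] E)) (hB : ∀ ξ ζ v, B ξ (B ζ v) = B ζ (B ξ v))
    (hss : ∀ ξ v, B ξ (B ξ v) = 0 → B ξ v = 0) (L : List (𝔥 →ₗ[ℝ] ℂ))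
    (hL : ∀ ξ v, aeval (B ξ : End ℝ E) (realWeightPoly L ξ) v = 0) :
    {s : Set 𝔥 | ∃ v, s = {ξ | B ξ v = 0}}.Finite := by
  refine ((List.finite_toSet L).finite_subsets.image
    fun W : Set (𝔥 →ₗ[ℝ] ℂ) => {ξ | ∀ χ ∈ W, χ ξ = 0}).subset ?_
  rintro _ ⟨v, rfl⟩
  let s : Submodule ℝ 𝔥 := LinearMap.ker
    ((LinearMap.applyₗ v).comp ((ContinuousLinearMap.coeLM ℝ).comp B))
  have hs : ∀ ξ, ξ ∈ s ↔ B ξ v = 0 := fun ξ => by simp [s]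
  refine ⟨{χ | χ ∈ L ∧ ∀ ξ ∈ s, χ ξ = 0}, fun χ hχ => hχ.1, ?_⟩
  ext ξ'
  refine ⟨fun h => ?_, fun h χ hχ => hχ.2 ξ' ((hs _).2 h)⟩
  -- an element of the annihilator on which the remaining weights do not vanish
  have hgen : ∃ ξ ∈ s, ∀ χ ∈ L, (∀ ζ ∈ s, χ ζ = 0) ∨ χ ξ ≠ 0 := by
    classical
    have hex : ∀ χ : {χ : 𝔥 →ₗ[ℝ] ℂ // χ ∈ L ∧ ∃ ζ ∈ s, χ ζ ≠ 0}, ∃ ζ ∈ s, χ.1 ζ ≠ 0 :=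
      fun χ => χ.2.2
    choose z hz hz' using hex
    have : Finite {χ : 𝔥 →ₗ[ℝ] ℂ // χ ∈ L ∧ ∃ ζ ∈ s, χ ζ ≠ 0} :=
      ((List.finite_toSet L).subset fun χ hχ => hχ.1 :
        {χ : 𝔥 →ₗ[ℝ] ℂ | χ ∈ L ∧ ∃ ζ ∈ s, χ ζ ≠ 0}.Finite)
    let f : {χ : 𝔥 →ₗ[ℝ] ℂ // χ ∈ L ∧ ∃ ζ ∈ s, χ ζ ≠ 0} → Module.Dual ℝ 𝔥 := fun χ =>
      Complex.reLm.comp ((LinearMap.mulLeft ℝ (starRingEnd ℂ (χ.1 (z χ)))).comp χ.1)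
    obtain ⟨ξ, hξ, hξ'⟩ := Module.Dual.exists_forall_mem_ne_zero_of_forall_exists s f
      (fun χ => ⟨z χ, hz χ, by
        simp only [f, LinearMap.comp_apply, LinearMap.mulLeft_apply, Complex.reLm_coe]
        rw [mul_comm, Complex.mul_conj, Complex.ofReal_re]
        exact (Complex.normSq_pos.2 (hz' χ)).ne'⟩)
    refine ⟨ξ, hξ, fun χ hχ => or_iff_not_imp_left.2 fun h0 h1 => ?_⟩
    push Not at h0
    exact hξ' ⟨χ, hχ, h0⟩ (by simp [f, h1])
  obtain ⟨ξ, hξ, hgen⟩ := hgen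
  have ht : ∀ L' : List (𝔥 →ₗ[ℝ] ℂ), (∀ χ ∈ L', χ ∈ L) → ∀ᶠ t : ℝ in Filter.atTop,
      ∀ χ ∈ L', χ (ξ' + t • ξ) = 0 ∨ 3 * ‖B ξ'‖ < ‖χ (ξ' + t • ξ)‖ := by
    intro L' hL'
    have : ∀ χ ∈ L', ∀ᶠ t : ℝ in Filter.atTop,
        χ (ξ' + t • ξ) = 0 ∨ 3 * ‖B ξ'‖ < ‖χ (ξ' + t • ξ)‖ := by
      intro χ hχ
      rcases hgen χ (hL' χ hχ) with h0 | h0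
      · exact Filter.Eventually.of_forall fun t => Or.inl (by
          rw [map_add, map_smul, h0 ξ hξ, h χ ⟨hL' χ hχ, h0⟩, smul_zero, add_zero])
      · have hpos : 0 < ‖χ ξ‖ := norm_pos_iff.2 h0
        have h1 : Filter.Tendsto (fun t : ℝ => t * ‖χ ξ‖ - ‖χ ξ'‖) Filter.atTop Filter.atTop :=
          Filter.tendsto_atTop_add_const_right _ _ (Filter.tendsto_id.atTop_mul_const hpos)
        filter_upwards [h1.eventually_gt_atTop (3 * ‖B ξ'‖), Filter.eventually_ge_atTop 0] with t h2 h3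
        right
        refine h2.trans_le ?_
        have h4 := norm_sub_norm_le (t • χ ξ) (-χ ξ')
        rw [norm_neg, norm_smul, Real.norm_of_nonneg h3, sub_neg_eq_add] at h4
        rw [map_add, map_smul, add_comm]
        exact h4
    exact (Filter.eventually_all_finite (List.finite_toSet L')).2 this
  obtain ⟨t, ht⟩ := (ht L fun _ h => h).exists
  obtain ⟨n, hn⟩ := exists_pow_apply_eq_zero B hB (t • ξ) ξ' L ht v
    ((hs _).1 (s.smul_mem t hξ)) (hL _ v)
  change B ξ' v = 0
  induction n with
  | zero =>
    have : v = 0 := by simpa using hn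
    rw [this, map_zero]
  | succ n ih =>
    cases n with
    | zero => simpa using hn
    | succ n =>
      refine ih ?_
      rw [pow_succ', pow_succ', Module.End.mul_apply, Module.End.mul_apply] at hn
      rw [pow_succ', Module.End.mul_apply]
      exact hss ξ' _ hn

/-! ### Closed subgroups of vector spaces -/

section ClosedSubgroup

variable {V : Type*} [NormedAddCommGroup V] [NormedSpace ℝ V]

/-- The largest linear subspace contained in an additive subgroup. -/
def lineSpace (C : AddSubgroup V) : Submodule ℝ V where
  carrier := {ξ | ∀ t : ℝ, t • ξ ∈ C}
  zero_mem' t := by simp [C.zero_mem]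
  add_mem' ha hb t := by rw [smul_add]; exact C.add_mem (ha t) (hb t)
  smul_mem' c _ ha t := by rw [smul_smul]; exact ha _

theorem lineSpace_le (C : AddSubgroup V) {ξ : V} (h : ξ ∈ lineSpace C) : ξ ∈ C := by
  simpa using h 1

/-- A closed subgroup contains the limits of real multiples of a null sequence in it, as these differ
from integer multiples by a null sequence. -/
theorem floor_smul_mem_closed (C : AddSubgroup V) (hC : IsClosed (C : Set V)) {b : ℕ → V} {u : V}
    (hb : ∀ n, b n ∈ C) (hb0 : Filter.Tendsto b Filter.atTop (𝓝 0)) {c : ℕ → ℝ}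
    (hu : Filter.Tendsto (fun n => c n • b n) Filter.atTop (𝓝 u)) : u ∈ C := by
  refine hC.mem_of_tendsto (f := fun n => ⌊c n⌋ • b n) (b := Filter.atTop) ?_
    (Filter.Eventually.of_forall fun n => C.zsmul_mem (hb n) _)
  have h1 : Filter.Tendsto (fun n => Int.fract (c n) • b n) Filter.atTop (𝓝 0) := by
    refine squeeze_zero_norm (a := fun n => ‖b n‖) (fun n => ?_) (by simpa using hb0.norm)
    rw [norm_smul, Real.norm_of_nonneg (Int.fract_nonneg _)]
    exact mul_le_of_le_one_left (norm_nonneg _) (Int.fract_lt_one _).le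
  have h2 := hu.sub h1
  rw [sub_zero] at h2
  refine h2.congr fun n => ?_
  rw [← sub_smul, Int.self_sub_fract, Int.cast_smul_eq_zsmul]

variable [FiniteDimensional ℝ V]

/-- There is a projection with a given kernel. -/
theorem exists_projection (s : Submodule ℝ V) :
    ∃ q : V →L[ℝ] V, (∀ ξ, q ξ = 0 ↔ ξ ∈ s) ∧ ∀ ξ, ξ - q ξ ∈ s := by
  obtain ⟨W, hW⟩ := s.exists_isCompl
  have hW' := hW.symm
  refine ⟨(W.subtype.comp (W.projectionOnto s hW')).toContinuousLinearMap,
    fun ξ => ?_, fun ξ => ?_⟩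
  · simp
  · have h1 : W.projectionOnto s hW' (ξ - (W.projectionOnto s hW' ξ : V)) = 0 := by
      rw [map_sub, Submodule.projectionOnto_apply_left, sub_self]
    exact (Submodule.projectionOnto_apply_eq_zero_iff hW').1 h1

/-- A closed subgroup of a vector space coincides near zero with a linear subspace. -/
theorem exists_ball_subset_lineSpace (C : AddSubgroup V) (hC : IsClosed (C : Set V)) :
    ∃ δ > 0, ∀ ξ ∈ C, ‖ξ‖ < δ → ξ ∈ lineSpace C := by
  by_contra! hcon
  obtain ⟨q, hq, hq'⟩ := exists_projection (lineSpace C)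
  choose ξ hξC hξn hξs using fun n : ℕ => hcon (1 / ((n : ℝ) + 1)) (by positivity)
  have hξ0 : Filter.Tendsto ξ Filter.atTop (𝓝 0) :=
    squeeze_zero_norm (fun n => (hξn n).le) tendsto_one_div_add_atTop_nhds_zero_nat
  have hb0 : Filter.Tendsto (fun n => q (ξ n)) Filter.atTop (𝓝 0) := by
    have := (q.continuous.tendsto 0).comp hξ0
    rwa [map_zero] at this
  have hbC : ∀ n, q (ξ n) ∈ C := fun n => by
    have := C.sub_mem (hξC n) (lineSpace_le C (hq' (ξ n)))
    simpa using this
  have hbne : ∀ n, q (ξ n) ≠ 0 := fun n h => hξs n ((hq _).1 h)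
  have hqq : ∀ v, q (q v) = q v := fun v => by
    have := (hq _).2 (hq' v)
    rw [map_sub, sub_eq_zero] at this
    exact this.symm
  obtain ⟨u, hu, φ, hφ, hlim⟩ := (isCompact_sphere (0 : V) 1).tendsto_subseq
    (x := fun n => ‖q (ξ n)‖⁻¹ • q (ξ n)) (fun n => by
      simp [norm_smul, inv_mul_cancel₀ (norm_ne_zero_iff.2 (hbne n))])
  have huC : u ∈ lineSpace C := fun t => by
    refine floor_smul_mem_closed C hC (fun n => hbC (φ n)) (hb0.comp hφ.tendsto_atTop)
      (c := fun n => t * ‖q (ξ (φ n))‖⁻¹) ?_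
    simp only [mul_smul]
    exact hlim.const_smul t
  have h1 : q u = u := by
    refine tendsto_nhds_unique ((q.continuous.tendsto u).comp hlim) (hlim.congr fun n => ?_)
    simp [hqq]
  rw [(hq u).2 huC] at h1
  rw [← h1] at hu
  simp at hu

/-- A cocompact subgroup `Λ` of a closed group `C` meets the linear part of `C` in a cocompact
subgroup. -/
theorem exists_cocompact_inter_lineSpace (C : AddSubgroup V) (hC : IsClosed (C : Set V))
    (Λ : AddSubgroup V) (hΛC : Λ ≤ C) (R : ℝ) (hR : ∀ ξ : V, ∃ η ∈ Λ, ‖ξ - η‖ ≤ R) :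
    ∃ R' : ℝ, ∀ ξ ∈ lineSpace C, ∃ η ∈ Λ, η ∈ lineSpace C ∧ ‖ξ - η‖ ≤ R' := by
  obtain ⟨q, hq, hq'⟩ := exists_projection (lineSpace C)
  obtain ⟨δ, hδ, hδC⟩ := exists_ball_subset_lineSpace C hC
  have hqq : ∀ v, q (q v) = q v := fun v => by
    have := (hq _).2 (hq' v)
    rw [map_sub, sub_eq_zero] at this
    exact this.symm
  let D : Set V := {b | b ∈ C ∧ q b = b ∧ ‖b‖ ≤ ‖q‖ * R}
  have hD : D.Finite := by
    have hbd : TotallyBounded D := by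
      refine ((isCompact_closedBall (0 : V) (‖q‖ * R)).totallyBounded).subset fun b hb => ?_
      simpa using hb.2.2
    obtain ⟨t, ht, htD⟩ := Metric.totallyBounded_iff.1 hbd (δ / 2) (by positivity)
    have hex : ∀ b : D, ∃ y ∈ t, dist b.1 y < δ / 2 := fun b => by
      simpa using htD b.2
    choose y hy hyd using hex
    have hinj : Function.Injective fun b : D => (⟨y b, hy b⟩ : t) := by
      intro b b' hbb
      have h1 : y b = y b' := congrArg Subtype.val hbb
      have h2 : ‖b.1 - b'.1‖ < δ := by
        rw [← dist_eq_norm]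
        calc dist b.1 b'.1 ≤ dist b.1 (y b) + dist b'.1 (y b) := dist_triangle_right _ _ _
          _ < δ := by have := hyd b; have := hyd b'; rw [h1] at *; linarith
      have h3 := (hq _).2 (hδC _ (C.sub_mem b.2.1 b'.2.1) h2)
      rw [map_sub, b.2.2.1, b'.2.2.1, sub_eq_zero] at h3
      exact Subtype.ext h3
    have := ht.to_subtype
    exact Set.finite_coe_iff.1 (Finite.of_injective _ hinj)
  have hch : ∀ b : V, ∃ η ∈ Λ, (∃ η' ∈ Λ, q η' = b) → q η = b := fun b => by
    by_cases h : ∃ η' ∈ Λ, q η' = b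
    · obtain ⟨η', h1, h2⟩ := h
      exact ⟨η', h1, fun _ => h2⟩
    · exact ⟨0, Λ.zero_mem, fun h' => absurd h' h⟩
  choose e he he' using hch
  obtain ⟨M, hM⟩ := (hD.image fun b => ‖e b‖).bddAbove
  refine ⟨R + M, fun ξ hξ => ?_⟩
  obtain ⟨η, hη, hηR⟩ := hR ξ
  have hb : q η ∈ D := by
    refine ⟨?_, hqq η, ?_⟩
    · have := C.sub_mem (hΛC hη) (lineSpace_le C (hq' η))
      simpa using this
    · have h1 : q (ξ - η) = -q η := by rw [map_sub, (hq ξ).2 hξ, zero_sub]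
      rw [← norm_neg, ← h1]
      exact (q.le_opNorm _).trans (by gcongr)
  refine ⟨η - e (q η), Λ.sub_mem hη (he _), ?_, ?_⟩
  · rw [← hq, map_sub, he' (q η) ⟨η, hη, rfl⟩, sub_self]
  · calc ‖ξ - (η - e (q η))‖ = ‖(ξ - η) + e (q η)‖ := by congr 1; abel
      _ ≤ ‖ξ - η‖ + ‖e (q η)‖ := norm_add_le _ _
      _ ≤ R + M := add_le_add hηR (hM ⟨_, hb, rfl⟩)

/-- A subset of bounded distance to all points of a subspace spans it. -/
theorem span_eq_of_cocompact (s : Submodule ℝ V) (A : Set V) (hA : A ⊆ s) (R : ℝ)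
    (hR : ∀ ξ ∈ s, ∃ η ∈ A, ‖ξ - η‖ ≤ R) : Submodule.span ℝ A = s := by
  refine le_antisymm (Submodule.span_le.2 hA) fun ξ hξ => ?_
  have hcl : IsClosed (Submodule.span ℝ A : Set V) := Submodule.closed_of_finiteDimensional _
  choose η hη hηR using fun n : ℕ => hR (((n : ℝ) + 1) • ξ) (s.smul_mem _ hξ)
  refine hcl.mem_of_tendsto (f := fun n : ℕ => ((n : ℝ) + 1)⁻¹ • η n) (b := Filter.atTop) ?_
    (Filter.Eventually.of_forall fun n => Submodule.smul_mem _ _ (Submodule.subset_span (hη n)))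
  rw [tendsto_iff_norm_sub_tendsto_zero]
  refine squeeze_zero (fun n => norm_nonneg _) (g := fun n : ℕ => (1 / ((n : ℝ) + 1)) * R)
    (fun n => ?_) (by simpa using (tendsto_one_div_add_atTop_nhds_zero_nat (𝕜 := ℝ)).mul_const R)
  have hn : (0 : ℝ) < (n : ℝ) + 1 := by positivity
  have h1 : ((n : ℝ) + 1)⁻¹ • η n - ξ = ((n : ℝ) + 1)⁻¹ • (η n - ((n : ℝ) + 1) • ξ) := by
    rw [smul_sub, smul_smul, inv_mul_cancel₀ hn.ne', one_smul]
  rw [h1, norm_smul, Real.norm_of_nonneg (by positivity), one_div, norm_sub_rev]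
  gcongr
  exact hηR n

end ClosedSubgroup

open Polynomial Module

/-! ### Averaging over a lattice in a vector space -/

/-- Averaging over a fundamental domain of the lattice spanned by a basis, for vector-valued
continuous functions. -/
theorem exists_average {s : Type*} [NormedAddCommGroup s] [NormedSpace ℝ s]
    [FiniteDimensional ℝ s] {ι : Type*} [Finite ι] (b : Basis ι ℝ s)
    (E : Type*) [NormedAddCommGroup E] [NormedSpace ℝ E] [CompleteSpace E] :
    ∃ (r : ℝ) (avg : (s → E) → E),
      (∀ F G, Continuous F → Continuous G → avg (fun ξ => F ξ - G ξ) = avg F - avg G) ∧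
      (∀ c, avg (fun _ => c) = c) ∧
      (∀ F C, Continuous F → (∀ ξ, ‖ξ‖ ≤ r → ‖F ξ‖ ≤ C) → ‖avg F‖ ≤ C) ∧
      (∀ F (T : E →L[ℝ] E), Continuous F → avg (fun ξ => T (F ξ)) = T (avg F)) ∧
      ∀ F v, Continuous F → (∀ i ξ, F (ξ + b i) = F ξ) → avg (fun ξ => F (ξ + v)) = avg F := by
  classical
  letI : MeasurableSpace s := borel s
  haveI : BorelSpace s := ⟨rfl⟩
  have : ProperSpace s := FiniteDimensional.proper ℝ s
  let μ : MeasureTheory.Measure s := MeasureTheory.Measure.addHaar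
  let D := ZSpan.fundamentalDomain b
  have hbdd : Bornology.IsBounded D := ZSpan.fundamentalDomain_isBounded b
  obtain ⟨r, hr⟩ := hbdd.subset_closedBall (0 : s)
  have hDm : MeasurableSet D := ZSpan.fundamentalDomain_measurableSet b
  have hD0 : μ D ≠ 0 := ZSpan.measure_fundamentalDomain_ne_zero b
  have hDt : μ D ≠ ⊤ := hbdd.measure_lt_top.ne
  have hint : ∀ F : s → E, Continuous F → MeasureTheory.IntegrableOn F D μ := fun F hF =>
    (hF.continuousOn.integrableOn_compact (isCompact_closedBall (0 : s) r)).mono_set hr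
  have hreal : 0 < μ.real D := ENNReal.toReal_pos hD0 hDt
  refine ⟨r, fun F => (μ.real D)⁻¹ • ∫ ξ in D, F ξ ∂μ, fun F G hF hG => ?_, fun c => ?_,
    fun F C hF hC => ?_, fun F T hF => ?_, fun F v hF hper => ?_⟩
  · simp only
    rw [MeasureTheory.integral_sub (hint F hF) (hint G hG), smul_sub]
  · simp only
    rw [MeasureTheory.setIntegral_const, smul_smul, inv_mul_cancel₀ hreal.ne', one_smul]
  · have h1 : ‖∫ ξ in D, F ξ ∂μ‖ ≤ C * μ.real D :=
      MeasureTheory.norm_setIntegral_le_of_norm_le_const hDt.lt_top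
        (fun ξ hξ => hC ξ (by simpa using hr hξ))
    rw [norm_smul, norm_inv, Real.norm_of_nonneg hreal.le, inv_mul_le_iff₀ hreal, mul_comm]
    exact h1
  · simp only
    rw [ContinuousLinearMap.integral_comp_comm T (hint F hF), map_smul]
  · simp only
    congr 1
    have hfd : MeasureTheory.IsAddFundamentalDomain (Submodule.span ℤ (Set.range b)) D μ :=
      ZSpan.isAddFundamentalDomain b μ
    have hfd' : MeasureTheory.IsAddFundamentalDomain (Submodule.span ℤ (Set.range b))
        ((fun ξ => ξ + v) ⁻¹' D) μ := by
      have hq : MeasureTheory.Measure.QuasiMeasurePreserving (fun ξ : s => ξ + v) μ μ :=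
        (MeasureTheory.measurePreserving_add_right μ v).quasiMeasurePreserving
      exact hfd.preimage_of_equiv hq (e := id) Function.bijective_id (fun g x => by
        simp only [id_eq, Submodule.vadd_def, vadd_eq_add]; abel)
    have hinv : ∀ (g : Submodule.span ℤ (Set.range b)) (x : s), F (g +ᵥ x) = F x := by
      rintro ⟨g, hg⟩ x
      change F (g + x) = F x
      rw [add_comm]
      induction hg using Submodule.span_induction generalizing x with
      | mem g hg => obtain ⟨i, rfl⟩ := hg; exact hper i x
      | zero => rw [add_zero]
      | add a c _ _ ha hc => rw [← add_assoc, hc, ha]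
      | smul n a _ ha =>
        induction n using Int.induction_on generalizing x with
        | zero => simp
        | succ k ih => rw [add_smul, one_smul, ← add_assoc, ha, ih]
        | pred k ih =>
          rw [← ha, sub_smul, one_smul, add_assoc, sub_add_cancel, ih]
    have h1 : ∫ ξ in (fun ξ => ξ + v) ⁻¹' D, F (ξ + v) ∂μ = ∫ ξ in D, F ξ ∂μ :=
      (MeasureTheory.measurePreserving_add_right μ v).setIntegral_preimage_emb
        (measurableEmbedding_addRight v) F D
    rw [← h1]
    have : MeasureTheory.VAddInvariantMeasure (Submodule.span ℤ (Set.range b)) s μ :=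
      ⟨fun g t _ => MeasureTheory.measure_preimage_add μ (g : s) t⟩
    refine hfd.setIntegral_eq hfd' fun g x => ?_
    have := hinv g (x + v)
    rw [← this]
    congr 1
    change (g : s) + x + v = (g : s) + (x + v)
    abel

/-! ### Smooth torus actions -/

/-- A smooth action of a vector group `V` on a Banach manifold `M` in which a cocompact
subgroup `Λ` of `V` acts trivially. -/
structure TorusAction (V : Type*) [NormedAddCommGroup V] [NormedSpace ℝ V]
    (E : Type*) [NormedAddCommGroup E] [NormedSpace ℝ E]
    (M : Type*) [TopologicalSpace M] [ChartedSpace E M] where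
  act : V → M → M
  zero (x : M) : act 0 x = x
  add (ξ ζ : V) (x : M) : act (ξ + ζ) x = act ξ (act ζ x)
  smooth : ContMDiff (𝓘(ℝ, V).prod 𝓘(ℝ, E)) 𝓘(ℝ, E) ∞ fun q : V × M => act q.1 q.2
  Λ : AddSubgroup V
  act_lattice (η : V) (hη : η ∈ Λ) (x : M) : act η x = x
  radius : ℝ
  cocompact (ξ : V) : ∃ η ∈ Λ, ‖ξ - η‖ ≤ radius

namespace TorusAction

variable {V : Type*} [NormedAddCommGroup V] [NormedSpace ℝ V]
    {E : Type*} [NormedAddCommGroup E] [NormedSpace ℝ E]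
    {M : Type*} [TopologicalSpace M] [ChartedSpace E M]
    (A : TorusAction V E M)

/-- The elements of `V` that fix all points of `Y`. -/
def fixGroup (Y : Set M) : AddSubgroup V where
  carrier := {ξ | ∀ x ∈ Y, A.act ξ x = x}
  zero_mem' x _ := A.zero x
  add_mem' ha hb x hx := by rw [A.add, hb x hx, ha x hx]
  neg_mem' {a} ha x hx := by
    have h := A.add (-a) a x
    rw [neg_add_cancel, A.zero, ha x hx] at h
    exact h.symm

/-- The Lie algebra of the pointwise stabilizer of `Y`. -/
def stab (Y : Set M) : Submodule ℝ V := lineSpace (A.fixGroup Y)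

theorem mem_stab {Y : Set M} {ξ : V} : ξ ∈ A.stab Y ↔ ∀ t : ℝ, ∀ x ∈ Y, A.act (t • ξ) x = x :=
  Iff.rfl

theorem act_of_mem_stab {y : M} {ξ : V} (h : ξ ∈ A.stab {y}) : A.act ξ y = y :=
  lineSpace_le _ h y rfl

theorem continuous_act : Continuous fun q : V × M => A.act q.1 q.2 := A.smooth.continuous

theorem isClosed_fixGroup [T2Space M] (Y : Set M) : IsClosed (A.fixGroup Y : Set V) := by
  have : (A.fixGroup Y : Set V) = ⋂ x ∈ Y, {ξ | A.act ξ x = x} := by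
    ext ξ; simp [fixGroup]
  rw [this]
  exact isClosed_biInter fun x _ => isClosed_eq
    (A.continuous_act.comp (continuous_id.prodMk continuous_const)) continuous_const

theorem lattice_le_fixGroup (Y : Set M) : A.Λ ≤ A.fixGroup Y :=
  fun η hη x _ => A.act_lattice η hη x

/-- The lattice meets the Lie algebra of the stabilizer of `Y` in a cocompact subset, since the
stabilizer is a closed subgroup. -/
theorem exists_cocompact_stab [T2Space M] [FiniteDimensional ℝ V] (Y : Set M) :
    ∃ R : ℝ, ∀ ξ ∈ A.stab Y, ∃ η ∈ A.Λ, η ∈ A.stab Y ∧ ‖ξ - η‖ ≤ R :=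
  exists_cocompact_inter_lineSpace _ (A.isClosed_fixGroup Y) _ (A.lattice_le_fixGroup Y) _
    A.cocompact

/-- Stabilizers of points near `y` are contained in the stabilizer of `y`, since the quotient of the
torus by the latter has no small subgroups. -/
theorem eventually_stab_le [T2Space M] [FiniteDimensional ℝ V] (y : M) :
    ∀ᶠ x in 𝓝 y, A.stab {x} ≤ A.stab {y} := by
  obtain ⟨q, hq, hq'⟩ := exists_projection (A.stab {y})
  obtain ⟨δ, hδ, hδC⟩ := exists_ball_subset_lineSpace _ (A.isClosed_fixGroup {y})
  obtain ⟨R, hR⟩ := A.exists_cocompact_stab {y}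
  have : ProperSpace V := FiniteDimensional.proper ℝ V
  let S : Set V := Metric.closedBall 0 (R + δ / 2) ∩ {ξ | ‖q ξ‖ = δ / 2}
  have hS : IsCompact S := (isCompact_closedBall _ _).inter_right
    (isClosed_eq (by fun_prop) continuous_const)
  have hSy : ∀ ξ ∈ S, A.act ξ y ≠ y := by
    intro ξ hξ h
    have h1 : ξ ∈ A.fixGroup {y} := fun x hx => by rw [hx]; exact h
    have h2 : q ξ ∈ A.fixGroup {y} := by
      have := (A.fixGroup {y}).sub_mem h1 (lineSpace_le _ (hq' ξ))
      rwa [sub_sub_cancel] at this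
    have h3 : q ξ ∈ A.stab {y} := hδC _ h2 (by rw [hξ.2]; linarith)
    have h4 : q ξ = 0 := by
      have h5 := (hq _).2 (hq' ξ)
      rw [map_sub, (hq _).2 h3, sub_zero] at h5
      exact h5
    have h6 := hξ.2
    simp only [Set.mem_ofPred_eq, h4, norm_zero] at h6
    linarith
  have hev : ∀ᶠ x in 𝓝 y, ∀ ξ ∈ S, A.act ξ x ≠ x := by
    refine hS.eventually_forall_of_forall_eventually fun ξ hξ => ?_
    have hc : Continuous fun z : M × V => A.act z.2 z.1 :=
      A.continuous_act.comp (continuous_snd.prodMk continuous_fst)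
    exact (isOpen_ne_fun hc continuous_fst).mem_nhds (hSy ξ hξ)
  filter_upwards [hev] with x hx ζ hζ
  by_contra hcon
  have hqζ : q ζ ≠ 0 := fun h => hcon ((hq ζ).1 h)
  set c := δ / 2 / ‖q ζ‖ with hc
  obtain ⟨η, hηΛ, hηs, hηR⟩ := hR _ (hq' (c • ζ))
  have hn : ‖q (c • ζ)‖ = δ / 2 := by
    rw [map_smul, norm_smul, Real.norm_of_nonneg (by positivity), hc,
      div_mul_cancel₀ _ (norm_ne_zero_iff.2 hqζ)]
  refine hx (c • ζ - η) ⟨?_, ?_⟩ ?_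
  · rw [mem_closedBall_zero_iff]
    calc ‖c • ζ - η‖ = ‖(c • ζ - q (c • ζ) - η) + q (c • ζ)‖ := by congr 1; abel
      _ ≤ R + δ / 2 := (norm_add_le _ _).trans (add_le_add hηR hn.le)
  · simp only [Set.mem_ofPred_eq]
    rw [map_sub, (hq η).2 hηs, sub_zero, hn]
  · rw [sub_eq_add_neg, A.add, A.act_lattice _ (A.Λ.neg_mem hηΛ), hζ c x rfl]

end TorusAction

open Polynomial Module

namespace TorusAction

variable {V : Type*} [NormedAddCommGroup V] [NormedSpace ℝ V]
    {E : Type*} [NormedAddCommGroup E] [NormedSpace ℝ E]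
    {M : Type*} [TopologicalSpace M] [ChartedSpace E M]
    (A : TorusAction V E M)

/-- The action in the chart at `y`. -/
def localAct (y : M) (q : V × E) : E :=
  extChartAt 𝓘(ℝ, E) y (A.act q.1 ((extChartAt 𝓘(ℝ, E) y).symm q.2))

/-- The domain on which the action can be read off in the chart at `y`. -/
def localDomain (y : M) : Set (V × E) :=
  {q | q.2 ∈ (extChartAt 𝓘(ℝ, E) y).target ∧
    A.act q.1 ((extChartAt 𝓘(ℝ, E) y).symm q.2) ∈ (extChartAt 𝓘(ℝ, E) y).source}

theorem isOpen_localDomain (y : M) : IsOpen (A.localDomain y) := by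
  have h1 : IsOpen {q : V × E | q.2 ∈ (extChartAt 𝓘(ℝ, E) y).target} :=
    (isOpen_extChartAt_target y).preimage continuous_snd
  have h2 : ContinuousOn (fun q : V × E => A.act q.1 ((extChartAt 𝓘(ℝ, E) y).symm q.2))
      {q : V × E | q.2 ∈ (extChartAt 𝓘(ℝ, E) y).target} :=
    A.continuous_act.comp_continuousOn (continuous_fst.continuousOn.prodMk
      ((continuousOn_extChartAt_symm y).comp continuous_snd.continuousOn fun q hq => hq))
  exact h2.isOpen_inter_preimage h1 (isOpen_extChartAt_source y)

theorem contDiffOn_local [IsManifold 𝓘(ℝ, E) ∞ M] (y : M) :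
    ContDiffOn ℝ ∞ (A.localAct y) (A.localDomain y) := by
  have h1 : ContMDiffOn 𝓘(ℝ, V × E) 𝓘(ℝ, E) ∞
      (fun q : V × E => (extChartAt 𝓘(ℝ, E) y).symm q.2) (A.localDomain y) :=
    (contMDiffOn_extChartAt_symm y).comp contDiff_snd.contMDiff.contMDiffOn fun q hq => hq.1
  have h2 : ContMDiffOn 𝓘(ℝ, V × E) (𝓘(ℝ, V).prod 𝓘(ℝ, E)) ∞
      (fun q : V × E => (q.1, (extChartAt 𝓘(ℝ, E) y).symm q.2)) (A.localDomain y) :=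
    contDiff_fst.contMDiff.contMDiffOn.prodMk h1
  have h3 := A.smooth.comp_contMDiffOn h2
  have h4 : ContMDiffOn 𝓘(ℝ, V × E) 𝓘(ℝ, E) ∞ (A.localAct y) (A.localDomain y) :=
    (contMDiffOn_extChartAt (I := 𝓘(ℝ, E)) (x := y)).comp h3 fun q hq => by
      have := hq.2
      rwa [extChartAt_source] at this
  exact h4.contDiffOn

/-- The partial derivative of the action in the chart at `y`, in the direction of the manifold. -/
def dLocal (y : M) (q : V × E) : E →L[ℝ] E :=
  (fderiv ℝ (A.localAct y) q).comp (ContinuousLinearMap.inr ℝ V E)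

theorem contDiffOn_dLocal [IsManifold 𝓘(ℝ, E) ∞ M] (y : M) :
    ContDiffOn ℝ ∞ (A.dLocal y) (A.localDomain y) :=
  ((A.contDiffOn_local y).fderiv_of_isOpen (A.isOpen_localDomain y) (by simp)).clm_comp
    contDiffOn_const

theorem hasFDerivAt_local [IsManifold 𝓘(ℝ, E) ∞ M] (y : M) (ξ : V) (z : E)
    (h : (ξ, z) ∈ A.localDomain y) :
    HasFDerivAt (fun w => A.localAct y (ξ, w)) (A.dLocal y (ξ, z)) z := by
  have h1 : DifferentiableAt ℝ (A.localAct y) (ξ, z) :=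
    ((A.contDiffOn_local y).contDiffAt ((A.isOpen_localDomain y).mem_nhds h)).differentiableAt
      (by simp)
  exact HasFDerivAt.comp z (g := A.localAct y) (f := fun w => (ξ, w)) h1.hasFDerivAt
    (hasFDerivAt_prodMk_right ξ z)

theorem mem_localDomain (y : M) {ξ : V} (h : ξ ∈ A.stab {y}) :
    (ξ, extChartAt 𝓘(ℝ, E) y y) ∈ A.localDomain y := by
  refine ⟨mem_extChartAt_target y, ?_⟩
  simp only [extChartAt_to_inv]
  rw [A.act_of_mem_stab h]
  exact mem_extChartAt_source y

/-- The isotropy representation of the stabilizer of `y`, read off in the chart at `y`. -/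
def isotropy (y : M) (ξ : A.stab {y}) : E →L[ℝ] E := A.dLocal y (ξ, extChartAt 𝓘(ℝ, E) y y)

theorem localAct_base (y : M) {ξ : V} (h : ξ ∈ A.stab {y}) :
    A.localAct y (ξ, extChartAt 𝓘(ℝ, E) y y) = extChartAt 𝓘(ℝ, E) y y := by
  simp only [localAct, extChartAt_to_inv]
  rw [A.act_of_mem_stab h]

theorem isotropy_eq_mfderiv [IsManifold 𝓘(ℝ, E) ∞ M] (y : M) (ξ : A.stab {y}) (v : E) :
    A.isotropy y ξ v = mfderiv 𝓘(ℝ, E) 𝓘(ℝ, E) (A.act ξ) y v := by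
  have hfix : A.act ξ y = y := A.act_of_mem_stab ξ.2
  have hd : MDifferentiableAt 𝓘(ℝ, E) 𝓘(ℝ, E) (A.act ξ) y := by
    have : ContMDiff 𝓘(ℝ, E) 𝓘(ℝ, E) ∞ (A.act ξ) :=
      A.smooth.comp (contMDiff_const.prodMk contMDiff_id)
    exact this.mdifferentiableAt (by simp)
  have h1 := (A.hasFDerivAt_local y ξ _ (A.mem_localDomain y ξ.2)).fderiv
  have h2 : writtenInExtChartAt 𝓘(ℝ, E) 𝓘(ℝ, E) y (A.act ξ) = fun w => A.localAct y (ξ, w) := by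
    funext w
    simp only [writtenInExtChartAt, Function.comp, localAct]
    rw [hfix]
  rw [hd.mfderiv, h2]
  simp only [modelWithCornersSelf_coe, Set.range_id, fderivWithin_univ]
  rw [h1]; rfl

theorem isotropy_zero [IsManifold 𝓘(ℝ, E) ∞ M] (y : M) {ξ : A.stab {y}} (hξ : (ξ : V) ∈ A.Λ) :
    A.isotropy y ξ = ContinuousLinearMap.id ℝ E := by
  refine ((A.hasFDerivAt_local y ξ _ (A.mem_localDomain y ξ.2)).congr_of_eventuallyEq ?_).unique
    (hasFDerivAt_id _)
  filter_upwards [extChartAt_target_mem_nhds (I := 𝓘(ℝ, E)) y] with w hw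
  simp only [localAct, A.act_lattice _ hξ, id]
  exact ((extChartAt 𝓘(ℝ, E) y).right_inv hw).symm

theorem isotropy_add [IsManifold 𝓘(ℝ, E) ∞ M] (y : M) (ξ ζ : A.stab {y}) :
    A.isotropy y (ξ + ζ) = (A.isotropy y ξ).comp (A.isotropy y ζ) := by
  have h1 := A.hasFDerivAt_local y ζ _ (A.mem_localDomain y ζ.2)
  have h2 := A.hasFDerivAt_local y ξ _ (A.mem_localDomain y ξ.2)
  rw [← A.localAct_base y ζ.2] at h2
  have h3 := HasFDerivAt.comp (g := fun w => A.localAct y (ξ, w)) (f := fun w => A.localAct y (ζ, w))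
    _ h2 h1
  rw [A.localAct_base y ζ.2] at h3
  refine ((A.hasFDerivAt_local y (ξ + ζ : A.stab {y}) _
    (A.mem_localDomain y (ξ + ζ : A.stab {y}).2)).congr_of_eventuallyEq ?_).unique h3
  have hn : ∀ᶠ w in 𝓝 (extChartAt 𝓘(ℝ, E) y y), ((ζ : V), w) ∈ A.localDomain y :=
    (Continuous.prodMk_right (ζ : V)).continuousAt.eventually
      ((A.isOpen_localDomain y).mem_nhds (A.mem_localDomain y ζ.2))
  filter_upwards [hn] with w hw
  simp only [localAct, Function.comp, Submodule.coe_add, A.add]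
  rw [(extChartAt 𝓘(ℝ, E) y).left_inv hw.2]

theorem contDiff_isotropy [IsManifold 𝓘(ℝ, E) ∞ M] (y : M) : ContDiff ℝ ∞ (A.isotropy y) := by
  rw [contDiff_iff_contDiffAt]
  intro ξ
  have h1 := (A.contDiffOn_dLocal y).contDiffAt
    ((A.isOpen_localDomain y).mem_nhds (A.mem_localDomain y ξ.2))
  exact h1.comp ξ ((A.stab {y}).subtypeL.contDiff.contDiffAt.prodMk contDiffAt_const)

/-- The infinitesimal isotropy representation. -/
def isotropyGen (y : M) : A.stab {y} →ₗ[ℝ] (E →L[ℝ] E) :=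
  (fderiv ℝ (A.isotropy y) 0).toLinearMap

theorem hasDerivAt_isotropy_zero [IsManifold 𝓘(ℝ, E) ∞ M] (y : M) (ξ : A.stab {y}) :
    HasDerivAt (fun t : ℝ => A.isotropy y (t • ξ)) (A.isotropyGen y ξ) 0 := by
  have h1 : HasFDerivAt (A.isotropy y) (fderiv ℝ (A.isotropy y) 0) ((0 : ℝ) • ξ) := by
    rw [zero_smul]
    exact ((A.contDiff_isotropy y).differentiable (by simp) 0).hasFDerivAt
  have h2 : HasDerivAt (fun t : ℝ => t • ξ) ξ 0 := by
    simpa using (hasDerivAt_id (0 : ℝ)).smul_const ξ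
  exact h1.comp_hasDerivAt 0 h2

theorem hasDerivAt_isotropy [IsManifold 𝓘(ℝ, E) ∞ M] (y : M) (ξ : A.stab {y}) (v : E) (t : ℝ) :
    HasDerivAt (fun t : ℝ => A.isotropy y (t • ξ) v)
      (A.isotropy y (t • ξ) (A.isotropyGen y ξ v)) t := by
  have h1 : HasDerivAt (fun u : ℝ => A.isotropy y (u • ξ) v) (A.isotropyGen y ξ v) (t - t) := by
    rw [sub_self]
    exact (A.hasDerivAt_isotropy_zero y ξ).clm_apply (hasDerivAt_const 0 v) |>.congr_deriv
      (by simp)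
  have h2 : HasDerivAt (fun u : ℝ => A.isotropy y ((u - t) • ξ) v) (A.isotropyGen y ξ v) t := by
    have := h1.scomp t (h := fun u => u - t) ((hasDerivAt_id t).sub_const t)
    rw [one_smul] at this
    exact this
  have h3 := (A.isotropy y (t • ξ)).hasFDerivAt.comp_hasDerivAt t h2
  refine h3.congr_of_eventuallyEq (Filter.Eventually.of_forall fun u => ?_)
  simp only [Function.comp]
  rw [← ContinuousLinearMap.comp_apply, ← A.isotropy_add, ← add_smul, add_sub_cancel]

theorem isotropyGen_comm [IsManifold 𝓘(ℝ, E) ∞ M] (y : M) (ξ ζ : A.stab {y}) (v : E) :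
    A.isotropyGen y ξ (A.isotropyGen y ζ v) = A.isotropyGen y ζ (A.isotropyGen y ξ v) := by
  have hR : ∀ a b : A.stab {y}, ∀ w, A.isotropy y a (A.isotropy y b w) =
      A.isotropy y b (A.isotropy y a w) := fun a b w => by
    rw [← ContinuousLinearMap.comp_apply, ← A.isotropy_add, add_comm, A.isotropy_add]; rfl
  have hder : ∀ (a : A.stab {y}) w, HasDerivAt (fun t : ℝ => A.isotropy y (t • a) w)
      (A.isotropyGen y a w) 0 := fun a w => by
    have := A.hasDerivAt_isotropy y a w 0
    rwa [zero_smul, A.isotropy_zero y A.Λ.zero_mem] at this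
  have h1 : ∀ b : A.stab {y}, ∀ w, A.isotropyGen y ξ (A.isotropy y b w) =
      A.isotropy y b (A.isotropyGen y ξ w) := fun b w =>
    (hder ξ (A.isotropy y b w)).unique (((A.isotropy y b).hasFDerivAt.comp_hasDerivAt 0
      (hder ξ w)).congr_of_eventuallyEq (Filter.Eventually.of_forall fun t => hR _ _ _))
  exact ((A.isotropyGen y ξ).hasFDerivAt.comp_hasDerivAt 0 (hder ζ v)).unique
    ((hder ζ (A.isotropyGen y ξ v)).congr_of_eventuallyEq
      (Filter.Eventually.of_forall fun t => h1 _ _))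

theorem isotropy_smul_eq_self_iff [IsManifold 𝓘(ℝ, E) ∞ M] (y : M) (ξ : A.stab {y}) (v : E) :
    (∀ t : ℝ, A.isotropy y (t • ξ) v = v) ↔ A.isotropyGen y ξ v = 0 := by
  have h0 : A.isotropy y ((0 : ℝ) • ξ) = ContinuousLinearMap.id ℝ E := by
    rw [zero_smul]; exact A.isotropy_zero y A.Λ.zero_mem
  constructor
  · intro h
    have h1 := A.hasDerivAt_isotropy y ξ v 0
    rw [h0] at h1
    exact h1.unique ((hasDerivAt_const 0 v).congr_of_eventuallyEq
      (Filter.Eventually.of_forall h))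
  · intro h t
    have h1 : ∀ t, HasDerivAt (fun t : ℝ => A.isotropy y (t • ξ) v) 0 t := fun t => by
      simpa [h] using A.hasDerivAt_isotropy y ξ v t
    have h2 := is_const_of_deriv_eq_zero (fun t => (h1 t).differentiableAt) (fun t => (h1 t).deriv)
      t 0
    simp only [h0] at h2
    exact h2

/-- The isotropy representation is bounded, hence its generators are semisimple. -/
theorem isotropyGen_semisimple [T2Space M] [FiniteDimensional ℝ V] [IsManifold 𝓘(ℝ, E) ∞ M]
    (y : M) (ξ : A.stab {y}) (v : E)
    (h : A.isotropyGen y ξ (A.isotropyGen y ξ v) = 0) : A.isotropyGen y ξ v = 0 := by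
  obtain ⟨R, hR⟩ := A.exists_cocompact_stab {y}
  have : ProperSpace (A.stab {y}) := FiniteDimensional.proper ℝ _
  obtain ⟨C, hC⟩ := (isCompact_closedBall (0 : A.stab {y}) R).exists_bound_of_continuousOn
    (A.contDiff_isotropy y).continuous.continuousOn
  have hbd : ∀ ζ : A.stab {y}, ‖A.isotropy y ζ‖ ≤ C := by
    intro ζ
    obtain ⟨η, hη, hηs, hηR⟩ := hR ζ ζ.2
    have h1 : ζ = ⟨η, hηs⟩ + (ζ - ⟨η, hηs⟩) := by abel
    rw [h1, A.isotropy_add, A.isotropy_zero y (ξ := ⟨η, hηs⟩) hη, ContinuousLinearMap.id_comp]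
    exact hC _ (by simpa using hηR)
  set w := A.isotropyGen y ξ v with hw
  have h1 := (A.isotropy_smul_eq_self_iff y ξ w).2 h
  have h2 : ∀ t : ℝ, A.isotropy y (t • ξ) v = v + t • w := by
    intro t
    have h3 : ∀ t, HasDerivAt (fun t : ℝ => A.isotropy y (t • ξ) v - t • w) 0 t := fun t => by
      have h4 := (A.hasDerivAt_isotropy y ξ v t).fun_sub ((hasDerivAt_id t).smul_const w)
      rw [← hw, h1 t, one_smul, sub_self] at h4
      exact h4
    have h5 := is_const_of_deriv_eq_zero (fun t => (h3 t).differentiableAt) (fun t => (h3 t).deriv)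
      t 0
    simp only [zero_smul, sub_zero] at h5
    rw [A.isotropy_zero y (ξ := 0) A.Λ.zero_mem] at h5
    rw [← sub_eq_iff_eq_add]
    exact h5
  by_contra hne
  have hpos : 0 < ‖w‖ := norm_pos_iff.2 hne
  obtain ⟨t, ht⟩ := exists_gt ((C * ‖v‖ + ‖v‖) / ‖w‖)
  have h3 : t * ‖w‖ ≤ C * ‖v‖ + ‖v‖ := by
    have h4 : t • w = A.isotropy y (t • ξ) v - v := by rw [h2]; abel
    calc t * ‖w‖ ≤ ‖t • w‖ := by
          rw [norm_smul]; gcongr; exact le_abs_self t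
      _ ≤ ‖A.isotropy y (t • ξ) v‖ + ‖v‖ := by rw [h4]; exact norm_sub_le _ _
      _ ≤ C * ‖v‖ + ‖v‖ := by
          gcongr
          exact (ContinuousLinearMap.le_opNorm _ _).trans (by gcongr; exact hbd _)
  rw [div_lt_iff₀ hpos] at ht
  linarith

end TorusAction

open Polynomial Module

namespace TorusAction

variable {V : Type*} [NormedAddCommGroup V] [NormedSpace ℝ V] [FiniteDimensional ℝ V]
    {E : Type*} [NormedAddCommGroup E] [NormedSpace ℝ E]
    {M : Type*} [TopologicalSpace M] [ChartedSpace E M] [IsManifold 𝓘(ℝ, E) ∞ M] [T2Space M]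
    (A : TorusAction V E M)

/-- A neighborhood on which all elements of the stabilizer of `y` act inside a given
neighborhood of `y`. -/
theorem eventually_forall_stab_mem (y : M) (W : Set M) (hW : W ∈ 𝓝 y) :
    ∀ᶠ x in 𝓝 y, ∀ ξ ∈ A.stab {y}, A.act ξ x ∈ W := by
  obtain ⟨R, hR⟩ := A.exists_cocompact_stab {y}
  have : ProperSpace V := FiniteDimensional.proper ℝ V
  have hcl : IsClosed (A.stab {y} : Set V) := Submodule.closed_of_finiteDimensional _
  have hK : IsCompact (Metric.closedBall (0 : V) R ∩ A.stab {y}) :=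
    (isCompact_closedBall _ _).inter_right hcl
  have hev : ∀ᶠ x in 𝓝 y, ∀ ξ ∈ Metric.closedBall (0 : V) R ∩ A.stab {y}, A.act ξ x ∈ W := by
    refine hK.eventually_forall_of_forall_eventually fun ξ hξ => ?_
    have hc : Continuous fun z : M × V => A.act z.2 z.1 :=
      A.continuous_act.comp (continuous_snd.prodMk continuous_fst)
    refine hc.continuousAt.eventually_mem ?_
    simp only
    rwa [A.act_of_mem_stab hξ.2]
  filter_upwards [hev] with x hx ξ hξ
  obtain ⟨η, hη, hηs, hηR⟩ := hR ξ hξ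
  have h1 := hx (ξ - η) ⟨by simpa using hηR, (A.stab {y}).sub_mem hξ hηs⟩
  rwa [sub_eq_add_neg, A.add, A.act_lattice _ (A.Λ.neg_mem hη)] at h1

/-- In the chart at `y`, the action of the stabilizer differs from the linear one by a map with
small Lipschitz constant, uniformly on bounded sets. -/
theorem exists_ball_lipschitz (y : M) (r : ℝ) :
    ∃ δ > 0, Metric.ball (extChartAt 𝓘(ℝ, E) y y) δ ⊆ (extChartAt 𝓘(ℝ, E) y).target ∧
      ∀ ξ : A.stab {y}, ‖ξ‖ ≤ r → ∀ z ∈ Metric.ball (extChartAt 𝓘(ℝ, E) y y) δ,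
        ∀ z' ∈ Metric.ball (extChartAt 𝓘(ℝ, E) y y) δ,
        ‖A.isotropy y (-ξ) (A.localAct y (ξ, z) - A.localAct y (ξ, z')) - (z - z')‖ ≤
          1 / 2 * ‖z - z'‖ := by
  set z0 := extChartAt 𝓘(ℝ, E) y y with hz0
  have : ProperSpace (A.stab {y}) := FiniteDimensional.proper ℝ _
  have hev : ∀ᶠ z in 𝓝 z0, ∀ ξ ∈ Metric.closedBall (0 : A.stab {y}) r,
      ((ξ : V), z) ∈ A.localDomain y ∧
      ‖(A.isotropy y (-ξ)).comp (A.dLocal y (ξ, z)) - ContinuousLinearMap.id ℝ E‖ < 1 / 2 := by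
    refine (isCompact_closedBall (0 : A.stab {y}) r).eventually_forall_of_forall_eventually
      fun ξ _ => ?_
    have hdom := (A.isOpen_localDomain y).mem_nhds (A.mem_localDomain y ξ.2)
    have hc : ContinuousAt (fun q : E × A.stab {y} => ((q.2 : V), q.1)) (z0, ξ) := by fun_prop
    have h1 : ∀ᶠ q : E × A.stab {y} in 𝓝 (z0, ξ), ((q.2 : V), q.1) ∈ A.localDomain y :=
      hc.eventually_mem hdom
    have h2 : ContinuousAt (A.dLocal y) ((ξ : V), z0) :=
      (A.contDiffOn_dLocal y).continuousOn.continuousAt hdom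
    have h3 : ContinuousAt (fun q : E × A.stab {y} => A.dLocal y ((q.2 : V), q.1)) (z0, ξ) :=
      ContinuousAt.comp (g := A.dLocal y) (f := fun q : E × A.stab {y} => ((q.2 : V), q.1)) h2 hc
    have h4 : ContinuousAt (fun q : E × A.stab {y} => A.isotropy y (-q.2)) (z0, ξ) :=
      ((A.contDiff_isotropy y).continuous.comp continuous_snd.neg).continuousAt
    have h5 : ContinuousAt (fun q : E × A.stab {y} =>
        ‖(A.isotropy y (-q.2)).comp (A.dLocal y (q.2, q.1)) - ContinuousLinearMap.id ℝ E‖)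
        (z0, ξ) := ((h4.clm_comp h3).sub continuousAt_const).norm
    have h6 : ‖(A.isotropy y (-ξ)).comp (A.dLocal y (ξ, z0)) - ContinuousLinearMap.id ℝ E‖
        < 1 / 2 := by
      have : (A.isotropy y (-ξ)).comp (A.dLocal y (ξ, z0)) = ContinuousLinearMap.id ℝ E := by
        have := A.isotropy_add y (-ξ) ξ
        rw [neg_add_cancel, A.isotropy_zero y (ξ := 0) A.Λ.zero_mem] at this
        exact this.symm
      rw [this]; simp
    exact h1.and (h5.eventually (gt_mem_nhds h6))
  obtain ⟨δ, hδ, hball⟩ := Metric.eventually_nhds_iff_ball.1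
    (hev.and (extChartAt_target_mem_nhds (I := 𝓘(ℝ, E)) y))
  refine ⟨δ, hδ, fun z hz => (hball z hz).2, fun ξ hξ z hz z' hz' => ?_⟩
  have hder : ∀ w ∈ Metric.ball z0 δ, HasFDerivWithinAt
      (fun w => A.isotropy y (-ξ) (A.localAct y (ξ, w)) - w)
      ((A.isotropy y (-ξ)).comp (A.dLocal y (ξ, w)) - ContinuousLinearMap.id ℝ E)
      (Metric.ball z0 δ) w := fun w hw =>
    (((A.isotropy y (-ξ)).hasFDerivAt.comp w (A.hasFDerivAt_local y ξ w
      ((hball w hw).1 ξ (by simpa using hξ)).1)).sub (hasFDerivAt_id w)).hasFDerivWithinAt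
  have h := (convex_ball z0 δ).norm_image_sub_le_of_norm_hasFDerivWithin_le hder
    (fun w hw => ((hball w hw).1 ξ (by simpa using hξ)).2.le) hz' hz
  refine le_of_eq_of_le ?_ h
  congr 1
  rw [map_sub]; abel

/-- Linearization: near `y` there is an injective map to `E` that is equivariant for the action of
the stabilizer of `y`, obtained by averaging a chart. -/
theorem exists_linearization [CompleteSpace E] (y : M) :
    ∃ (U : Set M) (G : M → E), U ∈ 𝓝 y ∧ (∀ x ∈ U, ∀ ξ ∈ A.stab {y}, A.act ξ x ∈ U) ∧
      Set.InjOn G U ∧ ∀ x ∈ U, ∀ ξ : A.stab {y}, G (A.act ξ x) = A.isotropy y ξ (G x) := by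
  obtain ⟨R, hR⟩ := A.exists_cocompact_stab {y}
  -- a basis of the stabilizer that consists of lattice vectors
  let Λ' : Set (A.stab {y}) := {η | (η : V) ∈ A.Λ}
  have hspan : Submodule.span ℝ Λ' = ⊤ := by
    refine span_eq_of_cocompact ⊤ Λ' (fun _ _ => trivial) R fun ξ _ => ?_
    obtain ⟨η, hη, hηs, hηR⟩ := hR ξ ξ.2
    exact ⟨⟨η, hηs⟩, hη, hηR⟩
  obtain ⟨B, hBΛ, hBspan, hBli⟩ := exists_linearIndependent ℝ Λ'
  have hBtop : ⊤ ≤ Submodule.span ℝ (Set.range ((↑) : B → A.stab {y})) := by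
    rw [Subtype.range_coe, hBspan, hspan]
  let b : Basis B ℝ (A.stab {y}) := Basis.mk hBli hBtop
  have : Finite B := Module.Finite.finite_basis b
  have hb : ∀ i, ((b i : A.stab {y}) : V) ∈ A.Λ := fun i => by
    rw [Basis.mk_apply]; exact hBΛ i.2
  obtain ⟨r, avg, hsub, hconst, hbound, hclm, htrans⟩ := exists_average b E
  obtain ⟨δ, hδ, htarget, hlip⟩ := A.exists_ball_lipschitz y r
  set φ := extChartAt 𝓘(ℝ, E) y with hφ
  let W : Set M := φ.source ∩ φ ⁻¹' Metric.ball (φ y) δ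
  have hW : W ∈ 𝓝 y := Filter.inter_mem (extChartAt_source_mem_nhds y)
    ((continuousAt_extChartAt y).preimage_mem_nhds (Metric.ball_mem_nhds _ hδ))
  let U : Set M := {x | ∀ ξ ∈ A.stab {y}, A.act ξ x ∈ W}
  let F : M → A.stab {y} → E := fun x ξ => A.isotropy y (-ξ) (φ (A.act ξ x))
  have hFc : ∀ x ∈ U, Continuous (F x) := by
    intro x hx
    have h1 : Continuous fun ξ : A.stab {y} => φ (A.act ξ x) := by
      refine (continuousOn_extChartAt (I := 𝓘(ℝ, E)) y).comp_continuous
        (A.continuous_act.comp ((continuous_subtype_val).prodMk continuous_const))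
        fun ξ => (hx ξ ξ.2).1
    exact ((A.contDiff_isotropy y).continuous.comp continuous_neg).clm_apply h1
  have hUself : ∀ x ∈ U, x ∈ W := fun x hx => by
    simpa [A.zero] using hx 0 (A.stab {y}).zero_mem
  refine ⟨U, fun x => avg (F x), A.eventually_forall_stab_mem y W hW, ?_, ?_, ?_⟩
  · intro x hx ξ hξ ζ hζ
    rw [← A.add]
    exact hx _ ((A.stab {y}).add_mem hζ hξ)
  · intro x hx x' hx' hG
    have hxW := hUself x hx
    have hxW' := hUself x' hx'
    set z := φ x with hz
    set z' := φ x' with hz'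
    have h1 : ‖avg (fun ξ => (F x ξ - F x' ξ) - (z - z'))‖ ≤ 1 / 2 * ‖z - z'‖ := by
      refine hbound _ _ (((hFc x hx).sub (hFc x' hx')).sub continuous_const) fun ξ hξ => ?_
      have h2 := hlip ξ hξ z hxW.2 z' hxW'.2
      have h3 : ∀ w ∈ φ.source, A.localAct y (ξ, φ w) = φ (A.act ξ w) := fun w hw => by
        simp only [localAct]
        rw [← hφ, φ.left_inv hw]
      rwa [hz, hz', h3 x hxW.1, h3 x' hxW'.1, map_sub] at h2
    rw [hsub (fun ξ => F x ξ - F x' ξ) _ ((hFc x hx).sub (hFc x' hx')) continuous_const,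
      hsub _ _ (hFc x hx) (hFc x' hx'), hconst] at h1
    simp only at hG
    rw [hG, sub_self, zero_sub, norm_neg] at h1
    have h4 : ‖z - z'‖ = 0 := by
      have := norm_nonneg (z - z')
      linarith
    exact φ.injOn hxW.1 hxW'.1 (sub_eq_zero.1 (norm_eq_zero.1 h4))
  · intro x hx ζ
    have h1 : F (A.act ζ x) = fun ξ => A.isotropy y ζ (F x (ξ + ζ)) := by
      funext ξ
      simp only [F, Submodule.coe_add]
      rw [A.add, ← ContinuousLinearMap.comp_apply, ← A.isotropy_add]
      congr 2
      abel
    have hc : Continuous fun ξ => F x (ξ + ζ) := (hFc x hx).comp (continuous_add_const ζ)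
    simp only
    rw [h1, hclm _ _ hc, htrans _ ζ (hFc x hx)]
    intro i ξ
    simp only [F, Submodule.coe_add]
    rw [A.add, A.act_lattice _ (hb i), neg_add, A.isotropy_add,
      A.isotropy_zero y (ξ := -b i) (by simpa using hb i), ContinuousLinearMap.comp_id]

/-- Near a point whose isotropy representation has finitely many weights there are only finitely
many infinitesimal stabilizers. -/
theorem exists_nhds_finite_stab [CompleteSpace E] (y : M) (L : List (A.stab {y} →ₗ[ℝ] ℂ))
    (hL : ∀ ξ v, aeval (A.isotropyGen y ξ : End ℝ E) (realWeightPoly L ξ) v = 0) :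
    ∃ U ∈ 𝓝 y, {s | ∃ x ∈ U, s = A.stab {x}}.Finite := by
  obtain ⟨U, G, hU, hinv, hinj, heq⟩ := A.exists_linearization y
  have hfin := finite_annihilators (A.isotropyGen y) (A.isotropyGen_comm y)
    (A.isotropyGen_semisimple y) L hL
  refine ⟨U ∩ {x | A.stab {x} ≤ A.stab {y}}, Filter.inter_mem hU (A.eventually_stab_le y), ?_⟩
  refine Set.Finite.of_finite_image (f := fun s : Submodule ℝ V =>
    (Subtype.val ⁻¹' (s : Set V) : Set (A.stab {y}))) (hfin.subset ?_) ?_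
  · rintro _ ⟨_, ⟨x, ⟨hxU, hxs⟩, rfl⟩, rfl⟩
    refine ⟨G x, ?_⟩
    ext ξ
    simp only [Set.mem_preimage, SetLike.mem_coe, Set.mem_ofPred_eq]
    rw [← A.isotropy_smul_eq_self_iff, A.mem_stab]
    refine forall_congr' fun t => ?_
    have h1 := heq x hxU (t • ξ)
    rw [← h1]
    simp only [Set.mem_singleton_iff, forall_eq, Submodule.coe_smul]
    refine ⟨fun h => by rw [h], fun h => ?_⟩
    exact hinj (hinv x hxU _ ((A.stab {y}).smul_mem t ξ.2)) hxU h
  · rintro _ ⟨x, ⟨hxU, hxs⟩, rfl⟩ _ ⟨x', ⟨hxU', hxs'⟩, rfl⟩ h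
    ext ξ
    refine ⟨fun hξ => ?_, fun hξ => ?_⟩
    · exact (Set.ext_iff.1 h ⟨ξ, hxs hξ⟩).1 hξ
    · exact (Set.ext_iff.1 h ⟨ξ, hxs' hξ⟩).2 hξ

end TorusAction

/-! ### The exponential map of matrices -/

section Auxiliary

variable {A : Type*} [NormedRing A] [NormedAlgebra ℝ A] [FiniteDimensional ℝ A]

theorem hasDerivAt_exp_smul_of_finiteDimensional (ξ : A) (t : ℝ) :
    HasDerivAt (fun u : ℝ => NormedSpace.exp (u • ξ)) (NormedSpace.exp (t • ξ) * ξ) t := by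
  haveI : CompleteSpace A := FiniteDimensional.complete ℝ A
  exact hasDerivAt_exp_smul_const ξ t

theorem hasStrictFDerivAt_exp_zero_of_finiteDimensional :
    HasStrictFDerivAt (NormedSpace.exp : A → A) (ContinuousLinearMap.id ℝ A) 0 := by
  haveI : CompleteSpace A := FiniteDimensional.complete ℝ A
  exact hasStrictFDerivAt_exp_zero

theorem continuous_exp_of_finiteDimensional : Continuous (NormedSpace.exp : A → A) := by
  haveI : CompleteSpace A := FiniteDimensional.complete ℝ A
  letI : NormedAlgebra ℚ A := NormedAlgebra.restrictScalars ℚ ℝ A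
  exact NormedSpace.exp_continuous

theorem pi_exp_apply_of_finiteDimensional {ι : Type*} [Finite ι] {A : ι → Type*}
    [∀ i, NormedRing (A i)] [∀ i, NormedAlgebra ℝ (A i)] [∀ i, FiniteDimensional ℝ (A i)]
    (x : ∀ i, A i) (i : ι) : NormedSpace.exp x i = NormedSpace.exp (x i) := by
  haveI : ∀ i, CompleteSpace (A i) := fun i => FiniteDimensional.complete ℝ (A i)
  letI : ∀ i, NormedAlgebra ℚ (A i) := fun i => NormedAlgebra.restrictScalars ℚ ℝ (A i)
  exact Pi.coe_exp x i

theorem mul_exp_of_mul_eq_of_finiteDimensional {a ξ ζ : A} (h : a * ξ = ζ * a) :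
    a * NormedSpace.exp ξ = NormedSpace.exp ζ * a := by
  haveI : CompleteSpace A := FiniteDimensional.complete ℝ A
  letI : NormedAlgebra ℚ A := NormedAlgebra.restrictScalars ℚ ℝ A
  have hpow : ∀ k : ℕ, a * ξ ^ k = ζ ^ k * a := fun k => (show SemiconjBy a ξ ζ from h).pow_right k
  have h1 := (NormedSpace.exp_series_hasSum_exp' (𝕂 := ℝ) ξ).mul_left a
  have h2 := (NormedSpace.exp_series_hasSum_exp' (𝕂 := ℝ) ζ).mul_right a
  have h3 : (fun k : ℕ => a * ((k.factorial : ℝ)⁻¹ • ξ ^ k)) =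
      fun k => ((k.factorial : ℝ)⁻¹ • ζ ^ k) * a := by
    funext k
    rw [mul_smul_comm, smul_mul_assoc, hpow]
  rw [h3] at h1
  exact h1.unique h2

end Auxiliary

theorem hasDerivAt_exp_smul {n : ℕ} (ξ : Mat n) (t : ℝ) :
    HasDerivAt (fun u : ℝ => NormedSpace.exp (u • ξ)) (NormedSpace.exp (t • ξ) * ξ) t := by
  letI : NormedRing (Mat n) := Matrix.linftyOpNormedRing
  letI : NormedAlgebra ℝ (Mat n) := Matrix.linftyOpNormedAlgebra
  exact hasDerivAt_exp_smul_of_finiteDimensional ξ t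

theorem hasStrictFDerivAt_matrix_exp_zero {n : ℕ} :
    HasStrictFDerivAt (NormedSpace.exp : Mat n → Mat n) (ContinuousLinearMap.id ℝ (Mat n)) 0 := by
  letI : NormedRing (Mat n) := Matrix.linftyOpNormedRing
  letI : NormedAlgebra ℝ (Mat n) := Matrix.linftyOpNormedAlgebra
  exact hasStrictFDerivAt_exp_zero_of_finiteDimensional

theorem continuous_matrix_exp {n : ℕ} : Continuous (NormedSpace.exp : Mat n → Mat n) := by
  letI : NormedRing (Mat n) := Matrix.linftyOpNormedRing
  letI : NormedAlgebra ℝ (Mat n) := Matrix.linftyOpNormedAlgebra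
  exact continuous_exp_of_finiteDimensional

theorem hasDerivAt_matrix_mul {n : ℕ} {f g : ℝ → Mat n} {f' g' : Mat n} {t : ℝ}
    (hf : HasDerivAt f f' t) (hg : HasDerivAt g g' t) :
    HasDerivAt (fun u => f u * g u) (f' * g t + f t * g') t := by
  letI : NormedRing (Mat n) := Matrix.linftyOpNormedRing
  letI : NormedAlgebra ℝ (Mat n) := Matrix.linftyOpNormedAlgebra
  exact HasDerivAt.mul hf hg

theorem CompactGroup.exp_apply {m : ℕ} (K : CompactGroup m) (x : K.A) (i : Fin m) :
    NormedSpace.exp x i = NormedSpace.exp (x i) := by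
  letI : ∀ i, NormedRing (Mat (K.size i)) := fun i => Matrix.linftyOpNormedRing
  letI : ∀ i, NormedAlgebra ℝ (Mat (K.size i)) := fun i => Matrix.linftyOpNormedAlgebra
  exact pi_exp_apply_of_finiteDimensional (A := fun i => Mat (K.size i)) x i

theorem exp_add_smul {n : ℕ} (s t : ℝ) (ξ : Mat n) :
    NormedSpace.exp ((s + t) • ξ) = NormedSpace.exp (s • ξ) * NormedSpace.exp (t • ξ) := by
  rw [add_smul]
  exact Matrix.exp_add_of_commute _ _ (((Commute.refl ξ).smul_left s).smul_right t)

theorem exp_mul_exp_neg {n : ℕ} (ξ : Mat n) :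
    NormedSpace.exp ξ * NormedSpace.exp (-ξ) = 1 := by
  rw [← Matrix.exp_add_of_commute _ _ ((Commute.refl ξ).neg_right), add_neg_cancel,
    NormedSpace.exp_zero]

theorem exp_neg_mul_exp {n : ℕ} (ξ : Mat n) :
    NormedSpace.exp (-ξ) * NormedSpace.exp ξ = 1 := by
  simpa using exp_mul_exp_neg (-ξ)

/-- A matrix that intertwines `ξ` and `ζ` intertwines their exponentials. -/
theorem mul_exp_of_mul_eq {n : ℕ} {a ξ ζ : Mat n} (h : a * ξ = ζ * a) :
    a * NormedSpace.exp ξ = NormedSpace.exp ζ * a := by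
  letI : NormedRing (Mat n) := Matrix.linftyOpNormedRing
  letI : NormedAlgebra ℝ (Mat n) := Matrix.linftyOpNormedAlgebra
  exact mul_exp_of_mul_eq_of_finiteDimensional h

/-- If `exp (t ξ)` and `a` commute for all `t`, so do `ξ` and `a`. -/
theorem commute_of_forall_exp {n : ℕ} {a ξ : Mat n}
    (h : ∀ t : ℝ, a * NormedSpace.exp (t • ξ) = NormedSpace.exp (t • ξ) * a) : a * ξ = ξ * a := by
  have h1 := hasDerivAt_exp_smul ξ 0
  have h2 := hasDerivAt_matrix_mul (hasDerivAt_const (0 : ℝ) a) h1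
  have h3 := hasDerivAt_matrix_mul h1 (hasDerivAt_const (0 : ℝ) a)
  have h4 := h2.unique (h3.congr_of_eventuallyEq (Filter.Eventually.of_forall h))
  simpa using h4

/-- The exponential map of matrices is injective near zero. -/
theorem exists_exp_injOn (n : ℕ) :
    ∃ U ∈ 𝓝 (0 : Mat n), Set.InjOn (NormedSpace.exp : Mat n → Mat n) U := by
  have h := hasStrictFDerivAt_matrix_exp_zero (n := n)
  let e : Mat n ≃L[ℝ] Mat n := ContinuousLinearEquiv.refl ℝ _
  have h' : HasStrictFDerivAt (NormedSpace.exp : Mat n → Mat n) (e : Mat n →L[ℝ] Mat n) 0 := h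
  exact ⟨_, (h'.toOpenPartialHomeomorph _).open_source.mem_nhds
    h'.mem_toOpenPartialHomeomorph_source, (h'.toOpenPartialHomeomorph _).injOn⟩

/-! ### Lie algebras of closed subgroups -/

/-- The generators of one-parameter subgroups of `H`. -/
def genSet {n : ℕ} (H : Subgroup (UGroup n)) : Set (Mat n) :=
  {ξ | ∀ t : ℝ, ∃ h ∈ H, (h : Mat n) = NormedSpace.exp (t • ξ)}

theorem genSet_subset_lieAlg {n : ℕ} (H : Subgroup (UGroup n)) : genSet H ⊆ lieAlg H :=
  Submodule.subset_span

theorem conjTranspose_of_mem_genSet {n : ℕ} {H : Subgroup (UGroup n)} {ξ : Mat n}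
    (hξ : ξ ∈ genSet H) : ξ.conjTranspose = -ξ := by
  have h1 : ∀ t : ℝ, NormedSpace.exp (t • ξ.conjTranspose) * NormedSpace.exp (t • ξ) = 1 := by
    intro t
    obtain ⟨h, -, hh⟩ := hξ t
    have : NormedSpace.exp (t • ξ.conjTranspose) = (NormedSpace.exp (t • ξ)).conjTranspose := by
      rw [← Matrix.exp_conjTranspose, Matrix.conjTranspose_smul, star_trivial]
    rw [this, ← hh]
    exact Matrix.UnitaryGroup.star_mul_self h
  have h2 := hasDerivAt_matrix_mul (hasDerivAt_exp_smul ξ.conjTranspose 0) (hasDerivAt_exp_smul ξ 0)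
  have h3 := h2.unique ((hasDerivAt_const (0 : ℝ) (1 : Mat n)).congr_of_eventuallyEq
    (Filter.Eventually.of_forall h1))
  simpa [add_eq_zero_iff_eq_neg] using h3

theorem conjTranspose_of_mem_lieAlg {n : ℕ} {H : Subgroup (UGroup n)} {ξ : Mat n}
    (hξ : ξ ∈ lieAlg H) : ξ.conjTranspose = -ξ := by
  induction hξ using Submodule.span_induction with
  | mem ξ h => exact conjTranspose_of_mem_genSet h
  | zero => simp
  | add a b _ _ ha hb => rw [Matrix.conjTranspose_add, ha, hb]; abel
  | smul c a _ ha => rw [Matrix.conjTranspose_smul, ha, star_trivial, smul_neg]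

/-- The Lie algebra of `H` is invariant under the adjoint action of `H`. -/
theorem conj_mem_lieAlg {n : ℕ} {H : Subgroup (UGroup n)} {h : UGroup n} (hh : h ∈ H) {ξ : Mat n}
    (hξ : ξ ∈ lieAlg H) : (h : Mat n) * ξ * ((h⁻¹ : UGroup n) : Mat n) ∈ lieAlg H := by
  have hinv : ((h⁻¹ : UGroup n) : Mat n) * (h : Mat n) = 1 := by
    rw [← Submonoid.coe_mul, inv_mul_cancel]; rfl
  have hinv' : (h : Mat n) * ((h⁻¹ : UGroup n) : Mat n) = 1 := by
    rw [← Submonoid.coe_mul, mul_inv_cancel]; rfl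
  induction hξ using Submodule.span_induction with
  | mem ξ hξ =>
    refine genSet_subset_lieAlg H fun t => ?_
    obtain ⟨k, hk, hkt⟩ := hξ t
    refine ⟨h * k * h⁻¹, H.mul_mem (H.mul_mem hh hk) (H.inv_mem hh), ?_⟩
    have h1 : (h : Mat n) * NormedSpace.exp (t • ξ) =
        NormedSpace.exp (t • ((h : Mat n) * ξ * ((h⁻¹ : UGroup n) : Mat n))) * (h : Mat n) :=
      mul_exp_of_mul_eq (by
        rw [smul_mul_assoc, mul_smul_comm, mul_assoc, hinv, mul_one])
    rw [Submonoid.coe_mul, Submonoid.coe_mul, hkt, h1, mul_assoc, hinv', mul_one]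
  | zero => simp
  | add a b _ _ ha hb => rw [mul_add, add_mul]; exact Submodule.add_mem _ ha hb
  | smul c a _ ha => rw [mul_smul_comm, smul_mul_assoc]; exact Submodule.smul_mem _ _ ha

/-- If `exp (z k)` lies in the closed group `H`, `z k → 0`, and the multiples `c k • z k` converge,
then the limit generates a point of `H`. -/
theorem exp_mem_of_tendsto {n : ℕ} {H : Subgroup (UGroup n)} (hH : IsClosed (H : Set (UGroup n)))
    {z : ℕ → Mat n} {u : Mat n} (hz : ∀ k, ∃ h ∈ H, (h : Mat n) = NormedSpace.exp (z k))
    (hz0 : Filter.Tendsto z Filter.atTop (𝓝 0)) {c : ℕ → ℝ}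
    (hu : Filter.Tendsto (fun k => c k • z k) Filter.atTop (𝓝 u)) :
    ∃ h ∈ H, (h : Mat n) = NormedSpace.exp u := by
  choose h hH' hh using hz
  have h1 : Filter.Tendsto (fun k => Int.fract (c k) • z k) Filter.atTop (𝓝 0) := by
    refine squeeze_zero_norm (a := fun k => ‖z k‖) (fun k => ?_) (by simpa using hz0.norm)
    rw [norm_smul, Real.norm_of_nonneg (Int.fract_nonneg _)]
    exact mul_le_of_le_one_left (norm_nonneg _) (Int.fract_lt_one _).le
  have h2 : Filter.Tendsto (fun k => ⌊c k⌋ • z k) Filter.atTop (𝓝 u) := by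
    have := hu.sub h1
    rw [sub_zero] at this
    refine this.congr fun k => ?_
    rw [← sub_smul, Int.self_sub_fract, Int.cast_smul_eq_zsmul]
  have h3 : ∀ k, ((h k ^ ⌊c k⌋ : UGroup n) : Mat n) = NormedSpace.exp (⌊c k⌋ • z k) := by
    intro k
    rw [Matrix.exp_zsmul, ← hh]
    have hinv : ∀ g : UGroup n, ((g⁻¹ : UGroup n) : Mat n) = (g : Mat n)⁻¹ := fun g => by
      refine (Matrix.inv_eq_left_inv ?_).symm
      rw [← Submonoid.coe_mul, inv_mul_cancel]; rfl
    obtain ⟨j, hj | hj⟩ := ⌊c k⌋.eq_nat_or_neg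
    · rw [hj]; simp
    · rw [hj, zpow_neg, zpow_natCast, hinv, Matrix.zpow_neg_natCast]; simp
  have h4 : Filter.Tendsto (fun k => ((h k ^ ⌊c k⌋ : UGroup n) : Mat n)) Filter.atTop
      (𝓝 (NormedSpace.exp u)) := by
    simp only [h3]
    exact (continuous_matrix_exp.tendsto u).comp h2
  have hcl : IsClosed (Subtype.val '' (H : Set (UGroup n)) : Set (Mat n)) := by
    refine (Topology.IsClosedEmbedding.isClosedMap ?_) _ hH
    refine IsClosed.isClosedEmbedding_subtypeVal ?_
    exact isClosed_unitary
  obtain ⟨g, hg, hg'⟩ := hcl.mem_of_tendsto h4 (Filter.Eventually.of_forall fun k =>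
    ⟨_, H.zpow_mem (hH' k) _, rfl⟩)
  exact ⟨g, hg, hg'⟩

/-! ### Tori -/

theorem isClosedEmbedding_coe_UGroup (n : ℕ) :
    Topology.IsClosedEmbedding (Subtype.val : UGroup n → Mat n) :=
  IsClosed.isClosedEmbedding_subtypeVal isClosed_unitary

theorem compactSpace_UGroup (n : ℕ) : CompactSpace (UGroup n) := by
  have : ProperSpace (Mat n) := FiniteDimensional.proper ℝ _
  rw [← isCompact_univ_iff, (isClosedEmbedding_coe_UGroup n).isCompact_iff, Set.image_univ]
  refine Metric.isCompact_of_isClosed_isBounded (isClosedEmbedding_coe_UGroup n).isClosed_range ?_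
  refine (Metric.isBounded_closedBall (x := (0 : Mat n)) (r := 1)).subset ?_
  rintro _ ⟨U, rfl⟩
  rw [mem_closedBall_zero_iff, Matrix.norm_le_iff zero_le_one]
  exact fun i j => entry_norm_bound_of_unitary U.2 i j

theorem coe_inv_mul {n : ℕ} (h : UGroup n) : ((h⁻¹ : UGroup n) : Mat n) * (h : Mat n) = 1 := by
  rw [← Submonoid.coe_mul, inv_mul_cancel]; rfl

theorem coe_mul_inv {n : ℕ} (h : UGroup n) : (h : Mat n) * ((h⁻¹ : UGroup n) : Mat n) = 1 := by
  rw [← Submonoid.coe_mul, mul_inv_cancel]; rfl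

/-- A logarithm of matrices near one, by the inverse function theorem. -/
theorem exists_log (n : ℕ) : ∃ log : Mat n → Mat n, Filter.Tendsto log (𝓝 1) (𝓝 0) ∧
    ∀ᶠ a in 𝓝 1, NormedSpace.exp (log a) = a := by
  have h := hasStrictFDerivAt_matrix_exp_zero (n := n)
  let e : Mat n ≃L[ℝ] Mat n := ContinuousLinearEquiv.refl ℝ _
  have h' : HasStrictFDerivAt (NormedSpace.exp : Mat n → Mat n) (e : Mat n →L[ℝ] Mat n) 0 := h
  have h1 := h'.localInverse_tendsto
  have h2 := h'.eventually_right_inverse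
  rw [NormedSpace.exp_zero] at h1 h2
  exact ⟨_, h1, h2⟩

section Torus

variable {n : ℕ} {T : Subgroup (UGroup n)} (hT : ∀ a ∈ T, ∀ b ∈ T, a * b = b * a)
include hT

theorem commute_of_mem_genSet {ξ : Mat n} (hξ : ξ ∈ genSet T) {h : UGroup n} (hh : h ∈ T) :
    (h : Mat n) * ξ = ξ * h := by
  refine commute_of_forall_exp fun t => ?_
  obtain ⟨k, hk, hkt⟩ := hξ t
  rw [← hkt, ← Submonoid.coe_mul, ← Submonoid.coe_mul, hT h hh k hk]

/-- For a commutative subgroup the generators of one-parameter subgroups form a subspace. -/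
theorem mem_lieAlg_torus_iff {ξ : Mat n} : ξ ∈ lieAlg T ↔ ξ ∈ genSet T := by
  refine ⟨fun h => ?_, fun h => genSet_subset_lieAlg T h⟩
  induction h using Submodule.span_induction with
  | mem ξ h => exact h
  | zero => exact fun t => ⟨1, T.one_mem, by simp⟩
  | add a b _ _ ha hb =>
    intro t
    obtain ⟨k, hk, hkt⟩ := ha t
    obtain ⟨l, hl, hlt⟩ := hb t
    have hab : a * b = b * a := commute_of_forall_exp fun t => by
      obtain ⟨l, hl, hlt⟩ := hb t
      rw [← hlt, commute_of_mem_genSet hT ha hl]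
    refine ⟨k * l, T.mul_mem hk hl, ?_⟩
    rw [smul_add, Matrix.exp_add_of_commute _ _
      (((show Commute a b from hab).smul_left t).smul_right t), ← hkt, ← hlt]; rfl
  | smul c a _ ha =>
    intro t
    rw [smul_smul]
    exact ha _

theorem commute_of_mem_lieAlg {ξ : Mat n} (hξ : ξ ∈ lieAlg T) {h : UGroup n} (hh : h ∈ T) :
    (h : Mat n) * ξ = ξ * h :=
  commute_of_mem_genSet hT ((mem_lieAlg_torus_iff hT).1 hξ) hh

theorem commute_lieAlg {ξ ζ : Mat n} (hξ : ξ ∈ lieAlg T) (hζ : ζ ∈ lieAlg T) : ξ * ζ = ζ * ξ :=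
  commute_of_forall_exp fun t => by
    obtain ⟨l, hl, hlt⟩ := (mem_lieAlg_torus_iff hT).1 hζ t
    rw [← hlt, commute_of_mem_lieAlg hT hξ hl]

theorem exists_exp_eq_of_mem_lieAlg {ξ : Mat n} (hξ : ξ ∈ lieAlg T) :
    ∃ h ∈ T, (h : Mat n) = NormedSpace.exp ξ := by
  simpa using (mem_lieAlg_torus_iff hT).1 hξ 1

/-- A closed abelian subgroup is, near the identity, the image of small elements of its Lie
algebra. -/
theorem eventually_exists_exp_eq (hTc : IsClosed (T : Set (UGroup n))) :
    ∀ᶠ t in 𝓝 (1 : UGroup n), t ∈ T → ∃ ξ ∈ lieAlg T, ‖ξ‖ ≤ 1 ∧ (t : Mat n) = NormedSpace.exp ξ := by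
  by_contra hcon
  rw [Filter.not_eventually] at hcon
  have : FirstCountableTopology (Mat n) :=
    inferInstanceAs (FirstCountableTopology (Fin n → Fin n → ℂ))
  have : FirstCountableTopology (UGroup n) :=
    (isClosedEmbedding_coe_UGroup n).isInducing.firstCountableTopology
  obtain ⟨t, ht1, ht⟩ := Filter.exists_seq_forall_of_frequently hcon
  have htT : ∀ k, t k ∈ T := fun k => by
    by_contra h
    exact ht k fun h' => absurd h' h
  obtain ⟨log, hlog, hexp⟩ := exists_log n
  obtain ⟨U, hU, hinj⟩ := exists_exp_injOn n
  obtain ⟨q, hq, hq'⟩ := exists_projection (lieAlg T)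
  have ht1' : Filter.Tendsto (fun k => (t k : Mat n)) Filter.atTop (𝓝 1) :=
    (continuous_subtype_val.tendsto (1 : UGroup n)).comp ht1
  set z : ℕ → Mat n := fun k => log (t k) with hz
  have hz0 : Filter.Tendsto z Filter.atTop (𝓝 0) := hlog.comp ht1'
  have hzexp : ∀ᶠ k in Filter.atTop, NormedSpace.exp (z k) = t k := ht1'.eventually hexp
  -- the logarithms commute with the Lie algebra, by uniqueness of small logarithms
  have hzU : ∀ᶠ k in Filter.atTop, ∀ g : UGroup n,
      (g : Mat n) * z k * ((g⁻¹ : UGroup n) : Mat n) ∈ U := by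
    have := compactSpace_UGroup n
    have h1 : ∀ᶠ w in 𝓝 (0 : Mat n), ∀ g ∈ (Set.univ : Set (UGroup n)),
        (g : Mat n) * w * ((g⁻¹ : UGroup n) : Mat n) ∈ U := by
      refine isCompact_univ.eventually_forall_of_forall_eventually fun g _ => ?_
      have hc : Continuous fun p : Mat n × UGroup n =>
          (p.2 : Mat n) * p.1 * ((p.2⁻¹ : UGroup n) : Mat n) := by fun_prop
      refine hc.continuousAt.eventually_mem ?_
      simpa using hU
    filter_upwards [hz0.eventually h1] with k hk g using hk g trivial
  have hcomm : ∀ᶠ k in Filter.atTop, ∀ ξ ∈ lieAlg T, Commute (z k) ξ := by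
    filter_upwards [hzU, hzexp] with k hkU hk ξ hξ
    refine commute_of_forall_exp fun s => ?_
    obtain ⟨g, hg, hgs⟩ := (mem_lieAlg_torus_iff hT).1 hξ s
    rw [← hgs]
    have h1 : NormedSpace.exp ((g : Mat n) * z k * ((g⁻¹ : UGroup n) : Mat n)) =
        NormedSpace.exp (z k) := by
      have h2 : (g : Mat n) * NormedSpace.exp (z k) = NormedSpace.exp
          ((g : Mat n) * z k * ((g⁻¹ : UGroup n) : Mat n)) * (g : Mat n) :=
        mul_exp_of_mul_eq (by rw [mul_assoc, coe_inv_mul, mul_one])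
      have h3 : (g : Mat n) * NormedSpace.exp (z k) = NormedSpace.exp (z k) * g := by
        rw [hk, ← Submonoid.coe_mul, hT g hg _ (htT k)]; rfl
      rw [h3] at h2
      have h4 := congrArg (fun a => a * ((g⁻¹ : UGroup n) : Mat n)) h2
      simp only [mul_assoc, coe_mul_inv, mul_one] at h4
      rw [← mul_assoc] at h4
      exact h4.symm
    have h5 := hinj (hkU g) (by simpa using hkU 1) h1
    conv_lhs => rw [← h5]
    rw [mul_assoc, coe_inv_mul, mul_one]
  have hb0 : Filter.Tendsto (fun k => q (z k)) Filter.atTop (𝓝 0) := by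
    have := (q.continuous.tendsto 0).comp hz0
    rwa [map_zero] at this
  have hbT : ∀ᶠ k in Filter.atTop, ∃ h ∈ T, (h : Mat n) = NormedSpace.exp (q (z k)) := by
    filter_upwards [hcomm, hzexp] with k hk hke
    obtain ⟨g, hg, hge⟩ := exists_exp_eq_of_mem_lieAlg hT ((lieAlg T).neg_mem (hq' (z k)))
    refine ⟨t k * g, T.mul_mem (htT k) hg, ?_⟩
    rw [Submonoid.coe_mul, hge, ← hke, ← Matrix.exp_add_of_commute _ _
      (hk _ ((lieAlg T).neg_mem (hq' (z k))))]
    congr 1; abel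
  have hbne : ∀ᶠ k in Filter.atTop, q (z k) ≠ 0 := by
    have hsmall : ∀ᶠ k in Filter.atTop, ‖z k‖ ≤ 1 := by
      have := hz0.norm
      rw [norm_zero] at this
      exact (this.eventually (gt_mem_nhds one_pos)).mono fun _ h => h.le
    filter_upwards [hzexp, hsmall] with k hk hs h
    exact ht k fun _ => ⟨z k, (hq _).1 h, hs, hk.symm⟩
  obtain ⟨N, hN⟩ := Filter.eventually_atTop.1 (hbT.and hbne)
  set b : ℕ → Mat n := fun k => q (z (k + N)) with hb
  have hb0' : Filter.Tendsto b Filter.atTop (𝓝 0) := hb0.comp (Filter.tendsto_add_atTop_nat N)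
  have : ProperSpace (Mat n) := FiniteDimensional.proper ℝ _
  obtain ⟨u, hu, φ, hφ, hlim⟩ := (isCompact_sphere (0 : Mat n) 1).tendsto_subseq
    (x := fun k => ‖b k‖⁻¹ • b k) (fun k => by
      simp [norm_smul, inv_mul_cancel₀ (norm_ne_zero_iff.2 (hN (k + N) (by omega)).2), hb])
  have hmem : u ∈ lieAlg T := genSet_subset_lieAlg T fun s => by
    refine exp_mem_of_tendsto hTc (fun k => (hN (φ k + N) (by omega)).1)
      (hb0'.comp hφ.tendsto_atTop) (c := fun k => s * ‖b (φ k)‖⁻¹) ?_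
    simp only [mul_smul]
    exact hlim.const_smul s
  have hqq : ∀ v, q (q v) = q v := fun v => by
    have := (hq _).2 (hq' v)
    rw [map_sub, sub_eq_zero] at this
    exact this.symm
  have h1 : q u = u := by
    refine tendsto_nhds_unique ((q.continuous.tendsto u).comp hlim) (hlim.congr fun k => ?_)
    simp [hqq, hb]
  rw [(hq u).2 hmem] at h1
  rw [← h1] at hu
  simp at hu

/-- The exponential map of a torus is onto, with bounded preimages. -/
theorem exists_exp_eq_torus (hTc : IsClosed (T : Set (UGroup n)))
    (hTconn : IsConnected (T : Set (UGroup n))) :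
    ∃ R : ℝ, ∀ t ∈ T, ∃ ξ ∈ lieAlg T, ‖ξ‖ ≤ R ∧ (t : Mat n) = NormedSpace.exp ξ := by
  have hadd : ∀ ξ ∈ lieAlg T, ∀ ζ ∈ lieAlg T,
      NormedSpace.exp (ξ + ζ) = NormedSpace.exp ξ * NormedSpace.exp ζ := fun ξ hξ ζ hζ =>
    Matrix.exp_add_of_commute _ _ (commute_lieAlg hT hξ hζ)
  have hev := eventually_exists_exp_eq hT hTc
  let S : Subgroup T :=
    { carrier := {t | ∃ ξ ∈ lieAlg T, ((t : UGroup n) : Mat n) = NormedSpace.exp ξ}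
      one_mem' := ⟨0, (lieAlg T).zero_mem, by simp⟩
      mul_mem' := by
        rintro a b ⟨ξ, hξ, ha⟩ ⟨ζ, hζ, hb⟩
        refine ⟨ξ + ζ, (lieAlg T).add_mem hξ hζ, ?_⟩
        rw [hadd ξ hξ ζ hζ, ← ha, ← hb]; rfl
      inv_mem' := by
        rintro a ⟨ξ, hξ, ha⟩
        refine ⟨-ξ, (lieAlg T).neg_mem hξ, ?_⟩
        have h1 := exp_neg_mul_exp ξ
        rw [← ha] at h1
        have h2 := congrArg (fun c => c * (((a : UGroup n)⁻¹ : UGroup n) : Mat n)) h1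
        simp only [mul_assoc, coe_mul_inv, mul_one, one_mul] at h2
        exact h2.symm }
  have hSopen : IsOpen (S : Set T) := by
    refine Subgroup.isOpen_of_mem_nhds S (g := 1) ?_
    have h1 : ∀ᶠ t : T in 𝓝 1, (t : UGroup n) ∈ T → ∃ ξ ∈ lieAlg T, ‖ξ‖ ≤ 1 ∧
        ((t : UGroup n) : Mat n) = NormedSpace.exp ξ :=
      (continuous_subtype_val.tendsto (1 : T)).eventually hev
    filter_upwards [h1] with t ht
    obtain ⟨ξ, hξ, -, h2⟩ := ht t.2
    exact ⟨ξ, hξ, h2⟩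
  have hconn : ConnectedSpace T := isConnected_iff_connectedSpace.1 hTconn
  have hStop : (S : Set T) = Set.univ :=
    IsClopen.eq_univ ⟨S.isClosed_of_isOpen hSopen, hSopen⟩ ⟨1, S.one_mem⟩
  have := compactSpace_UGroup n
  have hTcpt : IsCompact (T : Set (UGroup n)) := hTc.isCompact
  obtain ⟨W, hWev, hWo, h1W⟩ := eventually_nhds_iff.1 hev
  -- finitely many translates of a small neighborhood of the identity cover the torus
  obtain ⟨F, hF⟩ := hTcpt.elim_finite_subcover (fun s : T => (fun g : UGroup n => (s : UGroup n)⁻¹ * g) ⁻¹' W)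
    (fun s => hWo.preimage (continuous_const_mul _)) (fun t ht =>
      Set.mem_iUnion.2 ⟨⟨t, ht⟩, by simpa using h1W⟩)
  have hlogS : ∀ s : T, ∃ ξ ∈ lieAlg T, ((s : UGroup n) : Mat n) = NormedSpace.exp ξ := fun s => by
    have : s ∈ (S : Set T) := hStop ▸ Set.mem_univ s
    exact this
  choose l hl hl' using hlogS
  obtain ⟨M, hM⟩ := (F.finite_toSet.image fun s => ‖l s‖).bddAbove
  refine ⟨M + 1, fun t ht => ?_⟩
  obtain ⟨s, hs, hsW⟩ := Set.mem_iUnion₂.1 (hF ht)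
  obtain ⟨ξ, hξ, hξ1, hξe⟩ := hWev _ hsW (T.mul_mem (T.inv_mem s.2) ht)
  refine ⟨l s + ξ, (lieAlg T).add_mem (hl s) hξ, ?_, ?_⟩
  · exact (norm_add_le _ _).trans (add_le_add (hM ⟨s, hs, rfl⟩) hξ1)
  · rw [hadd _ (hl s) _ hξ, ← hl' s, ← hξe, ← Submonoid.coe_mul, mul_inv_cancel_left]

end Torus

/-- An element of the Lie algebra of `G` that commutes with the Lie algebra of a maximal torus
belongs to it. -/
theorem mem_lieAlg_of_commute {n : ℕ} {T G : Subgroup (UGroup n)} (hTG : IsMaximalTorus T G)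
    (hG : IsClosed (G : Set (UGroup n))) {ζ : Mat n} (hζ : ζ ∈ genSet G)
    (hcomm : ∀ ξ ∈ lieAlg T, ξ * ζ = ζ * ξ) : ζ ∈ lieAlg T := by
  obtain ⟨⟨⟨hTc, hTconn, hT⟩, hTle⟩, hmax⟩ := hTG
  obtain ⟨R, hR⟩ := exists_exp_eq_torus hT hTc hTconn
  choose e heG he using hζ
  have headd : ∀ s t, e (s + t) = e s * e t := fun s t => Subtype.ext (by
    rw [Submonoid.coe_mul, he, he, he, exp_add_smul])
  have he0 : e 0 = 1 := Subtype.ext (by rw [he]; simp)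
  have hTe : ∀ t ∈ T, ∀ s, t * e s = e s * t := fun t ht s => by
    obtain ⟨ξ, hξ, -, hte⟩ := hR t ht
    refine Subtype.ext ?_
    rw [Submonoid.coe_mul, Submonoid.coe_mul, he, hte]
    exact mul_exp_of_mul_eq (by
      rw [mul_smul_comm, smul_mul_assoc]
      congr 1
      exact (mul_exp_of_mul_eq (hcomm ξ hξ).symm).symm)
  have hec : Continuous e := by
    refine continuous_induced_rng.2 ?_
    have : (Subtype.val ∘ e) = fun s : ℝ => NormedSpace.exp (s • ζ) := funext he
    rw [this]
    exact continuous_matrix_exp.comp (by fun_prop)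
  let N : Subgroup (UGroup n) :=
    { carrier := {g | ∃ t ∈ T, ∃ s, g = t * e s}
      one_mem' := ⟨1, T.one_mem, 0, by rw [he0, mul_one]⟩
      mul_mem' := by
        rintro _ _ ⟨t, ht, s, rfl⟩ ⟨t', ht', s', rfl⟩
        refine ⟨t * t', T.mul_mem ht ht', s + s', ?_⟩
        rw [headd, mul_assoc, ← mul_assoc (e s), ← hTe t' ht' s]
        group
      inv_mem' := by
        rintro _ ⟨t, ht, s, rfl⟩
        refine ⟨t⁻¹, T.inv_mem ht, -s, ?_⟩
        have : e (-s) = (e s)⁻¹ := by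
          rw [eq_inv_iff_mul_eq_one, ← headd, neg_add_cancel, he0]
        rw [this, mul_inv_rev, ← mul_inv_rev, ← mul_inv_rev, hTe t ht] }
  have hTN : T ≤ N := fun t ht => ⟨t, ht, 0, by rw [he0, mul_one]⟩
  have hNcomm : ∀ a ∈ N, ∀ b ∈ N, a * b = b * a := by
    rintro _ ⟨t, ht, s, rfl⟩ _ ⟨t', ht', s', rfl⟩
    calc t * e s * (t' * e s') = t * (e s * t') * e s' := by group
      _ = (t * t') * (e s * e s') := by rw [← hTe t' ht']; group
      _ = (t' * t) * (e s' * e s) := by rw [hT t ht t' ht', ← headd, ← headd, add_comm]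
      _ = t' * (t * e s') * e s := by group
      _ = t' * e s' * (t * e s) := by rw [hTe t ht]; group
  have hNconn : IsConnected (N : Set (UGroup n)) := by
    have : (N : Set (UGroup n)) = (fun p : UGroup n × ℝ => p.1 * e p.2) ''
        ((T : Set (UGroup n)) ×ˢ Set.univ) := by
      ext g
      constructor
      · rintro ⟨t, ht, s, rfl⟩
        exact ⟨(t, s), ⟨ht, trivial⟩, rfl⟩
      · rintro ⟨⟨t, s⟩, ⟨ht, -⟩, rfl⟩
        exact ⟨t, ht, s, rfl⟩
    rw [this]
    exact (hTconn.prod isConnected_univ).image _ (by fun_prop)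
  have hNG : N ≤ G := by
    rintro _ ⟨t, ht, s, rfl⟩
    exact G.mul_mem (hTle ht) (heG s)
  have hclT : IsTorus N.topologicalClosure := by
    refine ⟨N.isClosed_topologicalClosure, hNconn.closure, ?_⟩
    have h1 : ∀ a ∈ N, ∀ b ∈ N.topologicalClosure, a * b = b * a := fun a ha => by
      have hcl : IsClosed {b : UGroup n | a * b = b * a} :=
        isClosed_eq (by fun_prop) (by fun_prop)
      exact fun b hb => closure_minimal (fun b hb => hNcomm a ha b hb) hcl hb
    intro a ha b hb
    have hcl : IsClosed {a : UGroup n | a * b = b * a} :=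
      isClosed_eq (by fun_prop) (by fun_prop)
    exact closure_minimal (fun a ha => h1 a ha b hb) hcl ha
  have hle := hmax ⟨hclT, N.topologicalClosure_minimal hNG hG⟩
    (hTN.trans N.le_topologicalClosure)
  refine genSet_subset_lieAlg T fun s => ⟨e s, hle (N.le_topologicalClosure ?_), he s⟩
  exact ⟨1, T.one_mem, s, by rw [one_mul]⟩

/-! ### Trigonometric loops and the exponential map of the loop group -/

namespace CompactGroup

variable {m : ℕ} (K : CompactGroup m)

theorem mul_exp_of_mul_eq {a ξ ζ : K.A} (h : a * ξ = ζ * a) :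
    a * NormedSpace.exp ξ = NormedSpace.exp ζ * a := by
  funext i
  rw [Pi.mul_apply, Pi.mul_apply, K.exp_apply, K.exp_apply]
  exact LoopSpace.mul_exp_of_mul_eq (congrFun h i)

theorem exp_add_of_commute {ξ ζ : K.A} (h : Commute ξ ζ) :
    NormedSpace.exp (ξ + ζ) = NormedSpace.exp ξ * NormedSpace.exp ζ := by
  funext i
  rw [Pi.mul_apply, K.exp_apply, K.exp_apply, K.exp_apply]
  exact Matrix.exp_add_of_commute _ _ (congrFun h i)

theorem exp_zero : NormedSpace.exp (0 : K.A) = 1 := by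
  funext i
  rw [K.exp_apply]; simp

theorem exp_mul_exp_neg (ξ : K.A) : NormedSpace.exp ξ * NormedSpace.exp (-ξ) = 1 := by
  rw [← K.exp_add_of_commute (Commute.refl ξ).neg_right, add_neg_cancel, K.exp_zero]

theorem exp_neg_mul_exp (ξ : K.A) : NormedSpace.exp (-ξ) * NormedSpace.exp ξ = 1 := by
  simpa using K.exp_mul_exp_neg (-ξ)

theorem mem_t {ξ : K.A} : ξ ∈ K.t ↔ ∀ i, ξ i ∈ lieAlg (K.T i) := by
  simp [t, Submodule.mem_pi]

theorem mem_g {ξ : K.A} : ξ ∈ K.g ↔ ∀ i, ξ i ∈ lieAlg (K.G i) := by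
  simp [g, Submodule.mem_pi]

theorem torus_comm (i : Fin m) : ∀ a ∈ K.T i, ∀ b ∈ K.T i, a * b = b * a :=
  (K.maximalTorus i).prop.1.2.2

theorem commute_t {ξ ζ : K.A} (hξ : ξ ∈ K.t) (hζ : ζ ∈ K.t) : Commute ξ ζ :=
  funext fun i => commute_lieAlg (K.torus_comm i) (K.mem_t.1 hξ i) (K.mem_t.1 hζ i)

/-! #### Loops with frequencies at most one -/

/-- The square summable family `v, 2^{ς/2} p, 2^{ς/2} q` at the frequencies `0, 1, -1`. -/
def trigSeq (ς : ℝ) (v p q : K.A) : lp (fun _ : ℤ => K.A) 2 :=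
  lp.single 2 0 v + ((2 : ℝ) ^ (ς / 2)) • (lp.single 2 1 p + lp.single 2 (-1) q)

theorem trigSeq_apply (ς : ℝ) (v p q : K.A) (k : ℤ) : K.trigSeq ς v p q k =
    (Pi.single 0 v : ℤ → K.A) k +
      ((2 : ℝ) ^ (ς / 2)) • ((Pi.single 1 p : ℤ → K.A) k + (Pi.single (-1) q : ℤ → K.A) k) := rfl

/-- The loop `x ↦ v + e^{2 π i x} p + e^{-2 π i x} q`. -/
def trig (ς : ℝ) (v p q : K.A) (hv : v ∈ K.g) (hp : p + q ∈ K.g)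
    (hq : Complex.I • (p - q) ∈ K.g) : K.loopAlg :=
  ⟨K.trigSeq ς v p q, by
    have hp' : q + p ∈ K.g := by rwa [add_comm]
    have hq' : Complex.I • (q - p) ∈ K.g := by
      have := K.g.neg_mem hq
      rwa [← smul_neg, neg_sub] at this
    have h0 : ∀ c : ℝ, Complex.I • (c • p - c • q) = c • (Complex.I • (p - q)) := fun c => by
      rw [← smul_sub, smul_comm]
    have h0' : ∀ c : ℝ, Complex.I • (c • q - c • p) = c • (Complex.I • (q - p)) := fun c => by
      rw [← smul_sub, smul_comm]
    intro k
    rcases eq_or_ne k 0 with rfl | hk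
    · refine ⟨?_, ?_⟩
      · simpa [trigSeq_apply] using K.g.add_mem hv hv
      · simp [trigSeq_apply]
    rcases eq_or_ne k 1 with rfl | hk1
    · refine ⟨?_, ?_⟩
      · simpa [trigSeq_apply, ← smul_add] using K.g.smul_mem _ hp
      · simpa [trigSeq_apply, h0] using K.g.smul_mem _ hq
    rcases eq_or_ne k (-1) with rfl | hk2
    · refine ⟨?_, ?_⟩
      · simpa [trigSeq_apply, ← smul_add] using K.g.smul_mem _ hp'
      · simpa [trigSeq_apply, h0'] using K.g.smul_mem _ hq'
    have hk' : -k ≠ 0 := neg_ne_zero.2 hk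
    have hk1' : -k ≠ 1 := fun h => hk2 (by omega)
    have hk2' : -k ≠ -1 := fun h => hk1 (by omega)
    refine ⟨?_, ?_⟩ <;> simp [trigSeq_apply, hk, hk1, hk2, hk1', -neg_inj, -neg_eq_zero, hk', hk2']⟩

variable {K} in
theorem coeff_trig {ς : ℝ} {v p q : K.A} (hv : v ∈ K.g) (hp : p + q ∈ K.g)
    (hq : Complex.I • (p - q) ∈ K.g) (k : ℤ) :
    K.coeff ς (K.trig ς v p q hv hp hq) k =
      if k = 0 then v else if k = 1 then p else if k = -1 then q else 0 := by
  have h2 : ((2 : ℝ) ^ (-ς / 2)) * (2 : ℝ) ^ (ς / 2) = 1 := by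
    rw [← Real.rpow_add two_pos]; ring_nf; simp
  have h3 : ((1 + 1 : ℝ) ^ (-ς / 2)) = (2 : ℝ) ^ (-ς / 2) := by norm_num
  rcases eq_or_ne k 0 with rfl | hk
  · simp [coeff, trig, trigSeq_apply]
  rcases eq_or_ne k 1 with rfl | hk1
  · simp [coeff, trig, trigSeq_apply, smul_smul, h3, h2]
  rcases eq_or_ne k (-1) with rfl | hk2
  · simp [coeff, trig, trigSeq_apply, smul_smul, h3, h2]
  simp [coeff, trig, trigSeq_apply, hk, hk1, hk2]

variable {K} in
theorem eval_trig {ς : ℝ} {v p q : K.A} (hv : v ∈ K.g) (hp : p + q ∈ K.g)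
    (hq : Complex.I • (p - q) ∈ K.g) (x : UnitAddCircle) :
    K.eval ς (K.trig ς v p q hv hp hq) x =
      v + (fourier 1 x : ℂ) • p + (fourier (-1) x : ℂ) • q := by
  rw [eval, tsum_eq_sum (s := {0, 1, -1})]
  · simp only [coeff_trig]
    rw [Finset.sum_insert (by simp), Finset.sum_insert (by decide), Finset.sum_singleton]
    simp [add_assoc]
  · intro k hk
    simp only [Finset.mem_insert, Finset.mem_singleton, not_or] at hk
    simp [coeff_trig, hk.1, hk.2.1, hk.2.2]

theorem coeff_const (s : ℝ) (ξ : K.t) (k : ℤ) :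
    K.coeff s (K.const ξ) k = if k = 0 then (ξ : K.A) else 0 := by
  rcases eq_or_ne k 0 with rfl | hk
  · simp [coeff, const]
  · simp [coeff, const, hk]

theorem eval_const (ς : ℝ) (ξ : K.t) (x : UnitAddCircle) : K.eval ς (K.const ξ) x = ξ := by
  rw [eval, tsum_eq_single 0]
  · simp [coeff_const]
  · intro k hk
    simp [coeff_const, hk]

theorem eval_smul (ς : ℝ) (c : ℝ) (ξ : K.Lg) (x : UnitAddCircle) :
    K.eval ς (c • ξ) x = c • K.eval ς ξ x := by
  have h1 : ∀ k : ℤ, (fourier k x : ℂ) • K.coeff ς (c • ξ) k =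
      c • ((fourier k x : ℂ) • K.coeff ς ξ k) := fun k => by
    simp only [coeff]
    rw [show ((c • ξ : K.Lg) : lp (fun _ : ℤ => K.A) 2) k = c • (ξ : lp (fun _ : ℤ => K.A) 2) k
      from rfl, smul_comm _ c, smul_comm _ c]
  simp only [eval, h1]
  exact tsum_const_smul'' c

theorem const_add (ξ ζ : K.t) : K.const (ξ + ζ) = K.const ξ + K.const ζ :=
  Subtype.ext (by simp [const])

theorem const_smul (c : ℝ) (ξ : K.t) : K.const (c • ξ) = c • K.const ξ :=
  Subtype.ext (by
    show lp.single (E := fun _ : ℤ => K.A) 2 0 (c • (ξ : K.A)) =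
      c • lp.single (E := fun _ : ℤ => K.A) 2 0 (ξ : K.A)
    exact lp.single_smul (E := fun _ : ℤ => K.A) 2 0 c (ξ : K.A))

theorem norm_const (ξ : K.t) : ‖K.const ξ‖ = ‖ξ‖ :=
  lp.norm_single (E := fun _ : ℤ => K.A) (p := 2) (by norm_num) 0 (ξ : K.A)

/-- The inclusion of `𝔱` as constant loops, as a continuous linear map. -/
def constL : K.t →L[ℝ] K.Lg :=
  LinearMap.mkContinuous ⟨⟨K.const, K.const_add⟩, K.const_smul⟩ 1 fun ξ => by
    rw [one_mul]; exact (K.norm_const ξ).le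

theorem constL_apply (ξ : K.t) : K.constL ξ = K.const ξ := rfl

/-! #### The exponential map -/

variable {ς : ℝ}

theorem loopMat_injective {g h : K.LG ς} (H : ∀ x, K.loopMat g.1 x = K.loopMat h.1 x) : g = h :=
  Subtype.ext (funext fun x => funext fun i => Subtype.ext (Subtype.ext (congrFun (H x) i)))

theorem loopMat_mul (g h : K.LG ς) (x : UnitAddCircle) :
    K.loopMat (g * h).1 x = K.loopMat g.1 x * K.loopMat h.1 x := rfl

theorem loopMat_one (x : UnitAddCircle) : K.loopMat (1 : K.LG ς).1 x = 1 := rfl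

theorem loopMat_mul_inv (g : K.LG ς) (x : UnitAddCircle) :
    K.loopMat g.1 x * K.loopMat (g⁻¹).1 x = 1 := by
  rw [← loopMat_mul, mul_inv_cancel, loopMat_one]

variable {K} {ℓ : Fin m → ℤ} {Ghat : Type*} [Group Ghat] [TopologicalSpace Ghat]
  [ChartedSpace (K.Lg × ℝ) Ghat] (P : K.LevelExtension ς ℓ Ghat)
include P

theorem loopExp_apply (ξ : K.Lg) (x : UnitAddCircle) :
    K.loopMat (K.loopExp ς ξ).1 x = NormedSpace.exp (K.eval ς ξ x) := by
  have h : ∃ g : K.LG ς, ∀ x, K.loopMat g.1 x = NormedSpace.exp (K.eval ς ξ x) :=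
    ⟨_, P.proj_exp ξ⟩
  rw [loopExp, dif_pos h]
  exact h.choose_spec x

theorem proj_exp_eq (ξ : K.Lg) : P.proj (P.exp ξ) = K.loopExp ς ξ :=
  K.loopMat_injective fun x => by rw [P.proj_exp, loopExp_apply P]

theorem exp_zero_eq : P.exp 0 = 1 := by
  have h := P.exp_add_smul 0 0 0
  simpa using h

theorem loopExp_zero : K.loopExp ς 0 = 1 := by
  rw [← proj_exp_eq P, exp_zero_eq P, map_one]

theorem loopExp_add_smul (s t : ℝ) (ξ : K.Lg) :
    K.loopExp ς ((s + t) • ξ) = K.loopExp ς (s • ξ) * K.loopExp ς (t • ξ) := by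
  simp only [← proj_exp_eq P, P.exp_add_smul, map_mul]

theorem loopExp_neg (ξ : K.Lg) : K.loopExp ς (-ξ) = (K.loopExp ς ξ)⁻¹ := by
  rw [eq_inv_iff_mul_eq_one]
  have h := loopExp_add_smul P (-1) 1 ξ
  simpa [loopExp_zero P] using h.symm

theorem loopExp_const_add (ξ ζ : K.t) :
    K.loopExp ς (K.const (ξ + ζ)) = K.loopExp ς (K.const ξ) * K.loopExp ς (K.const ζ) :=
  K.loopMat_injective fun x => by
    rw [loopMat_mul, loopExp_apply P, loopExp_apply P, loopExp_apply P, eval_const, eval_const,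
      eval_const, Submodule.coe_add, K.exp_add_of_commute (K.commute_t ξ.2 ζ.2)]

theorem loopExp_const_lattice {η : K.t} (hη : η ∈ K.lattice) : K.loopExp ς (K.const η) = 1 :=
  K.loopMat_injective fun x => by
    rw [loopExp_apply P, eval_const, loopMat_one]; exact hη

/-- Conjugation of exponentials in the loop group. -/
theorem conj_loopExp {g : K.LG ς} {ξ ξ' : K.Lg} (h : K.IsAd ς g ξ ξ') :
    g * K.loopExp ς ξ * g⁻¹ = K.loopExp ς ξ' := by
  rw [mul_inv_eq_iff_eq_mul]
  refine K.loopMat_injective fun x => ?_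
  rw [loopMat_mul, loopMat_mul, loopExp_apply P, loopExp_apply P]
  exact K.mul_exp_of_mul_eq (h x).symm

/-- Every element of the Lie algebra of a factor generates a one-parameter group in this factor,
because constant loops have exponentials in the loop group. -/
theorem mem_genSet_of_mem_lieAlg {i : Fin m} {v : Mat (K.size i)} (hv : v ∈ lieAlg (K.G i)) :
    v ∈ genSet (K.G i) := by
  intro t
  have hw : (Pi.single i (t • v) : K.A) ∈ K.g := K.mem_g.2 fun j => by
    rcases eq_or_ne j i with rfl | hj
    · simpa using (lieAlg (K.G j)).smul_mem t hv
    · simp [hj]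
  have h := loopExp_apply P (K.trig ς (Pi.single i (t • v)) 0 0 hw (by simp) (by simp)) 0
  rw [eval_trig] at h
  have h' := congrFun h i
  rw [K.exp_apply] at h'
  refine ⟨_, ((K.loopExp ς (K.trig ς (Pi.single i (t • v)) 0 0 hw (by simp) (by simp))).1 0 i).2, ?_⟩
  have h2 : ((Pi.single i (t • v) : K.A) + (fourier 1 (0 : UnitAddCircle) : ℂ) • (0 : K.A) +
      (fourier (-1) (0 : UnitAddCircle) : ℂ) • (0 : K.A)) i = t • v := by
    rw [smul_zero, smul_zero, add_zero, add_zero, Pi.single_eq_same]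
  rw [h2] at h'
  exact h'

end CompactGroup

/-! ### Co-roots of a simple factor -/

/-- The square of the Hilbert-Schmidt norm. -/
def sqNorm {n : ℕ} (X : Mat n) : ℝ := ∑ i, ∑ j, ‖X i j‖ ^ 2

theorem trace_mul_conjTranspose {n : ℕ} (X : Mat n) :
    Matrix.trace (X * X.conjTranspose) = (sqNorm X : ℂ) := by
  simp only [Matrix.trace, Matrix.diag, Matrix.mul_apply, Matrix.conjTranspose_apply, sqNorm]
  push_cast
  refine Finset.sum_congr rfl fun i _ => Finset.sum_congr rfl fun j _ => ?_
  rw [Complex.star_def, Complex.mul_conj, Complex.normSq_eq_norm_sq]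
  push_cast; rfl

theorem sqNorm_nonneg {n : ℕ} (X : Mat n) : 0 ≤ sqNorm X :=
  Finset.sum_nonneg fun _ _ => Finset.sum_nonneg fun _ _ => sq_nonneg _

theorem sq_norm_le_sqNorm {n : ℕ} (X : Mat n) : ‖X‖ ^ 2 ≤ sqNorm X := by
  rw [← Real.sqrt_le_sqrt_iff (sqNorm_nonneg X), Real.sqrt_sq (norm_nonneg X)]
  refine (Matrix.norm_le_iff (Real.sqrt_nonneg _)).2 fun i j => Real.le_sqrt_of_sq_le ?_
  refine le_trans ?_ (Finset.single_le_sum (f := fun i => ∑ j, ‖X i j‖ ^ 2)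
    (fun i _ => Finset.sum_nonneg fun j _ => sq_nonneg _) (Finset.mem_univ i))
  exact Finset.single_le_sum (f := fun j => ‖X i j‖ ^ 2) (fun j _ => sq_nonneg _)
    (Finset.mem_univ j)

theorem sqNorm_pos {n : ℕ} {X : Mat n} (hX : X ≠ 0) : 0 < sqNorm X :=
  lt_of_lt_of_le (by have := norm_pos_iff.2 hX; positivity) (sq_norm_le_sqNorm X)

theorem trace_mul_self_of_skew {n : ℕ} {ξ : Mat n} (h : ξ.conjTranspose = -ξ) :
    Matrix.trace (ξ * ξ) = -(sqNorm ξ : ℂ) := by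
  rw [← trace_mul_conjTranspose, h, mul_neg, Matrix.trace_neg, neg_neg]

theorem trace_mul_of_skew_im {n : ℕ} {ξ ζ : Mat n} (h : ξ.conjTranspose = -ξ)
    (h' : ζ.conjTranspose = -ζ) : (Matrix.trace (ξ * ζ)).im = 0 := by
  have h1 : star (Matrix.trace (ξ * ζ)) = Matrix.trace (ξ * ζ) := by
    rw [← Matrix.trace_conjTranspose, Matrix.conjTranspose_mul, h, h', neg_mul_neg,
      Matrix.trace_mul_comm]
  exact Complex.conj_eq_iff_im.1 h1

theorem norm_le_two_mul_of_bracket_eq_smul {A : Type*} [NormedRing A] [NormedAlgebra ℂ A]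
    {η X : A} {z : ℂ} (hX : X ≠ 0) (h : η * X - X * η = z • X) : ‖z‖ ≤ 2 * ‖η‖ := by
  refine le_of_mul_le_mul_right ?_ (norm_pos_iff.2 hX)
  rw [← norm_smul, ← h]
  calc ‖η * X - X * η‖ ≤ ‖η * X‖ + ‖X * η‖ := norm_sub_le _ _
    _ ≤ ‖η‖ * ‖X‖ + ‖X‖ * ‖η‖ := add_le_add (norm_mul_le _ _) (norm_mul_le _ _)
    _ = 2 * ‖η‖ * ‖X‖ := by ring

/-- An eigenvalue of `ad η` is bounded by the Hilbert-Schmidt norm of `η`. -/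
theorem norm_le_of_bracket_eq_smul {n : ℕ} {η X : Mat n} {z : ℂ} (hX : X ≠ 0)
    (h : η * X - X * η = z • X) : ‖z‖ ^ 2 ≤ 4 * sqNorm η := by
  letI := Matrix.frobeniusNormedRing (m := Fin n) (α := ℂ)
  letI := Matrix.frobeniusNormedAlgebra (m := Fin n) (R := ℂ) (α := ℂ)
  have h1 : ‖η‖ ^ 2 = sqNorm η := by
    have : ‖η‖ = (∑ i, ∑ j, ‖η i j‖ ^ (2 : ℝ)) ^ (1 / 2 : ℝ) := Matrix.frobenius_norm_def η
    rw [this, ← Real.sqrt_eq_rpow, Real.sq_sqrt]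
    · simp [sqNorm]
    · positivity
  have h3 : ‖z‖ ≤ 2 * ‖η‖ := norm_le_two_mul_of_bracket_eq_smul hX h
  calc ‖z‖ ^ 2 ≤ (2 * ‖η‖) ^ 2 := pow_le_pow_left₀ (norm_nonneg _) h3 2
    _ = 4 * sqNorm η := by rw [mul_pow, h1]; norm_num

section Factor

variable {n : ℕ} {T G : Subgroup (UGroup n)}

/-- The square lengths of co-roots are bounded below. -/
theorem le_sqNorm_of_isCoroot {η : Mat n} (h : IsCoroot G T η) : 4 * Real.pi ^ 2 ≤ sqNorm η := by
  obtain ⟨-, X, hX, -, -, -, h4⟩ := h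
  have h5 := norm_le_of_bracket_eq_smul hX h4
  rw [norm_mul, Complex.norm_I, mul_one, Complex.norm_real, Real.norm_eq_abs, sq_abs] at h5
  nlinarith [h5]

variable (hgen : ∀ v ∈ lieAlg G, v ∈ genSet G)
include hgen

/-- The Lie algebra is closed under brackets. -/
theorem bracket_mem_lieAlg {a b : Mat n} (ha : a ∈ lieAlg G) (hb : b ∈ lieAlg G) :
    a * b - b * a ∈ lieAlg G := by
  have hmem : ∀ s : ℝ, NormedSpace.exp (s • a) * b * NormedSpace.exp (s • (-a)) ∈ lieAlg G := by
    intro s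
    obtain ⟨g, hg, hge⟩ := hgen a ha s
    have h1 : NormedSpace.exp (s • (-a)) = ((g⁻¹ : UGroup n) : Mat n) := by
      have h2 := exp_neg_mul_exp (s • a)
      rw [← hge] at h2
      have h3 := congrArg (fun c => c * ((g⁻¹ : UGroup n) : Mat n)) h2
      simp only [mul_assoc, coe_mul_inv, mul_one, one_mul] at h3
      rw [smul_neg]; exact h3
    rw [h1, ← hge]
    exact conj_mem_lieAlg hg hb
  have hd : HasDerivAt (fun s : ℝ => NormedSpace.exp (s • a) * b * NormedSpace.exp (s • (-a)))
      (a * b - b * a) 0 := by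
    have h1 := hasDerivAt_matrix_mul (hasDerivAt_matrix_mul (hasDerivAt_exp_smul a 0)
      (hasDerivAt_const (0 : ℝ) b)) (hasDerivAt_exp_smul (-a) 0)
    refine h1.congr_deriv ?_
    simp [sub_eq_add_neg]
  have hlim := hasDerivAt_iff_tendsto_slope.1 hd
  refine (Submodule.closed_of_finiteDimensional (lieAlg G)).mem_of_tendsto hlim
    (Filter.Eventually.of_forall fun s => ?_)
  rw [slope_def_module]
  exact (lieAlg G).smul_mem _ ((lieAlg G).sub_mem (hmem s) (hmem 0))

/-- Existence of co-roots: every nonzero element of `𝔱` pairs non-trivially with a co-root. A root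
vector is found as a common eigenvector of `ad 𝔱` in the range of `ad ξ₀` on `𝔤 ⊗ ℂ`. -/
theorem exists_isCoroot_trace_ne_zero (hG : IsClosed (G : Set (UGroup n)))
    (hTG : IsMaximalTorus T G) (hsimple : IsSimpleLie (lieAlg G)) {ξ₀ : Mat n}
    (hξ₀ : ξ₀ ∈ lieAlg T) (hne : ξ₀ ≠ 0) : ∃ η, IsCoroot G T η ∧ Matrix.trace (ξ₀ * η) ≠ 0 := by
  have hTle : lieAlg T ≤ lieAlg G := Submodule.span_mono fun _ hx s =>
    (hx s).imp fun _ h => ⟨hTG.prop.2 h.1, h.2⟩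
  have hTcomm := hTG.prop.1.2.2
  have hskew : ∀ ξ ∈ lieAlg T, ξ.conjTranspose = -ξ := fun ξ hξ => conjTranspose_of_mem_lieAlg hξ
  let gC : Submodule ℂ (Mat n) :=
    { carrier := {X | ∃ A ∈ lieAlg G, ∃ B ∈ lieAlg G, X = A + Complex.I • B}
      zero_mem' := ⟨0, zero_mem _, 0, zero_mem _, by simp⟩
      add_mem' := by
        rintro _ _ ⟨A, hA, B, hB, rfl⟩ ⟨A', hA', B', hB', rfl⟩
        exact ⟨A + A', add_mem hA hA', B + B', add_mem hB hB', by rw [smul_add]; abel⟩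
      smul_mem' := by
        rintro z _ ⟨A, hA, B, hB, rfl⟩
        refine ⟨z.re • A - z.im • B, sub_mem ((lieAlg G).smul_mem _ hA)
          ((lieAlg G).smul_mem _ hB), z.im • A + z.re • B,
          add_mem ((lieAlg G).smul_mem _ hA) ((lieAlg G).smul_mem _ hB), ?_⟩
        ext i j
        simp only [Matrix.smul_apply, Matrix.add_apply, Matrix.sub_apply, smul_eq_mul,
          Complex.real_smul]
        conv_lhs => rw [← Complex.re_add_im z]
        linear_combination (z.im : ℂ) * B i j * Complex.I_mul_I }
  let ad : Mat n → Module.End ℂ (Mat n) := fun ξ =>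
    LinearMap.mulLeft ℂ ξ - LinearMap.mulRight ℂ ξ
  have had : ∀ ξ X, ad ξ X = ξ * X - X * ξ := fun ξ X => rfl
  have hinvC : ∀ ξ ∈ lieAlg G, ∀ X ∈ gC, ad ξ X ∈ gC := by
    rintro ξ hξ _ ⟨A, hA, B, hB, rfl⟩
    refine ⟨_, bracket_mem_lieAlg hgen hξ hA, _, bracket_mem_lieAlg hgen hξ hB, ?_⟩
    rw [had, mul_add, add_mul, Matrix.mul_smul, Matrix.smul_mul, smul_sub]; abel
  have hadcomm : ∀ ξ ∈ lieAlg T, ∀ ζ ∈ lieAlg T, Commute (ad ξ) (ad ζ) := by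
    intro ξ hξ ζ hζ
    refine LinearMap.ext fun X => ?_
    simp only [Module.End.mul_apply, had]
    have h1 := commute_lieAlg hTcomm hξ hζ
    have h2 : ξ * ζ * X = ζ * ξ * X := by rw [h1]
    have h3 : X * (ξ * ζ) = X * (ζ * ξ) := by rw [h1]
    simp only [mul_assoc, mul_sub, sub_mul] at h2 h3 ⊢
    rw [h2, h3]; abel
  let W : Submodule ℂ (Mat n) := gC.map (ad ξ₀)
  have hW : W ≠ ⊥ := by
    intro hbot
    -- otherwise `ξ₀` is central, and spans an ideal
    have hcentral : ∀ a ∈ lieAlg G, ξ₀ * a - a * ξ₀ = 0 := by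
      intro a ha
      have : ad ξ₀ a ∈ W := Submodule.mem_map_of_mem ⟨a, ha, 0, zero_mem _, by simp⟩
      rw [hbot] at this
      exact (Submodule.mem_bot ℂ).1 this
    obtain ⟨⟨a, ha, b, hb, hab⟩, hideal⟩ := hsimple
    have hJ := hideal (Submodule.span ℝ {ξ₀})
      (Submodule.span_le.2 (Set.singleton_subset_iff.2 (hTle hξ₀))) (by
        intro a ha b hb
        obtain ⟨c, rfl⟩ := Submodule.mem_span_singleton.1 hb
        have : a * c • ξ₀ - c • ξ₀ * a = 0 := by
          rw [mul_smul_comm, smul_mul_assoc, ← smul_sub, ← neg_sub, hcentral a ha]; simp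
        rw [this]; exact zero_mem _)
    rcases hJ with hJ | hJ
    · exact hne (by simpa using hJ)
    · rw [← hJ] at ha hb
      obtain ⟨c, rfl⟩ := Submodule.mem_span_singleton.1 ha
      obtain ⟨d, rfl⟩ := Submodule.mem_span_singleton.1 hb
      exact hab (by simp [mul_comm, smul_comm c d, smul_smul])
  have hWinv : ∀ ξ : lieAlg T, ∀ w ∈ W, ad ξ w ∈ W := by
    rintro ⟨ξ, hξ⟩ _ ⟨Y, hY, rfl⟩
    refine ⟨ad ξ Y, hinvC ξ (hTle hξ) Y hY, ?_⟩
    exact LinearMap.congr_fun (hadcomm ξ₀ hξ₀ ξ hξ) Y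
  obtain ⟨X, ⟨Y, hY, hXY⟩, hX0, χ, hχ⟩ := exists_common_eigenvector
    (fun ξ : lieAlg T => ad ξ) (fun ξ ζ => hadcomm ξ ξ.2 ζ ζ.2) W hW hWinv
  have hXC : X ∈ gC := by rw [← hXY]; exact hinvC ξ₀ (hTle hξ₀) Y hY
  set N := sqNorm X with hN
  have hNpos : 0 < N := sqNorm_pos hX0
  -- the trace form is invariant
  have htr : ∀ ξ Z : Mat n, Matrix.trace ((ξ * X - X * ξ) * Z) = Matrix.trace (ξ * (X * Z - Z * X)) := by
    intro ξ Z
    rw [sub_mul, mul_sub, Matrix.trace_sub, Matrix.trace_sub, mul_assoc, mul_assoc,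
      Matrix.trace_mul_comm X, mul_assoc]
  set H := X * X.conjTranspose - X.conjTranspose * X with hH
  have hχtr : ∀ ξ : lieAlg T, Matrix.trace ((ξ : Mat n) * H) = χ ξ * N := by
    intro ξ
    rw [hH, ← htr, ← had, hχ, Matrix.smul_mul, Matrix.trace_smul, trace_mul_conjTranspose,
      smul_eq_mul]
  have hHherm : H.conjTranspose = H := by
    simp [hH, Matrix.conjTranspose_sub, Matrix.conjTranspose_mul]
  have hχim : ∀ ξ : lieAlg T, (χ ξ).re = 0 := by
    intro ξ
    have h1 : star (Matrix.trace ((ξ : Mat n) * H)) = -Matrix.trace ((ξ : Mat n) * H) := by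
      rw [← Matrix.trace_conjTranspose, Matrix.conjTranspose_mul, hHherm, hskew ξ ξ.2, mul_neg,
        Matrix.trace_neg, Matrix.trace_mul_comm]
    rw [hχtr] at h1
    have h2 := congrArg Complex.re h1
    simp only [Complex.star_def, map_mul, Complex.conj_ofReal, Complex.neg_re, Complex.mul_re,
      Complex.conj_re, Complex.ofReal_re, Complex.ofReal_im, mul_zero, sub_zero] at h2
    have h3 : (χ ξ).re * N = 0 := by linarith
    exact (mul_eq_zero.1 h3).resolve_right hNpos.ne'
  have hχeq : ∀ ξ : lieAlg T, χ ξ = ((χ ξ).im : ℂ) * Complex.I := fun ξ => by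
    conv_lhs => rw [← Complex.re_add_im (χ ξ), hχim ξ]
    simp
  -- `X` is in the range of the skew operator `ad ξ₀`, hence not in its kernel
  have hχ0 : χ ⟨ξ₀, hξ₀⟩ ≠ 0 := by
    intro h0
    have h1 : ξ₀ * X - X * ξ₀ = 0 := by
      have := hχ ⟨ξ₀, hξ₀⟩
      rwa [h0, zero_smul] at this
    have h2 : X.conjTranspose = ξ₀ * Y.conjTranspose - Y.conjTranspose * ξ₀ := by
      rw [← hXY, had, Matrix.conjTranspose_sub, Matrix.conjTranspose_mul,
        Matrix.conjTranspose_mul, hskew ξ₀ hξ₀]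
      simp only [mul_neg, neg_mul]; abel
    have h3 : Matrix.trace (X * X.conjTranspose) =
        -Matrix.trace ((ξ₀ * X - X * ξ₀) * Y.conjTranspose) := by
      rw [h2, mul_sub, sub_mul, Matrix.trace_sub, Matrix.trace_sub, ← mul_assoc, ← mul_assoc,
        Matrix.trace_mul_comm _ ξ₀, ← mul_assoc]
      ring
    rw [h1, zero_mul, Matrix.trace_zero, neg_zero, trace_mul_conjTranspose] at h3
    exact hNpos.ne' (by exact_mod_cast h3)
  -- the bracket of `X` with its adjoint belongs to `i 𝔱`
  set C := Complex.I • H with hC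
  have hCG : C ∈ lieAlg G := by
    obtain ⟨A, hA, B, hB, hAB⟩ := hXC
    have h1 : C = (-2 : ℝ) • (A * B - B * A) := by
      rw [hC, hH, hAB, Matrix.conjTranspose_add, Matrix.conjTranspose_smul,
        conjTranspose_of_mem_lieAlg hA, conjTranspose_of_mem_lieAlg hB]
      have hstar : (star Complex.I • -B) = Complex.I • B := by simp
      rw [hstar]
      simp only [mul_add, add_mul, mul_neg, neg_mul, Matrix.mul_smul, Matrix.smul_mul, smul_sub,
        smul_add, smul_neg, smul_smul, Complex.I_mul_I]
      rw [show ((-2 : ℝ) • (A * B)) = (-2 : ℂ) • (A * B) by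
          ext; simp, show ((-2 : ℝ) • (B * A)) = (-2 : ℂ) • (B * A) by ext; simp]
      module
    rw [h1]
    exact (lieAlg G).smul_mem _ (bracket_mem_lieAlg hgen hA hB)
  have hadX' : ∀ ξ : lieAlg T, (ξ : Mat n) * X.conjTranspose - X.conjTranspose * (ξ : Mat n) =
      -(χ ξ • X.conjTranspose) := by
    intro ξ
    have h1 := congrArg Matrix.conjTranspose (hχ ξ)
    rw [had, Matrix.conjTranspose_sub, Matrix.conjTranspose_mul, Matrix.conjTranspose_mul,
      hskew ξ ξ.2, Matrix.conjTranspose_smul] at h1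
    have h2 : star (χ ξ) = -χ ξ := by rw [hχeq ξ]; simp
    rw [h2, neg_smul] at h1
    rw [← h1]; simp only [mul_neg, neg_mul]; abel
  have hCcomm : ∀ ξ ∈ lieAlg T, ξ * C = C * ξ := by
    intro ξ hξ
    have h1 := hχ ⟨ξ, hξ⟩
    have h2 := hadX' ⟨ξ, hξ⟩
    rw [had] at h1
    have h3 : ξ * H - H * ξ = 0 := by
      have e1 : ξ * H - H * ξ = (ξ * X - X * ξ) * X.conjTranspose +
          X * (ξ * X.conjTranspose - X.conjTranspose * ξ) -
          ((ξ * X.conjTranspose - X.conjTranspose * ξ) * X + X.conjTranspose * (ξ * X - X * ξ)) := by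
        rw [hH]; noncomm_ring
      rw [e1, h1, h2]
      simp only [Matrix.smul_mul, Matrix.mul_smul, mul_neg, neg_mul]; abel
    rw [hC, Matrix.mul_smul, Matrix.smul_mul, sub_eq_zero.1 h3]
  have hCT : C ∈ lieAlg T := mem_lieAlg_of_commute hTG hG (hgen C hCG) hCcomm
  have hH0 : H ≠ 0 := by
    intro h0
    have := hχtr ⟨ξ₀, hξ₀⟩
    rw [h0, mul_zero, Matrix.trace_zero] at this
    rcases mul_eq_zero.1 this.symm with h | h
    · exact hχ0 h
    · exact hNpos.ne' (by exact_mod_cast h)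
  have hχC : χ ⟨C, hCT⟩ = ((sqNorm H / N : ℝ) : ℂ) * Complex.I := by
    have h1 := hχtr ⟨C, hCT⟩
    have h2 : Matrix.trace (C * H) = (sqNorm H : ℂ) * Complex.I := by
      conv_lhs => rw [hC, ← hHherm, Matrix.smul_mul, Matrix.trace_smul]
      rw [hHherm]
      nth_rewrite 2 [← hHherm]
      rw [trace_mul_conjTranspose, smul_eq_mul, mul_comm]
    simp only [] at h1
    rw [h2] at h1
    have hN' : (N : ℂ) ≠ 0 := by exact_mod_cast hNpos.ne'
    push_cast
    field_simp
    rw [← h1]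
  set s : ℝ := 4 * Real.pi * N / sqNorm H with hs
  have hHpos := sqNorm_pos hH0
  have hspos : 0 < s := by have := Real.pi_pos; positivity
  refine ⟨s • C, ⟨(lieAlg T).smul_mem _ hCT, X, hX0, hXC, ?_, ⟨s, ?_⟩, ?_⟩, ?_⟩
  · intro ξ hξ
    refine ⟨(χ ⟨ξ, hξ⟩).im / (2 * Real.pi), ?_⟩
    rw [← had]
    refine (hχ ⟨ξ, hξ⟩).trans ?_
    congr 1
    conv_lhs => rw [hχeq]
    congr 2
    field_simp
  · rw [hC, mul_smul, Complex.coe_smul]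
  · have h1 := hχ ⟨C, hCT⟩
    rw [had, hχC] at h1
    simp only [] at h1
    rw [smul_mul_assoc, mul_smul_comm, ← smul_sub, h1, ← Complex.coe_smul, smul_smul]
    congr 1
    rw [hs]
    have h2 : (sqNorm H : ℂ) ≠ 0 := by exact_mod_cast hHpos.ne'
    have hN' : (N : ℂ) ≠ 0 := by exact_mod_cast hNpos.ne'
    push_cast
    field_simp
  · have h1 := hχtr ⟨ξ₀, hξ₀⟩
    simp only [] at h1
    rw [mul_smul_comm, hC, Matrix.mul_smul, ← Complex.coe_smul, Matrix.trace_smul,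
      Matrix.trace_smul, h1]
    have hN' : (N : ℂ) ≠ 0 := by exact_mod_cast hNpos.ne'
    have hs' : (s : ℂ) ≠ 0 := by exact_mod_cast hspos.ne'
    simp [hχ0, hN', hs']

end Factor

/-- A co-root is `2 π i [E, E^*]` for a root vector `E` with `[[E, E^*], E] = 2 E`. -/
theorem IsCoroot.exists_triple {n : ℕ} {G T : Subgroup (UGroup n)} {η : Mat n}
    (h : IsCoroot G T η) : ∃ E : Mat n,
      (∃ A ∈ lieAlg G, ∃ B ∈ lieAlg G, E = A + Complex.I • B) ∧
      (∀ ξ ∈ lieAlg T, ∃ α : ℝ, ξ * E - E * ξ = ((2 * Real.pi * α : ℝ) * Complex.I) • E) ∧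
      η = ((2 * Real.pi : ℝ) * Complex.I) • (E * E.conjTranspose - E.conjTranspose * E) ∧
      (E * E.conjTranspose - E.conjTranspose * E) * E -
        E * (E * E.conjTranspose - E.conjTranspose * E) = (2 : ℂ) • E := by
  obtain ⟨-, X, hX, ⟨A, hA, B, hB, hAB⟩, hroot, ⟨r, hr⟩, h4⟩ := h
  set H := X * X.conjTranspose - X.conjTranspose * X with hH
  have hpi := Real.pi_pos
  have hHherm : H.conjTranspose = H := by
    simp [hH, Matrix.conjTranspose_sub, Matrix.conjTranspose_mul]
  have hN := sqNorm_pos hX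
  have h5 : (4 * Real.pi * sqNorm X) = r * sqNorm H := by
    have h1 : Matrix.trace ((η * X - X * η) * X.conjTranspose) = Matrix.trace (η * H) := by
      rw [hH, sub_mul, mul_sub, Matrix.trace_sub, Matrix.trace_sub, mul_assoc, mul_assoc,
        Matrix.trace_mul_comm X, mul_assoc]
    have h2 : Matrix.trace (H * H) = (sqNorm H : ℂ) := by
      rw [← trace_mul_conjTranspose, hHherm]
    rw [h4, hr, Matrix.smul_mul, Matrix.smul_mul, Matrix.trace_smul, Matrix.trace_smul,
      trace_mul_conjTranspose, h2, smul_eq_mul, smul_eq_mul] at h1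
    have h3 := congrArg Complex.im h1
    simpa using h3
  have hr0 : 0 < r := by
    by_contra hcon
    have : r * sqNorm H ≤ 0 := mul_nonpos_of_nonpos_of_nonneg (not_lt.1 hcon) (sqNorm_nonneg H)
    have : 0 < 4 * Real.pi * sqNorm X := by positivity
    linarith
  set s := Real.sqrt (r / (2 * Real.pi)) with hs
  have hss : (s : ℂ) * s = r / (2 * Real.pi) := by
    have : s * s = r / (2 * Real.pi) := Real.mul_self_sqrt (by positivity)
    exact_mod_cast this
  have hpi' : (Real.pi : ℂ) ≠ 0 := by exact_mod_cast hpi.ne'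
  have hE : ((s : ℂ) • X) * ((s : ℂ) • X).conjTranspose -
      ((s : ℂ) • X).conjTranspose * ((s : ℂ) • X) = ((r : ℂ) / (2 * Real.pi)) • H := by
    rw [Matrix.conjTranspose_smul, hH, ← hss]
    simp only [Matrix.smul_mul, Matrix.mul_smul, smul_smul, Complex.star_def, Complex.conj_ofReal,
      smul_sub]
  refine ⟨(s : ℂ) • X, ⟨s • A, (lieAlg G).smul_mem _ hA, s • B, (lieAlg G).smul_mem _ hB, ?_⟩,
    fun ξ hξ => ?_, ?_, ?_⟩
  · rw [hAB, smul_add, Complex.coe_smul, Complex.coe_smul, smul_comm Complex.I]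
  · obtain ⟨α, hα⟩ := hroot ξ hξ
    refine ⟨α, ?_⟩
    rw [Matrix.mul_smul, Matrix.smul_mul, ← smul_sub, hα, smul_comm]
  · rw [hE, hr, smul_smul]
    congr 1
    push_cast
    field_simp
  · rw [hE]
    have h6 : H * X - X * H = ((4 * Real.pi : ℝ) / r : ℂ) • X := by
      rw [hr] at h4
      simp only [Matrix.smul_mul, Matrix.mul_smul, ← smul_sub] at h4
      have hrI : ((r : ℂ) * Complex.I) ≠ 0 := by
        have : (r : ℂ) ≠ 0 := by exact_mod_cast hr0.ne'
        simp [this]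
      rw [← eq_inv_smul_iff₀ hrI] at h4
      rw [h4, smul_smul]
      congr 1
      have : (r : ℂ) ≠ 0 := by exact_mod_cast hr0.ne'
      field_simp
    have hr' : (r : ℂ) ≠ 0 := by exact_mod_cast hr0.ne'
    simp only [Matrix.smul_mul, Matrix.mul_smul, smul_smul]
    rw [mul_comm (s : ℂ), ← smul_sub, h6, smul_smul]
    congr 1
    push_cast
    field_simp
    ring

namespace CompactGroup

variable {m : ℕ} (K : CompactGroup m)

theorem skew_of_mem_g {v : K.A} (hv : v ∈ K.g) (i : Fin m) : (v i).conjTranspose = -v i :=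
  conjTranspose_of_mem_lieAlg (K.mem_g.1 hv i)

theorem ip_add_right (a v w : K.A) : K.ip a (v + w) = K.ip a v + K.ip a w := by
  simp only [ip, Pi.add_apply, mul_add, Matrix.trace_add, neg_add, Finset.sum_add_distrib]

theorem ip_smul_right (c : ℂ) (a v : K.A) : K.ip a (c • v) = c * K.ip a v := by
  simp only [ip, Pi.smul_apply, Matrix.mul_smul, Matrix.trace_smul, Finset.mul_sum, smul_eq_mul]
  exact Finset.sum_congr rfl fun i _ => by ring

theorem ip_real_smul_right (c : ℝ) (a v : K.A) : K.ip a (c • v) = c * K.ip a v :=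
  K.ip_smul_right (c : ℂ) a v

theorem ip_comm (a v : K.A) : K.ip a v = K.ip v a := by
  simp only [ip]
  exact Finset.sum_congr rfl fun i _ => by rw [Matrix.trace_mul_comm]

theorem ip_zero_right (a : K.A) : K.ip a 0 = 0 := by simp [ip]

theorem ip_im {v w : K.A} (hv : v ∈ K.g) (hw : w ∈ K.g) : (K.ip v w).im = 0 := by
  simp only [ip, Complex.im_sum, Complex.neg_im, Complex.re_ofReal_mul, Complex.im_ofReal_mul]
  refine Finset.sum_eq_zero fun i _ => ?_
  rw [trace_mul_of_skew_im (K.skew_of_mem_g hv i) (K.skew_of_mem_g hw i), mul_zero, neg_zero]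

theorem ip_self_re {v : K.A} (hv : v ∈ K.g) :
    (K.ip v v).re = ∑ i, K.basicScale i * sqNorm (v i) := by
  simp only [ip, Complex.re_sum, Complex.neg_re, Complex.re_ofReal_mul]
  refine Finset.sum_congr rfl fun i _ => ?_
  rw [trace_mul_self_of_skew (K.skew_of_mem_g hv i)]
  simp

theorem ip_single_left (i : Fin m) (a : Mat (K.size i)) (w : K.A) :
    K.ip (Pi.single i a) w = -(K.basicScale i * Matrix.trace (a * w i)) := by
  rw [ip, Finset.sum_eq_single i]
  · simp
  · intro j _ hj
    simp [Pi.single_eq_of_ne hj]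
  · simp

theorem single_mem_t {i : Fin m} {η : Mat (K.size i)} (h : η ∈ lieAlg (K.T i)) :
    (Pi.single i η : K.A) ∈ K.t := K.mem_t.2 fun j => by
  rcases eq_or_ne j i with rfl | hj
  · simpa using h
  · simp [hj]

theorem single_mem_g {i : Fin m} {η : Mat (K.size i)} (h : η ∈ lieAlg (K.G i)) :
    (Pi.single i η : K.A) ∈ K.g := K.mem_g.2 fun j => by
  rcases eq_or_ne j i with rfl | hj
  · simpa using h
  · simp [hj]

/-- The basic inner product on `𝔱`, as a bilinear form. -/
def ipT : K.t →ₗ[ℝ] K.t →ₗ[ℝ] ℝ := LinearMap.mk₂ ℝ (fun ξ ζ => (K.ip ξ ζ).re)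
  (fun a b c => by
    rw [K.ip_comm, Submodule.coe_add, ip_add_right, Complex.add_re, K.ip_comm, K.ip_comm c])
  (fun r a b => by
    rw [K.ip_comm, Submodule.coe_smul, ip_real_smul_right, Complex.re_ofReal_mul, K.ip_comm]; rfl)
  (fun a b c => by rw [Submodule.coe_add, ip_add_right, Complex.add_re])
  (fun r a b => by rw [Submodule.coe_smul, ip_real_smul_right, Complex.re_ofReal_mul]; rfl)

/-- The co-roots of `G`, each of them belonging to one of the factors. -/
def coroots : Set K.t :=
  {η | ∃ i, ∃ η', IsCoroot (K.G i) (K.T i) η' ∧ (η : K.A) = Pi.single i η'}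

/-- The co-root lattice. -/
def corootLattice : AddSubgroup K.t := AddSubgroup.closure K.coroots

variable {ς : ℝ} {K} {ℓ : Fin m → ℤ} {Ghat : Type*} [Group Ghat] [TopologicalSpace Ghat]
  [ChartedSpace (K.Lg × ℝ) Ghat] (P : K.LevelExtension ς ℓ Ghat)
include P

theorem exists_isCoroot (i : Fin m) : ∃ η, IsCoroot (K.G i) (K.T i) η := by
  have hgen : ∀ v ∈ lieAlg (K.G i), v ∈ genSet (K.G i) := fun v => mem_genSet_of_mem_lieAlg P
  have hne : ∃ ξ₀ ∈ lieAlg (K.T i), ξ₀ ≠ 0 := by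
    by_contra! hcon
    obtain ⟨⟨a, ha, b, hb, hab⟩, -⟩ := K.simple i
    have h0 : ∀ v ∈ lieAlg (K.G i), v = 0 := fun v hv =>
      hcon v (mem_lieAlg_of_commute (K.maximalTorus i) (K.isClosed i) (hgen v hv)
        fun ξ hξ => by rw [hcon ξ hξ]; simp)
    exact hab (by rw [h0 a ha, h0 b hb])
  obtain ⟨ξ₀, hξ₀, hne⟩ := hne
  obtain ⟨η, hη, -⟩ := exists_isCoroot_trace_ne_zero hgen (K.isClosed i) (K.maximalTorus i)
    (K.simple i) hξ₀ hne
  exact ⟨η, hη⟩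

theorem basicScale_pos (i : Fin m) : 0 < K.basicScale i := by
  have hpi := Real.pi_pos
  have h1 : (4 * Real.pi ^ 2) ≤
      sInf {q : ℝ | ∃ η, IsCoroot (K.G i) (K.T i) η ∧ q = -(Matrix.trace (η * η)).re} := by
    obtain ⟨η, hη⟩ := exists_isCoroot P i
    refine le_csInf ⟨_, η, hη, rfl⟩ ?_
    rintro _ ⟨η, hη, rfl⟩
    rw [trace_mul_self_of_skew (conjTranspose_of_mem_lieAlg hη.1)]
    simpa using le_sqNorm_of_isCoroot hη
  exact div_pos two_pos (lt_of_lt_of_le (by positivity) h1)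

/-- The basic inner product is positive definite. -/
theorem exists_le_ip_self : ∃ c > 0, ∀ v ∈ K.g, c * ‖v‖ ^ 2 ≤ (K.ip v v).re := by
  have hex : ∃ c > 0, ∀ i, c ≤ K.basicScale i := by
    rcases isEmpty_or_nonempty (Fin m) with h | h
    · exact ⟨1, one_pos, fun i => isEmptyElim i⟩
    · obtain ⟨i, hi⟩ := Finite.exists_min K.basicScale
      exact ⟨_, basicScale_pos P i, hi⟩
  obtain ⟨c, hc, hci⟩ := hex
  refine ⟨c, hc, fun v hv => ?_⟩
  rw [K.ip_self_re hv]
  have hterm : ∀ i, c * ‖v i‖ ^ 2 ≤ K.basicScale i * sqNorm (v i) := fun i =>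
    mul_le_mul (hci i) (sq_norm_le_sqNorm _) (sq_nonneg _) (hc.le.trans (hci i))
  have hnn : ∀ i, 0 ≤ K.basicScale i * sqNorm (v i) := fun i =>
    le_trans (by positivity) (hterm i)
  have hsum : 0 ≤ ∑ i, K.basicScale i * sqNorm (v i) := Finset.sum_nonneg fun i _ => hnn i
  have hle : ‖v‖ ≤ Real.sqrt ((∑ i, K.basicScale i * sqNorm (v i)) / c) := by
    refine (pi_norm_le_iff_of_nonneg (Real.sqrt_nonneg _)).2 fun i => Real.le_sqrt_of_sq_le ?_
    rw [le_div_iff₀ hc, mul_comm]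
    exact (hterm i).trans (Finset.single_le_sum (f := fun i => K.basicScale i * sqNorm (v i))
      (fun i _ => hnn i) (Finset.mem_univ i))
  have h2 := pow_le_pow_left₀ (norm_nonneg _) hle 2
  rw [Real.sq_sqrt (by positivity), le_div_iff₀ hc] at h2
  linarith

theorem eq_zero_of_ipT_self (ξ : K.t) (h : K.ipT ξ ξ = 0) : ξ = 0 := by
  obtain ⟨c, hc, hpos⟩ := exists_le_ip_self P
  have h1 : (K.ip ξ ξ).re = 0 := h
  have h2 := hpos ξ (K.t_le_g ξ.2)
  rw [h1] at h2
  have h3 : ‖(ξ : K.A)‖ ^ 2 ≤ 0 := by nlinarith [sq_nonneg ‖(ξ : K.A)‖]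
  exact Subtype.ext (norm_eq_zero.1 (pow_eq_zero_iff two_ne_zero |>.1
    (le_antisymm h3 (sq_nonneg _))))

theorem exists_eq_ip (f : K.t →ₗ[ℝ] ℝ) : ∃ ξ : K.t, ∀ ζ : K.t, f ζ = (K.ip ξ ζ).re := by
  have hinj : Function.Injective K.ipT := (injective_iff_map_eq_zero K.ipT).2 fun ξ hξ =>
    eq_zero_of_ipT_self P ξ (by rw [hξ, LinearMap.zero_apply])
  have hsurj : Function.Surjective K.ipT :=
    (LinearMap.injective_iff_surjective_of_finrank_eq_finrank
      (Subspace.dual_finrank_eq (K := ℝ) (V := K.t)).symm).1 hinj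
  obtain ⟨ξ, hξ⟩ := hsurj f
  exact ⟨ξ, fun ζ => by rw [← hξ]; rfl⟩

theorem eq_of_forall_ip_eq {ξ ζ : K.t} (h : ∀ τ : K.t, K.ip ξ τ = K.ip ζ τ) : ξ = ζ := by
  obtain ⟨c, hc, hpos⟩ := exists_le_ip_self P
  have h1 : K.ip ((ξ - ζ : K.t) : K.A) ((ξ - ζ : K.t) : K.A) = 0 := by
    have e : ((ξ - ζ : K.t) : K.A) = (ξ : K.A) + (-1 : ℝ) • (ζ : K.A) := by
      rw [Submodule.coe_sub]; module
    conv_lhs => rw [K.ip_comm]; arg 3; rw [e]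
    rw [ip_add_right, ip_real_smul_right, K.ip_comm, h, K.ip_comm _ (ζ : K.A)]
    push_cast; ring
  have h2 := hpos _ (K.t_le_g (ξ - ζ).2)
  rw [h1, Complex.zero_re] at h2
  have h3 : ‖((ξ - ζ : K.t) : K.A)‖ ^ 2 ≤ 0 := by nlinarith [sq_nonneg ‖((ξ - ζ : K.t) : K.A)‖]
  have h4 : ((ξ - ζ : K.t) : K.A) = 0 :=
    norm_eq_zero.1 (pow_eq_zero_iff two_ne_zero |>.1 (le_antisymm h3 (sq_nonneg _)))
  exact sub_eq_zero.1 (Subtype.ext h4)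

/-- The co-roots span `𝔱`. -/
theorem span_coroots : Submodule.span ℝ K.coroots = ⊤ := by
  by_contra hne
  obtain ⟨f, hf0, hf⟩ := Submodule.exists_le_ker_of_lt_top _ (lt_top_iff_ne_top.2 hne)
  obtain ⟨ξ, hξ⟩ := exists_eq_ip P f
  have hξ0 : ξ ≠ 0 := by
    rintro rfl
    refine hf0 (LinearMap.ext fun ζ => ?_)
    rw [hξ, K.ip_comm, Submodule.coe_zero, K.ip_zero_right]; rfl
  have hi : ∃ i, (ξ : K.A) i ≠ 0 := by
    by_contra! hcon
    exact hξ0 (Subtype.ext (funext hcon))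
  obtain ⟨i, hi⟩ := hi
  obtain ⟨η, hη, hne⟩ := exists_isCoroot_trace_ne_zero (fun v => mem_genSet_of_mem_lieAlg P)
    (K.isClosed i) (K.maximalTorus i) (K.simple i) (K.mem_t.1 ξ.2 i) hi
  have h1 : f ⟨_, K.single_mem_t hη.1⟩ = 0 := hf (Submodule.subset_span ⟨i, η, hη, rfl⟩)
  rw [hξ, K.ip_comm, ip_single_left, Complex.neg_re, Complex.re_ofReal_mul, neg_eq_zero,
    mul_eq_zero, or_iff_right (basicScale_pos P i).ne', Matrix.trace_mul_comm] at h1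
  refine hne (Complex.ext h1 ?_)
  exact trace_mul_of_skew_im (conjTranspose_of_mem_lieAlg (K.mem_t.1 ξ.2 i))
    (conjTranspose_of_mem_lieAlg hη.1)

end CompactGroup

/-! ### The adjoint action of the central extension -/

theorem eq_zero_of_forall_circle_exp {x : ℝ} (h : ∀ t : ℝ, Circle.exp (2 * Real.pi * (t * x)) = 1) :
    x = 0 := by
  by_contra hx
  have h1 := h (2 * x)⁻¹
  rw [show 2 * Real.pi * ((2 * x)⁻¹ * x) = Real.pi by field_simp] at h1
  have h2 := congrArg (fun z : Circle => (z : ℂ)) h1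
  simp at h2
  norm_num at h2

namespace CompactGroup

section Adjoint

variable {m : ℕ} {K : CompactGroup m} {ς : ℝ} {ℓ : Fin m → ℤ} {Ghat : Type*} [Group Ghat]
  [TopologicalSpace Ghat] [ChartedSpace (K.Lg × ℝ) Ghat] (P : K.LevelExtension ς ℓ Ghat)

theorem IsAd.smul {g : K.LG ς} {ξ ξ' : K.Lg} (h : K.IsAd ς g ξ ξ') (t : ℝ) :
    K.IsAd ς g (t • ξ) (t • ξ') := fun x => by
  rw [eval_smul, eval_smul, smul_mul_assoc, h x, mul_smul_comm]

theorem IsAd.mul {g h : K.LG ς} {ξ ξ' ξ'' : K.Lg} (hh : K.IsAd ς h ξ ξ')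
    (hg : K.IsAd ς g ξ' ξ'') : K.IsAd ς (g * h) ξ ξ'' := fun x => by
  rw [loopMat_mul, ← mul_assoc, hg x, mul_assoc, hh x, mul_assoc]

theorem IsAd.of_mul {g h : K.LG ς} {ξ ξ' ξ'' : K.Lg} (hh : K.IsAd ς h ξ ξ')
    (hgh : K.IsAd ς (g * h) ξ ξ'') : K.IsAd ς g ξ' ξ'' := fun x => by
  have h1 := congrArg (fun a => a * K.loopMat (h⁻¹).1 x) (hgh x)
  have h2 := hh x
  simp only [loopMat_mul, mul_assoc, loopMat_mul_inv, mul_one] at h1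
  rwa [← mul_assoc (K.loopMat h.1 x), ← h2, mul_assoc, loopMat_mul_inv, mul_one] at h1

theorem IsAd.one (ξ : K.Lg) : K.IsAd ς 1 ξ ξ := fun x => by
  rw [loopMat_one, mul_one, one_mul]

include P

/-- The cocycle property of the adjoint action. It holds modulo `ℤ` by comparing conjugations, and
exactly because both sides are linear. -/
theorem adj_mul {a b : Ghat} {ξ ξ' ξ'' : K.Lg} (hb : K.IsAd ς (P.proj b) ξ ξ')
    (ha : K.IsAd ς (P.proj a) ξ' ξ'') : P.adj (a * b) ξ = P.adj a ξ' + P.adj b ξ := by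
  rw [← sub_eq_zero]
  refine eq_zero_of_forall_circle_exp fun t => ?_
  have h1 := P.conj_exp (a * b) (t • ξ) (t • ξ'') (by rw [map_mul]; exact (hb.mul ha).smul t)
  have h2 := P.conj_exp b (t • ξ) (t • ξ') (hb.smul t)
  have h3 := P.conj_exp a (t • ξ') (t • ξ'') (ha.smul t)
  have h4 : a * b * P.exp (t • ξ) * (a * b)⁻¹ = P.exp (t • ξ'') *
      P.central (Circle.exp (2 * Real.pi * P.adj a (t • ξ'))) *
      P.central (Circle.exp (2 * Real.pi * P.adj b (t • ξ))) := by
    rw [← h3]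
    calc a * b * P.exp (t • ξ) * (a * b)⁻¹ = a * (b * P.exp (t • ξ) * b⁻¹) * a⁻¹ := by group
      _ = a * P.exp (t • ξ') * (P.central (Circle.exp (2 * Real.pi * P.adj b (t • ξ))) * a⁻¹) := by
        rw [h2]; group
      _ = _ := by rw [P.central_comm]; group
  rw [h1, mul_assoc (P.exp (t • ξ'')), mul_right_inj, ← map_mul, P.central_injective.eq_iff,
    ← Circle.exp_add] at h4
  simp only [map_smul, smul_eq_mul] at h4
  rw [show 2 * Real.pi * (t * (P.adj (a * b) ξ - (P.adj a ξ' + P.adj b ξ))) =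
    2 * Real.pi * (t * P.adj (a * b) ξ) -
      (2 * Real.pi * (t * P.adj a ξ') + 2 * Real.pi * (t * P.adj b ξ)) by ring,
    Circle.exp_sub, h4, div_self']

theorem adj_eq_zero_of_proj_eq_one {a : Ghat} (h : P.proj a = 1) (ξ : K.Lg) : P.adj a ξ = 0 := by
  obtain ⟨z, rfl⟩ : a ∈ P.central.range := by rw [← P.ker_proj]; exact h
  refine eq_zero_of_forall_circle_exp fun t => ?_
  have h1 := P.conj_exp (P.central z) (t • ξ) (t • ξ) (by rw [h]; exact IsAd.one _)
  rw [P.central_comm, mul_inv_cancel_right, eq_comm, mul_eq_left, ← map_one P.central,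
    P.central_injective.eq_iff] at h1
  simpa using h1

theorem adj_inv {a : Ghat} {ξ : K.Lg} (h : K.IsAd ς (P.proj a) ξ ξ) :
    P.adj a⁻¹ ξ = -P.adj a ξ := by
  have hinv : K.IsAd ς (P.proj a⁻¹) ξ ξ := fun x => by
    have h1 := h x
    have h2 := K.loopMat_mul_inv (P.proj a) x
    have h3 := K.loopMat_mul_inv (P.proj a)⁻¹ x
    rw [inv_inv] at h3
    rw [map_inv]
    calc _ = K.loopMat ((P.proj a)⁻¹).1 x * (K.loopMat (P.proj a).1 x * K.eval ς ξ x) *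
          K.loopMat ((P.proj a)⁻¹).1 x := by rw [← mul_assoc, h3, one_mul]
      _ = _ := by rw [← h1, mul_assoc, mul_assoc, h2, mul_one]
  have h1 := adj_mul P (a := a⁻¹) h hinv
  rw [inv_mul_cancel, adj_eq_zero_of_proj_eq_one P (map_one _)] at h1
  linarith

/-- The derivative of the adjoint action along a one-parameter group is the cocycle. -/
theorem hasDerivAt_adj_exp {ξ ζ : K.Lg} {rot : ℝ → K.Lg}
    (h : ∀ v : ℝ, K.IsAd ς (K.loopExp ς (v • ξ)) ζ (rot v)) (v : ℝ) :
    HasDerivAt (fun v : ℝ => P.adj (P.exp (v • ξ)) ζ) (K.cocycle ς ℓ ξ (rot v)) v := by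
  have h1 : ∀ u : ℝ, P.adj (P.exp ((u + v) • ξ)) ζ =
      P.adj (P.exp (u • ξ)) (rot v) + P.adj (P.exp (v • ξ)) ζ := fun u => by
    rw [P.exp_add_smul]
    refine adj_mul P (ξ'' := rot (u + v)) (by rw [proj_exp_eq P]; exact h v) ?_
    rw [proj_exp_eq P]
    exact IsAd.of_mul (h v) (by rw [← loopExp_add_smul P]; exact h (u + v))
  have h2 : HasDerivAt (fun u : ℝ => P.adj (P.exp ((u + v) • ξ)) ζ)
      (K.cocycle ς ℓ ξ (rot v)) 0 := by
    simp only [h1]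
    exact (P.hasDerivAt_adj ξ (rot v)).add_const _
  have h3 : HasDerivAt (fun w : ℝ => w - v) 1 v := (hasDerivAt_id v).sub_const v
  have h4 := HasDerivAt.scomp (h := fun w : ℝ => w - v) v (by simpa using h2) h3
  simpa [Function.comp_def] using h4

end Adjoint

/-! ### The loops defined by co-roots -/

section Triple

variable {m : ℕ} (K : CompactGroup m)

theorem exp_smul_one (z : ℂ) : NormedSpace.exp (z • (1 : K.A)) = Complex.exp z • (1 : K.A) := by
  funext i
  rw [K.exp_apply, Pi.smul_apply, Pi.smul_apply, Pi.one_apply, ← Matrix.diagonal_one,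
    ← Matrix.diagonal_smul, ← Matrix.diagonal_smul, Matrix.exp_diagonal]
  congr 1
  funext j
  rw [Pi.coe_exp]
  simp [Complex.exp_eq_exp_ℂ]

theorem exp_mul_of_bracket_eq_smul {Y Z : K.A} {z : ℂ} (h : Y * Z - Z * Y = z • Z) :
    NormedSpace.exp Y * Z = Complex.exp z • (Z * NormedSpace.exp Y) := by
  have h1 : Z * (Y + z • (1 : K.A)) = Y * Z := by
    rw [mul_add, mul_smul_comm, mul_one, ← h]; abel
  have h2 := K.mul_exp_of_mul_eq h1
  rw [← h2, K.exp_add_of_commute ((Commute.one_right Y).smul_right z), exp_smul_one,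
    mul_smul_comm, mul_one, mul_smul_comm]

/-- An `𝔰𝔩₂`-triple `E, F, η / 2 π i` with `F = E^*`, spanned by root vectors. -/
structure IsRootTriple (E F : K.A) (η : K.t) : Prop where
  eta : (η : K.A) = ((2 * Real.pi : ℝ) * Complex.I) • (E * F - F * E)
  bracket_left : (η : K.A) * E - E * η = ((4 * Real.pi : ℝ) * Complex.I) • E
  bracket_right : (η : K.A) * F - F * η = -(((4 * Real.pi : ℝ) * Complex.I) • F)
  sub_mem : E - F ∈ K.g
  add_mem : Complex.I • (E + F) ∈ K.g
  root (ξ : K.t) : ∃ c : ℝ, (ξ : K.A) * E - E * ξ = ((4 * Real.pi * c : ℝ) * Complex.I) • E ∧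
    (ξ : K.A) * F - F * ξ = -(((4 * Real.pi * c : ℝ) * Complex.I) • F)

variable {K}

/-- Every co-root belongs to a root triple, with `F` the adjoint of `E` in the simple factor of the
co-root. -/
theorem exists_isRootTriple {η : K.t} (hη : η ∈ K.coroots) : ∃ E F, K.IsRootTriple E F η := by
  obtain ⟨i, η', hη', hη⟩ := hη
  obtain ⟨E, ⟨A, hA, B, hB, hE⟩, hroot, heta, hbr⟩ := hη'.exists_triple
  have hAs := conjTranspose_of_mem_lieAlg hA
  have hBs := conjTranspose_of_mem_lieAlg hB
  have hF : E.conjTranspose = -A + Complex.I • B := by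
    rw [hE, Matrix.conjTranspose_add, Matrix.conjTranspose_smul, hAs, hBs]; simp
  -- the bracket relations with the adjoint are the adjoints of the bracket relations
  have hadj : ∀ ξ : Mat (K.size i), ξ.conjTranspose = -ξ → ∀ c : ℝ,
      ξ * E - E * ξ = ((c : ℂ) * Complex.I) • E →
      ξ * E.conjTranspose - E.conjTranspose * ξ = -(((c : ℂ) * Complex.I) • E.conjTranspose) := by
    intro ξ hξ c h
    have h1 := congrArg Matrix.conjTranspose h
    rw [Matrix.conjTranspose_sub, Matrix.conjTranspose_mul, Matrix.conjTranspose_mul, hξ,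
      Matrix.conjTranspose_smul] at h1
    have h2 : star ((c : ℂ) * Complex.I) = -((c : ℂ) * Complex.I) := by simp
    rw [h2, neg_smul] at h1
    rw [← h1]; simp only [mul_neg, neg_mul]; abel
  have hetaE : η' * E - E * η' = ((4 * Real.pi : ℝ) * Complex.I) • E := by
    rw [heta, Matrix.smul_mul, Matrix.mul_smul, ← smul_sub, hbr, smul_smul]
    congr 1; push_cast; ring
  have hleft : ∀ (ξ : K.A) (b : Mat (K.size i)), ξ * (Pi.single i b : K.A) =
      Pi.single i (ξ i * b) := fun ξ b => by
    funext j
    rcases eq_or_ne j i with rfl | hj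
    · simp
    · simp [Pi.single_eq_of_ne hj]
  have hs : ∀ a b : Mat (K.size i), (Pi.single i a : K.A) * Pi.single i b = Pi.single i (a * b) :=
    fun a b => by
      rw [hleft, Pi.single_eq_same]
  have hright : ∀ (ξ : K.A) (b : Mat (K.size i)), (Pi.single i b : K.A) * ξ =
      Pi.single i (b * ξ i) := fun ξ b => by
    funext j
    rcases eq_or_ne j i with rfl | hj
    · simp
    · simp [Pi.single_eq_of_ne hj]
  have hηi : (η : K.A) i = η' := by rw [hη]; simp
  refine ⟨Pi.single i E, Pi.single i E.conjTranspose, ?_, ?_, ?_, ?_, ?_, ?_⟩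
  · rw [hη, hs, hs, ← Pi.single_sub, ← Pi.single_smul, heta]
  · rw [hleft, hright, ← Pi.single_sub, ← Pi.single_smul, hηi, hetaE]
  · rw [hleft, hright, ← Pi.single_sub, ← Pi.single_smul, ← Pi.single_neg, hηi,
      hadj _ (conjTranspose_of_mem_lieAlg hη'.1) _ hetaE]
  · rw [← Pi.single_sub]
    refine K.single_mem_g ?_
    rw [hF, hE]
    have : A + Complex.I • B - (-A + Complex.I • B) = (2 : ℝ) • A := by module
    rw [this]
    exact (lieAlg (K.G i)).smul_mem _ hA
  · rw [← Pi.single_add, ← Pi.single_smul]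
    refine K.single_mem_g ?_
    rw [hF, hE]
    have : Complex.I • (A + Complex.I • B + (-A + Complex.I • B)) = (-2 : ℝ) • B := by
      have h2 : (-2 : ℝ) • B = (-2 : ℂ) • B := by ext; simp
      rw [h2]
      have h3 : A + Complex.I • B + (-A + Complex.I • B) = (2 * Complex.I) • B := by module
      rw [h3, smul_smul]
      congr 1
      linear_combination 2 * Complex.I_mul_I
    rw [this]
    exact (lieAlg (K.G i)).smul_mem _ hB
  · intro ξ
    obtain ⟨α, hα⟩ := hroot _ (K.mem_t.1 ξ.2 i)
    have hα' : (ξ : K.A) i * E - E * (ξ : K.A) i =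
        ((4 * Real.pi * (α / 2) : ℝ) * Complex.I) • E := by
      rw [hα]; congr 3; ring
    refine ⟨α / 2, ?_, ?_⟩
    · rw [hleft, hright, ← Pi.single_sub, ← Pi.single_smul, hα']
    · rw [hleft, hright, ← Pi.single_sub, ← Pi.single_smul, ← Pi.single_neg,
        hadj _ (conjTranspose_of_mem_lieAlg (K.mem_t.1 ξ.2 i)) _ hα']

namespace IsRootTriple

variable {E F : K.A} {η : K.t} (h : K.IsRootTriple E F η)
include h

/-- Conjugation by `exp (v (π / 2) (w E - z F))` rotates `η` towards `w E + z F`. -/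
theorem exp_mul (z w : ℂ) (hzw : w * z = 1) (v : ℝ) {ξ : K.t} {c : ℝ}
    (hE : (ξ : K.A) * E - E * ξ = ((4 * Real.pi * c : ℝ) * Complex.I) • E)
    (hF : (ξ : K.A) * F - F * ξ = -(((4 * Real.pi * c : ℝ) * Complex.I) • F)) :
    NormedSpace.exp ((v * (Real.pi / 2) : ℂ) • (w • E - z • F)) * (ξ : K.A) =
      ((ξ : K.A) + (c * (Real.cos (Real.pi * v) - 1) : ℂ) • (η : K.A) +
        (-(2 * Real.pi * c * Real.sin (Real.pi * v)) * Complex.I : ℂ) • (w • E + z • F)) *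
      NormedSpace.exp ((v * (Real.pi / 2) : ℂ) • (w • E - z • F)) := by
  set Y := (v * (Real.pi / 2) : ℂ) • (w • E - z • F) with hY
  set S := w • E + z • F with hS
  clear_value S Y
  have hpi : (Real.pi : ℂ) ≠ 0 := by exact_mod_cast Real.pi_ne_zero
  have hpp : (Real.pi : ℂ) * (Real.pi : ℂ)⁻¹ = 1 := mul_inv_cancel₀ hpi
  have hEF : E * F - F * E = (-(Complex.I / (2 * Real.pi)) : ℂ) • (η : K.A) := by
    rw [h.eta, smul_smul]
    have : (-(Complex.I / (2 * Real.pi)) * ((2 * Real.pi : ℝ) * Complex.I) : ℂ) = 1 := by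
      push_cast; field_simp; simp
    rw [this, one_smul]
  have b1 : (w • E - z • F) * (η : K.A) - (η : K.A) * (w • E - z • F) =
      (-(4 * Real.pi * Complex.I) : ℂ) • S := by
    have e1 := h.bracket_left
    have e2 := h.bracket_right
    have : (w • E - z • F) * (η : K.A) - (η : K.A) * (w • E - z • F) =
        -(w • ((η : K.A) * E - E * η)) + z • ((η : K.A) * F - F * η) := by
      simp only [sub_mul, mul_sub, smul_mul_assoc, mul_smul_comm, smul_sub]; abel
    rw [this, e1, e2, hS]
    push_cast
    module
  have b2 : (w • E - z • F) * S - S * (w • E - z • F) = (-(Complex.I / Real.pi) : ℂ) • (η : K.A) := by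
    have : (w • E - z • F) * S - S * (w • E - z • F) = (2 * (w * z)) • (E * F - F * E) := by
      rw [hS]
      simp only [sub_mul, mul_sub, add_mul, mul_add, smul_mul_assoc, mul_smul_comm, smul_smul,
        smul_sub]
      module
    rw [this, hzw, hEF, smul_smul]
    congr 1
    field_simp
  have p1 := K.exp_mul_of_bracket_eq_smul (Y := Y) (Z := (η : K.A) + (-(2 * Real.pi) : ℂ) • S)
    (z := (Real.pi * v : ℂ) * Complex.I) (by
      have : Y * ((η : K.A) + (-(2 * Real.pi) : ℂ) • S) - ((η : K.A) + (-(2 * Real.pi) : ℂ) • S) * Y =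
          (v * (Real.pi / 2) : ℂ) • (((w • E - z • F) * (η : K.A) - (η : K.A) * (w • E - z • F)) +
            (-(2 * Real.pi) : ℂ) • ((w • E - z • F) * S - S * (w • E - z • F))) := by
        rw [hY]
        simp only [mul_add, add_mul, mul_sub, sub_mul, smul_mul_assoc, mul_smul_comm, smul_smul,
          smul_sub, smul_add]
        module
      rw [this, b1, b2]
      simp only [div_eq_mul_inv]
      match_scalars
      · ring
      · linear_combination ((v * Real.pi * Complex.I) : ℂ) * hpp)
  have p2 := K.exp_mul_of_bracket_eq_smul (Y := Y) (Z := (η : K.A) + (2 * Real.pi : ℂ) • S)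
    (z := -(Real.pi * v : ℂ) * Complex.I) (by
      have : Y * ((η : K.A) + (2 * Real.pi : ℂ) • S) - ((η : K.A) + (2 * Real.pi : ℂ) • S) * Y =
          (v * (Real.pi / 2) : ℂ) • (((w • E - z • F) * (η : K.A) - (η : K.A) * (w • E - z • F)) +
            (2 * Real.pi : ℂ) • ((w • E - z • F) * S - S * (w • E - z • F))) := by
        rw [hY]
        simp only [mul_add, add_mul, mul_sub, sub_mul, smul_mul_assoc, mul_smul_comm, smul_smul,
          smul_sub, smul_add]
        module
      rw [this, b1, b2]
      simp only [div_eq_mul_inv]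
      match_scalars
      · ring
      · linear_combination (-(v * Real.pi * Complex.I) : ℂ) * hpp)
  have p3 : NormedSpace.exp Y * ((ξ : K.A) + (-c : ℂ) • (η : K.A)) =
      ((ξ : K.A) + (-c : ℂ) • (η : K.A)) * NormedSpace.exp Y := by
    refine (K.mul_exp_of_mul_eq ?_).symm
    have e1 := h.bracket_left
    have e2 := h.bracket_right
    rw [← sub_eq_zero]
    have : ((ξ : K.A) + (-c : ℂ) • (η : K.A)) * Y - Y * ((ξ : K.A) + (-c : ℂ) • (η : K.A)) =
        (v * (Real.pi / 2) : ℂ) • (w • (((ξ : K.A) * E - E * ξ) + (-c : ℂ) • ((η : K.A) * E - E * η)) -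
          z • (((ξ : K.A) * F - F * ξ) + (-c : ℂ) • ((η : K.A) * F - F * η))) := by
      rw [hY]
      simp only [mul_add, add_mul, smul_mul_assoc, mul_smul_comm, smul_smul, mul_sub, sub_mul,
        smul_sub, smul_add]
      module
    rw [this, hE, hF, e1, e2]
    push_cast
    module
  have hdec : (ξ : K.A) = ((ξ : K.A) + (-c : ℂ) • (η : K.A)) +
      ((c / 2 : ℂ) • ((η : K.A) + (-(2 * Real.pi) : ℂ) • S) +
        (c / 2 : ℂ) • ((η : K.A) + (2 * Real.pi : ℂ) • S)) := by
    module
  have hcos : (Real.cos (Real.pi * v) : ℂ) = (Complex.exp (Real.pi * v * Complex.I) +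
      Complex.exp (-(Real.pi * v) * Complex.I)) / 2 := by
    rw [Complex.ofReal_cos, Complex.cos]; push_cast; rfl
  have hsin : (Real.sin (Real.pi * v) : ℂ) = (Complex.exp (-(Real.pi * v) * Complex.I) -
      Complex.exp (Real.pi * v * Complex.I)) * Complex.I / 2 := by
    rw [Complex.ofReal_sin, Complex.sin]; push_cast; rfl
  conv_lhs => rw [hdec]
  rw [mul_add (NormedSpace.exp Y) ((ξ : K.A) + (-c : ℂ) • (η : K.A)), p3,
    mul_add (NormedSpace.exp Y) ((c / 2 : ℂ) • _), mul_smul_comm, mul_smul_comm, p1, p2, hcos, hsin]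
  simp only [← smul_mul_assoc, ← add_mul]
  congr 1
  match_scalars
  · ring
  · ring
  · linear_combination (c * Real.pi * (Complex.exp (-(Real.pi * v) * Complex.I) -
      Complex.exp (Real.pi * v * Complex.I)) : ℂ) * Complex.I_mul_I

end IsRootTriple
end Triple
end CompactGroup

namespace CompactGroup

section Pairing

variable {m : ℕ} (K : CompactGroup m)

theorem mulLevel_smul (ℓ : Fin m → ℤ) (z : ℂ) (a : K.A) :
    K.mulLevel ℓ (z • a) = z • K.mulLevel ℓ a :=
  funext fun i => smul_comm (ℓ i : ℂ) z (a i)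

theorem mulLevel_add (ℓ : Fin m → ℤ) (a b : K.A) :
    K.mulLevel ℓ (a + b) = K.mulLevel ℓ a + K.mulLevel ℓ b :=
  funext fun _ => smul_add _ _ _

theorem mulLevel_zero (ℓ : Fin m → ℤ) : K.mulLevel ℓ 0 = 0 :=
  funext fun _ => smul_zero _

theorem mulLevel_neg (ℓ : Fin m → ℤ) (a : K.A) : K.mulLevel ℓ (-a) = -K.mulLevel ℓ a :=
  funext fun _ => smul_neg _ _

theorem ip_add_left (a b v : K.A) : K.ip (a + b) v = K.ip a v + K.ip b v := by
  rw [K.ip_comm, ip_add_right, K.ip_comm, K.ip_comm v]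

theorem ip_smul_left (c : ℂ) (a v : K.A) : K.ip (c • a) v = c * K.ip a v := by
  rw [K.ip_comm, ip_smul_right, K.ip_comm]

theorem ip_zero_left (v : K.A) : K.ip 0 v = 0 := by rw [K.ip_comm, ip_zero_right]

theorem ip_neg_left (a v : K.A) : K.ip (-a) v = -K.ip a v := by
  have h := K.ip_smul_left (-1) a v
  simpa using h

theorem ip_mulLevel_comm (ℓ : Fin m → ℤ) (a b : K.A) :
    K.ip (K.mulLevel ℓ a) b = K.ip (K.mulLevel ℓ b) a := by
  simp only [ip, mulLevel, Matrix.smul_mul, Matrix.trace_smul]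
  exact Finset.sum_congr rfl fun i _ => by rw [Matrix.trace_mul_comm]

/-- The form `(a, b) ↦ ℓ a · b` is invariant. -/
theorem ip_mulLevel_bracket (ℓ : Fin m → ℤ) (a b c : K.A) :
    K.ip (K.mulLevel ℓ (a * b - b * a)) c = K.ip (K.mulLevel ℓ a) (b * c - c * b) := by
  simp only [ip, mulLevel, Matrix.smul_mul, Matrix.trace_smul]
  refine Finset.sum_congr rfl fun i _ => ?_
  congr 3
  simp only [Pi.sub_apply, Pi.mul_apply]
  rw [sub_mul, mul_sub, Matrix.trace_sub, Matrix.trace_sub, mul_assoc, mul_assoc,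
    Matrix.trace_mul_comm (b i), mul_assoc]

variable {K}

/-- The Lie algebra cocycle on loops with frequencies at most one. -/
theorem cocycle_trig {ς : ℝ} (ℓ : Fin m → ℤ) {v p q v' p' q' : K.A} (hv : v ∈ K.g)
    (hp : p + q ∈ K.g) (hq : Complex.I • (p - q) ∈ K.g) (hv' : v' ∈ K.g)
    (hp' : p' + q' ∈ K.g) (hq' : Complex.I • (p' - q') ∈ K.g) :
    K.cocycle ς ℓ (K.trig ς v p q hv hp hq) (K.trig ς v' p' q' hv' hp' hq') =
      ((2 * Real.pi * Complex.I) *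
        (K.ip (K.mulLevel ℓ p) q' - K.ip (K.mulLevel ℓ q) p')).re := by
  rw [cocycle, tsum_eq_sum (s := {1, -1})]
  · simp only [coeff_trig]
    rw [Finset.sum_insert (by decide), Finset.sum_singleton]
    rw [← Complex.add_re]
    congr 1
    norm_num [mulLevel_smul, ip_smul_left, mulLevel_neg, ip_neg_left]
    ring
  · intro k hk
    simp only [Finset.mem_insert, Finset.mem_singleton, not_or] at hk
    rcases eq_or_ne k 0 with rfl | hk0
    · simp [mulLevel_zero, ip_zero_left]
    · simp [coeff_trig, hk.1, hk.2, hk0, mulLevel_zero, ip_zero_left]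

end Pairing

section CorootLoop

variable {m : ℕ} {K : CompactGroup m} {ς : ℝ} {E F : K.A} {η : K.t}

theorem fourier_neg_one_mul_fourier_one (x : UnitAddCircle) :
    (fourier (-1) x : ℂ) * fourier 1 x = 1 := by
  rw [← fourier_add]; simp

namespace IsRootTriple

variable (h : K.IsRootTriple E F η)
include h

theorem smul_sub_mem : (Real.pi / 2 : ℂ) • (E - F) ∈ K.g := by
  have h1 := K.g.smul_mem (Real.pi / 2) h.sub_mem
  rw [← Complex.coe_smul] at h1
  push_cast at h1
  exact h1

/-- The constant loop `(π / 2) (E - F)`. -/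
def fixedLoop (ς : ℝ) : K.Lg :=
  K.trig ς ((Real.pi / 2 : ℂ) • (E - F)) 0 0 h.smul_sub_mem (by simp) (by simp)

/-- The loop `x ↦ (π / 2) (e^{-2 π i x} E - e^{2 π i x} F)`. -/
def turningLoop (ς : ℝ) : K.Lg :=
  K.trig ς 0 ((-(Real.pi / 2) : ℂ) • F) ((Real.pi / 2 : ℂ) • E) K.g.zero_mem
    (by
      have h1 := h.smul_sub_mem
      rwa [show (-(Real.pi / 2) : ℂ) • F + (Real.pi / 2 : ℂ) • E = (Real.pi / 2 : ℂ) • (E - F) by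
        module])
    (by
      have h1 := K.g.smul_mem (-(Real.pi / 2)) h.add_mem
      rw [← Complex.coe_smul] at h1
      push_cast at h1
      rwa [show Complex.I • ((-(Real.pi / 2) : ℂ) • F - (Real.pi / 2 : ℂ) • E) =
        (-(Real.pi / 2) : ℂ) • Complex.I • (E + F) by module])

theorem eval_smul_fixedLoop (v : ℝ) (x : UnitAddCircle) :
    K.eval ς (v • h.fixedLoop ς) x = (v * (Real.pi / 2) : ℂ) • ((1 : ℂ) • E - (1 : ℂ) • F) := by
  rw [eval_smul, fixedLoop, eval_trig, ← Complex.coe_smul]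
  module

theorem eval_smul_turningLoop (v : ℝ) (x : UnitAddCircle) :
    K.eval ς (v • h.turningLoop ς) x =
      (v * (Real.pi / 2) : ℂ) • ((fourier (-1) x : ℂ) • E - (fourier 1 x : ℂ) • F) := by
  rw [eval_smul, turningLoop, eval_trig, ← Complex.coe_smul]
  module

theorem add_smul_mem (ξ : K.t) (r : ℝ) : (ξ : K.A) + (r : ℂ) • (η : K.A) ∈ K.g := by
  rw [Complex.coe_smul]
  exact K.g.add_mem (K.t_le_g ξ.2) (K.g.smul_mem _ (K.t_le_g η.2))

theorem smul_add_mem (r : ℝ) : ((r : ℂ) * Complex.I) • (E + F) ∈ K.g := by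
  rw [mul_smul, Complex.coe_smul]
  exact K.g.smul_mem _ h.add_mem

/-- The conjugate of `ξ` by `exp (v Y)`, for the constant loop `Y = (π / 2) (E - F)`. -/
def fixedRot (ς : ℝ) (ξ : K.t) (c v : ℝ) : K.Lg :=
  K.trig ς (((ξ : K.A) + ((c * (Real.cos (Real.pi * v) - 1) : ℝ) : ℂ) • (η : K.A)) +
      (((-(2 * Real.pi * c * Real.sin (Real.pi * v)) : ℝ) : ℂ) * Complex.I) • (E + F)) 0 0
    (K.g.add_mem (h.add_smul_mem ξ _) (h.smul_add_mem _)) (by simp) (by simp)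

/-- The conjugate of `ξ` by `exp (v Y)`, for the loop `Y = (π / 2) (e^{-2 π i x} E - e^{2 π i x} F)`.
-/
def turningRot (ς : ℝ) (ξ : K.t) (c v : ℝ) : K.Lg :=
  K.trig ς ((ξ : K.A) + ((c * (Real.cos (Real.pi * v) - 1) : ℝ) : ℂ) • (η : K.A))
      ((((-(2 * Real.pi * c * Real.sin (Real.pi * v)) : ℝ) : ℂ) * Complex.I) • F)
      ((((-(2 * Real.pi * c * Real.sin (Real.pi * v)) : ℝ) : ℂ) * Complex.I) • E)
    (h.add_smul_mem ξ _)
    (by rw [← smul_add, add_comm]; exact h.smul_add_mem _)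
    (by
      rw [← smul_sub, smul_smul]
      have h1 := K.g.smul_mem (-(2 * Real.pi * c * Real.sin (Real.pi * v))) h.sub_mem
      rw [← Complex.coe_smul] at h1
      rwa [mul_left_comm, Complex.I_mul_I, mul_neg_one, neg_smul, ← smul_neg, neg_sub])

variable {ℓ : Fin m → ℤ} {Ghat : Type*} [Group Ghat]
  [TopologicalSpace Ghat] [ChartedSpace (K.Lg × ℝ) Ghat] (P : K.LevelExtension ς ℓ Ghat)
  {ξ : K.t} {c : ℝ} (hE : (ξ : K.A) * E - E * ξ = ((4 * Real.pi * c : ℝ) * Complex.I) • E)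
  (hF : (ξ : K.A) * F - F * ξ = -(((4 * Real.pi * c : ℝ) * Complex.I) • F))
include P hE hF

theorem isAd_fixedLoop (v : ℝ) :
    K.IsAd ς (K.loopExp ς (v • h.fixedLoop ς)) (K.const ξ) (h.fixedRot ς ξ c v) := fun x => by
  rw [loopExp_apply P, eval_smul_fixedLoop, eval_const, h.exp_mul 1 1 (one_mul 1) v hE hF,
    fixedRot, eval_trig]
  congr 1
  push_cast
  module

theorem isAd_turningLoop (v : ℝ) :
    K.IsAd ς (K.loopExp ς (v • h.turningLoop ς)) (K.const ξ) (h.turningRot ς ξ c v) := fun x => by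
  rw [loopExp_apply P, eval_smul_turningLoop, eval_const,
    h.exp_mul _ _ (fourier_neg_one_mul_fourier_one x) v hE hF, turningRot, eval_trig]
  congr 1
  push_cast
  module

/-- The exponential curve of the loop `fixedLoop` has no effect on the central component, since the
cocycle vanishes along it. -/
theorem adj_fixedLoop (v : ℝ) : P.adj (P.exp (v • h.fixedLoop ς)) (K.const ξ) = 0 := by
  have h1 : ∀ v, HasDerivAt (fun v : ℝ => P.adj (P.exp (v • h.fixedLoop ς)) (K.const ξ)) 0 v :=
    fun v => by
      refine (hasDerivAt_adj_exp P (fun v => h.isAd_fixedLoop P hE hF v) v).congr_deriv ?_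
      rw [fixedLoop, fixedRot, cocycle_trig]
      simp [mulLevel_zero, ip_zero_left]
  have h2 := is_const_of_deriv_eq_zero (fun v => (h1 v).differentiableAt) (fun v => (h1 v).deriv)
    v 0
  rw [h2, zero_smul, exp_zero_eq P]
  exact adj_eq_zero_of_proj_eq_one P (map_one _) _

/-- Along the exponential curve of `turningLoop` the central component solves a differential equation
with solution a multiple of `cos (π v) - 1`. -/
theorem adj_turningLoop : P.adj (P.exp (h.turningLoop ς)) (K.const ξ) =
    -(8 * Real.pi ^ 2 * c * (K.ip (K.mulLevel ℓ E) F).re) := by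
  set κ := (K.ip (K.mulLevel ℓ E) F).re with hκ
  have h1 : ∀ v, HasDerivAt (fun v : ℝ => P.adj (P.exp (v • h.turningLoop ς)) (K.const ξ) -
      4 * Real.pi ^ 2 * c * κ * Real.cos (Real.pi * v)) 0 v := fun v => by
    have h2 := hasDerivAt_adj_exp P (fun v => h.isAd_turningLoop P hE hF v) v
    have h3 : HasDerivAt (fun v : ℝ => 4 * Real.pi ^ 2 * c * κ * Real.cos (Real.pi * v))
        (4 * Real.pi ^ 2 * c * κ * (-Real.sin (Real.pi * v) * (Real.pi * 1))) v :=
      ((Real.hasDerivAt_cos _).comp v ((hasDerivAt_id v).const_mul Real.pi)).const_mul _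
    refine (h2.sub h3).congr_deriv ?_
    rw [turningLoop, turningRot, cocycle_trig]
    simp only [mulLevel_smul, ip_smul_left, ip_smul_right]
    rw [K.ip_mulLevel_comm ℓ F E]
    have e : (2 * Real.pi * Complex.I) *
        ((((-(2 * Real.pi * c * Real.sin (Real.pi * v)) : ℝ) : ℂ) * Complex.I) *
          (-(Real.pi / 2) * K.ip (K.mulLevel ℓ E) F) -
        (((-(2 * Real.pi * c * Real.sin (Real.pi * v)) : ℝ) : ℂ) * Complex.I) *
          (Real.pi / 2 * K.ip (K.mulLevel ℓ E) F)) = ((-(4 * Real.pi ^ 3 * c * Real.sin (Real.pi * v)) : ℝ) : ℂ) *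
        K.ip (K.mulLevel ℓ E) F := by
      push_cast
      linear_combination (4 * Real.pi ^ 3 * c * Complex.sin (Real.pi * v) *
        K.ip (K.mulLevel ℓ E) F : ℂ) * Complex.I_mul_I
    rw [e, Complex.re_ofReal_mul, ← hκ]
    ring
  have h2 := is_const_of_deriv_eq_zero (fun v => (h1 v).differentiableAt) (fun v => (h1 v).deriv)
    1 0
  simp only [one_smul, zero_smul, exp_zero_eq P, mul_one, mul_zero, Real.cos_pi, Real.cos_zero,
    adj_eq_zero_of_proj_eq_one P (map_one _)] at h2
  linarith

omit hE hF

/-- The product `exp (Y₁) exp (-Y₀)` of the turning and the fixed loop is the lattice loop of the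
co-root. -/
theorem isLatticeLoop :
    K.IsLatticeLoop ς η (P.proj (P.exp (h.turningLoop ς) * P.exp (-h.fixedLoop ς))) := fun x => by
  rw [map_mul, loopMat_mul, P.proj_exp, P.proj_exp]
  have e1 := h.eval_smul_turningLoop (ς := ς) 1 (x : UnitAddCircle)
  have e2 := h.eval_smul_fixedLoop (ς := ς) 1 (x : UnitAddCircle)
  have e3 := h.eval_smul_fixedLoop (ς := ς) (-1) (x : UnitAddCircle)
  rw [one_smul] at e1 e2
  rw [neg_one_smul] at e3
  set z := (fourier 1 (x : UnitAddCircle) : ℂ) with hz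
  set w := (fourier (-1) (x : UnitAddCircle) : ℂ) with hw
  set Y := K.eval ς (h.fixedLoop ς) (x : UnitAddCircle) with hY
  have hYneg : K.eval ς (-h.fixedLoop ς) (x : UnitAddCircle) = -Y := by
    rw [e3, e2]; push_cast; module
  rw [hYneg]
  set Yh := K.eval ς (h.turningLoop ς) (x : UnitAddCircle) with hYh
  have hz' : z = Complex.exp (2 * Real.pi * x * Complex.I) := by
    rw [hz, fourier_coe_apply]; congr 1; push_cast; ring
  have hw' : w = Complex.exp (-(2 * Real.pi * x) * Complex.I) := by
    rw [hw, fourier_coe_apply]; congr 1; push_cast; ring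
  set U := NormedSpace.exp ((-(x / 2) : ℂ) • (η : K.A)) with hU
  have uE : U * E = w • (E * U) := by
    rw [hU, hw']
    refine K.exp_mul_of_bracket_eq_smul ?_
    rw [smul_mul_assoc, mul_smul_comm, ← smul_sub, h.bracket_left, smul_smul]
    congr 1; push_cast; ring
  have uF : U * F = z • (F * U) := by
    rw [hU, hz']
    refine K.exp_mul_of_bracket_eq_smul ?_
    rw [smul_mul_assoc, mul_smul_comm, ← smul_sub, h.bracket_right, smul_neg, smul_smul, ← neg_smul]
    congr 1; push_cast; ring
  have uY : U * Y = Yh * U := by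
    rw [e1, e2]
    simp only [mul_smul_comm, smul_mul_assoc, mul_sub, sub_mul, uE, uF, one_smul]
  have uexp : U * NormedSpace.exp Y = NormedSpace.exp Yh * U := K.mul_exp_of_mul_eq uY
  -- conjugation by `exp Y` is the reflection in the root
  have hη := h.exp_mul 1 1 (one_mul 1) 1 (ξ := η) (c := 1) (by simpa using h.bracket_left)
    (by simpa using h.bracket_right)
  rw [← e2] at hη
  have hη' : NormedSpace.exp Y * ((x / 2 : ℂ) • (η : K.A)) =
      ((-(x / 2) : ℂ) • (η : K.A)) * NormedSpace.exp Y := by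
    rw [mul_smul_comm, hη, smul_mul_assoc, ← smul_mul_assoc, ← smul_mul_assoc]
    congr 1
    simp only [mul_one, Real.cos_pi, Real.sin_pi, Complex.ofReal_zero, mul_zero, neg_zero, zero_mul,
      zero_smul, add_zero]
    push_cast
    module
  have hexp := K.mul_exp_of_mul_eq hη'
  have hUU : U * NormedSpace.exp ((x / 2 : ℂ) • (η : K.A)) = 1 := by
    rw [hU, neg_smul]; exact K.exp_neg_mul_exp _
  have hsq : U * U = NormedSpace.exp (-x • (η : K.A)) := by
    rw [hU, ← K.exp_add_of_commute (Commute.refl _)]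
    congr 1
    rw [← Complex.coe_smul]
    push_cast; module
  calc NormedSpace.exp Yh * NormedSpace.exp (-Y)
      = NormedSpace.exp Yh * (U * NormedSpace.exp ((x / 2 : ℂ) • (η : K.A))) *
        NormedSpace.exp (-Y) := by rw [hUU, mul_one]
    _ = U * (NormedSpace.exp Y * NormedSpace.exp ((x / 2 : ℂ) • (η : K.A))) *
        NormedSpace.exp (-Y) := by rw [← mul_assoc, ← uexp, mul_assoc U]
    _ = U * U * (NormedSpace.exp Y * NormedSpace.exp (-Y)) := by rw [hexp, ← hU]; noncomm_ring
    _ = _ := by rw [K.exp_mul_exp_neg, mul_one, hsq]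

/-- The central component of the adjoint action of a lift of the lattice loop. The factor from the
fixed loop carries `ξ` to its reflection `ξ'` in the root, with no effect on the central component,
and the factor from the turning loop is applied to `ξ'`. -/
theorem adj_latticeLoop (ξ : K.t) :
    P.adj (P.exp (h.turningLoop ς) * P.exp (-h.fixedLoop ς)) (K.const ξ) =
      -(K.ip (K.mulLevel ℓ η) ξ).re := by
  obtain ⟨c, hE, hF⟩ := h.root ξ
  set ξ' : K.t := ξ + (-(2 * c)) • η with hξ'
  have hco : (ξ' : K.A) = (ξ : K.A) + (-(2 * c) : ℂ) • (η : K.A) := by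
    rw [hξ', Submodule.coe_add, Submodule.coe_smul, ← Complex.coe_smul]; push_cast; rfl
  have hE' : (ξ' : K.A) * E - E * ξ' = ((4 * Real.pi * (-c) : ℝ) * Complex.I) • E := by
    have e : (ξ' : K.A) * E - E * ξ' = ((ξ : K.A) * E - E * ξ) +
        (-(2 * c) : ℂ) • ((η : K.A) * E - E * η) := by
      rw [hco]; simp only [add_mul, mul_add, smul_mul_assoc, mul_smul_comm, smul_sub]; abel
    rw [e, hE, h.bracket_left]; push_cast; module
  have hF' : (ξ' : K.A) * F - F * ξ' = -(((4 * Real.pi * (-c) : ℝ) * Complex.I) • F) := by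
    have e : (ξ' : K.A) * F - F * ξ' = ((ξ : K.A) * F - F * ξ) +
        (-(2 * c) : ℂ) • ((η : K.A) * F - F * η) := by
      rw [hco]; simp only [add_mul, mul_add, smul_mul_assoc, mul_smul_comm, smul_sub]; abel
    rw [e, hF, h.bracket_right]; push_cast; module
  have h1 : K.IsAd ς (P.proj (P.exp (-h.fixedLoop ς))) (K.const ξ) (K.const ξ') := fun x => by
    have h2 := h.isAd_fixedLoop P hE hF (-1) x
    rw [neg_one_smul] at h2
    rw [proj_exp_eq P, ← h2]
    congr 1
    rw [eval_const, fixedRot, eval_trig, hco]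
    simp only [mul_neg, mul_one, Real.cos_neg, Real.cos_pi, Real.sin_neg, Real.sin_pi]
    push_cast
    module
  have h2 := adj_mul P (a := P.exp (h.turningLoop ς)) h1 (ξ'' := h.turningRot ς ξ' (-c) 1) (by
    have h3 := h.isAd_turningLoop P hE' hF' 1
    rwa [one_smul, ← proj_exp_eq P] at h3)
  have h3 := h.adj_fixedLoop P hE hF (-1)
  rw [neg_one_smul] at h3
  rw [h2, h3, h.adj_turningLoop P hE' hF', add_zero, h.eta, mulLevel_smul, ip_smul_left,
    ip_mulLevel_bracket]
  have e : F * (ξ : K.A) - (ξ : K.A) * F = ((4 * Real.pi * c : ℝ) * Complex.I) • F := by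
    rw [← neg_sub, hF, neg_neg]
  rw [e, ip_smul_right]
  have e2 : (((2 * Real.pi : ℝ) * Complex.I) * (((4 * Real.pi * c : ℝ) * Complex.I) *
      K.ip (K.mulLevel ℓ E) F) : ℂ) = ((-(8 * Real.pi ^ 2 * c) : ℝ) : ℂ) *
      K.ip (K.mulLevel ℓ E) F := by
    push_cast
    linear_combination (8 * Real.pi ^ 2 * c * K.ip (K.mulLevel ℓ E) F : ℂ) * Complex.I_mul_I
  rw [e2, Complex.re_ofReal_mul]
  ring

end IsRootTriple

end CorootLoop
end CompactGroup

/-! ### Lattice loops and gauge transformations -/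

/-- A skew-Hermitian matrix with exponential `1` is diagonalizable with eigenvalues in `2 π i ℤ`. -/
theorem exists_diagonal_of_exp_eq_one {n : ℕ} {η : Mat n} (hη : η.conjTranspose = -η)
    (hexp : NormedSpace.exp η = 1) : ∃ (V W : Mat n) (k : Fin n → ℤ), V * W = 1 ∧ W * V = 1 ∧
      η = V * Matrix.diagonal (fun j => -(2 * Real.pi * Complex.I * k j)) * W := by
  have hA : (Complex.I • η).IsHermitian := by
    show (Complex.I • η).conjTranspose = Complex.I • η
    rw [Matrix.conjTranspose_smul, hη]; simp
  set V : Mat n := Subtype.val hA.eigenvectorUnitary with hV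
  set W : Mat n := star V with hW
  have hVW : V * W = 1 := Unitary.coe_mul_star_self hA.eigenvectorUnitary
  have hWV : W * V = 1 := Unitary.coe_star_mul_self hA.eigenvectorUnitary
  have hspec : Complex.I • η = V * Matrix.diagonal (fun j => (hA.eigenvalues j : ℂ)) * W := by
    have h1 := hA.spectral_theorem
    rw [Unitary.conjStarAlgAut_apply] at h1
    exact h1
  have hη' : η = V * Matrix.diagonal (fun j => -Complex.I * (hA.eigenvalues j : ℂ)) * W := by
    have h1 : η = (-Complex.I) • (Complex.I • η) := by rw [smul_smul]; simp
    have h2 : Matrix.diagonal (fun j => -Complex.I * (hA.eigenvalues j : ℂ)) =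
        (-Complex.I) • Matrix.diagonal (fun j => (hA.eigenvalues j : ℂ)) := by
      rw [← Matrix.diagonal_smul]; rfl
    rw [h2, Matrix.mul_smul, Matrix.smul_mul, ← hspec]
    exact h1
  have hdiag : ∀ j, Complex.exp (-Complex.I * (hA.eigenvalues j : ℂ)) = 1 := by
    have h1 : V * NormedSpace.exp (Matrix.diagonal
        (fun j => -Complex.I * (hA.eigenvalues j : ℂ))) = NormedSpace.exp η * V :=
      mul_exp_of_mul_eq (by
        have h0 := congrArg (fun A => A * V) hη'
        rw [mul_assoc _ W, hWV, mul_one] at h0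
        exact h0.symm)
    rw [hexp, one_mul, Matrix.exp_diagonal] at h1
    have h2 := congrArg (fun A => W * A) h1
    simp only [← mul_assoc, hWV, one_mul] at h2
    intro j
    have h3 := congrFun (congrFun h2 j) j
    rw [Matrix.diagonal_apply_eq, Matrix.one_apply_eq, Pi.coe_exp] at h3
    rwa [Complex.exp_eq_exp_ℂ]
  choose k hk using fun j => Complex.exp_eq_one_iff.1 (hdiag j)
  refine ⟨V, W, fun j => -k j, hVW, hWV, ?_⟩
  refine hη'.trans ?_
  congr 3
  funext j
  rw [hk j]; push_cast; ring

theorem exp_smul_conj_diagonal {n : ℕ} {V W : Mat n} {d : Fin n → ℂ} (hWV : W * V = 1)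
    (hVW : V * W = 1) (x : ℝ) : NormedSpace.exp (x • (V * Matrix.diagonal d * W)) =
      V * Matrix.diagonal (fun j => Complex.exp (x * d j)) * W := by
  have h1 : V * NormedSpace.exp (Matrix.diagonal (fun j => (x : ℂ) * d j)) =
      NormedSpace.exp (x • (V * Matrix.diagonal d * W)) * V := by
    refine mul_exp_of_mul_eq ?_
    have h2 : Matrix.diagonal (fun j => (x : ℂ) * d j) = x • Matrix.diagonal d := by
      rw [← Complex.coe_smul, ← Matrix.diagonal_smul]; rfl
    rw [h2, mul_smul_comm, smul_mul_assoc, mul_assoc _ W, hWV, mul_one]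
  rw [Matrix.exp_diagonal] at h1
  have h2 := congrArg (fun A => A * W) h1
  rw [mul_assoc (NormedSpace.exp _) V W, hVW, mul_one] at h2
  rw [← h2]
  congr 3
  funext j
  rw [Pi.coe_exp, Complex.exp_eq_exp_ℂ]

/-- The Fourier coefficients of a trigonometric polynomial. -/
theorem fourierCoeff_sum_fourier {A : Type*} [NormedAddCommGroup A] [NormedSpace ℂ A]
    [CompleteSpace A] (Q : Finset ℤ) (p : ℤ → A) (hp : ∀ q ∉ Q, p q = 0) (n : ℤ) :
    fourierCoeff (fun x : UnitAddCircle => ∑ q ∈ Q, (fourier q x : ℂ) • p q) n = p n := by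
  have hterm : ∀ q, fourierCoeff (fun x : UnitAddCircle => (fourier q x : ℂ) • p q) n =
      if n = q then p q else 0 := fun q => by
    have h1 : (fun x : UnitAddCircle => (fourier (-n) x : ℂ) • ((fourier q x : ℂ) • p q)) =
        fun x => ((fourier (-n) x : ℂ) • (fourier q x : ℂ)) • p q := by
      funext x; rw [smul_assoc]
    have h2 := congrFun (fourierCoeff_fourier (T := 1) q) n
    rw [fourierCoeff] at h2 ⊢
    rw [h1, integral_smul_const, h2]
    rcases eq_or_ne n q with rfl | h
    · simp
    · simp [Pi.single_eq_of_ne h, h]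
  have hint : ∀ q, MeasureTheory.Integrable (fun x : UnitAddCircle => (fourier q x : ℂ) • p q)
      AddCircle.haarAddCircle := fun q =>
    Continuous.integrable_of_hasCompactSupport (by fun_prop)
      (HasCompactSupport.of_compactSpace _)
  have h3 := fourierCoeff.sum Q (fun q (x : UnitAddCircle) => (fourier q x : ℂ) • p q)
    (fun q _ => hint q)
  have h4 : (fun x : UnitAddCircle => ∑ q ∈ Q, (fourier q x : ℂ) • p q) =
      ∑ q ∈ Q, fun x : UnitAddCircle => (fourier q x : ℂ) • p q := by
    funext x; rw [Finset.sum_apply]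
  rw [h4, h3, Finset.sum_apply]
  simp only [hterm, Finset.sum_ite_eq]
  split_ifs with h
  · rfl
  · exact (hp n h).symm

namespace CompactGroup

variable {m : ℕ} {K : CompactGroup m} {ς : ℝ}

/-- A lattice loop is a trigonometric polynomial, and convolution by its Fourier coefficients is
injective. Hence the gauge transform of a connection by a lattice loop is unique. -/
theorem IsGauge.unique {η : K.t} (hη : η ∈ K.lattice) {g : K.LG ς} (hg : K.IsLatticeLoop ς η g)
    {a b b' : K.LgDual} (hb : K.IsGauge ς g a b) (hb' : K.IsGauge ς g a b') : b = b' := by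
  have hexp : ∀ i, NormedSpace.exp ((η : K.A) i) = 1 := fun i => by
    rw [← K.exp_apply]; exact congrFun hη i
  choose V W k hVW hWV hηk using fun i =>
    exists_diagonal_of_exp_eq_one (K.skew_of_mem_g (K.t_le_g η.2) i) (hexp i)
  set p : ℤ → K.A := fun q i =>
    V i * Matrix.diagonal (fun j => if k i j = q then (1 : ℂ) else 0) * W i with hp
  set Q : Finset ℤ := Finset.univ.biUnion fun i => Finset.univ.image (k i) with hQ
  have hkQ : ∀ i j, k i j ∈ Q := fun i j => Finset.mem_biUnion.2
    ⟨i, Finset.mem_univ _, Finset.mem_image_of_mem _ (Finset.mem_univ j)⟩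
  have hpQ : ∀ q ∉ Q, p q = 0 := fun q hq => by
    funext i
    have : (fun j => if k i j = q then (1 : ℂ) else 0) = 0 := by
      funext j
      exact if_neg fun h : k i j = q => hq (h ▸ hkQ i j)
    simp [hp, this]
  have hloop : K.loopMat g.1 = fun x : UnitAddCircle => ∑ q ∈ Q, (fourier q x : ℂ) • p q := by
    funext x
    induction x using QuotientAddGroup.induction_on with
    | H x =>
    refine (hg x).trans ?_
    funext i
    rw [K.exp_apply, Pi.smul_apply, hηk i, exp_smul_conj_diagonal (hWV i) (hVW i),
      Finset.sum_apply]
    simp only [Pi.smul_apply, hp]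
    have h1 : ∀ q, (fourier q ((x : ℝ) : UnitAddCircle) : ℂ) •
        (V i * Matrix.diagonal (fun j => if k i j = q then (1 : ℂ) else 0) * W i) =
        V i * Matrix.diagonal (fun j => if k i j = q then
          (fourier q ((x : ℝ) : UnitAddCircle) : ℂ) else 0) * W i := fun q => by
      rw [← Matrix.smul_mul, ← Matrix.mul_smul, ← Matrix.diagonal_smul]
      congr 3
      funext j
      simp
    have h2 : ∀ q ∈ Q, (fourier q ((x : ℝ) : UnitAddCircle) : ℂ) •
        (V i * Matrix.diagonal (fun j => if k i j = q then (1 : ℂ) else 0) * W i) = _ :=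
      fun q _ => h1 q
    refine Eq.trans ?_ (Finset.sum_congr rfl h2).symm
    rw [← Finset.sum_mul, ← Finset.mul_sum]
    congr 2
    ext j j'
    rw [Matrix.sum_apply]
    rcases eq_or_ne j j' with rfl | hj
    · simp only [Matrix.diagonal_apply_eq, Finset.sum_ite_eq, hkQ, if_true]
      rw [fourier_coe_apply]
      congr 1; push_cast; ring
    · simp [Matrix.diagonal_apply_ne _ hj]
  have hcoef : ∀ q, fourierCoeff (K.loopMat g.1) q = p q := fun q => by
    rw [hloop]; exact fourierCoeff_sum_fourier Q p hpQ q
  have hsum : ∀ (u : K.LgDual) (n : ℤ), ∑' q : ℤ, K.coeff (ς - 1) u (n - q) *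
      fourierCoeff (K.loopMat g.1) q = ∑ q ∈ Q, K.coeff (ς - 1) u (n - q) * p q := fun u n => by
    simp only [hcoef]
    exact tsum_eq_sum fun q hq => by rw [hpQ q hq, mul_zero]
  have hcol : ∀ (u : K.LgDual) (n : ℤ) (i : Fin m) (j j' : Fin (K.size i)),
      ((∑ q ∈ Q, K.coeff (ς - 1) u (n - q) * p q) i * V i) j' j =
        (K.coeff (ς - 1) u (n - k i j) i * V i) j' j := fun u n i j j' => by
    rw [Finset.sum_apply, Finset.sum_mul, Matrix.sum_apply, Finset.sum_eq_single (k i j)]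
    · simp only [Pi.mul_apply, hp]
      rw [mul_assoc, mul_assoc _ (W i), hWV, mul_one, ← mul_assoc, Matrix.mul_diagonal, if_pos rfl,
        mul_one]
    · intro q _ hq
      simp only [Pi.mul_apply, hp]
      rw [mul_assoc, mul_assoc _ (W i), hWV, mul_one, ← mul_assoc, Matrix.mul_diagonal,
        if_neg (Ne.symm hq), mul_zero]
    · exact fun h => absurd (hkQ i j) h
  have heq : ∀ (n : ℤ) (i : Fin m), K.coeff (ς - 1) b n i = K.coeff (ς - 1) b' n i := fun n i => by
    have h1 : K.coeff (ς - 1) b n i * V i = K.coeff (ς - 1) b' n i * V i := by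
      ext j' j
      have h2 := (hb (n + k i j)).trans (hb' (n + k i j)).symm
      rw [hsum, hsum] at h2
      have h3 := hcol b (n + k i j) i j j'
      rw [h2, hcol b', add_sub_cancel_right] at h3
      exact h3.symm
    have h2 := congrArg (fun A => A * W i) h1
    simpa [mul_assoc, hVW] using h2
  refine Subtype.ext (lp.ext (funext fun n => ?_))
  have h1 : K.coeff (ς - 1) b n = K.coeff (ς - 1) b' n := funext (heq n)
  rw [coeff, coeff] at h1
  have hpos : (0 : ℝ) < (1 + (n : ℝ) ^ 2) ^ (-(ς - 1) / 2) := by positivity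
  exact smul_right_injective K.A hpos.ne' h1

end CompactGroup

/-! ### The co-root lattice -/

/-- A subgroup that contains a spanning set is cocompact. -/
theorem exists_cocompact_of_span_eq_top {V : Type*} [NormedAddCommGroup V] [NormedSpace ℝ V]
    [FiniteDimensional ℝ V] {s : Set V} (hs : Submodule.span ℝ s = ⊤) (Λ : AddSubgroup V)
    (hsΛ : s ⊆ Λ) : ∃ R : ℝ, ∀ ξ, ∃ η ∈ Λ, ‖ξ - η‖ ≤ R := by
  obtain ⟨b, hbs, hb⟩ := (Submodule.fg_span_iff_fg_span_finset_subset s).1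
    (IsNoetherian.noetherian (Submodule.span ℝ s))
  refine ⟨∑ v ∈ b, ‖v‖, fun ξ => ?_⟩
  have hξ : ξ ∈ Submodule.span ℝ (b : Set V) := by rw [← hb, hs]; trivial
  obtain ⟨f, -, rfl⟩ := Submodule.mem_span_finset.1 hξ
  refine ⟨∑ v ∈ b, ⌊f v⌋ • v, Λ.sum_mem fun v hv => Λ.zsmul_mem (hsΛ (hbs hv)) _, ?_⟩
  rw [← Finset.sum_sub_distrib]
  refine (norm_sum_le _ _).trans (Finset.sum_le_sum fun v _ => ?_)
  rw [← Int.cast_smul_eq_zsmul ℝ, ← sub_smul, norm_smul, Real.norm_eq_abs, ← Int.fract,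
    abs_of_nonneg (Int.fract_nonneg _)]
  exact mul_le_of_le_one_left (norm_nonneg _) (Int.fract_lt_one _).le

namespace CompactGroup

variable {m : ℕ} {K : CompactGroup m} {ς : ℝ}

theorem mem_lattice_of_isLatticeLoop {η : K.t} {g : K.LG ς} (h : K.IsLatticeLoop ς η g) :
    η ∈ K.lattice := by
  have h1 := h (-1)
  have h2 := h 0
  have h3 : (((-1 : ℝ) : ℝ) : UnitAddCircle) = ((0 : ℝ) : UnitAddCircle) := by
    rw [AddCircle.coe_neg, AddCircle.coe_period, AddCircle.coe_zero, neg_zero]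
  rw [h3, h2] at h1
  simp only [neg_zero, zero_smul, neg_neg, one_smul, K.exp_zero] at h1
  exact h1.symm

theorem IsLatticeLoop.one : K.IsLatticeLoop ς 0 1 := fun x => by
  rw [loopMat_one, Submodule.coe_zero, smul_zero, K.exp_zero]

theorem IsLatticeLoop.mul {η η' : K.t} {g g' : K.LG ς} (h : K.IsLatticeLoop ς η g)
    (h' : K.IsLatticeLoop ς η' g') : K.IsLatticeLoop ς (η + η') (g * g') := fun x => by
  rw [loopMat_mul, h x, h' x, Submodule.coe_add, smul_add, K.exp_add_of_commute]
  exact ((K.commute_t η.2 η'.2).smul_left _).smul_right _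

theorem IsLatticeLoop.inv {η : K.t} {g : K.LG ς} (h : K.IsLatticeLoop ς η g) :
    K.IsLatticeLoop ς (-η) g⁻¹ := fun x => by
  have h1 := K.loopMat_mul_inv g x
  rw [h x] at h1
  have h2 := congrArg (fun a => NormedSpace.exp (-(-x • (η : K.A))) * a) h1
  simp only [← mul_assoc, K.exp_neg_mul_exp, one_mul, mul_one] at h2
  rw [h2, Submodule.coe_neg, smul_neg]

/-- A lattice loop is determined by the lattice element. -/
theorem IsLatticeLoop.unique {η : K.t} {g g' : K.LG ς} (h : K.IsLatticeLoop ς η g)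
    (h' : K.IsLatticeLoop ς η g') : g = g' :=
  K.loopMat_injective fun x => by
    induction x using QuotientAddGroup.induction_on with
    | H x => exact (h x).trans (h' x).symm

/-- Lattice loops commute with constant loops in the torus. -/
theorem IsLatticeLoop.isAd {η : K.t} {g : K.LG ς} (h : K.IsLatticeLoop ς η g) (ξ : K.t) :
    K.IsAd ς g (K.const ξ) (K.const ξ) := fun x => by
  induction x using QuotientAddGroup.induction_on with
  | H x =>
    rw [eval_const]
    have h1 : K.loopMat g.1 (x : UnitAddCircle) = NormedSpace.exp (-x • (η : K.A)) := h x
    refine (congrArg (fun a => (ξ : K.A) * a) h1).trans (Eq.trans ?_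
      (congrArg (fun a => a * (ξ : K.A)) h1).symm)
    exact K.mul_exp_of_mul_eq (by
      rw [mul_smul_comm, smul_mul_assoc, (K.commute_t ξ.2 η.2).eq])

/-- Multiplication by the level, on `𝔱`. -/
def levelT (K : CompactGroup m) (ℓ : Fin m → ℤ) : K.t →ₗ[ℝ] K.t where
  toFun ξ := ⟨K.mulLevel ℓ ξ, K.mem_t.2 fun i => by
    have h := (lieAlg (K.T i)).smul_mem (ℓ i : ℝ) (K.mem_t.1 ξ.2 i)
    rw [← Complex.coe_smul] at h
    simpa [mulLevel] using h⟩
  map_add' ξ ζ := Subtype.ext (K.mulLevel_add ℓ ξ ζ)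
  map_smul' c ξ := Subtype.ext (K.mulLevel_smul ℓ (c : ℂ) ξ)

theorem coe_levelT (ℓ : Fin m → ℤ) (ξ : K.t) : (K.levelT ℓ ξ : K.A) = K.mulLevel ℓ ξ := rfl

theorem levelT_injective {ℓ : Fin m → ℤ} (hℓ : ∀ i, 0 < ℓ i) :
    Function.Injective (K.levelT ℓ) := by
  refine (injective_iff_map_eq_zero _).2 fun ξ hξ => Subtype.ext (funext fun i => ?_)
  have h1 : (ℓ i : ℂ) • (ξ : K.A) i = 0 := congrFun (congrArg Subtype.val hξ) i
  exact (smul_eq_zero.1 h1).resolve_left (by exact_mod_cast (hℓ i).ne')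

/-- A multiple of the co-root lattice is contained in its image under the level. -/
theorem exists_levelT_eq {ℓ : Fin m → ℤ} (hℓ : ∀ i, 0 < ℓ i) : ∃ N : ℤ, 0 < N ∧
    ∀ η ∈ K.corootLattice, ∃ η' ∈ K.corootLattice, K.levelT ℓ η' = N • η := by
  refine ⟨∏ i, ℓ i, Finset.prod_pos fun i _ => hℓ i, fun η hη => ?_⟩
  induction hη using AddSubgroup.closure_induction with
  | mem η h =>
    obtain ⟨i, η₀, hη₀, h⟩ := id h
    have hmem : η ∈ K.corootLattice := AddSubgroup.subset_closure ⟨i, η₀, hη₀, h⟩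
    refine ⟨(∏ j ∈ Finset.univ.erase i, ℓ j) • η, zsmul_mem hmem _, ?_⟩
    rw [map_zsmul, ← Finset.prod_erase_mul _ _ (Finset.mem_univ i), mul_smul]
    congr 1
    refine Subtype.ext ?_
    rw [coe_levelT, h]
    funext j
    rcases eq_or_ne j i with rfl | hj
    · have e : ((ℓ j • η : K.t) : K.A) j = ℓ j • (η : K.A) j := rfl
      rw [e, h, mulLevel, Int.cast_smul_eq_zsmul]
    · have e : ((ℓ i • η : K.t) : K.A) j = ℓ i • (η : K.A) j := rfl
      rw [e, h, mulLevel, Pi.single_eq_of_ne hj, smul_zero, smul_zero]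
  | zero => exact ⟨0, zero_mem _, by simp⟩
  | add a b _ _ ha hb =>
    obtain ⟨a', ha', ha⟩ := ha
    obtain ⟨b', hb', hb⟩ := hb
    exact ⟨a' + b', add_mem ha' hb', by rw [map_add, ha, hb, smul_add]⟩
  | neg a _ ha =>
    obtain ⟨a', ha', ha⟩ := ha
    exact ⟨-a', neg_mem ha', by rw [map_neg, ha, smul_neg]⟩

variable {ℓ : Fin m → ℤ} {Ghat : Type*} [Group Ghat] [TopologicalSpace Ghat]
  [ChartedSpace (K.Lg × ℝ) Ghat] (P : K.LevelExtension ς ℓ Ghat)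
include P

/-- The lattice loop of an element of the co-root lattice has a lift to the central extension, and
the adjoint action of this lift on `𝔱` is given by the level. -/
theorem exists_lift {η : K.t} (hη : η ∈ K.corootLattice) :
    ∃ a : Ghat, K.IsLatticeLoop ς η (P.proj a) ∧
      ∀ ξ : K.t, P.adj a (K.const ξ) = -(K.ip (K.mulLevel ℓ η) ξ).re := by
  induction hη using AddSubgroup.closure_induction with
  | mem η h =>
    obtain ⟨E, F, h⟩ := exists_isRootTriple h
    exact ⟨_, h.isLatticeLoop P, h.adj_latticeLoop P⟩
  | zero =>
    refine ⟨1, ?_, fun ξ => ?_⟩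
    · rw [map_one]; exact IsLatticeLoop.one
    · rw [adj_eq_zero_of_proj_eq_one P (map_one _), Submodule.coe_zero, mulLevel_zero,
        ip_zero_left]; simp
  | add η η' _ _ h h' =>
    obtain ⟨a, ha, ha'⟩ := h
    obtain ⟨b, hb, hb'⟩ := h'
    refine ⟨a * b, ?_, fun ξ => ?_⟩
    · rw [map_mul]; exact ha.mul hb
    · rw [adj_mul P (hb.isAd ξ) (ha.isAd ξ), ha', hb', Submodule.coe_add, mulLevel_add,
        ip_add_left, Complex.add_re, neg_add]
  | neg η _ h =>
    obtain ⟨a, ha, ha'⟩ := h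
    refine ⟨a⁻¹, ?_, fun ξ => ?_⟩
    · rw [map_inv]; exact ha.inv
    · rw [adj_inv P (ha.isAd ξ), ha', Submodule.coe_neg, mulLevel_neg, ip_neg_left,
        Complex.neg_re]

theorem corootLattice_subset_lattice {η : K.t} (hη : η ∈ K.corootLattice) : η ∈ K.lattice := by
  obtain ⟨a, ha, -⟩ := exists_lift P hη
  exact mem_lattice_of_isLatticeLoop ha

theorem exists_corootLattice_cocompact :
    ∃ R : ℝ, ∀ ξ : K.t, ∃ η ∈ K.corootLattice, ‖ξ - η‖ ≤ R :=
  exists_cocompact_of_span_eq_top (span_coroots P) K.corootLattice AddSubgroup.subset_closure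

end CompactGroup

/-! ### Generating vector fields -/

/-- A curve with vanishing velocity is constant. -/
theorem eq_of_forall_mfderiv_eq_zero {E : Type*} [NormedAddCommGroup E] [NormedSpace ℝ E]
    {M : Type*} [TopologicalSpace M] [ChartedSpace E M] [IsManifold 𝓘(ℝ, E) ∞ M] {γ : ℝ → M}
    (hγ : ∀ t, HasMFDerivAt 𝓘(ℝ, ℝ) 𝓘(ℝ, E) γ t (0 : ℝ →L[ℝ] E)) (s t : ℝ) : γ s = γ t := by
  have hcont : Continuous γ := continuous_iff_continuousAt.2 fun t => (hγ t).continuousAt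
  have hloc : IsLocallyConstant γ := by
    refine (IsLocallyConstant.iff_eventually_eq γ).2 fun t₀ => ?_
    have hsrc : ∀ᶠ t in 𝓝 t₀, γ t ∈ (chartAt E (γ t₀)).source :=
      hcont.continuousAt.eventually ((chartAt E (γ t₀)).open_source.mem_nhds
        (mem_chart_source E (γ t₀)))
    obtain ⟨δ, hδ, hball⟩ := Metric.eventually_nhds_iff_ball.1 hsrc
    have hd : ∀ t ∈ Metric.ball t₀ δ,
        HasFDerivAt (fun u => extChartAt 𝓘(ℝ, E) (γ t₀) (γ u)) (0 : ℝ →L[ℝ] E) t := by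
      intro t ht
      have h1 : MDifferentiableAt 𝓘(ℝ, E) 𝓘(ℝ, E) (extChartAt 𝓘(ℝ, E) (γ t₀)) (γ t) :=
        mdifferentiableAt_extChartAt (hball t ht)
      have h2 := (h1.hasMFDerivAt.comp t (hγ t)).hasFDerivAt
      refine h2.congr_fderiv ?_
      ext
      exact (mfderiv 𝓘(ℝ, E) 𝓘(ℝ, E) (extChartAt 𝓘(ℝ, E) (γ t₀)) (γ t)).map_zero
    have hconst : ∀ t ∈ Metric.ball t₀ δ, extChartAt 𝓘(ℝ, E) (γ t₀) (γ t) =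
        extChartAt 𝓘(ℝ, E) (γ t₀) (γ t₀) := fun t ht =>
      Metric.isOpen_ball.is_const_of_fderiv_eq_zero (convex_ball t₀ δ).isPreconnected
        (fun u hu => (hd u hu).differentiableAt.differentiableWithinAt)
        (fun u hu => (hd u hu).fderiv) ht (Metric.mem_ball_self hδ)
    filter_upwards [Metric.ball_mem_nhds t₀ hδ] with t ht
    refine (extChartAt 𝓘(ℝ, E) (γ t₀)).injOn ?_ (mem_extChartAt_source _) (hconst t ht)
    rw [extChartAt_source]
    exact hball t ht
  exact hloc.apply_eq_of_isPreconnected isPreconnected_univ trivial trivial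

theorem contMDiff_slice {E : Type*} [NormedAddCommGroup E] [NormedSpace ℝ E]
    {M : Type*} [TopologicalSpace M] [ChartedSpace E M]
    {W : Type*} [NormedAddCommGroup W] [NormedSpace ℝ W] {f : W × M → M}
    (hf : ContMDiff (𝓘(ℝ, W).prod 𝓘(ℝ, E)) 𝓘(ℝ, E) ∞ f) (x : M) :
    ContMDiff 𝓘(ℝ, W) 𝓘(ℝ, E) ∞ fun ξ => f (ξ, x) :=
  hf.comp (contMDiff_id.prodMk contMDiff_const)

theorem contMDiff_comp_left {E : Type*} [NormedAddCommGroup E] [NormedSpace ℝ E]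
    {M : Type*} [TopologicalSpace M] [ChartedSpace E M] {V W : Type*} [NormedAddCommGroup V]
    [NormedSpace ℝ V] [NormedAddCommGroup W] [NormedSpace ℝ W] {f : W × M → M}
    (hf : ContMDiff (𝓘(ℝ, W).prod 𝓘(ℝ, E)) 𝓘(ℝ, E) ∞ f) (L : V →L[ℝ] W) :
    ContMDiff (𝓘(ℝ, V).prod 𝓘(ℝ, E)) 𝓘(ℝ, E) ∞ fun q : V × M => f (L q.1, q.2) :=
  hf.comp ((L.contDiff.contMDiff.comp contMDiff_fst).prodMk contMDiff_snd)

section Action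

variable {m : ℕ} {K : CompactGroup m} {ς : ℝ}
  {E : Type*} [NormedAddCommGroup E] [NormedSpace ℝ E]
  {M : Type*} [TopologicalSpace M] [ChartedSpace E M] [MulAction (K.LG ς) M]
  {ℓ : Fin m → ℤ} {Ghat : Type*} [Group Ghat] [TopologicalSpace Ghat]
  [ChartedSpace (K.Lg × ℝ) Ghat] (P : K.LevelExtension ς ℓ Ghat)
  (hsm : IsSmoothAction K ς (E := E) M)

variable (K ς) in
/-- The differential of the orbit map `ξ ↦ exp (ξ) • x`. -/
def orbitDeriv (x : M) : K.Lg →L[ℝ] E :=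
  mfderiv 𝓘(ℝ, K.Lg) 𝓘(ℝ, E) (fun ξ : K.Lg => K.loopExp ς ξ • x) 0

include hsm

theorem contMDiff_orbitMap (x : M) :
    ContMDiff 𝓘(ℝ, K.Lg) 𝓘(ℝ, E) ∞ fun ξ : K.Lg => K.loopExp ς ξ • x :=
  contMDiff_slice hsm.2 x

theorem hasMFDerivAt_loopExp_smul (ξ : K.Lg) (x : M) :
    HasMFDerivAt 𝓘(ℝ, ℝ) 𝓘(ℝ, E) (fun u : ℝ => K.loopExp ς (u • ξ) • x) 0
      (ContinuousLinearMap.toSpanSingleton ℝ (orbitDeriv K ς (E := E) x ξ)) := by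
  have key : ∀ p : K.Lg, p = 0 → HasMFDerivAt 𝓘(ℝ, K.Lg) 𝓘(ℝ, E)
      (fun ξ : K.Lg => K.loopExp ς ξ • x) p (orbitDeriv K ς (E := E) x) := by
    rintro _ rfl
    exact ((contMDiff_orbitMap hsm x).mdifferentiableAt (by simp)).hasMFDerivAt
  have h2 : HasMFDerivAt 𝓘(ℝ, ℝ) 𝓘(ℝ, K.Lg) (fun u : ℝ => u • ξ) 0
      (ContinuousLinearMap.toSpanSingleton ℝ ξ) :=
    (ContinuousLinearMap.toSpanSingleton ℝ ξ).hasFDerivAt.hasMFDerivAt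
  refine ((key _ (zero_smul ℝ ξ)).comp (0 : ℝ) h2).congr_mfderiv ?_
  refine ContinuousLinearMap.ext_ring ?_
  show orbitDeriv K ς (E := E) x ((1 : ℝ) • ξ) = (1 : ℝ) • orbitDeriv K ς (E := E) x ξ
  rw [one_smul, one_smul]

theorem genField_eq_neg (ξ : K.Lg) (x : M) :
    genField K ς (E := E) ξ x = -(orbitDeriv K ς (E := E) x ξ) := by
  have h := hasMFDerivAt_loopExp_smul hsm (-ξ) x
  have e : (fun u : ℝ => K.loopExp ς (u • -ξ) • x) = fun u : ℝ => K.loopExp ς (-u • ξ) • x := by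
    funext u; rw [smul_neg, neg_smul]
  rw [e] at h
  have h1 : mfderiv 𝓘(ℝ, ℝ) 𝓘(ℝ, E) (fun u : ℝ => K.loopExp ς (-u • ξ) • x) 0 = _ := h.mfderiv
  rw [genField, h1]
  show (1 : ℝ) • orbitDeriv K ς (E := E) x (-ξ) = _
  rw [one_smul, map_neg]

include P

/-- If the initial velocity vanishes, the one-parameter group fixes the point. -/
theorem eq_of_orbitDeriv_eq_zero [IsManifold 𝓘(ℝ, E) ∞ M] {ξ : K.Lg} {x : M}
    (h : orbitDeriv K ς (E := E) x ξ = 0) (u : ℝ) : K.loopExp ς (u • ξ) • x = x := by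
  have hγ : ∀ t, HasMFDerivAt 𝓘(ℝ, ℝ) 𝓘(ℝ, E) (fun u : ℝ => K.loopExp ς (u • ξ) • x) t
      (0 : ℝ →L[ℝ] E) := by
    intro t
    have h1 := hasMFDerivAt_loopExp_smul hsm ξ x
    have h2 : HasMFDerivAt 𝓘(ℝ, ℝ) 𝓘(ℝ, ℝ) (fun u : ℝ => u - t) t
        (ContinuousLinearMap.id ℝ ℝ) := ((hasFDerivAt_id t).sub_const t).hasMFDerivAt
    have key : ∀ p : ℝ, p = 0 → HasMFDerivAt 𝓘(ℝ, ℝ) 𝓘(ℝ, E)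
        (fun u : ℝ => K.loopExp ς (u • ξ) • x) p
        (ContinuousLinearMap.toSpanSingleton ℝ (orbitDeriv K ς (E := E) x ξ)) := by
      rintro _ rfl
      exact h1
    have h3 := HasMFDerivAt.comp (g := fun u : ℝ => K.loopExp ς (u • ξ) • x)
      (f := fun u : ℝ => u - t) t (key _ (sub_self t)) h2
    have h4 := ((hsm.1 (K.loopExp ς (t • ξ))).mdifferentiableAt (by simp)
      (x := K.loopExp ς ((t - t) • ξ) • x)).hasMFDerivAt.comp t h3
    have e : (fun y : M => K.loopExp ς (t • ξ) • y) ∘ ((fun u : ℝ => K.loopExp ς (u • ξ) • x) ∘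
        fun u : ℝ => u - t) = fun u : ℝ => K.loopExp ς (u • ξ) • x := by
      funext u
      show K.loopExp ς (t • ξ) • K.loopExp ς ((u - t) • ξ) • x = _
      rw [← mul_smul, ← CompactGroup.loopExp_add_smul P, add_sub_cancel]
    rw [e] at h4
    refine h4.congr_mfderiv ?_
    refine ContinuousLinearMap.ext_ring ?_
    show mfderiv 𝓘(ℝ, E) 𝓘(ℝ, E) _ _ ((1 : ℝ) • orbitDeriv K ς (E := E) x ξ) = 0
    rw [h, smul_zero]
    exact map_zero _
  have h1 := eq_of_forall_mfderiv_eq_zero hγ u 0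
  simpa [CompactGroup.loopExp_zero P] using h1

theorem genField_eq_zero_iff [IsManifold 𝓘(ℝ, E) ∞ M] {ξ : K.Lg} {x : M} :
    genField K ς (E := E) ξ x = 0 ↔ ∀ u : ℝ, K.loopExp ς (u • ξ) • x = x := by
  rw [genField_eq_neg hsm]
  constructor
  · intro h
    exact eq_of_orbitDeriv_eq_zero P hsm (neg_eq_zero.1 h)
  · intro h
    have h1 := hasMFDerivAt_loopExp_smul hsm ξ x
    have e : (fun u : ℝ => K.loopExp ς (u • ξ) • x) = fun _ => x := funext h
    have h2 := h1.mfderiv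
    have h3 : mfderiv 𝓘(ℝ, ℝ) 𝓘(ℝ, E) (fun u : ℝ => K.loopExp ς (u • ξ) • x) 0 =
        (0 : ℝ →L[ℝ] E) := by
      rw [e]; exact mfderiv_const
    rw [h3] at h2
    have h4 := DFunLike.congr_fun h2 (1 : ℝ)
    have h5 : (0 : E) = (1 : ℝ) • orbitDeriv K ς (E := E) x ξ := h4
    rw [one_smul] at h5
    exact neg_eq_zero.2 h5.symm

/-- Equivariance of generating vector fields. -/
theorem dAct_genField {g : K.LG ς} {ξ ξ' : K.Lg} (h : K.IsAd ς g ξ ξ') (x : M) :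
    dAct K ς g x (genField K ς (E := E) ξ x) = genField K ς (E := E) ξ' (g • x) := by
  rw [genField_eq_neg hsm, genField_eq_neg hsm]
  have h1 := hasMFDerivAt_loopExp_smul hsm ξ x
  have h2 := hasMFDerivAt_loopExp_smul hsm ξ' (g • x)
  have e0 : K.loopExp ς ((0 : ℝ) • ξ) • x = x := by
    rw [zero_smul, CompactGroup.loopExp_zero P, one_smul]
  have key : ∀ p : M, p = x → HasMFDerivAt 𝓘(ℝ, E) 𝓘(ℝ, E) (fun y : M => g • y) p
      (dAct K ς g x : E →L[ℝ] E) := by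
    rintro _ rfl
    exact ((hsm.1 g).mdifferentiableAt (by simp)).hasMFDerivAt
  have h3 := (key _ e0).comp (0 : ℝ) h1
  have e : ((fun y : M => g • y) ∘ fun u : ℝ => K.loopExp ς (u • ξ) • x) =
      fun u : ℝ => K.loopExp ς (u • ξ') • g • x := by
    funext u
    show g • K.loopExp ς (u • ξ) • x = _
    rw [← CompactGroup.conj_loopExp P (h.smul u), ← mul_smul, ← mul_smul, inv_mul_cancel_right]
  rw [e] at h3
  have h4 := DFunLike.congr_fun (h3.mfderiv.symm.trans h2.mfderiv) (1 : ℝ)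
  have h5 : (dAct K ς g x : E →L[ℝ] E) ((1 : ℝ) • orbitDeriv K ς (E := E) x ξ) =
      (1 : ℝ) • orbitDeriv K ς (E := E) (g • x) ξ' := h4
  rw [one_smul, one_smul] at h5
  exact ((dAct K ς g x : E →L[ℝ] E).map_neg _).trans (congrArg Neg.neg h5)

/-- The action of the maximal torus on `M`, as an action of `𝔱` that is trivial on the co-root
lattice. -/
def torusAction : TorusAction K.t E M where
  act ξ x := K.loopExp ς (K.const ξ) • x
  zero x := by
    rw [← K.constL_apply, map_zero, CompactGroup.loopExp_zero P, one_smul]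
  add ξ ζ x := by rw [CompactGroup.loopExp_const_add P, mul_smul]
  smooth := contMDiff_comp_left hsm.2 K.constL
  Λ := K.corootLattice
  act_lattice η hη x := by
    rw [CompactGroup.loopExp_const_lattice P (CompactGroup.corootLattice_subset_lattice P hη),
      one_smul]
  radius := (CompactGroup.exists_corootLattice_cocompact P).choose
  cocompact := (CompactGroup.exists_corootLattice_cocompact P).choose_spec

end Action

/-! ### Compactness of the transversal modulo the lattice -/

section Transversal

variable {m : ℕ} {K : CompactGroup m} {ς : ℝ}
  {E : Type*} [NormedAddCommGroup E] [NormedSpace ℝ E]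
  {M : Type*} [TopologicalSpace M] [ChartedSpace E M] [IsManifold 𝓘(ℝ, E) ∞ M]
  [MulAction (K.LG ς) M]
  {ℓ : Fin m → ℤ} {Ghat : Type*} [Group Ghat] [TopologicalSpace Ghat]
  [ChartedSpace (K.Lg × ℝ) Ghat] (P : K.LevelExtension ς ℓ Ghat)
  {σ : ∀ x : M, TangentSpace 𝓘(ℝ, E) x →L[ℝ] TangentSpace 𝓘(ℝ, E) x →L[ℝ] ℝ}
  {μ : M → K.LgDual} {ε : ℝ} {r : K.t × K.tPerp → K.LgDual}

theorem CompactGroup.continuous_ip_self : Continuous fun v : K.A => (K.ip v v).re := by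
  unfold CompactGroup.ip
  refine Complex.continuous_re.comp (continuous_finsetSum _ fun i _ => Continuous.neg ?_)
  refine continuous_const.mul (Continuous.matrix_trace ?_)
  exact (continuous_apply i).matrix_mul (continuous_apply i)

include P in
/-- The part of the tube over a ball in `𝔱` is compact. -/
theorem CompactGroup.isCompact_tube_inter (ε R : ℝ) :
    IsCompact (K.tube ε ∩ {p | ‖p.1‖ ≤ R}) := by
  obtain ⟨c, hc, hpos⟩ := CompactGroup.exists_le_ip_self P
  haveI : ProperSpace K.t := FiniteDimensional.proper ℝ _
  haveI : ProperSpace K.tPerp := FiniteDimensional.proper ℝ _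
  refine Metric.isCompact_of_isClosed_isBounded (IsClosed.inter ?_ ?_) ?_
  · exact isClosed_le (CompactGroup.continuous_ip_self.comp
      (continuous_subtype_val.comp continuous_snd)) continuous_const
  · exact isClosed_le (continuous_norm.comp continuous_fst) continuous_const
  · refine isBounded_iff_forall_norm_le.2 ⟨max R (Real.sqrt (ε ^ 2 / c)), fun p hp => ?_⟩
    refine max_le_max hp.2 (Real.le_sqrt_of_sq_le ?_)
    rw [le_div_iff₀ hc, mul_comm]
    exact (hpos _ p.2.2.1).trans hp.1

/-- The loops in the lattice translate the moment map along the thickening of `𝔱`. -/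
theorem IsHamiltonian.moment_smul (hM : IsHamiltonian K ς σ μ) (hr : K.IsThickening ς ε r)
    {η : K.t} (hη : η ∈ K.lattice) {g : K.LG ς} (hg : K.IsLatticeLoop ς η g) {x : M}
    {p : K.t × K.tPerp} (hp : p ∈ K.tube ε) (hx : μ x = r p) :
    μ (g • x) = r (p.1 + η, p.2) := by
  have h1 := hM.equivariant g x
  rw [hx] at h1
  exact CompactGroup.IsGauge.unique hη hg h1 (hr.translation η hη g hg p hp)

/-- The loops in the co-root lattice preserve the transversal. -/
theorem IsHamiltonian.smul_mem (hM : IsHamiltonian K ς σ μ) (hr : K.IsThickening ς ε r)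
    {η : K.t} (hη : η ∈ K.lattice) {g : K.LG ς} (hg : K.IsLatticeLoop ς η g) {x : M}
    (hx : x ∈ μ ⁻¹' (r '' K.tube ε)) : g • x ∈ μ ⁻¹' (r '' K.tube ε) := by
  obtain ⟨p, hp, hpx⟩ := hx
  exact ⟨(p.1 + η, p.2), hp, (hM.moment_smul hr hη hg hp hpx.symm).symm⟩

include P in
/-- The transversal is the union of the translates of a compact set by the loops in the co-root
lattice. -/
theorem IsHamiltonian.exists_isCompact (hM : IsHamiltonian K ς σ μ) (hr : K.IsThickening ς ε r) :
    ∃ C : Set M, IsCompact C ∧ C ⊆ μ ⁻¹' (r '' K.tube ε) ∧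
      ∀ x ∈ μ ⁻¹' (r '' K.tube ε), ∃ η ∈ K.corootLattice, ∃ g : K.LG ς,
        K.IsLatticeLoop ς η g ∧ g • x ∈ C := by
  obtain ⟨R, hR⟩ := CompactGroup.exists_corootLattice_cocompact P
  refine ⟨μ ⁻¹' (r '' (K.tube ε ∩ {p | ‖p.1‖ ≤ R})), hM.proper.isCompact_preimage
    ((CompactGroup.isCompact_tube_inter P ε R).image_of_continuousOn
      (hr.contDiffOn.continuousOn.mono Set.inter_subset_left)),
    Set.preimage_mono (Set.image_mono Set.inter_subset_left), fun x hx => ?_⟩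
  obtain ⟨p, hp, hpx⟩ := hx
  obtain ⟨η, hη, hle⟩ := hR p.1
  have hη' : -η ∈ K.corootLattice := neg_mem hη
  obtain ⟨a, ha, -⟩ := CompactGroup.exists_lift P hη'
  refine ⟨-η, hη', P.proj a, ha, (p.1 + -η, p.2), ⟨hp, ?_⟩,
    (hM.moment_smul hr (CompactGroup.corootLattice_subset_lattice P hη') ha hp hpx.symm).symm⟩
  rw [← sub_eq_add_neg]
  exact hle

end Transversal

/-! ### The adjoint action of the maximal torus on `L𝔤` -/

section Auxiliary

open Polynomial Module

variable {W : Type*} [NormedAddCommGroup W] [NormedSpace ℝ W]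

/-- A linear map, applied to the terms of a square summable family. -/
def lpMap (A : W →L[ℝ] W) : lp (fun _ : ℤ => W) 2 →L[ℝ] lp (fun _ : ℤ => W) 2 :=
  lp.mapCLM 2 (fun _ => A) (norm_nonneg A) fun _ => le_rfl

theorem hasDerivAt_lpMap {A : ℝ → W →L[ℝ] W} {A' : W →L[ℝ] W} {t : ℝ} (h : HasDerivAt A A' t)
    (u : lp (fun _ : ℤ => W) 2) : HasDerivAt (fun s => lpMap (A s) u) (lpMap A' u) t := by
  let L : (W →L[ℝ] W) →L[ℝ] lp (fun _ : ℤ => W) 2 →L[ℝ] lp (fun _ : ℤ => W) 2 :=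
    LinearMap.mkContinuous
      { toFun := lpMap
        map_add' := fun A B => by ext u k; rfl
        map_smul' := fun c A => by ext u k; rfl } 1
      fun A => by rw [one_mul]; exact lp.norm_mapCLM_le 2 _ (norm_nonneg A) fun _ => le_rfl
  have h1 := L.hasFDerivAt.comp_hasDerivAt t h
  exact h1.clm_apply (hasDerivAt_const t u) |>.congr_deriv (by simp; rfl)

theorem hasDerivAt_of_coe {p : Submodule ℝ W} {f : ℝ → p} {v : p} {t : ℝ}
    (h : HasDerivAt (fun s => (f s : W)) (v : W) t) : HasDerivAt f v t := by
  rw [hasDerivAt_iff_isLittleO, ← Asymptotics.isLittleO_norm_left] at h ⊢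
  exact h

theorem hasDerivAt_toContinuousLinearMap [FiniteDimensional ℝ W]
    (β : W →ₗ[ℝ] W →ₗ[ℝ] (W →ₗ[ℝ] W)) {f g : ℝ → W} {f' g' : W}
    {t : ℝ} (hf : HasDerivAt f f' t) (hg : HasDerivAt g g' t) :
    HasDerivAt (fun s => (β (f s) (g s)).toContinuousLinearMap)
      (β (f t) g' + β f' (g t)).toContinuousLinearMap t := by
  let τ : (W →ₗ[ℝ] W) →ₗ[ℝ] (W →L[ℝ] W) := LinearMap.toContinuousLinearMap.toLinearMap
  let β' : W →L[ℝ] W →L[ℝ] (W →L[ℝ] W) :=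
    (LinearMap.toContinuousLinearMap.toLinearMap.comp (β.compr₂ τ)).toContinuousLinearMap
  exact (β'.hasDerivAt_of_bilinear (fun _ => hf) (fun _ => hg)).congr_deriv (map_add τ _ _).symm

/-- A derivative of a curve in a closed subspace is in the subspace. -/
theorem mem_of_hasDerivAt {p : Submodule ℝ W} (hp : IsClosed (p : Set W)) {f : ℝ → W} {v : W}
    {t : ℝ} (h : HasDerivAt f v t) (hf : ∀ s, f s ∈ p) : v ∈ p := by
  refine hp.mem_of_tendsto (hasDerivAt_iff_tendsto_slope.1 h)
    (Filter.Eventually.of_forall fun s => ?_)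
  rw [slope_def_module]
  exact p.smul_mem _ (p.sub_mem (hf s) (hf t))

/-- A commuting family of operators has finitely many weights if this is the case on an invariant
subspace of finite codimension. -/
theorem exists_realWeights_of_quotient {𝔥 V : Type*} [AddCommGroup 𝔥] [Module ℝ 𝔥]
    [AddCommGroup V] [Module ℝ V] (B : 𝔥 →ₗ[ℝ] End ℝ V) (hB : ∀ ξ ζ, Commute (B ξ) (B ζ))
    (p : Submodule ℝ V) (hp : ∀ ξ, ∀ v ∈ p, B ξ v ∈ p) [FiniteDimensional ℝ (V ⧸ p)]
    (L : List (𝔥 →ₗ[ℝ] ℂ)) (hL : ∀ ξ, ∀ v ∈ p, aeval (B ξ) (realWeightPoly L ξ) v = 0) :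
    ∃ L : List (𝔥 →ₗ[ℝ] ℂ), ∀ ξ v, aeval (B ξ) (realWeightPoly L ξ) v = 0 := by
  let Bq : 𝔥 →ₗ[ℝ] End ℝ (V ⧸ p) :=
    { toFun := fun ξ => p.mapQ p (B ξ) (hp ξ)
      map_add' := fun a b => by
        ext v; simp [Submodule.mapQ_apply]
      map_smul' := fun a b => by
        ext v; simp [Submodule.mapQ_apply] }
  have hq : ∀ ξ v, Bq ξ (p.mkQ v) = p.mkQ (B ξ v) := fun ξ v => rfl
  obtain ⟨L', hL'⟩ := exists_realWeights Bq fun ξ ζ => by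
    refine LinearMap.ext fun v => ?_
    obtain ⟨v, rfl⟩ := p.mkQ_surjective v
    show Bq ξ (Bq ζ (p.mkQ v)) = Bq ζ (Bq ξ (p.mkQ v))
    rw [hq, hq, hq, hq]
    exact congrArg p.mkQ (DFunLike.congr_fun (hB ξ ζ) v)
  refine ⟨L ++ L', fun ξ v => ?_⟩
  rw [realWeightPoly_append, map_mul]
  refine hL ξ _ ?_
  rw [← p.ker_mkQ, LinearMap.mem_ker,
    aeval_intertwine p.mkQ (B ξ) (Bq ξ) (fun u => (hq ξ u).symm), hL' ξ]
  rfl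

end Auxiliary

namespace CompactGroup

open Polynomial Module

variable {m : ℕ} {K : CompactGroup m} {ς : ℝ}

/-- A linear map that preserves `𝔤`, applied pointwise to loops. -/
def loopMap (A : K.A →ₗ[ℂ] K.A) (hA : ∀ v ∈ K.g, A v ∈ K.g) : K.Lg →ₗ[ℝ] K.Lg :=
  (lpMap (A.restrictScalars ℝ).toContinuousLinearMap).toLinearMap.restrict fun u hu k => by
    have h1 := hA _ (hu k).1
    have h2 := hA _ (hu k).2
    rw [map_add] at h1
    rw [map_smul, map_sub] at h2
    exact ⟨h1, h2⟩

theorem eval_loopMap (A : K.A ≃ₗ[ℂ] K.A) (hA : ∀ v ∈ K.g, A v ∈ K.g) (u : K.Lg)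
    (x : UnitAddCircle) : K.eval ς (loopMap A.toLinearMap hA u) x = A (K.eval ς u x) := by
  have h := A.toContinuousLinearEquiv.map_tsum
    (L := SummationFilter.unconditional ℤ) (f := fun k : ℤ => (fourier k x : ℂ) • K.coeff ς u k)
  refine Eq.trans ?_ h.symm
  refine tsum_congr fun k => ?_
  show _ = A _
  rw [map_smul]
  congr 1
  exact ((A.toLinearMap.restrictScalars ℝ).map_smul _ _).symm

/-- Conjugation by `exp ξ`. -/
def conjExp (ξ : K.A) : K.A ≃ₗ[ℂ] K.A where
  toFun v := NormedSpace.exp ξ * v * NormedSpace.exp (-ξ)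
  map_add' v w := by rw [mul_add, add_mul]
  map_smul' c v := by rw [mul_smul_comm, smul_mul_assoc]; rfl
  invFun v := NormedSpace.exp (-ξ) * v * NormedSpace.exp ξ
  left_inv v := by
    simp only [mul_assoc, K.exp_neg_mul_exp, mul_one]
    rw [← mul_assoc, K.exp_neg_mul_exp, one_mul]
  right_inv v := by
    simp only [mul_assoc, K.exp_mul_exp_neg, mul_one]
    rw [← mul_assoc, K.exp_mul_exp_neg, one_mul]

theorem conjExp_apply (ξ v : K.A) : conjExp ξ v = NormedSpace.exp ξ * v * NormedSpace.exp (-ξ) := rfl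

/-- The commutator `v ↦ [ξ, v]`. -/
def adMat (ξ : K.A) : K.A →ₗ[ℂ] K.A where
  toFun v := ξ * v - v * ξ
  map_add' v w := by rw [mul_add, add_mul]; abel
  map_smul' c v := by rw [mul_smul_comm, smul_mul_assoc, ← smul_sub]; rfl

theorem hasDerivAt_conjExp (ξ : K.A) :
    HasDerivAt (fun t : ℝ => ((conjExp (t • ξ)).toLinearMap.restrictScalars ℝ).toContinuousLinearMap)
      ((adMat ξ).restrictScalars ℝ).toContinuousLinearMap 0 := by
  let β : K.A →ₗ[ℝ] K.A →ₗ[ℝ] (K.A →ₗ[ℝ] K.A) := LinearMap.mk₂ ℝ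
    (fun a b => (LinearMap.mulLeft ℝ a).comp (LinearMap.mulRight ℝ b))
    (fun a a' b => LinearMap.ext fun v => add_mul a a' (v * b))
    (fun c a b => LinearMap.ext fun v => smul_mul_assoc c a (v * b))
    (fun a b b' => LinearMap.ext fun v => by
      show a * (v * (b + b')) = a * (v * b) + a * (v * b')
      rw [mul_add, mul_add])
    (fun c a b => LinearMap.ext fun v => by
      show a * (v * (c • b)) = c • (a * (v * b))
      rw [mul_smul_comm, mul_smul_comm])
  have hexp : ∀ ξ : K.A, HasDerivAt (fun t : ℝ => NormedSpace.exp (t • ξ)) ξ 0 := fun ξ => by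
    refine hasDerivAt_pi.2 fun i => ?_
    have h := hasDerivAt_exp_smul (ξ i) 0
    simp only [zero_smul, NormedSpace.exp_zero, one_mul] at h
    refine h.congr_of_eventuallyEq (Filter.Eventually.of_forall fun t => ?_)
    exact K.exp_apply _ _
  have h1 := hasDerivAt_toContinuousLinearMap β (hexp ξ) (hexp (-ξ))
  refine (h1.congr_of_eventuallyEq (Filter.Eventually.of_forall fun t => ?_)).congr_deriv ?_
  · ext1 v
    show NormedSpace.exp (t • ξ) * v * NormedSpace.exp (-(t • ξ)) =
      NormedSpace.exp (t • ξ) * (v * NormedSpace.exp (t • -ξ))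
    rw [smul_neg, mul_assoc]
  · ext1 v
    show NormedSpace.exp ((0 : ℝ) • ξ) * (v * -ξ) + ξ * (v * NormedSpace.exp ((0 : ℝ) • -ξ)) =
      ξ * v - v * ξ
    rw [zero_smul, zero_smul, K.exp_zero, one_mul, mul_one, mul_neg]
    abel

section

variable {ℓ : Fin m → ℤ} {Ghat : Type*} [Group Ghat] [TopologicalSpace Ghat]
  [ChartedSpace (K.Lg × ℝ) Ghat] (P : K.LevelExtension ς ℓ Ghat)
include P

theorem adMat_mem {ξ v : K.A} (hξ : ξ ∈ K.g) (hv : v ∈ K.g) : adMat ξ v ∈ K.g :=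
  K.mem_g.2 fun i => bracket_mem_lieAlg (fun _ h => mem_genSet_of_mem_lieAlg P h)
    (K.mem_g.1 hξ i) (K.mem_g.1 hv i)

theorem conjExp_mem {ξ v : K.A} (hξ : ξ ∈ K.g) (hv : v ∈ K.g) : conjExp ξ v ∈ K.g := by
  refine K.mem_g.2 fun i => ?_
  obtain ⟨a, ha, hae⟩ := mem_genSet_of_mem_lieAlg P (K.mem_g.1 hξ i) 1
  have h1 := conj_mem_lieAlg ha (K.mem_g.1 hv i)
  rw [one_smul] at hae
  have h2 : ((a⁻¹ : UGroup (K.size i)) : Mat (K.size i)) = NormedSpace.exp (-ξ i) := by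
    have h3 : ((a⁻¹ : UGroup (K.size i)) : Mat (K.size i)) * (a : Mat (K.size i)) = 1 := by
      rw [← Submonoid.coe_mul, inv_mul_cancel]; rfl
    have h4 := congrArg (fun b => b * NormedSpace.exp (-ξ i)) h3
    rwa [mul_assoc, hae, LoopSpace.exp_mul_exp_neg, mul_one, one_mul] at h4
  rw [h2, hae] at h1
  rw [conjExp_apply, Pi.mul_apply, Pi.mul_apply, K.exp_apply, K.exp_apply]
  exact h1

/-- The constant loop with value `exp ξ` acts on loops by pointwise conjugation. -/
theorem isAd_conjExp (ξ : K.t) (u : K.Lg) : K.IsAd ς (K.loopExp ς (K.const ξ)) u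
    (loopMap (conjExp (ξ : K.A)).toLinearMap (fun _ hv => conjExp_mem P (K.t_le_g ξ.2) hv) u) := by
  intro x
  rw [eval_loopMap, loopExp_apply P, eval_const, conjExp_apply, mul_assoc, mul_assoc,
    K.exp_neg_mul_exp, mul_one]

theorem hasDerivAt_loopMap_conjExp (ξ : K.t) (u : K.Lg) :
    HasDerivAt (fun t : ℝ => loopMap (conjExp ((t • ξ : K.t) : K.A)).toLinearMap
      (fun _ hv => conjExp_mem P (K.t_le_g (t • ξ).2) hv) u)
      (loopMap (adMat (ξ : K.A)) (fun _ hv => adMat_mem P (K.t_le_g ξ.2) hv) u) 0 :=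
  hasDerivAt_of_coe (hasDerivAt_lpMap (hasDerivAt_conjExp (ξ : K.A)) _)

/-- The adjoint action of `𝔱` on `L𝔤` has finitely many weights. -/
theorem exists_adWeights : ∃ L : List (K.t →ₗ[ℝ] ℂ), ∀ (ξ : K.t) (u : K.Lg),
    aeval (loopMap (adMat (ξ : K.A)) (fun _ hv => adMat_mem P (K.t_le_g ξ.2) hv) : End ℝ K.Lg)
      (realWeightPoly L ξ) u = 0 := by
  let B : K.t →ₗ[ℝ] End ℝ K.A :=
    { toFun := fun ξ => (adMat (ξ : K.A)).restrictScalars ℝ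
      map_add' := fun a b => by
        refine LinearMap.ext fun v => ?_
        show ((a : K.A) + b) * v - v * (a + b) = (a * v - v * a) + (b * v - v * b)
        rw [add_mul, mul_add]; abel
      map_smul' := fun c a => by
        refine LinearMap.ext fun v => ?_
        show (c • (a : K.A)) * v - v * (c • a) = c • (a * v - v * a)
        rw [smul_mul_assoc, mul_smul_comm, smul_sub] }
  obtain ⟨L, hL⟩ := exists_realWeights B fun ξ ζ => by
    refine LinearMap.ext fun v => ?_
    have h := K.commute_t ξ.2 ζ.2
    show (ξ : K.A) * (ζ * v - v * ζ) - (ζ * v - v * ζ) * ξ =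
      ζ * (ξ * v - v * ξ) - (ξ * v - v * ξ) * ζ
    have h1 : (ξ : K.A) * (ζ * v) = ζ * (ξ * v) := by rw [← mul_assoc, h.eq, mul_assoc]
    have h2 : v * ζ * (ξ : K.A) = v * ξ * ζ := by rw [mul_assoc, mul_assoc, h.eq]
    rw [mul_sub, mul_sub, sub_mul, sub_mul, h1, h2, mul_assoc (ζ : K.A) v ξ, mul_assoc (ξ : K.A) v ζ]
    abel
  refine ⟨L, fun ξ u => ?_⟩
  refine Subtype.ext (lp.ext (funext fun k => ?_))
  let ev : K.Lg →ₗ[ℝ] K.A :=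
    { toFun := fun u => (u : lp (fun _ : ℤ => K.A) 2) k
      map_add' := fun _ _ => rfl
      map_smul' := fun _ _ => rfl }
  refine (aeval_intertwine ev _ (B ξ) (fun u => rfl) (realWeightPoly L ξ) u).trans ?_
  rw [hL ξ]
  rfl

end

end CompactGroup

/-! ### Weights of the isotropy representations -/

section Isotropy

open Polynomial Module

variable {m : ℕ} {K : CompactGroup m} {ς : ℝ}
  {E : Type*} [NormedAddCommGroup E] [NormedSpace ℝ E]
  {M : Type*} [TopologicalSpace M] [ChartedSpace E M] [IsManifold 𝓘(ℝ, E) ∞ M]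
  [MulAction (K.LG ς) M]
  {ℓ : Fin m → ℤ} {Ghat : Type*} [Group Ghat] [TopologicalSpace Ghat]
  [ChartedSpace (K.Lg × ℝ) Ghat] (P : K.LevelExtension ς ℓ Ghat)
  (hsm : IsSmoothAction K ς (E := E) M)

/-- The derivative of the orbit map intertwines the adjoint representation of the maximal torus on
`L𝔤` with the isotropy representation. -/
theorem isotropy_orbitDeriv (y : M) (ξ : (torusAction P hsm).stab {y}) (u : K.Lg) :
    (torusAction P hsm).isotropy y ξ (orbitDeriv K ς (E := E) y u) =
      orbitDeriv K ς (E := E) y (CompactGroup.loopMap (CompactGroup.conjExp (ξ : K.A)).toLinearMap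
        (fun _ hv => CompactGroup.conjExp_mem P (K.t_le_g ξ.1.2) hv) u) := by
  rw [TorusAction.isotropy_eq_mfderiv]
  have hfix : K.loopExp ς (K.const ξ) • y = y := (torusAction P hsm).act_of_mem_stab ξ.2
  have h := dAct_genField P hsm (CompactGroup.isAd_conjExp P ξ u) y
  rw [genField_eq_neg hsm, genField_eq_neg hsm, hfix] at h
  have h1 : (dAct K ς (K.loopExp ς (K.const ξ)) y : E →L[ℝ] E)
      (-(orbitDeriv K ς (E := E) y u)) = _ := h
  exact neg_injective (((dAct K ς (K.loopExp ς (K.const ξ)) y : E →L[ℝ] E).map_neg _).symm.trans h1)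

theorem isotropyGen_orbitDeriv (y : M) (ξ : (torusAction P hsm).stab {y}) (u : K.Lg) :
    (torusAction P hsm).isotropyGen y ξ (orbitDeriv K ς (E := E) y u) =
      orbitDeriv K ς (E := E) y (CompactGroup.loopMap (CompactGroup.adMat (ξ : K.A))
        (fun _ hv => CompactGroup.adMat_mem P (K.t_le_g ξ.1.2) hv) u) := by
  have h1 := (torusAction P hsm).hasDerivAt_isotropy y ξ (orbitDeriv K ς (E := E) y u) 0
  rw [zero_smul, (torusAction P hsm).isotropy_zero y (torusAction P hsm).Λ.zero_mem] at h1
  have h2 := (orbitDeriv K ς (E := E) y).hasFDerivAt.comp_hasDerivAt 0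
    (CompactGroup.hasDerivAt_loopMap_conjExp P (ξ : K.t) u)
  exact h1.unique (h2.congr_of_eventuallyEq (Filter.Eventually.of_forall fun t =>
    isotropy_orbitDeriv P hsm y (t • ξ) u))

include hsm in
theorem vert_le_range (y : M) : (vert K ς y : Submodule ℝ E) ≤
    (orbitDeriv K ς (E := E) y).toLinearMap.range := by
  refine Submodule.span_le.2 ?_
  rintro _ ⟨ξ, -, rfl⟩
  refine ⟨-ξ, ?_⟩
  rw [genField_eq_neg hsm]
  exact (orbitDeriv K ς (E := E) y).map_neg ξ

/-- The isotropy representation at a point has finitely many weights if the tangent space of the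
orbit of the based loop group has finite codimension. -/
theorem exists_isotropyWeights
    {h : ∀ x : M, TangentSpace 𝓘(ℝ, E) x →L[ℝ] TangentSpace 𝓘(ℝ, E) x →L[ℝ] ℝ}
    (h_ker : ∀ (x : M) (v : TangentSpace 𝓘(ℝ, E) x), h x v v = 0 ↔ v ∈ vert K ς x)
    (h_invariant : ∀ (g : K.LG ς) (x : M) (v w : TangentSpace 𝓘(ℝ, E) x),
      h (g • x) (dAct K ς g x v) (dAct K ς g x w) = h x v w)
    (y : M) (hfd : FiniteDimensional ℝ (E ⧸ (vert K ς y : Submodule ℝ E))) :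
    ∃ L : List ((torusAction P hsm).stab {y} →ₗ[ℝ] ℂ), ∀ ξ v,
      aeval ((torusAction P hsm).isotropyGen y ξ : End ℝ E) (realWeightPoly L ξ) v = 0 := by
  obtain ⟨L, hL⟩ := CompactGroup.exists_adWeights P
  let B : (torusAction P hsm).stab {y} →ₗ[ℝ] End ℝ E :=
    { toFun := fun ξ => ((torusAction P hsm).isotropyGen y ξ : End ℝ E)
      map_add' := fun a b => by rw [map_add]; rfl
      map_smul' := fun a b => by rw [map_smul]; rfl }
  let hy : E →L[ℝ] E →L[ℝ] ℝ := h y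
  let W : Submodule ℝ E := vert K ς y
  have hker : ∀ v : E, v ∈ W ↔ hy v v = 0 := fun v => (h_ker y v).symm
  have hclosed : IsClosed (W : Set E) := by
    have e : (W : Set E) = {v | hy v v = 0} := Set.ext hker
    rw [e]
    exact isClosed_eq (hy.continuous.clm_apply continuous_id) continuous_const
  have hinv : ∀ (ξ : (torusAction P hsm).stab {y}) (v : E), v ∈ W →
      (torusAction P hsm).isotropy y ξ v ∈ W := by
    intro ξ v hv
    rw [hker] at hv ⊢
    rw [TorusAction.isotropy_eq_mfderiv]
    have hfix : K.loopExp ς (K.const ξ) • y = y := (torusAction P hsm).act_of_mem_stab ξ.2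
    have key : ∀ z : M, z = y → ∀ w : E, (h z : E →L[ℝ] E →L[ℝ] ℝ) w w = hy w w := by
      rintro _ rfl w; rfl
    exact ((key _ hfix _).symm.trans (h_invariant (K.loopExp ς (K.const ξ)) y v v)).trans hv
  haveI : FiniteDimensional ℝ (E ⧸ W) := hfd
  refine exists_realWeights_of_quotient B
    (fun ξ ζ => LinearMap.ext fun v => (torusAction P hsm).isotropyGen_comm y ξ ζ v)
    W (fun ξ v hv => ?_)
    (L.map fun χ => χ.comp ((torusAction P hsm).stab {y}).subtype) fun ξ v hv => ?_
  · have h1 := (torusAction P hsm).hasDerivAt_isotropy y ξ v 0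
    rw [zero_smul, (torusAction P hsm).isotropy_zero y (torusAction P hsm).Λ.zero_mem] at h1
    exact mem_of_hasDerivAt hclosed h1 fun t => hinv _ _ hv
  · obtain ⟨u, rfl⟩ := vert_le_range hsm y hv
    have e : realWeightPoly (L.map fun χ => χ.comp ((torusAction P hsm).stab {y}).subtype) ξ =
        realWeightPoly L (ξ : K.t) := by
      simp only [realWeightPoly, List.map_map]; rfl
    rw [e, ← aeval_intertwine (orbitDeriv K ς (E := E) y).toLinearMap _ (B ξ)
      (fun u => (isotropyGen_orbitDeriv P hsm y ξ u).symm), hL ξ]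
    exact map_zero _

end Isotropy

/-! ### The rank of the spinor bundle -/

section Spinors

open Module

theorem map_complex_smul {U W : Type*} [AddCommGroup U] [Module ℂ U] [AddCommGroup W] [Module ℂ W]
    (f : U →ₗ[ℝ] W) (hf : ∀ u, f (Complex.I • u) = Complex.I • f u) (z : ℂ) (u : U) :
    f (z • u) = z • f u := by
  conv_lhs => rw [← Complex.re_add_im z, add_smul, mul_smul, map_add]
  conv_rhs => rw [← Complex.re_add_im z, add_smul, mul_smul]
  rw [Complex.coe_smul, Complex.coe_smul, Complex.coe_smul, Complex.coe_smul, map_smul, map_smul, hf]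

/-- A Clifford action on a graded complex line vanishes. -/
theorem eq_zero_of_odd_of_finrank_eq_one {U : Type*} [AddCommGroup U] [Module ℂ U]
    (hU : finrank ℂ U = 1) (Γ c : U →ₗ[ℝ] U) (hΓ : ∀ u, Γ (Complex.I • u) = Complex.I • Γ u)
    (hc : ∀ u, c (Complex.I • u) = Complex.I • c u) (hΓ2 : ∀ u, Γ (Γ u) = u)
    (hodd : ∀ u, Γ (c u) = -c (Γ u)) (u : U) : c u = 0 := by
  obtain ⟨e, he, hspan⟩ := finrank_eq_one_iff'.1 hU
  obtain ⟨γ, hγ⟩ := hspan (Γ e)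
  obtain ⟨z, hz⟩ := hspan (c e)
  obtain ⟨w, rfl⟩ := hspan u
  have h1 := hodd e
  rw [← hγ, ← hz, map_complex_smul Γ hΓ, map_complex_smul c hc, ← hγ, ← hz, eq_neg_iff_add_eq_zero,
    smul_smul, smul_smul, mul_comm γ z, ← add_smul, ← two_mul, smul_eq_zero] at h1
  have hγ0 : γ ≠ 0 := by
    rintro rfl
    have := hΓ2 e
    rw [← hγ, zero_smul, map_zero] at this
    exact he this.symm
  have hz0 : z = 0 := by
    rcases h1 with h1 | h1
    · simpa [hγ0] using h1
    · exact absurd h1 he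
  rw [map_complex_smul c hc, ← hz, hz0, zero_smul, smul_zero]

variable {m : ℕ} {K : CompactGroup m} {ς : ℝ}
  {E : Type*} [NormedAddCommGroup E] [NormedSpace ℝ E]
  {M : Type*} [TopologicalSpace M] [ChartedSpace E M] [IsManifold 𝓘(ℝ, E) ∞ M]
  [MulAction (K.LG ς) M]
  {ℓ : Fin m → ℤ} {Ghat : Type*} [Group Ghat] [TopologicalSpace Ghat]
  [ChartedSpace (K.Lg × ℝ) Ghat] {P : K.LevelExtension ς ℓ Ghat}
  {F : Type*} [NormedAddCommGroup F] [NormedSpace ℂ F]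
  {S : M → Type*} [TopologicalSpace (TotalSpace F S)]
  [∀ x, AddCommGroup (S x)] [∀ x, Module ℂ (S x)] [∀ x, TopologicalSpace (S x)]
  [∀ x, IsTopologicalAddGroup (S x)] [∀ x, ContinuousSMul ℝ (S x)]
  [FiberBundle F S] [VectorBundle ℝ F S] [ContMDiffVectorBundle ∞ F S 𝓘(ℝ, E)]
  [MulAction Ghat (TotalSpace F S)]
  {h : ∀ x : M, TangentSpace 𝓘(ℝ, E) x →L[ℝ] TangentSpace 𝓘(ℝ, E) x →L[ℝ] ℝ}
  {metric : ContMDiffRiemannianMetric 𝓘(ℝ, E) ∞ F S}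
  {grading : ∀ x : M, S x →L[ℝ] S x}
  {c : ∀ x : M, TangentSpace 𝓘(ℝ, E) x →L[ℝ] S x →L[ℝ] S x}

/-- The normal spaces of the orbits of the based loop group are finite-dimensional, since otherwise
their Clifford module would be a line. -/
theorem IsSpinorBundle.finiteDimensional_quotient (hS : IsSpinorBundle K ς P h metric grading c)
    (y : M) : FiniteDimensional ℝ (E ⧸ (vert K ς y : Submodule ℝ E)) := by
  by_contra hne
  have h0 : finrank ℝ (E ⧸ (vert K ς y : Submodule ℝ E)) = 0 :=
    finrank_of_not_finite hne
  have h1 : finrank ℂ (S y) ^ 2 = 2 ^ finrank ℝ (E ⧸ (vert K ς y : Submodule ℝ E)) := hS.rank y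
  rw [h0, pow_zero] at h1
  have h2 : finrank ℂ (S y) = 1 := by
    exact (pow_eq_one_iff.1 h1).resolve_right two_ne_zero
  obtain ⟨e, he, -⟩ := finrank_eq_one_iff'.1 h2
  have htop : (vert K ς y : Submodule ℝ E) = ⊤ := by
    refine Submodule.eq_top_iff'.2 fun v => (hS.h_ker y v).1 ?_
    have h3 := hS.c_sq y v e
    have h4 := eq_zero_of_odd_of_finrank_eq_one h2 (grading y).toLinearMap (c y v).toLinearMap
      (hS.grading_I y) (hS.c_I y v) (hS.grading_sq y) (hS.c_odd y v)
    have h5 : -(h y v v • e) = 0 := h3.symm.trans (h4 _)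
    exact (smul_eq_zero.1 (neg_eq_zero.1 h5)).resolve_right he
  refine hne ?_
  rw [htop]
  exact Module.Finite.of_surjective (0 : ℝ →ₗ[ℝ] E ⧸ (⊤ : Submodule ℝ E))
    fun v => ⟨0, Subsingleton.elim _ _⟩

end Spinors

/-! ### Local sections of the anti-canonical line bundle -/

section Average

variable {R : Type*} [Ring R] [Algebra ℝ R]

/-- The average of `l` over conjugation with a Clifford generator `a`, `a² = -q`. It commutes
with `a`. -/
def cliffordAverage (q : ℝ) (a l : R) : R := (1 / 2 : ℝ) • (l - q⁻¹ • (a * l * a))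

theorem cliffordAverage_mul {q : ℝ} (hq : q ≠ 0) {a : R} (ha : a * a = -(q • 1)) (l : R) :
    cliffordAverage q a l * a = (1 / 2 : ℝ) • (l * a + a * l) := by
  rw [cliffordAverage, smul_mul_assoc, sub_mul, smul_mul_assoc, mul_assoc, ha, mul_neg,
    mul_smul_comm, mul_one, smul_neg, smul_smul, inv_mul_cancel₀ hq, one_smul, sub_neg_eq_add]

theorem mul_cliffordAverage {q : ℝ} (hq : q ≠ 0) {a : R} (ha : a * a = -(q • 1)) (l : R) :
    a * cliffordAverage q a l = cliffordAverage q a l * a := by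
  rw [cliffordAverage_mul hq ha, cliffordAverage, mul_smul_comm, mul_sub, mul_smul_comm,
    ← mul_assoc, ← mul_assoc, ha, neg_mul, smul_mul_assoc, one_mul, neg_mul, smul_neg,
    smul_mul_assoc, smul_smul, inv_mul_cancel₀ hq, one_smul, sub_neg_eq_add, add_comm]

theorem commute_cliffordAverage {q : ℝ} {a b l : R} (hab : b * a = -(a * b)) (hl : b * l = l * b) :
    b * cliffordAverage q a l = cliffordAverage q a l * b := by
  have h1 : b * (a * l * a) = a * l * a * b := by
    rw [← mul_assoc, ← mul_assoc, hab, neg_mul, neg_mul, mul_assoc a b l, hl, mul_assoc, mul_assoc,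
      hab, mul_neg, mul_neg, neg_neg]
    simp only [mul_assoc]
  rw [cliffordAverage, mul_smul_comm, smul_mul_assoc, mul_sub, sub_mul, mul_smul_comm,
    smul_mul_assoc, h1, hl]

theorem anticommute_cliffordAverage {q : ℝ} {a b l : R} (hab : b * a = a * b)
    (hl : b * l = -(l * b)) : b * cliffordAverage q a l = -(cliffordAverage q a l * b) := by
  have h1 : b * (a * l * a) = -(a * l * a * b) := by
    rw [← mul_assoc, ← mul_assoc, hab, mul_assoc a b l, hl, mul_neg, neg_mul, mul_assoc,
      mul_assoc, hab]
    simp only [mul_assoc]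
  rw [cliffordAverage, mul_smul_comm, smul_mul_assoc, mul_sub, sub_mul, mul_smul_comm,
    smul_mul_assoc, h1, hl]
  module

/-- If the average of `l` vanishes, then that of `l g a` does not, where `g` is the grading. -/
theorem cliffordAverage_grading_ne_zero {q : ℝ} (hq : q ≠ 0) {a g l : R} (ha : a * a = -(q • 1))
    (hg : g * g = 1) (hag : g * a = -(a * g)) (hl : l ≠ 0) (h0 : cliffordAverage q a l = 0) :
    cliffordAverage q a (l * g * a) ≠ 0 := by
  intro h1
  have h2 := cliffordAverage_mul hq ha l
  have h3 := cliffordAverage_mul hq ha (l * g * a)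
  rw [h0, zero_mul, eq_comm, smul_eq_zero_iff_right (by norm_num), add_eq_zero_iff_eq_neg'] at h2
  rw [h1, zero_mul, eq_comm, smul_eq_zero_iff_right (by norm_num)] at h3
  have h4 : a * (l * g * a) = l * g * a * a := by
    rw [← mul_assoc, ← mul_assoc, h2, neg_mul, neg_mul, mul_assoc l a g, mul_assoc l g a, hag,
      mul_neg, neg_mul]
  rw [h4, ← two_smul ℝ, smul_eq_zero_iff_right (by norm_num), mul_assoc (l * g), ha, mul_neg,
    mul_smul_comm, mul_one, neg_eq_zero, smul_eq_zero_iff_right hq] at h3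
  have h5 := congrArg (fun r => r * g) h3
  simp only [mul_assoc, hg, mul_one, zero_mul] at h5
  exact hl h5

theorem commute_mul_grading {a b g l : R} (hab : b * a = -(a * b)) (hbg : b * g = -(g * b))
    (hl : b * l = l * b) : b * (l * g * a) = l * g * a * b := by
  rw [← mul_assoc, ← mul_assoc, hl, mul_assoc l b g, hbg, mul_neg, neg_mul, mul_assoc, mul_assoc,
    mul_assoc, hab]
  simp only [mul_neg, neg_neg, mul_assoc]

end Average

section LocalSections

open Module

variable {E : Type*} [NormedAddCommGroup E] [NormedSpace ℝ E]
  {M : Type*} [TopologicalSpace M] [ChartedSpace E M]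
  {F : Type*} [NormedAddCommGroup F] [NormedSpace ℂ F]

/-- A Clifford module bundle over `U`, in a local trivialization. -/
structure IsLocalClifford (U : Set M) (h : M → E →L[ℝ] E →L[ℝ] ℝ) (c : M → E →L[ℝ] F →L[ℝ] F)
    (Γ : M → F →L[ℝ] F) : Prop where
  h_smooth : ContMDiffOn 𝓘(ℝ, E) 𝓘(ℝ, E →L[ℝ] E →L[ℝ] ℝ) ∞ h U
  c_smooth : ContMDiffOn 𝓘(ℝ, E) 𝓘(ℝ, E →L[ℝ] F →L[ℝ] F) ∞ c U
  Γ_smooth : ContMDiffOn 𝓘(ℝ, E) 𝓘(ℝ, F →L[ℝ] F) ∞ Γ U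
  h_symm : ∀ x ∈ U, ∀ v w, h x v w = h x w v
  Γ_I : ∀ x ∈ U, ∀ s, Γ x (Complex.I • s) = Complex.I • Γ x s
  Γ_sq : ∀ x ∈ U, ∀ s, Γ x (Γ x s) = s
  c_I : ∀ x ∈ U, ∀ v s, c x v (Complex.I • s) = Complex.I • c x v s
  c_odd : ∀ x ∈ U, ∀ v s, Γ x (c x v s) = -c x v (Γ x s)
  c_sq : ∀ x ∈ U, ∀ v s, c x v (c x v s) = -(h x v v • s)
  c_ker : ∀ x ∈ U, ∀ v, h x v v = 0 → c x v = 0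

variable {U : Set M} {h : M → E →L[ℝ] E →L[ℝ] ℝ} {c : M → E →L[ℝ] F →L[ℝ] F} {Γ : M → F →L[ℝ] F}

namespace IsLocalClifford

theorem polarization (H : IsLocalClifford U h c Γ) {x : M} (hx : x ∈ U) (v w : E) :
    c x v * c x w + c x w * c x v = -((2 * h x v w) • (1 : F →L[ℝ] F)) := by
  ext s
  have h1 := H.c_sq x hx (v + w) s
  have h2 := H.c_sq x hx v s
  have h3 := H.c_sq x hx w s
  have h4 := H.h_symm x hx w v
  simp only [map_add, add_apply] at h1
  rw [h2, h3, h4] at h1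
  show c x v (c x w s) + c x w (c x v s) = -((2 * h x v w) • s)
  have h5 : c x v (c x w s) + c x w (c x v s) = (-(h x v v • s) + c x w (c x v s) +
      (c x v (c x w s) + -(h x w w • s))) + (h x v v • s) + (h x w w • s) := by abel
  rw [h5, h1]
  module

theorem anticommute (H : IsLocalClifford U h c Γ) {x : M} (hx : x ∈ U) {v w : E}
    (hvw : h x v w = 0) : c x v * c x w = -(c x w * c x v) := by
  have h1 := H.polarization hx v w
  rw [hvw, mul_zero, zero_smul, neg_zero] at h1
  exact eq_neg_of_add_eq_zero_left h1

theorem mul_self (H : IsLocalClifford U h c Γ) {x : M} (hx : x ∈ U) (v : E) :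
    c x v * c x v = -(h x v v • (1 : F →L[ℝ] F)) := by
  ext s; exact H.c_sq x hx v s

/-- The vectors in the kernel are orthogonal to all vectors. -/
theorem eq_zero_of_self (H : IsLocalClifford U h c Γ) [Nontrivial F] {x : M} (hx : x ∈ U) {v : E}
    (hv : h x v v = 0) (w : E) : h x v w = 0 := by
  have h1 := H.polarization hx v w
  rw [H.c_ker x hx v hv, zero_mul, mul_zero, add_zero, eq_comm, neg_eq_zero, smul_eq_zero] at h1
  rcases h1 with h1 | h1
  · simpa using h1
  · obtain ⟨s, hs⟩ := exists_ne (0 : F)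
    exact absurd (DFunLike.congr_fun h1 s) hs

end IsLocalClifford

/-- An orthogonal frame of `k` sections over a neighbourhood of `y`, together with an antilinear
endomorphism of the Clifford module that is nonzero at `y` and commutes with the action of the
frame. -/
def HasFrame (U₀ : Set M) (h : M → E →L[ℝ] E →L[ℝ] ℝ) (c : M → E →L[ℝ] F →L[ℝ] F) (y : M)
    (k : ℕ) : Prop :=
  ∃ U : Set M, IsOpen U ∧ y ∈ U ∧ U ⊆ U₀ ∧ ∃ (f : Fin k → M → E) (lam : M → F →L[ℝ] F),
    (∀ i, ContMDiffOn 𝓘(ℝ, E) 𝓘(ℝ, E) ∞ (f i) U) ∧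
    (∀ x ∈ U, ∀ i j, i ≠ j → h x (f i x) (f j x) = 0) ∧
    (∀ x ∈ U, ∀ i, h x (f i x) (f i x) ≠ 0) ∧
    ContMDiffOn 𝓘(ℝ, E) 𝓘(ℝ, F →L[ℝ] F) ∞ lam U ∧
    (∀ x ∈ U, ∀ s, lam x (Complex.I • s) = -(Complex.I • lam x s)) ∧
    (∀ x ∈ U, ∀ i, c x (f i x) * lam x = lam x * c x (f i x)) ∧ lam y ≠ 0

/-- The empty frame, with a conjugation followed by a rank one operator as the conjugate linear
map. -/
theorem hasFrame_zero (hU : IsOpen U) {y : M} (hy : y ∈ U) [Nontrivial F] : HasFrame U h c y 0 := by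
  obtain ⟨e, he⟩ := exists_ne (0 : F)
  obtain ⟨χ, -, hχ⟩ := exists_dual_vector'' ℂ e
  let J : F →L[ℝ] F :=
    (ContinuousLinearMap.toSpanSingleton ℂ e).restrictScalars ℝ ∘L
      (Complex.conjCLE : ℂ →L[ℝ] ℂ) ∘L χ.restrictScalars ℝ
  have hJ : ∀ s, J s = (starRingEnd ℂ (χ s)) • e := fun s => rfl
  refine ⟨U, hU, hy, subset_rfl, fun i => i.elim0, fun _ => J, fun i => i.elim0,
    fun x _ i => i.elim0, fun x _ i => i.elim0, contMDiffOn_const, fun x _ s => ?_,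
    fun x _ i => i.elim0, fun h0 => ?_⟩
  · rw [hJ, hJ, map_smul, smul_eq_mul, map_mul, Complex.conj_I, neg_mul, neg_smul, mul_smul]
  · have h1 := DFunLike.congr_fun h0 e
    rw [hJ, hχ] at h1
    simp [he] at h1

/-- Averaging extends the frame by a section orthogonal to it. -/
theorem HasFrame.succ (H : IsLocalClifford U h c Γ) {y : M} {k : ℕ}
    (W : Submodule ℝ E) (hW : ∀ v, h y v v = 0 → v ∈ W) [FiniteDimensional ℝ (E ⧸ W)]
    (hk : k < finrank ℝ (E ⧸ W)) (hf : HasFrame U h c y k) : HasFrame U h c y (k + 1) := by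
  obtain ⟨U', hU', hy, hsub, f, lam, hfs, hort, hne, hls, hanti, hcomm, hl⟩ := hf
  obtain ⟨v, hv⟩ : ∃ v : E, W.mkQ v ∉ Submodule.span ℝ (Set.range fun i => W.mkQ (f i y)) := by
    have h1 : Submodule.span ℝ (Set.range fun i => W.mkQ (f i y)) ≠ ⊤ := by
      intro h2
      have h3 := finrank_range_le_card (R := ℝ) fun i => W.mkQ (f i y)
      rw [Set.finrank, h2, finrank_top, Fintype.card_fin] at h3
      omega
    obtain ⟨q, hq⟩ := not_forall.1 (mt Submodule.eq_top_iff'.2 h1)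
    obtain ⟨v, rfl⟩ := W.mkQ_surjective q
    exact ⟨v, hq⟩
  have hh : ∀ {a b : M → E}, ContMDiffOn 𝓘(ℝ, E) 𝓘(ℝ, E) ∞ a U' →
      ContMDiffOn 𝓘(ℝ, E) 𝓘(ℝ, E) ∞ b U' →
      ContMDiffOn 𝓘(ℝ, E) 𝓘(ℝ, ℝ) ∞ (fun x => h x (a x) (b x)) U' := fun ha hb =>
    ((H.h_smooth.mono hsub).clm_apply ha).clm_apply hb
  have hinv : ∀ {a : M → ℝ} {V : Set M}, ContMDiffOn 𝓘(ℝ, E) 𝓘(ℝ, ℝ) ∞ a V →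
      (∀ x ∈ V, a x ≠ 0) → ContMDiffOn 𝓘(ℝ, E) 𝓘(ℝ, ℝ) ∞ (fun x => (a x)⁻¹) V :=
    fun ha h0 x hx => (contDiffAt_inv ℝ (h0 x hx)).contMDiffAt.comp_contMDiffWithinAt x (ha x hx)
  set w : M → E := fun x => v - ∑ i, (h x v (f i x) * (h x (f i x) (f i x))⁻¹) • f i x with hw
  have hws : ContMDiffOn 𝓘(ℝ, E) 𝓘(ℝ, E) ∞ w U' := by
    refine contMDiffOn_const.sub ?_
    refine contMDiffOn_finsetSum fun i _ => ?_
    exact ((hh contMDiffOn_const (hfs i)).mul (hinv (hh (hfs i) (hfs i)) fun x hx => hne x hx i)).smul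
      (hfs i)
  have hwort : ∀ x ∈ U', ∀ j, h x (w x) (f j x) = 0 := by
    intro x hx j
    simp only [hw, map_sub, map_sum, map_smul, sub_apply,
      sum_apply, smul_apply]
    rw [Finset.sum_eq_single j (fun i _ hij => by rw [hort x hx i j hij, smul_zero])
      (fun h0 => absurd (Finset.mem_univ j) h0), smul_eq_mul, mul_assoc,
      inv_mul_cancel₀ (hne x hx j), mul_one, sub_self]
  have hwy : h y (w y) (w y) ≠ 0 := by
    intro h0
    have h1 : W.mkQ (w y) = 0 := by
      rw [← LinearMap.mem_ker, W.ker_mkQ]; exact hW _ h0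
    refine hv ?_
    simp only [hw, map_sub, map_sum, map_smul] at h1
    rw [sub_eq_zero.1 h1]
    exact Submodule.sum_mem _ fun i _ => Submodule.smul_mem _ _ (Submodule.subset_span ⟨i, rfl⟩)
  set V : Set M := U' ∩ {x | h x (w x) (w x) ≠ 0} with hV
  have hVo : IsOpen V := (hh hws hws).continuousOn.isOpen_inter_preimage hU' isOpen_ne
  have hVU : V ⊆ U' := Set.inter_subset_left
  have hcs : ContMDiffOn 𝓘(ℝ, E) 𝓘(ℝ, F →L[ℝ] F) ∞ (fun x => c x (w x)) V :=
    ((H.c_smooth.mono hsub).clm_apply hws).mono hVU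
  -- one of `lam` and `lam ∘ Γ ∘ c(w)` has nonzero average at `y`
  obtain ⟨l, hls', hanti', hcomm', hl'⟩ : ∃ l : M → F →L[ℝ] F,
      ContMDiffOn 𝓘(ℝ, E) 𝓘(ℝ, F →L[ℝ] F) ∞ l V ∧
      (∀ x ∈ V, ∀ s, l x (Complex.I • s) = -(Complex.I • l x s)) ∧
      (∀ x ∈ V, ∀ i, c x (f i x) * l x = l x * c x (f i x)) ∧
      cliffordAverage (h y (w y) (w y)) (c y (w y)) (l y) ≠ 0 := by
    by_cases h0 : cliffordAverage (h y (w y) (w y)) (c y (w y)) (lam y) = 0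
    · refine ⟨fun x => lam x * Γ x * c x (w x), ?_, fun x hx s => ?_, fun x hx i => ?_, ?_⟩
      · exact ((hls.mono hVU).clm_comp (H.Γ_smooth.mono (hVU.trans hsub))).clm_comp hcs
      · show lam x (Γ x (c x (w x) (Complex.I • s))) = -(Complex.I • lam x (Γ x (c x (w x) s)))
        rw [H.c_I x (hsub hx.1), H.Γ_I x (hsub hx.1), hanti x hx.1]
      · refine commute_mul_grading (H.anticommute (hsub hx.1) ?_) ?_ (hcomm x hx.1 i)
        · rw [H.h_symm x (hsub hx.1)]; exact hwort x hx.1 i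
        · ext s
          have h1 := H.c_odd x (hsub hx.1) (f i x) s
          show c x (f i x) (Γ x s) = -(Γ x (c x (f i x) s))
          rw [h1, neg_neg]
      · exact cliffordAverage_grading_ne_zero hwy (H.mul_self (hsub hy) _)
          (by ext s; exact H.Γ_sq y (hsub hy) s) (by ext s; exact H.c_odd y (hsub hy) _ s) hl h0
    · exact ⟨lam, hls.mono hVU, fun x hx => hanti x hx.1, fun x hx => hcomm x hx.1, h0⟩
  refine ⟨V, hVo, ⟨hy, hwy⟩, hVU.trans hsub, Fin.cons w f,
    fun x => cliffordAverage (h x (w x) (w x)) (c x (w x)) (l x), ?_, ?_, ?_, ?_, ?_, ?_, hl'⟩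
  · intro i
    refine Fin.cases ?_ (fun i => ?_) i
    · exact hws.mono hVU
    · exact (hfs i).mono hVU
  · intro x hx i j
    refine Fin.cases ?_ (fun i => ?_) i
    · refine Fin.cases (fun h0 => absurd rfl h0) (fun j _ => ?_) j
      exact hwort x hx.1 j
    · refine Fin.cases (fun _ => ?_) (fun j hij => ?_) j
      · rw [H.h_symm x (hsub hx.1)]; exact hwort x hx.1 i
      · exact hort x hx.1 i j fun h0 => hij (congrArg Fin.succ h0)
  · intro x hx i
    refine Fin.cases ?_ (fun i => ?_) i
    · exact hx.2
    · exact hne x hx.1 i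
  · show ContMDiffOn 𝓘(ℝ, E) 𝓘(ℝ, F →L[ℝ] F) ∞ (fun x => (1 / 2 : ℝ) •
      (l x - (h x (w x) (w x))⁻¹ • ((c x (w x)).comp (l x)).comp (c x (w x)))) V
    have hhalf : ContMDiffOn 𝓘(ℝ, E) 𝓘(ℝ, ℝ) ∞ (fun _ : M => (1 / 2 : ℝ)) V := contMDiffOn_const
    refine hhalf.smul (hls'.sub ?_)
    exact (hinv ((hh hws hws).mono hVU) fun x hx => hx.2).smul ((hcs.clm_comp hls').clm_comp hcs)
  · intro x hx s
    have h1 := anticommute_cliffordAverage (R := F →L[ℝ] F) (q := h x (w x) (w x))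
      (a := c x (w x)) (l := l x)
      (b := (Complex.I • ContinuousLinearMap.id ℂ F).restrictScalars ℝ)
      (by ext s; exact (H.c_I x (hsub hx.1) _ s).symm)
      (by ext s; exact neg_eq_iff_eq_neg.1 (hanti' x hx s).symm)
    have h2 := DFunLike.congr_fun h1 s
    exact neg_eq_iff_eq_neg.1 h2.symm
  · intro x hx i
    refine Fin.cases ?_ (fun i => ?_) i
    · exact mul_cliffordAverage hx.2 (H.mul_self (hsub hx.1) _) _
    · refine commute_cliffordAverage (H.anticommute (hsub hx.1) ?_) (hcomm' x hx i)
      show h x (f i x) (w x) = 0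
      rw [H.h_symm x (hsub hx.1)]; exact hwort x hx.1 i

/-- A local antilinear endomorphism that commutes with the Clifford action. -/
theorem IsLocalClifford.exists_section (H : IsLocalClifford U h c Γ) (hU : IsOpen U) {y : M}
    (hy : y ∈ U) [Nontrivial F] (W : M → Submodule ℝ E) (hW : ∀ x ∈ U, ∀ v, h x v v = 0 ↔ v ∈ W x)
    (n : ℕ) (hfd : ∀ x ∈ U, FiniteDimensional ℝ (E ⧸ W x))
    (hn : ∀ x ∈ U, finrank ℝ (E ⧸ W x) = n) :
    ∃ V : Set M, IsOpen V ∧ y ∈ V ∧ V ⊆ U ∧ ∃ lam : M → F →L[ℝ] F,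
      ContMDiffOn 𝓘(ℝ, E) 𝓘(ℝ, F →L[ℝ] F) ∞ lam V ∧
      (∀ x ∈ V, ∀ s, lam x (Complex.I • s) = -(Complex.I • lam x s)) ∧
      (∀ x ∈ V, ∀ v s, lam x (c x v s) = c x v (lam x s)) ∧ lam y ≠ 0 := by
  have hall : ∀ k ≤ n, HasFrame U h c y k := by
    intro k
    induction k with
    | zero => exact fun _ => hasFrame_zero hU hy
    | succ k ih =>
      intro hk
      haveI := hfd y hy
      exact HasFrame.succ H (W y) (fun v => (hW y hy v).1) (by rw [hn y hy]; omega)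
        (ih (by omega))
  obtain ⟨V, hVo, hyV, hsub, f, lam, -, hort, hne, hls, hanti, hcomm, hl⟩ := hall n le_rfl
  refine ⟨V, hVo, hyV, hsub, lam, hls, hanti, fun x hx v s => ?_, hl⟩
  haveI := hfd x (hsub hx)
  have hlin : LinearIndependent ℝ fun i => (W x).mkQ (f i x) := by
    rw [Fintype.linearIndependent_iff]
    intro a ha j
    have h1 : ∑ i, a i • f i x ∈ W x := by
      rw [← (W x).ker_mkQ, LinearMap.mem_ker, map_sum, ← ha]
      exact Finset.sum_congr rfl fun i _ => map_smul _ _ _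
    have h2 := H.eq_zero_of_self (hsub hx) ((hW x (hsub hx) _).2 h1) (f j x)
    simp only [map_sum, map_smul, sum_apply,
      smul_apply] at h2
    rw [Finset.sum_eq_single j (fun i _ hij => by rw [hort x hx i j hij, smul_zero])
      (fun h0 => absurd (Finset.mem_univ j) h0), smul_eq_mul] at h2
    exact (mul_eq_zero.1 h2).resolve_right (hne x hx j)
  have hspan := hlin.span_eq_top_of_card_eq_finrank' (by rw [Fintype.card_fin, hn x (hsub hx)])
  have hv : (W x).mkQ v ∈ Submodule.span ℝ (Set.range fun i => (W x).mkQ (f i x)) := by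
    rw [hspan]; trivial
  obtain ⟨a, ha⟩ := (Submodule.mem_span_range_iff_exists_fun ℝ).1 hv
  have h1 : v - ∑ i, a i • f i x ∈ W x := by
    rw [← (W x).ker_mkQ, LinearMap.mem_ker, map_sub, map_sum, ← ha, sub_eq_zero]
    exact Finset.sum_congr rfl fun i _ => (map_smul _ _ _).symm
  have h2 := H.c_ker x (hsub hx) _ ((hW x (hsub hx) _).2 h1)
  rw [map_sub, sub_eq_zero, map_sum] at h2
  rw [h2]
  simp only [map_smul, sum_apply, smul_apply, map_sum]
  exact Finset.sum_congr rfl fun i _ => congrArg _ (DFunLike.congr_fun (hcomm x hx i) s).symm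

end LocalSections

/-- In local trivializations, smoothness of a section of a bundle of linear maps is smoothness of
an operator valued function. -/
theorem contMDiffOn_inCoordinates {E : Type*} [NormedAddCommGroup E] [NormedSpace ℝ E]
    {M : Type*} [TopologicalSpace M] [ChartedSpace E M]
    {F₁ F₂ : Type*} [NormedAddCommGroup F₁] [NormedSpace ℝ F₁] [NormedAddCommGroup F₂]
    [NormedSpace ℝ F₂] {E₁ E₂ : M → Type*} [TopologicalSpace (TotalSpace F₁ E₁)]
    [∀ x, AddCommGroup (E₁ x)] [∀ x, Module ℝ (E₁ x)] [∀ x, TopologicalSpace (E₁ x)]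
    [FiberBundle F₁ E₁] [VectorBundle ℝ F₁ E₁] [ContMDiffVectorBundle ∞ F₁ E₁ 𝓘(ℝ, E)]
    [TopologicalSpace (TotalSpace F₂ E₂)]
    [∀ x, AddCommGroup (E₂ x)] [∀ x, Module ℝ (E₂ x)] [∀ x, TopologicalSpace (E₂ x)]
    [∀ x, IsTopologicalAddGroup (E₂ x)] [∀ x, ContinuousSMul ℝ (E₂ x)]
    [FiberBundle F₂ E₂] [VectorBundle ℝ F₂ E₂] [ContMDiffVectorBundle ∞ F₂ E₂ 𝓘(ℝ, E)]
    {ϕ : ∀ x, E₁ x →L[ℝ] E₂ x} {U : Set M} (hU : IsOpen U) (y : M)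
    (h₁ : U ⊆ (trivializationAt F₁ E₁ y).baseSet) (h₂ : U ⊆ (trivializationAt F₂ E₂ y).baseSet) :
    ContMDiffOn 𝓘(ℝ, E) (𝓘(ℝ, E).prod 𝓘(ℝ, F₁ →L[ℝ] F₂)) ∞ (fun x =>
      TotalSpace.mk' (F₁ →L[ℝ] F₂) (E := fun x : M => E₁ x →L[ℝ] E₂ x) x (ϕ x)) U ↔
    ContMDiffOn 𝓘(ℝ, E) 𝓘(ℝ, F₁ →L[ℝ] F₂) ∞ (fun x =>
      ContinuousLinearMap.inCoordinates F₁ E₁ F₂ E₂ y x y x (ϕ x)) U :=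
  Trivialization.contMDiffOn_section_iff (IB := 𝓘(ℝ, E)) (n := ∞)
    (trivializationAt (F₁ →L[ℝ] F₂) (fun x : M => E₁ x →L[ℝ] E₂ x) y) hU
    (fun _ hx => ⟨h₁ hx, h₂ hx⟩)

section Spinors

open Module

variable {m : ℕ} {K : CompactGroup m} {ς : ℝ}
  {E : Type*} [NormedAddCommGroup E] [NormedSpace ℝ E]
  {M : Type*} [TopologicalSpace M] [ChartedSpace E M] [IsManifold 𝓘(ℝ, E) ∞ M]
  [MulAction (K.LG ς) M]
  {ℓ : Fin m → ℤ} {Ghat : Type*} [Group Ghat] [TopologicalSpace Ghat]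
  [ChartedSpace (K.Lg × ℝ) Ghat] {P : K.LevelExtension ς ℓ Ghat}
  {F : Type*} [NormedAddCommGroup F] [NormedSpace ℂ F]
  {S : M → Type*} [TopologicalSpace (TotalSpace F S)]
  [∀ x, AddCommGroup (S x)] [∀ x, Module ℂ (S x)] [∀ x, TopologicalSpace (S x)]
  [∀ x, IsTopologicalAddGroup (S x)] [∀ x, ContinuousSMul ℝ (S x)]
  [FiberBundle F S] [VectorBundle ℂ F S] [VectorBundle ℝ F S] [ContMDiffVectorBundle ∞ F S 𝓘(ℝ, E)]
  [MulAction Ghat (TotalSpace F S)]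
  {h : ∀ x : M, TangentSpace 𝓘(ℝ, E) x →L[ℝ] TangentSpace 𝓘(ℝ, E) x →L[ℝ] ℝ}
  {metric : ContMDiffRiemannianMetric 𝓘(ℝ, E) ∞ F S}
  {grading : ∀ x : M, S x →L[ℝ] S x}
  {c : ∀ x : M, TangentSpace 𝓘(ℝ, E) x →L[ℝ] S x →L[ℝ] S x}

omit [VectorBundle ℂ F S] in
set_option synthInstance.maxHeartbeats 200000 in
theorem contMDiffOn_inCoordinates_clifford (y : M) {U : Set M} (hU : IsOpen U)
    (h₁ : U ⊆ (trivializationAt E (TangentSpace 𝓘(ℝ, E) : M → Type _) y).baseSet)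
    (h₂ : U ⊆ (trivializationAt F S y).baseSet)
    (hc : ContMDiff 𝓘(ℝ, E) (𝓘(ℝ, E).prod 𝓘(ℝ, E →L[ℝ] F →L[ℝ] F)) ∞
    fun x => TotalSpace.mk' (E →L[ℝ] F →L[ℝ] F)
      (E := fun x : M => TangentSpace 𝓘(ℝ, E) x →L[ℝ] S x →L[ℝ] S x) x (c x)) :
    ContMDiffOn 𝓘(ℝ, E) 𝓘(ℝ, E →L[ℝ] F →L[ℝ] F) ∞ (fun x =>
    ContinuousLinearMap.inCoordinates E (TangentSpace 𝓘(ℝ, E) : M → Type _) (F →L[ℝ] F)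
      (fun x : M => S x →L[ℝ] S x) y x y x (c x)) U :=
  (contMDiffOn_inCoordinates hU y h₁ (by exact fun _ hx => ⟨h₂ hx, h₂ hx⟩)).1 hc.contMDiffOn

set_option synthInstance.maxHeartbeats 200000 in
theorem contMDiffOn_inCoordinates_twoTensor (y : M) {U : Set M} (hU : IsOpen U)
    (h₁ : U ⊆ (trivializationAt E (TangentSpace 𝓘(ℝ, E) : M → Type _) y).baseSet)
    (hc : IsSmoothTwoTensor h) :
    ContMDiffOn 𝓘(ℝ, E) 𝓘(ℝ, E →L[ℝ] E →L[ℝ] ℝ) ∞ (fun x =>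
    ContinuousLinearMap.inCoordinates E (TangentSpace 𝓘(ℝ, E) : M → Type _) (E →L[ℝ] ℝ)
      (fun x : M => TangentSpace 𝓘(ℝ, E) x →L[ℝ] ℝ) y x y x (h x)) U :=
  (contMDiffOn_inCoordinates hU y h₁ (by exact fun _ hx => ⟨h₁ hx, trivial⟩)).1 hc.contMDiffOn

/-- Tangent vectors of length zero act trivially, since their Clifford action is skew. -/
theorem IsSpinorBundle.c_eq_zero (hS : IsSpinorBundle K ς P h metric grading c) {x : M}
    {v : TangentSpace 𝓘(ℝ, E) x} (hv : h x v v = 0) (s : S x) : c x v s = 0 := by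
  by_contra h0
  have h1 := metric.pos x _ h0
  rw [hS.c_skew, hS.c_sq, hv, zero_smul, neg_zero, map_zero, neg_zero] at h1
  exact lt_irrefl _ h1

omit [ContMDiffVectorBundle ∞ F S 𝓘(ℝ, E)] [IsManifold 𝓘(ℝ, E) ∞ M]
  [∀ x, IsTopologicalAddGroup (S x)] [∀ x, ContinuousSMul ℝ (S x)] in
theorem continuousLinearMapAt_I_smul (e : Trivialization F (π F S)) [MemTrivializationAtlas e]
    {x : M} (hx : x ∈ e.baseSet) (s : S x) :
    e.continuousLinearMapAt ℝ x (Complex.I • s) = Complex.I • e.continuousLinearMapAt ℝ x s := by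
  have h1 : ∀ s, e.continuousLinearMapAt ℝ x s = (e ⟨x, s⟩).2 := fun s => by
    exact e.continuousLinearMapAt_apply_of_mem ℝ hx s
  rw [h1, h1]
  exact (e.linear ℂ hx).map_smul _ _

omit [ContMDiffVectorBundle ∞ F S 𝓘(ℝ, E)] [IsManifold 𝓘(ℝ, E) ∞ M]
  [∀ x, IsTopologicalAddGroup (S x)] [∀ x, ContinuousSMul ℝ (S x)] in
theorem symmL_I_smul (e : Trivialization F (π F S)) [MemTrivializationAtlas e]
    {x : M} (hx : x ∈ e.baseSet) (s : F) :
    e.symmL ℝ x (Complex.I • s) = Complex.I • e.symmL ℝ x s := by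
  have h1 := continuousLinearMapAt_I_smul e hx (e.symmL ℝ x s)
  rw [e.continuousLinearMapAt_symmL hx] at h1
  rw [← h1, e.symmL_continuousLinearMapAt hx]

theorem IsSpinorBundle.finrank_quotient [FiniteDimensional ℂ F]
    (hS : IsSpinorBundle K ς P h metric grading c) (x : M) :
    finrank ℂ F ^ 2 = 2 ^ finrank ℝ (E ⧸ (vert K ς x : Submodule ℝ E)) := by
  have h1 : finrank ℂ (S x) = finrank ℂ F :=
    ((trivializationAt F S x).continuousLinearEquivAt ℂ x
      (FiberBundle.mem_baseSet_trivializationAt' x)).toLinearEquiv.finrank_eq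
  rw [← h1]
  exact hS.rank x

theorem IsSpinorBundle.nontrivial [FiniteDimensional ℂ F]
    (hS : IsSpinorBundle K ς P h metric grading c) (x : M) : Nontrivial F := by
  refine Module.nontrivial_of_finrank_pos (R := ℂ) (Nat.pos_of_ne_zero fun h0 => ?_)
  have h1 := hS.finrank_quotient x
  rw [h0, zero_pow two_ne_zero] at h1
  exact (pow_ne_zero _ two_ne_zero) h1.symm

/-- The anti-canonical line bundle has local sections that are nonzero at a given point. -/
theorem IsSpinorBundle.exists_section [FiniteDimensional ℂ F]
    (hS : IsSpinorBundle K ς P h metric grading c) (y : M) :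
    ∃ (U : Set M) (lam : ∀ x : M, S x →L[ℝ] S x), IsSectionOn (F := F) c U lam ∧ y ∈ U ∧
      ∃ s, lam y s ≠ 0 := by
  haveI := hS.nontrivial y
  set eS := trivializationAt F S y with heS
  set eT := trivializationAt E (TangentSpace 𝓘(ℝ, E) : M → Type _) y with heT
  set U : Set M := eS.baseSet ∩ eT.baseSet with hU
  have hUo : IsOpen U := eS.open_baseSet.inter eT.open_baseSet
  have hyU : y ∈ U := ⟨FiberBundle.mem_baseSet_trivializationAt' y,
    FiberBundle.mem_baseSet_trivializationAt' y⟩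
  let hh : M → E →L[ℝ] E →L[ℝ] ℝ := fun x =>
    ContinuousLinearMap.inCoordinates E (TangentSpace 𝓘(ℝ, E) : M → Type _) (E →L[ℝ] ℝ)
      (fun x : M => TangentSpace 𝓘(ℝ, E) x →L[ℝ] ℝ) y x y x (h x)
  let cc : M → E →L[ℝ] F →L[ℝ] F := fun x =>
    ContinuousLinearMap.inCoordinates E (TangentSpace 𝓘(ℝ, E) : M → Type _) (F →L[ℝ] F)
      (fun x : M => S x →L[ℝ] S x) y x y x (c x)
  let Γ : M → F →L[ℝ] F := fun x => ContinuousLinearMap.inCoordinates F S F S y x y x (grading x)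
  have hh_apply : ∀ x ∈ U, ∀ v w, hh x v w = h x (eT.symmL ℝ x v) (eT.symmL ℝ x w) := by
    intro x hx v w
    refine (inCoordinates_apply_eq₂ (E₃ := Bundle.Trivial M ℝ) hx.2 hx.2 (by simp)).trans ?_
    rw [← eT.symmL_apply (R := ℝ) hx.2, ← eT.symmL_apply (R := ℝ) hx.2]
    simp [heT]
  have cc_apply : ∀ x ∈ U, ∀ v s, cc x v s =
      eS.continuousLinearMapAt ℝ x (c x (eT.symmL ℝ x v) (eS.symmL ℝ x s)) := by
    intro x hx v s
    refine (inCoordinates_apply_eq₂ hx.2 hx.1 hx.1).trans ?_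
    rw [← eT.symmL_apply (R := ℝ) hx.2, ← eS.symmL_apply (R := ℝ) hx.1]
    rfl
  have Γ_apply : ∀ x, ∀ s, Γ x s =
      eS.continuousLinearMapAt ℝ x (grading x (eS.symmL ℝ x s)) := fun x s => rfl
  have H : IsLocalClifford U hh cc Γ :=
    { h_smooth := contMDiffOn_inCoordinates_twoTensor y hUo (fun _ hx => hx.2) hS.h_smooth
      c_smooth := contMDiffOn_inCoordinates_clifford y hUo (fun _ hx => hx.2) (fun _ hx => hx.1)
        hS.c_smooth
      Γ_smooth := (contMDiffOn_inCoordinates hUo y (fun _ hx => hx.1) (fun _ hx => hx.1)).1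
        hS.grading_smooth.contMDiffOn
      h_symm := fun x hx v w => by rw [hh_apply x hx, hh_apply x hx, hS.h_symm]
      Γ_I := fun x hx s => by
        rw [Γ_apply, Γ_apply, symmL_I_smul eS hx.1, hS.grading_I,
          continuousLinearMapAt_I_smul eS hx.1]
      Γ_sq := fun x hx s => by
        rw [Γ_apply, Γ_apply, eS.symmL_continuousLinearMapAt hx.1, hS.grading_sq,
          eS.continuousLinearMapAt_symmL hx.1]
      c_I := fun x hx v s => by
        rw [cc_apply x hx, cc_apply x hx, symmL_I_smul eS hx.1, hS.c_I,
          continuousLinearMapAt_I_smul eS hx.1]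
      c_odd := fun x hx v s => by
        rw [cc_apply x hx, cc_apply x hx, Γ_apply, Γ_apply, eS.symmL_continuousLinearMapAt hx.1,
          eS.symmL_continuousLinearMapAt hx.1, hS.c_odd, map_neg]
      c_sq := fun x hx v s => by
        rw [cc_apply x hx, cc_apply x hx, hh_apply x hx, eS.symmL_continuousLinearMapAt hx.1,
          hS.c_sq, map_neg, map_smul, eS.continuousLinearMapAt_symmL hx.1]
      c_ker := fun x hx v hv => by
        ext s
        rw [hh_apply x hx] at hv
        rw [cc_apply x hx, hS.c_eq_zero hv, map_zero]
        rfl }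
  let W : M → Submodule ℝ E := fun x =>
    (vert K ς x : Submodule ℝ E).comap (eT.symmL ℝ x : E →L[ℝ] E).toLinearMap
  have hW : ∀ x ∈ U, ∀ v, hh x v v = 0 ↔ v ∈ W x := fun x hx v => by
    rw [hh_apply x hx]
    exact hS.h_ker x _
  have hequiv : ∀ x ∈ U, Nonempty ((E ⧸ W x) ≃ₗ[ℝ] E ⧸ (vert K ς x : Submodule ℝ E)) := by
    intro x hx
    let e : E ≃ₗ[ℝ] E := (eT.continuousLinearEquivAt ℝ x hx.2).symm.toLinearEquiv
    have he : ∀ v, e v = eT.symmL ℝ x v := fun v => by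
      exact congrFun (eT.symm_continuousLinearEquivAt_eq (R := ℝ) hx.2) v
    refine ⟨Submodule.Quotient.equiv _ _ e ?_⟩
    ext v
    constructor
    · rintro ⟨w, hw, rfl⟩
      exact (he w).symm ▸ hw
    · intro hv
      refine ⟨e.symm v, ?_, e.apply_symm_apply v⟩
      show eT.symmL ℝ x (e.symm v) ∈ vert K ς x
      rw [← he, e.apply_symm_apply]
      exact hv
  obtain ⟨V, hVo, hyV, hVU, l, hl, hanti, hcomm, hl0⟩ := H.exists_section hUo hyU W hW
    (finrank ℝ (E ⧸ (vert K ς y : Submodule ℝ E)))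
    (fun x hx => by
      obtain ⟨e⟩ := hequiv x hx
      haveI := hS.finiteDimensional_quotient x
      exact Module.Finite.equiv e.symm)
    (fun x hx => by
      obtain ⟨e⟩ := hequiv x hx
      rw [e.finrank_eq]
      exact Nat.pow_right_injective le_rfl
        ((hS.finrank_quotient x).symm.trans (hS.finrank_quotient y)))
  refine ⟨V, fun x => (eS.symmL ℝ x).comp ((l x).comp (eS.continuousLinearMapAt ℝ x)),
    ⟨hVo, fun x hx => ⟨fun s => ?_, fun v s => ?_⟩, ?_⟩, hyV, ?_⟩
  · have hxU := hVU hx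
    show eS.symmL ℝ x (l x (eS.continuousLinearMapAt ℝ x (Complex.I • s))) =
      -(Complex.I • eS.symmL ℝ x (l x (eS.continuousLinearMapAt ℝ x s)))
    rw [continuousLinearMapAt_I_smul eS hxU.1, hanti x hx, map_neg, symmL_I_smul eS hxU.1]
  · have hxU := hVU hx
    show eS.symmL ℝ x (l x (eS.continuousLinearMapAt ℝ x (c x v s))) =
      c x v (eS.symmL ℝ x (l x (eS.continuousLinearMapAt ℝ x s)))
    have h1 := hcomm x hx (eT.continuousLinearMapAt ℝ x v) (eS.continuousLinearMapAt ℝ x s)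
    rw [cc_apply x hxU, cc_apply x hxU, eT.symmL_continuousLinearMapAt hxU.2,
      eS.symmL_continuousLinearMapAt hxU.1] at h1
    rw [h1, eS.symmL_continuousLinearMapAt hxU.1]
  · refine (contMDiffOn_inCoordinates hVo y (fun _ hx => (hVU hx).1) (fun _ hx => (hVU hx).1)).2
      (hl.congr fun x hx => ?_)
    ext s
    show eS.continuousLinearMapAt ℝ x (eS.symmL ℝ x (l x (eS.continuousLinearMapAt ℝ x
      (eS.symmL ℝ x s)))) = l x s
    rw [eS.continuousLinearMapAt_symmL (hVU hx).1, eS.continuousLinearMapAt_symmL (hVU hx).1]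
  · by_contra h0
    simp only [not_exists, not_not] at h0
    refine hl0 (ContinuousLinearMap.ext fun s => ?_)
    have h1 := congrArg (eS.continuousLinearMapAt ℝ y) (h0 (eS.symmL ℝ y s))
    rw [map_zero] at h1
    have h2 : eS.continuousLinearMapAt ℝ y (eS.symmL ℝ y (l y (eS.continuousLinearMapAt ℝ y
      (eS.symmL ℝ y s)))) = 0 := h1
    rwa [eS.continuousLinearMapAt_symmL hyU.1, eS.continuousLinearMapAt_symmL hyU.1] at h2

end Spinors

/-! ### Translates of sections of the anti-canonical line bundle -/

/-- An operator valued function on a finite-dimensional space is smooth if its values on all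
vectors are. -/
theorem contMDiffAt_clm_of_apply {E : Type*} [NormedAddCommGroup E] [NormedSpace ℝ E]
    {M : Type*} [TopologicalSpace M] [ChartedSpace E M]
    {F : Type*} [NormedAddCommGroup F] [NormedSpace ℝ F] [FiniteDimensional ℝ F]
    {f : M → F →L[ℝ] F} {x : M}
    (hf : ∀ v, ContMDiffAt 𝓘(ℝ, E) 𝓘(ℝ, F) ∞ (fun y => f y v) x) :
    ContMDiffAt 𝓘(ℝ, E) 𝓘(ℝ, F →L[ℝ] F) ∞ f x := by
  let b := Module.finBasis ℝ F
  let e : F ≃L[ℝ] (Fin (Module.finrank ℝ F) → ℝ) := b.equivFun.toContinuousLinearEquiv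
  let Ψ : (Fin (Module.finrank ℝ F) → F) →L[ℝ] (F →L[ℝ] F) :=
    ∑ i, (ContinuousLinearMap.smulRightL ℝ F F
      ((ContinuousLinearMap.proj (R := ℝ) (φ := fun _ : Fin (Module.finrank ℝ F) => ℝ) i).comp
        (e : F →L[ℝ] (Fin (Module.finrank ℝ F) → ℝ)))).comp
      (ContinuousLinearMap.proj (R := ℝ) (φ := fun _ : Fin (Module.finrank ℝ F) => F) i)
  have hΨ : f = fun y => Ψ fun i => f y (b i) := by
    funext y
    ext v
    simp only [Ψ, sum_apply, ContinuousLinearMap.comp_apply,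
      ContinuousLinearMap.proj_apply]
    conv_lhs => rw [← b.sum_equivFun v, map_sum]
    exact Finset.sum_congr rfl fun i _ => map_smul (f y) (b.equivFun v i) (b i)
  rw [hΨ]
  exact Ψ.contDiff.contMDiff.contMDiffAt.comp x (contMDiffAt_pi_space.2 fun i => hf (b i))

theorem contMDiff_apply_left {V W : Type*} [NormedAddCommGroup V] [NormedSpace ℝ V]
    [NormedAddCommGroup W] [NormedSpace ℝ W] {H : Type*} [TopologicalSpace H]
    {J : ModelWithCorners ℝ V H} {G N : Type*} [TopologicalSpace G] [ChartedSpace W G]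
    [TopologicalSpace N] [ChartedSpace H N] {f : G × N → N}
    (hf : ContMDiff (𝓘(ℝ, W).prod J) J ∞ f) (a : G) : ContMDiff J J ∞ fun x => f (a, x) :=
  hf.comp (contMDiff_const.prodMk contMDiff_id)

section Translate

variable {m : ℕ} {K : CompactGroup m} {ς : ℝ}
  {E : Type*} [NormedAddCommGroup E] [NormedSpace ℝ E]
  {M : Type*} [TopologicalSpace M] [ChartedSpace E M] [IsManifold 𝓘(ℝ, E) ∞ M]
  [MulAction (K.LG ς) M]
  {ℓ : Fin m → ℤ} {Ghat : Type*} [Group Ghat] [TopologicalSpace Ghat]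
  [ChartedSpace (K.Lg × ℝ) Ghat] {P : K.LevelExtension ς ℓ Ghat}
  {F : Type*} [NormedAddCommGroup F] [NormedSpace ℂ F]
  {S : M → Type*} [TopologicalSpace (TotalSpace F S)]
  [∀ x, AddCommGroup (S x)] [∀ x, Module ℂ (S x)] [∀ x, TopologicalSpace (S x)]
  [∀ x, IsTopologicalAddGroup (S x)] [∀ x, ContinuousSMul ℝ (S x)]
  [FiberBundle F S] [VectorBundle ℝ F S] [ContMDiffVectorBundle ∞ F S 𝓘(ℝ, E)]
  [MulAction Ghat (TotalSpace F S)]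
  {h : ∀ x : M, TangentSpace 𝓘(ℝ, E) x →L[ℝ] TangentSpace 𝓘(ℝ, E) x →L[ℝ] ℝ}
  {metric : ContMDiffRiemannianMetric 𝓘(ℝ, E) ∞ F S}
  {grading : ∀ x : M, S x →L[ℝ] S x}
  {c : ∀ x : M, TangentSpace 𝓘(ℝ, E) x →L[ℝ] S x →L[ℝ] S x}

omit [TopologicalSpace M] [TopologicalSpace (TotalSpace F S)] [∀ x, Module ℂ (S x)]
  [∀ x, TopologicalSpace (S x)] [∀ x, IsTopologicalAddGroup (S x)] [NormedSpace ℂ F] in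
theorem mk_toFiber {x : M} {u : TotalSpace F S} (hu : u.proj = x) :
    TotalSpace.mk' F x (toFiber (F := F) x u) = u := by
  subst hu
  simp [toFiber]

theorem IsSpinorBundle.contMDiff_smul (hS : IsSpinorBundle K ς P h metric grading c) (a : Ghat) :
    ContMDiff (𝓘(ℝ, E).prod 𝓘(ℝ, F)) (𝓘(ℝ, E).prod 𝓘(ℝ, F)) ∞ fun u : TotalSpace F S => a • u :=
  contMDiff_apply_left hS.act_smooth a

/-- The map `S_y → S_x` given by the action of `a`, for `x = a y`. -/
def IsSpinorBundle.fibMap (hS : IsSpinorBundle K ς P h metric grading c) (a : Ghat) {y x : M}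
    (hyx : P.proj a • y = x) : S y →L[ℝ] S x where
  toFun s := toFiber (F := F) x (a • TotalSpace.mk' F y s)
  map_add' s t := by subst hyx; exact hS.act_add a y s t
  map_smul' r s := by subst hyx; exact hS.act_smul a y (r : ℂ) s
  cont := by
    refine (FiberBundle.totalSpaceMk_isInducing F S x).continuous_iff.2 ?_
    refine ((hS.contMDiff_smul a).continuous.comp
      (FiberBundle.totalSpaceMk_isInducing F S y).continuous).congr fun s => ?_
    exact (mk_toFiber ((hS.act_proj a _).trans hyx)).symm

theorem IsSpinorBundle.mk_fibMap (hS : IsSpinorBundle K ς P h metric grading c) (a : Ghat) {y x : M}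
    (hyx : P.proj a • y = x) (s : S y) :
    TotalSpace.mk' F x (hS.fibMap a hyx s) = a • TotalSpace.mk' F y s :=
  mk_toFiber ((hS.act_proj a _).trans hyx)

theorem IsSpinorBundle.fibMap_smul (hS : IsSpinorBundle K ς P h metric grading c) (a : Ghat)
    {y x : M} (hyx : P.proj a • y = x) (z : ℂ) (s : S y) :
    hS.fibMap a hyx (z • s) = z • hS.fibMap a hyx s := by
  subst hyx; exact hS.act_smul a y z s

theorem IsSpinorBundle.fibMap_eq (hS : IsSpinorBundle K ς P h metric grading c) {a : Ghat}
    {y x : M} (hyx : P.proj a • y = x) {s : S y} {t : S x}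
    (ht : TotalSpace.mk' F x t = a • TotalSpace.mk' F y s) : hS.fibMap a hyx s = t :=
  TotalSpace.mk_injective x ((hS.mk_fibMap a hyx s).trans ht.symm)

theorem IsSpinorBundle.fibMap_inv (hS : IsSpinorBundle K ς P h metric grading c) {a b : Ghat}
    {y x : M} (hyx : P.proj a • y = x) (hxy : P.proj b • x = y) (hab : b * a = 1) (s : S y) :
    hS.fibMap b hxy (hS.fibMap a hyx s) = s :=
  hS.fibMap_eq hxy (by rw [hS.mk_fibMap, ← mul_smul, hab, one_smul])

theorem IsSpinorBundle.fibMap_c (hS : IsSpinorBundle K ς P h metric grading c) (a : Ghat) {y x : M}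
    (hyx : P.proj a • y = x) (v : TangentSpace 𝓘(ℝ, E) y) :
    ∃ w : TangentSpace 𝓘(ℝ, E) x, ∀ s : S y,
      hS.fibMap a hyx (c y v s) = c x w (hS.fibMap a hyx s) := by
  subst hyx; exact ⟨dAct K ς (P.proj a) y v, hS.act_c a y v⟩

theorem proj_smul_inv_smul (a : Ghat) (x : M) : P.proj a • P.proj a⁻¹ • x = x := by
  rw [map_inv, smul_inv_smul]

/-- The section `a · lam`. -/
def IsSpinorBundle.translate (hS : IsSpinorBundle K ς P h metric grading c) (a : Ghat)
    (lam : ∀ x : M, S x →L[ℝ] S x) (x : M) : S x →L[ℝ] S x :=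
  (hS.fibMap a (proj_smul_inv_smul a x)).comp
    ((lam (P.proj a⁻¹ • x)).comp (hS.fibMap a⁻¹ rfl))

theorem IsSpinorBundle.actSection_eq (hS : IsSpinorBundle K ς P h metric grading c) (a : Ghat)
    (lam : ∀ x : M, S x →L[ℝ] S x) (x : M) (s : S x) :
    actSection K ς P (F := F) a lam x s = hS.translate a lam x s := rfl

/-- A family of fibrewise maps, as a map of the total space. -/
def totalMap (lam : ∀ x : M, S x →L[ℝ] S x) (u : TotalSpace F S) : TotalSpace F S :=
  TotalSpace.mk' F u.proj (lam u.proj u.2)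

theorem IsSpinorBundle.mk_translate (hS : IsSpinorBundle K ς P h metric grading c) (a : Ghat)
    (lam : ∀ x : M, S x →L[ℝ] S x) (x : M) (s : S x) :
    TotalSpace.mk' F x (hS.translate a lam x s) = a • totalMap lam (a⁻¹ • TotalSpace.mk' F x s) := by
  rw [← hS.mk_fibMap a⁻¹ rfl]
  exact hS.mk_fibMap a (proj_smul_inv_smul a x) _

theorem IsSpinorBundle.totalMap_translate (hS : IsSpinorBundle K ς P h metric grading c) (a : Ghat)
    (lam : ∀ x : M, S x →L[ℝ] S x) (u : TotalSpace F S) :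
    totalMap (hS.translate a lam) u = a • totalMap lam (a⁻¹ • u) :=
  hS.mk_translate a lam u.proj u.2

/-- Antilinear endomorphisms, hence sections of the anti-canonical line bundle, have weight two
under the centre. -/
theorem IsSpinorBundle.totalMap_central (hS : IsSpinorBundle K ς P h metric grading c) (z : Circle)
    {lam : ∀ x : M, S x →L[ℝ] S x} (u : TotalSpace F S)
    (hlam : ∀ s, lam u.proj (Complex.I • s) = -(Complex.I • lam u.proj s)) :
    totalMap lam (P.central z • u) = P.central z⁻¹ • totalMap lam u := by
  have hz : ∀ (z : ℂ) (s : S u.proj), lam u.proj (z • s) = (starRingEnd ℂ z) • lam u.proj s := by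
    intro z s
    conv_lhs => rw [← Complex.re_add_im z, add_smul, mul_smul, map_add]
    rw [Complex.coe_smul, Complex.coe_smul, map_smul, map_smul, hlam,
      show (starRingEnd ℂ z) = (z.re : ℂ) - (z.im : ℂ) * Complex.I from by
        apply Complex.ext <;> simp, sub_smul, mul_smul, Complex.coe_smul, Complex.coe_smul, smul_neg,
      sub_eq_add_neg]
  rw [show u = TotalSpace.mk' F u.proj u.2 from rfl, hS.act_central]
  show TotalSpace.mk' F u.proj (lam u.proj ((z : ℂ) • u.2)) =
    P.central z⁻¹ • TotalSpace.mk' F u.proj (lam u.proj u.2)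
  rw [hS.act_central, hz, Circle.coe_inv_eq_conj]

theorem IsSpinorBundle.inAnticanonical_translate (hS : IsSpinorBundle K ς P h metric grading c)
    (a : Ghat) {lam : ∀ x : M, S x →L[ℝ] S x} {x : M}
    (hlam : InAnticanonical c (P.proj a⁻¹ • x) (lam (P.proj a⁻¹ • x))) :
    InAnticanonical c x (hS.translate a lam x) := by
  constructor
  · intro s
    show hS.fibMap a (proj_smul_inv_smul a x) (lam _ (hS.fibMap a⁻¹ rfl (Complex.I • s))) =
      -(Complex.I • hS.fibMap a (proj_smul_inv_smul a x) (lam _ (hS.fibMap a⁻¹ rfl s)))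
    rw [hS.fibMap_smul, hlam.1, map_neg, hS.fibMap_smul]
  · intro v s
    obtain ⟨w, hw⟩ := hS.fibMap_c a⁻¹ (y := x) rfl v
    obtain ⟨v', hv'⟩ := hS.fibMap_c a (proj_smul_inv_smul a x) w
    have hinv : ∀ t : S x, hS.fibMap a (proj_smul_inv_smul a x) (hS.fibMap a⁻¹ rfl t) = t :=
      hS.fibMap_inv rfl _ (mul_inv_cancel a)
    have hcv : ∀ t : S x, c x v t = c x v' t := fun t => by
      have h1 := hv' (hS.fibMap a⁻¹ rfl t)
      rwa [← hw, hinv, hinv] at h1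
    show hS.fibMap a (proj_smul_inv_smul a x) (lam _ (hS.fibMap a⁻¹ rfl (c x v s))) =
      c x v (hS.fibMap a (proj_smul_inv_smul a x) (lam _ (hS.fibMap a⁻¹ rfl s)))
    rw [hw, hlam.2, hv', hcv]

theorem IsSpinorBundle.isSectionOn_translate [FiniteDimensional ℂ F]
    (hS : IsSpinorBundle K ς P h metric grading c) (hsm : IsSmoothAction K ς (E := E) M)
    (a : Ghat) {U : Set M} {lam : ∀ x : M, S x →L[ℝ] S x} (hl : IsSectionOn (F := F) c U lam) :
    IsSectionOn (F := F) c ((fun x => P.proj a⁻¹ • x) ⁻¹' U) (hS.translate a lam) := by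
  have hopen : IsOpen ((fun x : M => P.proj a⁻¹ • x) ⁻¹' U) :=
    hl.1.preimage (hsm.1 (P.proj a⁻¹)).continuous
  refine ⟨hopen, fun x hx => hS.inAnticanonical_translate a (hl.2.1 _ hx), fun x hx => ?_⟩
  refine ContMDiffAt.contMDiffWithinAt ?_
  haveI : FiniteDimensional ℝ F := FiniteDimensional.complexToReal F
  rw [contMDiffAt_hom_bundle]
  refine ⟨contMDiffAt_id, contMDiffAt_clm_of_apply fun v => ?_⟩
  set e := trivializationAt F S x with he
  have hx0 : x ∈ e.baseSet := FiberBundle.mem_baseSet_trivializationAt' x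
  have h1 : ContMDiffAt 𝓘(ℝ, E) (𝓘(ℝ, E).prod 𝓘(ℝ, F)) ∞
      (fun y => TotalSpace.mk' F y (e.symmL ℝ y v)) x := by
    refine (e.contMDiffAt_section_iff hx0).2 ((contMDiffAt_const (c := v)).congr_of_eventuallyEq ?_)
    filter_upwards [e.open_baseSet.mem_nhds hx0] with y hy
    rw [← e.continuousLinearMapAt_apply_of_mem ℝ hy, e.continuousLinearMapAt_symmL hy]
  have h2 : ContMDiffAt 𝓘(ℝ, E) (𝓘(ℝ, E).prod 𝓘(ℝ, F)) ∞
      (fun y => TotalSpace.mk' F (P.proj a⁻¹ • y) (hS.fibMap a⁻¹ rfl (e.symmL ℝ y v))) x := by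
    refine ((hS.contMDiff_smul a⁻¹).contMDiffAt.comp x h1).congr_of_eventuallyEq
      (Filter.Eventually.of_forall fun y => ?_)
    exact hS.mk_fibMap a⁻¹ rfl _
  have h3 : ContMDiffAt 𝓘(ℝ, E) (𝓘(ℝ, E).prod 𝓘(ℝ, F →L[ℝ] F)) ∞ (fun y => TotalSpace.mk'
      (F →L[ℝ] F) (E := fun x : M => S x →L[ℝ] S x) (P.proj a⁻¹ • y) (lam (P.proj a⁻¹ • y))) x :=
    ((hl.2.2 _ hx).contMDiffAt (hl.1.mem_nhds hx)).comp x (hsm.1 (P.proj a⁻¹)).contMDiffAt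
  have h4 := h3.clm_bundle_apply h2
  have h5 := (hS.contMDiff_smul a).contMDiffAt.comp x h4
  have h6 : ContMDiffAt 𝓘(ℝ, E) (𝓘(ℝ, E).prod 𝓘(ℝ, F)) ∞
      (fun y => TotalSpace.mk' F y (hS.translate a lam y (e.symmL ℝ y v))) x := by
    refine h5.congr_of_eventuallyEq (Filter.Eventually.of_forall fun y => ?_)
    exact hS.mk_fibMap a (proj_smul_inv_smul a y) _
  refine ((e.contMDiffAt_section_iff hx0).1 h6).congr_of_eventuallyEq ?_
  filter_upwards [e.open_baseSet.mem_nhds hx0] with y hy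
  exact e.continuousLinearMapAt_apply_of_mem ℝ hy _

end Translate

/-! ### Equivariance and integrality of the moment map -/

/-- Post-composition of a curve in a topological vector space with a continuous linear map. -/
theorem hasDerivAt_clm_comp {V W : Type*} [AddCommGroup V] [Module ℝ V] [TopologicalSpace V]
    [IsTopologicalAddGroup V] [ContinuousSMul ℝ V] [NormedAddCommGroup W] [NormedSpace ℝ W]
    (L : V →L[ℝ] W) {f : ℝ → V} {f' : V} {u : ℝ} (hf : HasDerivAt f f' u) :
    HasDerivAt (fun t => L (f t)) (L f') u := by
  have h1 := hasFDerivAt_iff_isLittleOTVS.1 hf.hasFDerivAt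
  refine hasDerivAt_iff_hasFDerivAt.2 (hasFDerivAt_iff_isLittleOTVS.2 ?_)
  refine ((L.isBigOTVS_fun_comp (𝕜 := ℝ)).trans_isLittleOTVS h1).congr_left fun t => ?_
  simp [map_sub]

section Moment

variable {m : ℕ} {K : CompactGroup m} {ς : ℝ}
  {E : Type*} [NormedAddCommGroup E] [NormedSpace ℝ E]
  {M : Type*} [TopologicalSpace M] [ChartedSpace E M] [IsManifold 𝓘(ℝ, E) ∞ M]
  [MulAction (K.LG ς) M]
  {ℓ : Fin m → ℤ} {Ghat : Type*} [Group Ghat] [TopologicalSpace Ghat]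
  [ChartedSpace (K.Lg × ℝ) Ghat] {P : K.LevelExtension ς ℓ Ghat}
  {F : Type*} [NormedAddCommGroup F] [NormedSpace ℂ F]
  {S : M → Type*} [TopologicalSpace (TotalSpace F S)]
  [∀ x, AddCommGroup (S x)] [∀ x, Module ℂ (S x)] [∀ x, TopologicalSpace (S x)]
  [∀ x, IsTopologicalAddGroup (S x)] [∀ x, ContinuousSMul ℝ (S x)]
  [FiberBundle F S] [VectorBundle ℝ F S] [ContMDiffVectorBundle ∞ F S 𝓘(ℝ, E)]
  [MulAction Ghat (TotalSpace F S)]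
  {h : ∀ x : M, TangentSpace 𝓘(ℝ, E) x →L[ℝ] TangentSpace 𝓘(ℝ, E) x →L[ℝ] ℝ}
  {metric : ContMDiffRiemannianMetric 𝓘(ℝ, E) ∞ F S}
  {grading : ∀ x : M, S x →L[ℝ] S x}
  {c : ∀ x : M, TangentSpace 𝓘(ℝ, E) x →L[ℝ] S x →L[ℝ] S x}
  {D : (∀ x : M, S x →L[ℝ] S x) → ∀ x : M, TangentSpace 𝓘(ℝ, E) x →L[ℝ] S x →L[ℝ] S x}
  {φM : M → Module.Dual ℝ K.Lg}

theorem IsSpinorBundle.fibAct_eq (hS : IsSpinorBundle K ς P h metric grading c) (a : Ghat)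
    (x : M) (s : S x) : fibAct K ς P (F := F) a x s = hS.fibMap a rfl s := rfl

theorem IsSpinorBundle.translate_one (hS : IsSpinorBundle K ς P h metric grading c)
    (lam : ∀ x : M, S x →L[ℝ] S x) (x : M) (s : S x) : hS.translate 1 lam x s = lam x s := by
  refine TotalSpace.mk_injective (F := F) x ?_
  show TotalSpace.mk' F x _ = TotalSpace.mk' F x _
  rw [hS.mk_translate, inv_one, one_smul, one_smul]
  rfl

theorem IsSpinorBundle.translate_mul (hS : IsSpinorBundle K ς P h metric grading c) (a b : Ghat)
    (lam : ∀ x : M, S x →L[ℝ] S x) (x : M) (s : S x) :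
    hS.translate (a * b) lam x s = hS.translate a (hS.translate b lam) x s := by
  refine TotalSpace.mk_injective (F := F) x ?_
  show TotalSpace.mk' F x _ = TotalSpace.mk' F x _
  rw [hS.mk_translate, hS.mk_translate, hS.totalMap_translate, mul_inv_rev, mul_smul, mul_smul]

theorem IsSpinorBundle.translate_apply (hS : IsSpinorBundle K ς P h metric grading c) (a : Ghat)
    (lam : ∀ x : M, S x →L[ℝ] S x) {x y : M} (hxy : P.proj a • x = y) (s : S x) :
    hS.translate a lam y (hS.fibMap a hxy s) = hS.fibMap a hxy (lam x s) := by
  refine TotalSpace.mk_injective (F := F) y ?_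
  show TotalSpace.mk' F y _ = TotalSpace.mk' F y _
  rw [hS.mk_translate, hS.mk_fibMap, hS.mk_fibMap, inv_smul_smul]
  rfl

theorem IsSpinorBundle.translate_central (hS : IsSpinorBundle K ς P h metric grading c)
    (z : Circle) {lam : ∀ x : M, S x →L[ℝ] S x} {x : M}
    (hlam : ∀ s, lam x (Complex.I • s) = -(Complex.I • lam x s)) (s : S x) :
    hS.translate (P.central z) lam x s = ((z : ℂ) ^ 2) • lam x s := by
  refine TotalSpace.mk_injective (F := F) x ?_
  show TotalSpace.mk' F x _ = TotalSpace.mk' F x _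
  rw [hS.mk_translate, ← map_inv, hS.totalMap_central z⁻¹ (TotalSpace.mk' F x s) hlam, inv_inv]
  show P.central z • P.central z • TotalSpace.mk' F x (lam x s) = _
  rw [hS.act_central, hS.act_central, smul_smul, ← sq]

/-- The central circle acts with weight two on conjugate linear maps: if `b a = a e z` with `z` in the
central circle, then `b · (a · lam) = z² (a · (e · lam))`. -/
theorem IsSpinorBundle.translate_conj (hS : IsSpinorBundle K ς P h metric grading c)
    {a b e : Ghat} {z : Circle} (hb : b * a = a * e * P.central z)
    {lam : ∀ x : M, S x →L[ℝ] S x} {x y : M} (hxy : P.proj a • x = y)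
    (hlam : ∀ s, lam ((P.proj e)⁻¹ • x) (Complex.I • s) =
      -(Complex.I • lam ((P.proj e)⁻¹ • x) s)) (s : S x) :
    hS.translate b (hS.translate a lam) y (hS.fibMap a hxy s) =
      ((z : ℂ) ^ 2) • hS.fibMap a hxy (hS.translate e lam x s) := by
  have hI : ∀ s, hS.translate e lam x (Complex.I • s) = -(Complex.I • hS.translate e lam x s) := by
    intro s
    have hpt : P.proj e⁻¹ • x = (P.proj e)⁻¹ • x := by rw [map_inv]
    have hl : ∀ s, lam (P.proj e⁻¹ • x) (Complex.I • s) =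
        -(Complex.I • lam (P.proj e⁻¹ • x) s) := by rw [hpt]; exact hlam
    show hS.fibMap e (proj_smul_inv_smul e x) (lam _ (hS.fibMap e⁻¹ rfl (Complex.I • s))) =
      -(Complex.I • hS.fibMap e (proj_smul_inv_smul e x) (lam _ (hS.fibMap e⁻¹ rfl s)))
    rw [hS.fibMap_smul, hl, map_neg, hS.fibMap_smul]
  have hb' : b * a = a * (P.central z * e) := by rw [P.central_comm, ← mul_assoc, hb]
  rw [← hS.translate_mul, hb', hS.translate_mul, hS.translate_apply, hS.translate_mul,
    hS.translate_central z hI, hS.fibMap_smul]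

variable [VectorBundle ℂ F S] [FiniteDimensional ℂ F]

/-- The coordinate map on a fibre. -/
def fibCoord (F : Type*) [NormedAddCommGroup F] [NormedSpace ℂ F]
    {S : M → Type*} [TopologicalSpace (TotalSpace F S)]
    [∀ x, AddCommGroup (S x)] [∀ x, Module ℂ (S x)] [∀ x, TopologicalSpace (S x)]
    [FiberBundle F S] [VectorBundle ℝ F S] (x : M) : S x →L[ℝ] F :=
  (trivializationAt F S x).continuousLinearMapAt ℝ x

omit [ChartedSpace E M] [IsManifold 𝓘(ℝ, E) ∞ M] [MulAction (K.LG ς) M]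
  [∀ x, IsTopologicalAddGroup (S x)] [∀ x, ContinuousSMul ℝ (S x)]
  [ContMDiffVectorBundle ∞ F S 𝓘(ℝ, E)] [MulAction Ghat (TotalSpace F S)]
  [FiniteDimensional ℂ F] in
theorem fibCoord_smul (x : M) (z : ℂ) (s : S x) :
    fibCoord F x (z • s) = z • fibCoord F x s := by
  have hI := continuousLinearMapAt_I_smul (F := F) (trivializationAt F S x)
    (FiberBundle.mem_baseSet_trivializationAt' x)
  rw [← Complex.re_add_im z, add_smul, add_smul, mul_smul, mul_smul, map_add, Complex.coe_smul,
    Complex.coe_smul, map_smul, map_smul, Complex.coe_smul, Complex.coe_smul]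
  congr 2
  exact hI s

omit [ChartedSpace E M] [IsManifold 𝓘(ℝ, E) ∞ M] [MulAction (K.LG ς) M]
  [∀ x, IsTopologicalAddGroup (S x)] [∀ x, ContinuousSMul ℝ (S x)]
  [ContMDiffVectorBundle ∞ F S 𝓘(ℝ, E)] [MulAction Ghat (TotalSpace F S)]
  [FiniteDimensional ℂ F] [VectorBundle ℂ F S] in
theorem fibCoord_injective (x : M) : Function.Injective (fibCoord F x : S x → F) :=
  fun s t hst => by
    have h1 := congrArg ((trivializationAt F S x).symmL ℝ x) hst
    have hx := FiberBundle.mem_baseSet_trivializationAt' (F := F) (E := S) x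
    exact ((trivializationAt F S x).symmL_continuousLinearMapAt hx s).symm.trans
      (h1.trans ((trivializationAt F S x).symmL_continuousLinearMapAt hx t))

set_option maxHeartbeats 800000 in
/-- The moment map is equivariant for the affine action of `LG` given by the central extension: the
section `a · lam` satisfies the moment map equation at `a x` for `Ad_a ξ`, up to the central
character, which acts with weight two on the anti-canonical line bundle. -/
theorem IsSpincMomentMap.smul_eq (hφM : IsSpincMomentMap K ς P (F := F) c D φM)
    (hS : IsSpinorBundle K ς P h metric grading c) (hD : IsConnection K ς P metric c D)
    (hsm : IsSmoothAction K ς (E := E) M) (a : Ghat) {ξ ξ' : K.Lg}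
    (hξ : K.IsAd ς (P.proj a) ξ ξ') (x : M) :
    φM (P.proj a • x) ξ' = φM x ξ - P.adj a ξ := by
  obtain ⟨U, lam, hl, hxU, s, hs⟩ := hS.exists_section x
  have hl' := hS.isSectionOn_translate hsm a hl
  have hxU' : P.proj a • x ∈ (fun y : M => P.proj a⁻¹ • y) ⁻¹' U := by
    show P.proj a⁻¹ • P.proj a • x ∈ U
    rwa [map_inv, inv_smul_smul]
  have h1 := hasDerivAt_clm_comp ((fibCoord F (P.proj a • x)).comp
    (hS.fibMap a (rfl : _ = P.proj a • x))) (hφM ξ U lam hl x hxU s)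
  have h2 := hasDerivAt_clm_comp (fibCoord F (P.proj a • x)) 
    (hφM ξ' _ _ hl' (P.proj a • x) hxU' (hS.fibMap a (rfl : _ = P.proj a • x) s))
  have hinv : D (hS.translate a lam) (P.proj a • x) (genField K ς ξ' (P.proj a • x))
      (hS.fibMap a (rfl : _ = P.proj a • x) s) =
      hS.fibMap a rfl (D lam x (genField K ς ξ x) s) := by
    have h3 := hD.invariant a U _ lam (hS.translate a lam) (fun z hz => by
      show P.proj a⁻¹ • P.proj a • z ∈ U
      rwa [map_inv, inv_smul_smul]) hl hl'
      (fun z _ t => hS.translate_apply a lam rfl t) x hxU (genField K ς ξ x) s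
    rw [dAct_genField P hsm hξ x, hS.fibAct_eq, hS.fibAct_eq] at h3
    exact h3
  set w : ℝ → Circle := fun u => Circle.exp (-(2 * Real.pi * (u * P.adj a ξ))) with hw
  have hnear : ∀ᶠ u : ℝ in 𝓝 0, (P.proj (P.exp (u • ξ)))⁻¹ • x ∈ U := by
    have hc : Continuous fun u : ℝ => K.loopExp ς (-(u • ξ)) • x :=
      (contMDiff_orbitMap hsm x).continuous.comp (continuous_id.smul continuous_const).neg
    have h0 : K.loopExp ς (-((0 : ℝ) • ξ)) • x ∈ U := by
      rw [zero_smul, neg_zero, CompactGroup.loopExp_zero P, one_smul]; exact hxU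
    filter_upwards [hc.continuousAt.preimage_mem_nhds (hl.1.mem_nhds h0)] with u hu
    rw [CompactGroup.proj_exp_eq, ← CompactGroup.loopExp_neg P]
    exact hu
  have hfun : (fun u : ℝ => fibCoord F (P.proj a • x) (actSection K ς P (F := F) (P.exp (u • ξ'))
        (hS.translate a lam) (P.proj a • x) (hS.fibMap a (rfl : _ = P.proj a • x) s))) =ᶠ[𝓝 0]
      fun u : ℝ => ((w u : ℂ) ^ 2) • ((fibCoord F (P.proj a • x)).comp
        (hS.fibMap a (rfl : _ = P.proj a • x))) (actSection K ς P (F := F) (P.exp (u • ξ)) lam x s) := by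
    filter_upwards [hnear] with u hu
    rw [hS.actSection_eq, hS.actSection_eq, hS.translate_conj (z := w u) (e := P.exp (u • ξ)) ?_
      rfl (hl.2.1 _ hu).1, fibCoord_smul]
    · rfl
    · have h4 := P.conj_exp a (u • ξ) (u • ξ') (hξ.smul u)
      have h5 : a * P.exp (u • ξ) = P.exp (u • ξ') *
          P.central (Circle.exp (2 * Real.pi * P.adj a (u • ξ))) * a := by
        rw [← h4, inv_mul_cancel_right]
      rw [h5, mul_assoc (P.exp (u • ξ')), P.central_comm, mul_assoc, mul_assoc, ← map_mul,
        hw, map_smul, smul_eq_mul, ← Circle.exp_add, add_neg_cancel, Circle.exp_zero, map_one,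
        mul_one]
  have hwd : HasDerivAt (fun u : ℝ => (w u : ℂ) ^ 2)
      (-((4 * Real.pi * P.adj a ξ : ℝ) : ℂ) * Complex.I) 0 := by
    have h6 : (fun u : ℝ => (w u : ℂ) ^ 2) = fun u : ℝ =>
        Complex.exp ((u : ℂ) * (-((4 * Real.pi * P.adj a ξ : ℝ) : ℂ) * Complex.I)) := by
      funext u
      rw [hw, Circle.coe_exp, ← Complex.exp_nat_mul]
      congr 1
      push_cast
      ring
    rw [h6]
    have h7 := (((Complex.ofRealCLM.hasDerivAt (x := (0 : ℝ))).mul_const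
      (-((4 * Real.pi * P.adj a ξ : ℝ) : ℂ) * Complex.I))).cexp
    simpa using h7
  have h8 := (hwd.smul h1).congr_of_eventuallyEq hfun
  have h9 := h2.unique h8
  have h10 : actSection K ς P (F := F) (P.exp ((0 : ℝ) • ξ)) lam x s = lam x s := by
    rw [zero_smul, CompactGroup.exp_zero_eq P, hS.actSection_eq, hS.translate_one]
  have hw0 : ((w 0 : Circle) : ℂ) ^ 2 = 1 := by simp [hw]
  rw [hinv, hS.translate_apply, h10, hw0, one_smul, map_add, map_add, fibCoord_smul] at h9
  simp only [ContinuousLinearMap.comp_apply] at h9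
  rw [hS.fibMap_smul, fibCoord_smul, add_assoc] at h9
  have h11 := add_left_cancel h9
  rw [← add_smul] at h11
  have hne : fibCoord F (P.proj a • x) (hS.fibMap a rfl (lam x s)) ≠ 0 := by
    intro h0
    have h12 := fibCoord_injective (F := F) _ (h0.trans (map_zero _).symm)
    have h13 := hS.fibMap_inv (b := a⁻¹) rfl (by rw [map_inv, inv_smul_smul])
      (inv_mul_cancel a) (lam x s)
    rw [h12, map_zero] at h13
    exact hs h13.symm
  have h14 := smul_left_injective ℂ hne h11
  have h15 := congrArg Complex.im h14
  simp only [Complex.mul_im, Complex.add_im, Complex.neg_im, Complex.neg_re, Complex.ofReal_re,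
    Complex.ofReal_im, Complex.I_re, Complex.I_im, Complex.mul_re] at h15
  norm_num at h15
  have hpi := Real.pi_pos
  have h16 : Real.pi * (φM (P.proj a • x) ξ' - (φM x ξ - P.adj a ξ)) = 0 := by linarith
  rcases mul_eq_zero.1 h16 with h17 | h17
  · exact absurd h17 hpi.ne'
  · linarith

/-- At a fixed point of a one-parameter subgroup that closes up after unit time, the moment map
is the weight of a circle action on a fibre, twisted by the character of the central extension. -/
theorem IsSpincMomentMap.exp_eq (hφM : IsSpincMomentMap K ς P (F := F) c D φM)
    (hS : IsSpinorBundle K ς P h metric grading c)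
    (hsm : IsSmoothAction K ς (E := E) M) {ξ : K.Lg} {x : M}
    (hx : ∀ u : ℝ, K.loopExp ς (u • ξ) • x = x) {z : Circle} (hz : P.exp ξ = P.central z) :
    Complex.exp ((4 * Real.pi * φM x ξ : ℝ) * Complex.I) = (z : ℂ) ^ 2 := by
  obtain ⟨U, lam, hl, hxU, s, hs⟩ := hS.exists_section x
  have hgen : genField K ς (E := E) ξ x = 0 := (genField_eq_zero_iff P hsm).2 hx
  have hpx : ∀ u : ℝ, P.proj (P.exp (u • ξ)) • x = x := fun u => by rw [CompactGroup.proj_exp_eq]; exact hx u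
  set w : ℂ := (4 * Real.pi * φM x ξ : ℝ) * Complex.I with hw
  set f : ℝ → F := fun u => fibCoord F x (hS.translate (P.exp (u • ξ)) lam x s) with hf
  have hd0 : ∀ t : S x, HasDerivAt (fun u : ℝ => hS.translate (P.exp (u • ξ)) lam x t)
      (w • lam x t) 0 := fun t => by
    have h1 := hφM ξ U lam hl x hxU t
    rw [hgen, map_zero, zero_apply, zero_add] at h1
    have hw' : (2 * (2 * Real.pi * φM x ξ : ℝ) * Complex.I : ℂ) = w := by
      rw [hw]; push_cast; ring
    rw [hw'] at h1
    exact h1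
  have htr : ∀ u v : ℝ, ∀ t : S x, hS.translate (P.exp ((u + v) • ξ)) lam x
      (hS.fibMap (P.exp (u • ξ)) (hpx u) t) =
      hS.fibMap (P.exp (u • ξ)) (hpx u) (hS.translate (P.exp (v • ξ)) lam x t) := fun u v t => by
    rw [P.exp_add_smul, hS.translate_mul, hS.translate_apply]
  have hdf : ∀ u : ℝ, HasDerivAt f (w • f u) u := fun u => by
    have hinvx : P.proj (P.exp (u • ξ))⁻¹ • x = x := by
      rw [map_inv, inv_smul_eq_iff]; exact (hpx u).symm
    set t := hS.fibMap (P.exp (u • ξ))⁻¹ hinvx s with ht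
    have hst : hS.fibMap (P.exp (u • ξ)) (hpx u) t = s :=
      hS.fibMap_inv hinvx (hpx u) (mul_inv_cancel _) s
    have h1 := hasDerivAt_clm_comp ((fibCoord F x).comp (hS.fibMap (P.exp (u • ξ)) (hpx u))) (hd0 t)
    have h2 : HasDerivAt (fun v : ℝ => f (u + v)) (w • f u) 0 := by
      have e1 : (fun v : ℝ => f (u + v)) = fun v : ℝ => ((fibCoord F x).comp
          (hS.fibMap (P.exp (u • ξ)) (hpx u))) (hS.translate (P.exp (v • ξ)) lam x t) := by
        funext v
        show fibCoord F x (hS.translate (P.exp ((u + v) • ξ)) lam x s) = _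
        rw [← hst, htr]
        rfl
      have e2 : w • f u = ((fibCoord F x).comp (hS.fibMap (P.exp (u • ξ)) (hpx u)))
          (w • lam x t) := by
        rw [ContinuousLinearMap.comp_apply, hS.fibMap_smul, fibCoord_smul, hf]
        show w • fibCoord F x (hS.translate (P.exp (u • ξ)) lam x s) = _
        conv_lhs => rw [← hst, hS.translate_apply]
      rw [e1, e2]
      exact h1
    have h3 : HasDerivAt (fun v : ℝ => f (u + v)) (w • f u) (u - u) := by rwa [sub_self]
    have h4 := h3.comp_sub_const u u
    simpa using h4
  have hexp : ∀ u : ℝ, HasDerivAt (fun u : ℝ => Complex.exp (-((u : ℂ) * w)))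
      (Complex.exp (-((u : ℂ) * w)) * -w) u := fun u => by
    have h7 := (((Complex.ofRealCLM.hasDerivAt (x := u)).mul_const w).neg).cexp
    simpa using h7
  have hconst : ∀ u : ℝ, Complex.exp (-((u : ℂ) * w)) • f u = f 0 := fun u => by
    have h5 : ∀ u : ℝ, HasDerivAt (fun u : ℝ => Complex.exp (-((u : ℂ) * w)) • f u) 0 u :=
      fun u => by
        have h6 := (hexp u).smul (hdf u)
        rwa [smul_smul, mul_neg, neg_smul, add_neg_cancel] at h6
    have h6 := is_const_of_deriv_eq_zero (fun u => (h5 u).differentiableAt)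
      (fun u => (h5 u).deriv) u 0
    simpa using h6
  have h0 : f 0 = fibCoord F x (lam x s) := by
    rw [hf]
    simp only [zero_smul]
    rw [CompactGroup.exp_zero_eq P, hS.translate_one]
  have h1 : f 1 = ((z : ℂ) ^ 2) • fibCoord F x (lam x s) := by
    rw [hf]
    simp only [one_smul]
    rw [hz, hS.translate_central z (hl.2.1 x hxU).1, fibCoord_smul]
  have h2 := hconst 1
  rw [h0, h1, smul_smul] at h2
  have hne : fibCoord F x (lam x s) ≠ 0 := fun h3 =>
    hs (fibCoord_injective (F := F) x (h3.trans (map_zero _).symm))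
  have h3 := smul_left_injective ℂ hne (h2.trans (one_smul ℂ _).symm)
  simp only [Complex.ofReal_one, one_mul] at h3
  rw [Complex.exp_neg] at h3
  field_simp [Complex.exp_ne_zero] at h3
  exact h3.symm

end Moment

/-! ### Finiteness of the critical sets modulo the lattice -/

section Finiteness

/-- A bounded set of vectors whose pairings with a cocompact set are determined modulo half
integers is finite. -/
theorem finite_of_exp_eq {V : Type*} [NormedAddCommGroup V] [NormedSpace ℝ V]
    [FiniteDimensional ℝ V] (B : V →ₗ[ℝ] V →ₗ[ℝ] ℝ) (hB : ∀ v, B v v = 0 → v = 0)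
    (s : Submodule ℝ V) (Λ : Set V) (hΛ : Λ ⊆ s) {R : ℝ}
    (hR : ∀ ξ ∈ s, ∃ η ∈ Λ, ‖ξ - η‖ ≤ R) (c : V → ℂ) (C : ℝ) :
    {β | β ∈ s ∧ ‖β‖ ≤ C ∧
      ∀ ζ ∈ Λ, Complex.exp ((4 * Real.pi * B β ζ : ℝ) * Complex.I) = c ζ}.Finite := by
  have hspan : Submodule.span ℝ Λ = s := span_eq_of_cocompact s Λ hΛ R hR
  obtain ⟨t, htΛ, ht⟩ := Submodule.fg_span_iff_fg_span_finset_subset Λ |>.1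
    (IsNoetherian.noetherian (Submodule.span ℝ Λ))
  set Q := {β | β ∈ s ∧ ‖β‖ ≤ C ∧
      ∀ ζ ∈ Λ, Complex.exp ((4 * Real.pi * B β ζ : ℝ) * Complex.I) = c ζ} with hQ
  rcases Q.eq_empty_or_nonempty with h0 | ⟨β₀, hβ₀⟩
  · rw [h0]; exact Set.finite_empty
  have hint : ∀ β ∈ Q, ∀ ζ ∈ Λ, ∃ k : ℤ, 2 * B (β - β₀) ζ = k := by
    intro β hβ ζ hζ
    have h1 := (hβ.2.2 ζ hζ).trans (hβ₀.2.2 ζ hζ).symm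
    obtain ⟨k, hk⟩ := Complex.exp_eq_exp_iff_exists_int.1 h1
    refine ⟨k, ?_⟩
    have h2 := congrArg Complex.im hk
    simp only [Complex.mul_im, Complex.add_im, Complex.ofReal_re, Complex.ofReal_im, Complex.I_re,
      Complex.I_im, Complex.intCast_re, Complex.intCast_im, Complex.mul_re, Complex.re_ofNat,
      Complex.im_ofNat] at h2
    rw [map_sub, LinearMap.sub_apply]
    have h3 : Real.pi * (2 * (B β ζ - B β₀ ζ) - k) = 0 := by linarith
    rcases mul_eq_zero.1 h3 with h4 | h4
    · exact absurd h4 Real.pi_pos.ne'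
    · linarith
  choose! k hk using hint
  have hbound : ∃ n : ℤ, ∀ β ∈ Q, ∀ ζ ∈ t, k β ζ ∈ Set.Icc (-n) n := by
    have h1 : ∀ ζ : V, ∃ n : ℤ, ∀ β ∈ Q, ζ ∈ Λ → |k β ζ| ≤ n := by
      intro ζ
      set f : V →L[ℝ] ℝ := LinearMap.toContinuousLinearMap (B.flip ζ) with hf
      obtain ⟨n, hn⟩ := exists_int_gt (2 * (‖f‖ * (2 * C)))
      refine ⟨n, fun β hβ hζ => ?_⟩
      have h2 : ‖β - β₀‖ ≤ 2 * C :=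
        (norm_sub_le _ _).trans (by linarith [hβ.2.1, hβ₀.2.1])
      have h3 : |B (β - β₀) ζ| ≤ ‖f‖ * (2 * C) :=
        (f.le_opNorm (β - β₀)).trans (by gcongr)
      have h4 : |(k β ζ : ℝ)| ≤ n := by
        rw [← hk β hβ ζ hζ, abs_mul, abs_two]
        linarith
      exact_mod_cast h4
    choose n hn using h1
    refine ⟨∑ ζ ∈ t, |n ζ|, fun β hβ ζ hζ => abs_le.1 ((hn ζ β hβ (htΛ hζ)).trans ?_)⟩
    exact (le_abs_self _).trans
      (Finset.single_le_sum (f := fun ζ => |n ζ|) (fun _ _ => abs_nonneg _) hζ)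
  obtain ⟨n, hn⟩ := hbound
  refine Set.Finite.of_injOn (f := fun β (ζ : t) => k β ζ)
    (t := Set.univ.pi fun _ : t => Set.Icc (-n) n) (fun β hβ ζ _ => hn β hβ ζ ζ.2) ?_
    (Set.Finite.pi fun _ => Set.finite_Icc _ _)
  intro β hβ β' hβ' heq
  have h1 : ∀ ζ ∈ t, B (β - β') ζ = 0 := fun ζ hζ => by
    have h2 := hk β hβ ζ (htΛ hζ)
    have h3 := hk β' hβ' ζ (htΛ hζ)
    have h4 : k β ζ = k β' ζ := congrFun heq ⟨ζ, hζ⟩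
    rw [h4] at h2
    rw [map_sub, LinearMap.sub_apply] at h2 h3 ⊢
    linarith
  have h2 : s ≤ LinearMap.ker (B (β - β')) := by
    rw [← hspan, ht, Submodule.span_le]
    exact h1
  exact sub_eq_zero.1 (hB _ (h2 (s.sub_mem hβ.1 hβ'.1)))

variable {V : Type*} [NormedAddCommGroup V] [NormedSpace ℝ V] [FiniteDimensional ℝ V]
  {E : Type*} [NormedAddCommGroup E] [NormedSpace ℝ E]
  {M : Type*} [TopologicalSpace M] [T2Space M] [ChartedSpace E M] [IsManifold 𝓘(ℝ, E) ∞ M]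

/-- The set of points of `X` that are fixed by the one-parameter group of `β` and where `φ` has the
value `β`. -/
def TorusAction.critical (T : TorusAction V E M) (X : Set M) (φ : M → V) (β : V) : Set M :=
  {x ∈ X | (∀ u : ℝ, T.act (u • β) x = x) ∧ φ x = β}

omit [FiniteDimensional ℝ V] [T2Space M] in
theorem TorusAction.mem_critical {T : TorusAction V E M} {X : Set M} {φ : M → V} {β : V} {x : M} :
    x ∈ T.critical X φ β ↔ x ∈ X ∧ β ∈ T.stab {x} ∧ φ x = β := by
  have h1 : β ∈ T.stab {x} ↔ ∀ u : ℝ, T.act (u • β) x = x :=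
    ⟨fun h u => h u x rfl, fun h u y hy => by rw [Set.mem_singleton_iff.1 hy]; exact h u⟩
  rw [h1]
  rfl

/-- The critical sets of an equivariant map `φ` for an action of a lattice by translations fall into
finitely many orbits. The critical sets `Z_β` for which the fixed point set `X^β` is that of a given
torus form one orbit for each class of `β` modulo translations: the values of `φ` on `X^β` lie in a
discrete set, and the lattice acts cocompactly on the Lie algebra of the torus. -/
theorem TorusAction.exists_finite_critical (T : TorusAction V E M) (X : Set M) (φ : M → V)
    (τ : V → M → M) (A : V →ₗ[ℝ] V)
    (hfin : ((fun x => T.stab {x}) '' X).Finite)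
    (hτX : ∀ η ∈ T.Λ, ∀ x ∈ X, τ η x ∈ X) (hτ : ∀ η ∈ T.Λ, ∀ x, τ η (τ (-η) x) = x)
    (hτs : ∀ η ∈ T.Λ, ∀ x, T.stab {τ η x} = T.stab {x})
    (hφ : ∀ η ∈ T.Λ, ∀ x ∈ X, φ (τ η x) = φ x + A η)
    {N : ℤ} (hN : 0 < N) (hA : ∀ η ∈ T.Λ, ∃ η' ∈ T.Λ, A η' = N • η)
    (B : V →ₗ[ℝ] V →ₗ[ℝ] ℝ) (hB : ∀ v, B v v = 0 → v = 0) (c : V → ℂ)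
    (hc : ∀ x ∈ X, ∀ ζ ∈ T.Λ, ζ ∈ T.stab {x} →
      Complex.exp ((4 * Real.pi * B (φ x) ζ : ℝ) * Complex.I) = c ζ) :
    ∃ S ⊆ {β | (T.critical X φ β).Nonempty}, S.Finite ∧
      ∀ β, (T.critical X φ β).Nonempty → ∃ α ∈ S, ∃ η ∈ T.Λ,
        T.critical X φ β = τ η '' T.critical X φ α := by
  classical
  -- the Lie algebra of the largest torus with the same fixed points as `β`
  let s : V → Submodule ℝ V := fun β => T.stab {x ∈ X | β ∈ T.stab {x}}
  have hstab : ∀ β, s β = sInf ((fun x => T.stab {x}) '' {x ∈ X | β ∈ T.stab {x}}) := by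
    intro β
    ext ξ
    rw [Submodule.mem_sInf]
    constructor
    · rintro h _ ⟨x, hx, rfl⟩ u y hy
      rw [Set.mem_singleton_iff.1 hy]
      exact h u x hx
    · intro h u x hx
      exact h _ ⟨x, hx, rfl⟩ u x rfl
  have hsfin : (Set.range s).Finite := by
    refine (hfin.finite_subsets.image sInf).subset ?_
    rintro _ ⟨β, rfl⟩
    exact ⟨_, Set.image_mono (fun x hx => hx.1), (hstab β).symm⟩
  have hmem : ∀ β, β ∈ s β := fun β u x hx => hx.2 u x rfl
  have hle : ∀ β, ∀ x ∈ X, β ∈ T.stab {x} → s β ≤ T.stab {x} := fun β x hx hβ ξ hξ u y hy => by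
    rw [Set.mem_singleton_iff.1 hy]
    exact hξ u x ⟨hx, hβ⟩
  -- two critical sets with the same torus, at values that differ by a translation
  have htrans : ∀ β α, s β = s α → ∀ η ∈ T.Λ, β = α + A η →
      T.critical X φ β = τ η '' T.critical X φ α := by
    intro β α hs η hη hβ
    have hneg : ∀ x, τ (-η) (τ η x) = x := fun x => by
      have := hτ (-η) (neg_mem hη) x
      rwa [neg_neg] at this
    ext x
    constructor
    · intro hx
      obtain ⟨h1, h2, h3⟩ := T.mem_critical.1 hx
      refine ⟨τ (-η) x, T.mem_critical.2 ⟨hτX _ (neg_mem hη) x h1, ?_, ?_⟩, hτ η hη x⟩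
      · rw [hτs _ (neg_mem hη)]
        exact hle β x h1 h2 (hs ▸ hmem α)
      · rw [hφ _ (neg_mem hη) x h1, h3, hβ, map_neg, add_neg_cancel_right]
    · rintro ⟨y, hy, rfl⟩
      obtain ⟨h1, h2, h3⟩ := T.mem_critical.1 hy
      refine T.mem_critical.2 ⟨hτX _ hη y h1, ?_, ?_⟩
      · rw [hτs _ hη]
        exact hle α y h1 h2 (hs ▸ hmem β)
      · rw [hφ _ hη y h1, h3, hβ]
  -- finitely many classes modulo translations for each torus
  have hclass : ∀ σ : Submodule ℝ V, ∃ Q : Set V, Q.Finite ∧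
      ∀ β, (T.critical X φ β).Nonempty → s β = σ → ∃ γ ∈ Q, ∃ η ∈ T.Λ, β = γ + A η := by
    intro σ
    by_cases hσ : ∃ β, s β = σ
    · obtain ⟨β₀, rfl⟩ := hσ
      obtain ⟨R, hR⟩ := T.exists_cocompact_stab {x ∈ X | β₀ ∈ T.stab {x}}
      have hN' : (0 : ℝ) < (N : ℝ) := by exact_mod_cast hN
      refine ⟨_, finite_of_exp_eq B hB (s β₀) {ζ | ζ ∈ T.Λ ∧ ζ ∈ s β₀} (fun ζ hζ => hζ.2)
        (fun ξ hξ => (hR ξ hξ).imp fun η h => ⟨⟨h.1, h.2.1⟩, h.2.2⟩) c (N * R),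
        fun β hβ hs => ?_⟩
      obtain ⟨x, hx⟩ := hβ
      obtain ⟨h1, h2, h3⟩ := T.mem_critical.1 hx
      obtain ⟨η, hη, hηs, hηR⟩ := hR ((N : ℝ)⁻¹ • β) ((s β₀).smul_mem _ (hs ▸ hmem β))
      obtain ⟨η', hη', hA'⟩ := hA η hη
      have hAη : A η' = (N : ℝ) • η := by rw [hA', Int.cast_smul_eq_zsmul]
      refine ⟨β - A η', ⟨?_, ?_, fun ζ hζ => ?_⟩, η', hη', (sub_add_cancel _ _).symm⟩
      · rw [hAη]
        exact (s β₀).sub_mem (hs ▸ hmem β) ((s β₀).smul_mem _ hηs)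
      · have h4 : β - A η' = (N : ℝ) • ((N : ℝ)⁻¹ • β - η) := by
          rw [hAη, smul_sub, smul_smul, mul_inv_cancel₀ hN'.ne', one_smul]
        rw [h4, norm_smul, Real.norm_of_nonneg hN'.le]
        gcongr
      · have h5 : φ (τ (-η') x) = β - A η' := by
          rw [hφ _ (neg_mem hη') x h1, h3, map_neg, sub_eq_add_neg]
        rw [← h5]
        refine hc _ (hτX _ (neg_mem hη') x h1) ζ hζ.1 ?_
        rw [hτs _ (neg_mem hη')]
        exact hle β x h1 h2 (hs ▸ hζ.2)
    · exact ⟨∅, Set.finite_empty, fun β _ hs => absurd ⟨β, hs⟩ hσ⟩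
  choose Q hQ hQ' using hclass
  -- one representative for each pair of a torus and a class that occurs
  let I : Set (Submodule ℝ V × V) := {p | p.1 ∈ Set.range s ∧ p.2 ∈ Q p.1}
  have hI : I.Finite := by
    refine (hsfin.biUnion fun σ _ => (hQ σ).image (Prod.mk σ)).subset ?_
    rintro ⟨σ, γ⟩ ⟨h1, h2⟩
    exact Set.mem_biUnion h1 ⟨γ, h2, rfl⟩
  let good : Submodule ℝ V × V → V → Prop := fun p β =>
    (T.critical X φ β).Nonempty ∧ s β = p.1 ∧ ∃ η ∈ T.Λ, β = p.2 + A η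
  let rep : Submodule ℝ V × V → V := fun p => if h : ∃ β, good p β then h.choose else 0
  have hrep : ∀ p, (∃ β, good p β) → good p (rep p) := fun p h => by
    simp only [rep, dif_pos h]
    exact h.choose_spec
  refine ⟨rep '' {p ∈ I | ∃ β, good p β}, ?_, (hI.subset fun p hp => hp.1).image rep,
    fun β hβ => ?_⟩
  · rintro _ ⟨p, hp, rfl⟩
    exact (hrep p hp.2).1
  · obtain ⟨γ, hγ, η, hη, hβη⟩ := hQ' (s β) β hβ rfl
    have hgood : ∃ β', good (s β, γ) β' := ⟨β, hβ, rfl, η, hη, hβη⟩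
    obtain ⟨-, h2, η₁, hη₁, h3⟩ := hrep (s β, γ) hgood
    refine ⟨rep (s β, γ), ⟨(s β, γ), ⟨⟨⟨β, rfl⟩, hγ⟩, hgood⟩, rfl⟩, η - η₁, sub_mem hη hη₁,
      htrans β _ h2.symm _ (sub_mem hη hη₁) ?_⟩
    rw [h3, map_sub, hβη]
    abel

end Finiteness

/-! ### The moment map on the transversal -/

section Transversal

variable {m : ℕ} {K : CompactGroup m} {ς : ℝ}
  {E : Type*} [NormedAddCommGroup E] [NormedSpace ℝ E]
  {M : Type*} [TopologicalSpace M] [ChartedSpace E M] [IsManifold 𝓘(ℝ, E) ∞ M]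
  [MulAction (K.LG ς) M]
  {ℓ : Fin m → ℤ} {Ghat : Type*} [Group Ghat] [TopologicalSpace Ghat]
  [ChartedSpace (K.Lg × ℝ) Ghat] (P : K.LevelExtension ς ℓ Ghat)
  (hsm : IsSmoothAction K ς (E := E) M)

theorem stab_smul {η : K.t} {g : K.LG ς} (hg : K.IsLatticeLoop ς η g) (x : M) :
    (torusAction P hsm).stab {g • x} = (torusAction P hsm).stab {x} := by
  have hact : ∀ (ξ : K.t) (y : M), K.loopExp ς (K.const ξ) • g • y =
      g • K.loopExp ς (K.const ξ) • y := fun ξ y => by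
    rw [← mul_smul, ← mul_smul]
    conv_lhs => rw [← CompactGroup.conj_loopExp P (hg.isAd ξ), inv_mul_cancel_right]
  ext ξ
  constructor
  · rintro h u y rfl
    have h1 : K.loopExp ς (K.const (u • ξ)) • g • y = g • y := h u _ rfl
    rw [hact] at h1
    exact MulAction.injective g h1
  · rintro h u y rfl
    show K.loopExp ς (K.const (u • ξ)) • g • x = g • x
    rw [hact]
    exact congrArg (g • ·) (h u x rfl)

variable {P}
  {F : Type*} [NormedAddCommGroup F] [NormedSpace ℂ F] [FiniteDimensional ℂ F]
  {S : M → Type*} [TopologicalSpace (TotalSpace F S)]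
  [∀ x, AddCommGroup (S x)] [∀ x, Module ℂ (S x)] [∀ x, TopologicalSpace (S x)]
  [∀ x, IsTopologicalAddGroup (S x)] [∀ x, ContinuousSMul ℝ (S x)]
  [FiberBundle F S] [VectorBundle ℂ F S] [VectorBundle ℝ F S]
  [ContMDiffVectorBundle ∞ F S 𝓘(ℝ, E)]
  [MulAction Ghat (TotalSpace F S)]
  {h : ∀ x : M, TangentSpace 𝓘(ℝ, E) x →L[ℝ] TangentSpace 𝓘(ℝ, E) x →L[ℝ] ℝ}
  {metric : ContMDiffRiemannianMetric 𝓘(ℝ, E) ∞ F S}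
  {grading : ∀ x : M, S x →L[ℝ] S x}
  {c : ∀ x : M, TangentSpace 𝓘(ℝ, E) x →L[ℝ] S x →L[ℝ] S x}
  {D : (∀ x : M, S x →L[ℝ] S x) → ∀ x : M, TangentSpace 𝓘(ℝ, E) x →L[ℝ] S x →L[ℝ] S x}
  {φM : M → Module.Dual ℝ K.Lg} {φ : M → K.t} {X : Set M}
  {σ : ∀ x : M, TangentSpace 𝓘(ℝ, E) x →L[ℝ] TangentSpace 𝓘(ℝ, E) x →L[ℝ] ℝ}
  {μ : M → K.LgDual} {ε : ℝ} {r : K.t × K.tPerp → K.LgDual}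

/-- The component of the moment map in `𝔱` is equivariant for the action of the lattice by
translations scaled by the level. -/
theorem IsSpincMomentMap.eq_add_levelT (hφM : IsSpincMomentMap K ς P (F := F) c D φM)
    (hS : IsSpinorBundle K ς P h metric grading c) (hD : IsConnection K ς P metric c D)
    (hsm : IsSmoothAction K ς (E := E) M)
    (hφ : ∀ x ∈ X, ∀ ξ : K.t, K.ip (φ x) ξ = (φM x (K.const ξ) : ℂ))
    {η : K.t} (hη : η ∈ K.corootLattice) {g : K.LG ς} (hg : K.IsLatticeLoop ς η g)
    {x : M} (hx : x ∈ X) (hgx : g • x ∈ X) : φ (g • x) = φ x + K.levelT ℓ η := by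
  obtain ⟨a, ha, hadj⟩ := CompactGroup.exists_lift P hη
  obtain rfl := hg.unique ha
  refine CompactGroup.eq_of_forall_ip_eq P fun ξ => ?_
  have him : (K.ip (K.mulLevel ℓ η) ξ).im = 0 :=
    K.ip_im (K.t_le_g (K.levelT ℓ η).2) (K.t_le_g ξ.2)
  have h1 : ((K.ip (K.mulLevel ℓ η) ξ).re : ℂ) = K.ip (K.mulLevel ℓ η) ξ :=
    Complex.ext rfl him.symm
  rw [hφ _ hgx, hφM.smul_eq hS hD hsm a (ha.isAd ξ), hadj, sub_neg_eq_add, Complex.ofReal_add, h1,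
    ← hφ x hx, Submodule.coe_add, CompactGroup.ip_add_left, CompactGroup.coe_levelT]

omit [FiniteDimensional ℂ F] [VectorBundle ℂ F S] in
/-- Only finitely many subspaces of `𝔱` are infinitesimal stabilizers of points of the
transversal. -/
theorem IsSpinorBundle.finite_stab [CompleteSpace E] [T2Space M]
    (hS : IsSpinorBundle K ς P h metric grading c) (hM : IsHamiltonian K ς σ μ)
    (hr : K.IsThickening ς ε r) :
    ((fun x => (torusAction P hM.smoothAction).stab {x}) '' (μ ⁻¹' (r '' K.tube ε))).Finite := by
  set hsm := hM.smoothAction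
  obtain ⟨C, hC, -, hCX⟩ := hM.exists_isCompact P hr
  have hloc : ∀ y : M, ∃ U ∈ 𝓝 y, {s | ∃ x ∈ U, s = (torusAction P hsm).stab {x}}.Finite := by
    intro y
    obtain ⟨L, hL⟩ := exists_isotropyWeights P hsm hS.h_ker hS.h_invariant y
      (hS.finiteDimensional_quotient y)
    exact (torusAction P hsm).exists_nhds_finite_stab y L hL
  choose U hU hfin using hloc
  obtain ⟨t, -, ht⟩ := hC.elim_nhds_subcover U fun y _ => hU y
  refine (t.finite_toSet.biUnion fun y _ => hfin y).subset ?_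
  rintro _ ⟨x, hx, rfl⟩
  obtain ⟨η, -, g, hg, hgx⟩ := hCX x hx
  obtain ⟨y, hy, hgy⟩ := Set.mem_iUnion₂.1 (ht hgx)
  exact Set.mem_biUnion hy ⟨g • x, hgy, (stab_smul P hsm hg x).symm⟩

end Transversal

end LoopSpace

end

theorem mainTheorem11 {m : ℕ} (K : LoopSpace.CompactGroup m) (ς : ℝ) (hς : 1 / 2 < ς)
    {E : Type*} [NormedAddCommGroup E] [NormedSpace ℝ E] [CompleteSpace E]
    {M : Type*} [TopologicalSpace M] [T2Space M] [ChartedSpace E M] [IsManifold 𝓘(ℝ, E) ∞ M]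
    [MulAction (K.LG ς) M]
    -- a proper Hamiltonian loop group space
    (σ : ∀ x : M, TangentSpace 𝓘(ℝ, E) x →L[ℝ] TangentSpace 𝓘(ℝ, E) x →L[ℝ] ℝ)
    (μ : M → K.LgDual) (hM : LoopSpace.IsHamiltonian K ς σ μ)
    -- a global transversal
    (ε : ℝ) (r : K.t × K.tPerp → K.LgDual) (hr : K.IsThickening ς ε r)
    (X : Set M) (hX : X = μ ⁻¹' (r '' K.tube ε))
    -- the central extension of positive level
    (ℓ : Fin m → ℤ) (hℓ : ∀ i, 0 < ℓ i)
    {Ghat : Type*} [Group Ghat] [TopologicalSpace Ghat] [ChartedSpace (K.Lg × ℝ) Ghat]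
    [LieGroup 𝓘(ℝ, K.Lg × ℝ) ∞ Ghat] (P : K.LevelExtension ς ℓ Ghat)
    -- a spinor bundle of level ℓ
    {F : Type*} [NormedAddCommGroup F] [NormedSpace ℂ F] [FiniteDimensional ℂ F]
    {S : M → Type*} [TopologicalSpace (TotalSpace F S)]
    [∀ x, AddCommGroup (S x)] [∀ x, Module ℂ (S x)] [∀ x, TopologicalSpace (S x)]
    [∀ x, IsTopologicalAddGroup (S x)] [∀ x, ContinuousSMul ℝ (S x)]
    [FiberBundle F S] [VectorBundle ℂ F S] [VectorBundle ℝ F S]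
    [ContMDiffVectorBundle ∞ F S 𝓘(ℝ, E)] [MulAction Ghat (TotalSpace F S)]
    (h : ∀ x : M, TangentSpace 𝓘(ℝ, E) x →L[ℝ] TangentSpace 𝓘(ℝ, E) x →L[ℝ] ℝ)
    (metric : ContMDiffRiemannianMetric 𝓘(ℝ, E) ∞ F S)
    (grading : ∀ x : M, S x →L[ℝ] S x)
    (c : ∀ x : M, TangentSpace 𝓘(ℝ, E) x →L[ℝ] S x →L[ℝ] S x)
    (hS : LoopSpace.IsSpinorBundle K ς P h metric grading c)
    -- an invariant Hermitian connection on the anti-canonical line bundle, and the moment map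
    (D : (∀ x : M, S x →L[ℝ] S x) → ∀ x : M, TangentSpace 𝓘(ℝ, E) x →L[ℝ] S x →L[ℝ] S x)
    (hD : LoopSpace.IsConnection K ς P metric c D)
    (φM : M → Module.Dual ℝ K.Lg) (hφM : LoopSpace.IsSpincMomentMap K ς P (F := F) c D φM)
    -- its component in 𝔱
    (φ : M → K.t) (hφ : ∀ x ∈ X, ∀ ξ : K.t, K.ip (φ x) ξ = (φM x (K.const ξ) : ℂ)) :
    {x ∈ X | LoopSpace.kirwan K ς (E := E) φ x = 0} =
        ⋃ β ∈ LoopSpace.indexSet K ς X φ, LoopSpace.zeroPart K ς X φ β ∧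
      (∃ B : Set K.t, Minimal (LoopSpace.IsFiniteSystem K ς X φ) B) ∧
      ((∃ ξ : K.t, ∃ x ∈ X, LoopSpace.genField K ς (E := E) (K.const ξ) x ≠ 0) →
        ∃ g ∈ K.latticeLoops ς, ∃ x ∈ X, LoopSpace.kirwan K ς (E := E) φ (g • x) ≠
          LoopSpace.dAct K ς g x (LoopSpace.kirwan K ς φ x)) := by
  have hsm := hM.smoothAction
  have hgen : ∀ (ξ : K.t) (x : M), LoopSpace.genField K ς (E := E) (K.const ξ) x = 0 ↔
      ∀ u : ℝ, K.loopExp ς (K.const (u • ξ)) • x = x := fun ξ x => by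
    simp only [LoopSpace.genField_eq_zero_iff P hsm, LoopSpace.CompactGroup.const_smul]
  have hlat : ∀ η ∈ K.corootLattice, ∃ g : K.LG ς, K.IsLatticeLoop ς η g := fun η hη =>
    (LoopSpace.CompactGroup.exists_lift P hη).imp' P.proj fun _ ha => ha.1
  have hsub : ∀ η ∈ K.corootLattice, ∀ g : K.LG ς, K.IsLatticeLoop ς η g → g ∈ K.latticeLoops ς :=
    fun η hη g hg => ⟨η, LoopSpace.CompactGroup.corootLattice_subset_lattice P hη, hg⟩
  have hXg : ∀ η ∈ K.corootLattice, ∀ g : K.LG ς, K.IsLatticeLoop ς η g → ∀ x ∈ X, g • x ∈ X := by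
    intro η hη g hg x hx
    rw [hX] at hx ⊢
    exact hM.smul_mem hr (LoopSpace.CompactGroup.corootLattice_subset_lattice P hη) hg hx
  refine ⟨?_, ?_, ?_⟩
  · ext x
    simp only [Set.mem_ofPred_eq, Set.mem_iUnion, exists_prop]
    constructor
    · rintro ⟨hx, h0⟩
      have hmem : x ∈ LoopSpace.zeroPart K ς X φ (φ x) := ⟨⟨hx, (hgen _ x).1 h0⟩, rfl⟩
      exact ⟨φ x, ⟨x, hmem⟩, hmem⟩
    · rintro ⟨β, -, ⟨hx, hfix⟩, hβ⟩
      obtain rfl : φ x = β := hβ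
      exact ⟨hx, (hgen _ x).2 hfix⟩
  · -- a finite system of least cardinality is minimal
    suffices hex : ∃ B, LoopSpace.IsFiniteSystem K ς X φ B by
      obtain ⟨B, hB, hmin⟩ := (measure Set.ncard).wf.has_min
        {B | LoopSpace.IsFiniteSystem K ς X φ B} hex
      refine ⟨B, hB, fun B' hB' hle => ?_⟩
      have hcard : B.ncard ≤ B'.ncard := not_lt.1 (hmin B' hB')
      exact (Set.eq_of_subset_of_ncard_le hle hcard hB.2.1).ge
    classical
    obtain ⟨N, hN, hA⟩ := LoopSpace.CompactGroup.exists_levelT_eq (K := K) hℓ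
    choose! g hg using hlat
    obtain ⟨B, hBsub, hBfin, hB⟩ := (LoopSpace.torusAction P hsm).exists_finite_critical X φ
      (fun η x => g η • x) (K.levelT ℓ)
      (by rw [hX]; exact hS.finite_stab hM hr)
      (fun η hη => hXg η hη _ (hg η hη))
      (fun η hη x => by
        show g η • g (-η) • x = x
        rw [(hg (-η) (neg_mem hη)).unique (hg η hη).inv, smul_inv_smul])
      (fun η hη x => LoopSpace.stab_smul P hsm (hg η hη) x)
      (fun η hη x hx => hφM.eq_add_levelT hS hD hsm hφ hη (hg η hη) hx
        (hXg η hη _ (hg η hη) x hx)) hN hA K.ipT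
      (LoopSpace.CompactGroup.eq_zero_of_ipT_self P)
      (fun ζ => if h : ∃ z, P.exp (K.const ζ) = P.central z then (h.choose : ℂ) ^ 2 else 0)
      (fun x hx ζ hζ hζx => by
        have hz : ∃ z, P.exp (K.const ζ) = P.central z := by
          have h1 : P.exp (K.const ζ) ∈ P.proj.ker := by
            rw [MonoidHom.mem_ker, LoopSpace.CompactGroup.proj_exp_eq,
              LoopSpace.CompactGroup.loopExp_const_lattice P
                (LoopSpace.CompactGroup.corootLattice_subset_lattice P hζ)]
          rw [P.ker_proj] at h1
          obtain ⟨z, hz⟩ := h1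
          exact ⟨z, hz.symm⟩
        have hip : K.ipT (φ x) ζ = φM x (K.const ζ) := congrArg Complex.re (hφ x hx ζ)
        rw [dif_pos hz, hip]
        refine hφM.exp_eq hS hsm (fun u => ?_) hz.choose_spec
        rw [← LoopSpace.CompactGroup.const_smul]
        exact hζx u x rfl)
    have hcrit : (LoopSpace.torusAction P hsm).critical X φ = LoopSpace.zeroPart K ς X φ :=
      funext fun β => Set.ext fun x => and_assoc.symm
    rw [hcrit] at hBsub hB
    refine ⟨B, hBsub, hBfin, fun β hβ => ?_⟩
    obtain ⟨α, hα, η, hη, heq⟩ := hB β hβ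
    exact ⟨α, hα, g η, hsub η hη _ (hg η hη), heq⟩
  · -- otherwise the generating vector fields of the translations by the lattice vanish on `X`
    rintro ⟨ξ, x, hx, hne⟩
    by_contra! hinv
    refine hne ?_
    have hzero : ∀ η ∈ K.corootLattice,
        LoopSpace.orbitDeriv K ς (E := E) x (K.const (K.levelT ℓ η)) = 0 := by
      intro η hη
      obtain ⟨g, hg⟩ := hlat η hη
      have hy : g⁻¹ • x ∈ X := hXg (-η) (neg_mem hη) _ hg.inv x hx
      have h1 := hinv g (hsub η hη g hg) _ hy
      have hgy : g • g⁻¹ • x = x := smul_inv_smul g x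
      have h2 := hφM.eq_add_levelT hS hD hsm hφ hη hg hy (by rw [hgy]; exact hx)
      unfold LoopSpace.kirwan at h1
      rw [LoopSpace.dAct_genField P hsm (hg.isAd _), h2, LoopSpace.CompactGroup.const_add,
        LoopSpace.genField_eq_neg hsm, LoopSpace.genField_eq_neg hsm, map_add] at h1
      rw [hgy] at h1
      have h3 := neg_injective h1
      exact left_eq_add.1 h3.symm
    have hsurj : Function.Surjective (K.levelT ℓ) :=
      LinearMap.injective_iff_surjective.1 (LoopSpace.CompactGroup.levelT_injective hℓ)
    have hall : (LoopSpace.orbitDeriv K ς (E := E) x).toLinearMap ∘ₗ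
        K.constL.toLinearMap ∘ₗ K.levelT ℓ = 0 := by
      refine LinearMap.ext_on_range (v := fun η : K.coroots => (η : K.t)) ?_ ?_
      · rw [Subtype.range_coe]; exact LoopSpace.CompactGroup.span_coroots P
      · exact fun η => hzero η (AddSubgroup.subset_closure η.2)
    obtain ⟨ζ, rfl⟩ := hsurj ξ
    rw [LoopSpace.genField_eq_neg hsm]
    exact neg_eq_zero.2 (LinearMap.congr_fun hall ζ)
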